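/- Notation. Let $\mathbb D$ be the open unit disc. A map $f$ on an open set $\Omega\subset\mathbb C$ is called $K$-quasiconformal ($1\le K<\infty$) if it is a homeomorphism onto its image, is absolutely continuous on lines in $\Omega$, and satisfies $|\partial_{\bar z}f|\le\frac{K-1}{K+1}|\partial_z f|$ almost everywhere; it is quasiconformal if it is $K$-quasiconformal for some $K$, and then its dilatation is $$K_f=\operatorname*{ess\,sup}_{z\in\Omega}\frac{|\partial_z f(z)|+|\partial_{\bar z}f(z)|}{|\partial_z f(z)|-|\partial_{\bar z}f(z)|}.$$ For $r>1$ let $\frac1{2\pi}\log\Phi(r)$ be the module of the Grötzsch domain $\mathbb C\setminus(\overline{\mathbb D}\cup[r,\infty))$; that is, $\Phi(r)$ is the number $\rho>1$ for which this domain is conformally equivalent to the annulus $\{1<|w|<\rho\}$. For $a,b>0$ let $\mathcal E(a,b)$ be the open ellipse centred at $0$ with horizontal semi-axis $a$ and vertical semi-axis $b$. Let $0<x<1$, $R=\sqrt{\Phi(1/x)}$, $\mathcal E_1=\mathcal E\left(R-\frac1R,R+\frac1R\right)$, $\mathcal E_2=\mathcal E\left(R+\frac1R,R-\frac1R\right)$,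 and $$A(u+iv)=\frac{R+\frac1R}{R-\frac1R}\,u+i\,\frac{R-\frac1R}{R+\frac1R}\,v ,$$ an affine map of $\overline{\mathcal E_1}$ onto $\overline{\mathcal E_2}$. Theorem. (a) There is a conformal map $\varphi$ of $\mathbb D\setminus i[-\sqrt x,\sqrt x]$ onto the annulus $\{1<|w|<R\}$ which commutes with the reflections in the two coordinate axes and maps the first quadrant of the disc onto the first quadrant of the annulus, with $0,1,i,i\sqrt x$ corresponding on the boundary to $1,R,iR,i$ respectively. There are continuous maps $p_1:\overline{\mathcal E_1}\to\overline{\mathbb D}$ and $p_2:\overline{\mathcal E_2}\to\overline{\mathbb D}$ such that $$p_1\left(\varphi(z)-\frac1{\varphi(z)}\right)=z^2=p_2\left(\varphi(z)+\frac1{\varphi(z)}\right)\qquad\left(z\in\mathbb D\setminus i[-\sqrt x,\sqrt x]\right).$$ Each $p_j$ is surjective, restricts to a holomorphic two-sheeted covering of $\mathbb D$ by $\mathcal E_j$ branched only at $0$, and satisfies $p_j(w)=p_j(w')$ if and only if $w'=\pm w$, for $w,w'\in\overline{\mathcal E_j}$; moreover $p_1(0)=0$ and $p_2(0)=-x$.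 (b) There is a map $f_{(0,x)}:\overline{\mathbb D}\to\overline{\mathbb D}$ with $f_{(0,x)}\circ p_1=p_2\circ A$ on $\overline{\mathcal E_1}$. It is a quasiconformal map of $\mathbb D$ onto $\mathbb D$, continuous on $\overline{\mathbb D}$, equal to the identity on the unit circle, it sends $0$ to $-x$, and $$K_{f_{(0,x)}}=\left(\frac{\Phi(1/x)+1}{\Phi(1/x)-1}\right)^2 .$$ (c) Let $f:\overline{\mathbb D}\to\overline{\mathbb D}$ be any continuous map which restricts to a quasiconformal map of $\mathbb D$ onto $\mathbb D$, is the identity on the unit circle and satisfies $f(0)=-x$. Then there is a continuous bijection $F:\overline{\mathcal E_1}\to\overline{\mathcal E_2}$ with $f\circ p_1=p_2\circ F$, $F(0)=0$, and $F=A$ on $\partial\mathcal E_1$. Moreover $$K_f\ge\left(\frac{R^2+1}{R^2-1}\right)^2,$$ with equality if and only if $f=f_{(0,x)}$ on $\overline{\mathbb D}$. -/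

import Mathlib

open Set Filter Topology MeasureTheory

noncomputable section

/-! ### Quasiconformal mappings (analytic definition) -/

/-- `∂f/∂x` at `z`, for `z = x + iy`. -/
def partialX (f : ℂ → ℂ) (z : ℂ) : ℂ := deriv (fun t : ℝ => f (z + (t : ℂ))) 0

/-- `∂f/∂y` at `z`, for `z = x + iy`. -/
def partialY (f : ℂ → ℂ) (z : ℂ) : ℂ := deriv (fun t : ℝ => f (z + (t : ℂ) * Complex.I)) 0

/-- `∂_z f = (∂_x f - i ∂_y f) / 2`. -/
def wirtingerZ (f : ℂ → ℂ) (z : ℂ) : ℂ := (partialX f z - Complex.I * partialY f z) / 2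

/-- `∂_z̄ f = (∂_x f + i ∂_y f) / 2`. -/
def wirtingerZbar (f : ℂ → ℂ) (z : ℂ) : ℂ := (partialX f z + Complex.I * partialY f z) / 2

/-- `f` is absolutely continuous on lines in `Ω`: for each compact rectangle contained in `Ω`, `f` is
absolutely continuous on almost every horizontal and almost every vertical segment of it. -/
def IsACL (f : ℂ → ℂ) (Ω : Set ℂ) : Prop :=
  ∀ a b c d : ℝ, a < b → c < d → Icc a b ×ℂ Icc c d ⊆ Ω →
    (∀ᵐ y : ℝ, y ∈ Icc c d →
      AbsolutelyContinuousOnInterval (fun t : ℝ => f ⟨t, y⟩) a b) ∧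
    (∀ᵐ t : ℝ, t ∈ Icc a b →
      AbsolutelyContinuousOnInterval (fun y : ℝ => f ⟨t, y⟩) c d)

/-- `f` is `K`-quasiconformal on the open set `Ω`: a homeomorphism of `Ω` onto its image, ACL, with
`|∂_z̄ f| ≤ k |∂_z f|` almost everywhere, `k = (K - 1) / (K + 1)`. -/
structure IsKQuasiconformalOn (K : ℝ) (f : ℂ → ℂ) (Ω : Set ℂ) : Prop where
  one_le : 1 ≤ K
  isOpen : IsOpen Ω
  isEmbedding : IsEmbedding (fun z : Ω => f z)
  acl : IsACL f Ω
  dilatation : ∀ᵐ z ∂(volume.restrict Ω),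
    ‖wirtingerZbar f z‖ ≤ (K - 1) / (K + 1) * ‖wirtingerZ f z‖

/-- `f` is quasiconformal on `Ω`. -/
def IsQuasiconformalOn (f : ℂ → ℂ) (Ω : Set ℂ) : Prop := ∃ K : ℝ, IsKQuasiconformalOn K f Ω

/-- The quasiconformal dilatation of a quasiconformal map `f` of `Ω`: the essential supremum over `Ω`
of `(|∂_z f| + |∂_z̄ f|) / (|∂_z f| - |∂_z̄ f|)`. -/
def qcDilatation (f : ℂ → ℂ) (Ω : Set ℂ) : ℝ :=
  essSup (fun z => (‖wirtingerZ f z‖ + ‖wirtingerZbar f z‖) /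
    (‖wirtingerZ f z‖ - ‖wirtingerZbar f z‖)) (volume.restrict Ω)

/-- The open unit disc. -/
def unitDisc : Set ℂ := Metric.ball 0 1

/-- The closed unit disc. -/
def closedUnitDisc : Set ℂ := Metric.closedBall 0 1

/-- `f` is a quasiconformal map of the unit disc onto itself, whose (continuous) boundary values are
the identity of the unit circle, and which sends `0` to `-x`. Only the values of `f` on the closed
unit disc are relevant. -/
structure IsDiscShift (x : ℝ) (f : ℂ → ℂ) : Prop where
  qc : IsQuasiconformalOn f unitDisc
  image : f '' unitDisc = unitDisc
  cont : ContinuousOn f closedUnitDisc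
  boundary : ∀ z : ℂ, ‖z‖ = 1 → f z = z
  map_zero : f 0 = -(x : ℂ)

/-! ### Modules of doubly connected domains and the Grötzsch module function -/

/-- The round annulus `1 < |w| < R`. -/
def annulus (R : ℝ) : Set ℂ := {w | 1 < ‖w‖ ∧ ‖w‖ < R}

/-- There is a holomorphic bijection of `Ω` onto an annulus `1 < |w| < R`, and
`m = log R / (2π)`. -/
def HasModule (Ω : Set ℂ) (m : ℝ) : Prop :=
  ∃ R : ℝ, 1 < R ∧ (∃ h : ℂ → ℂ, DifferentiableOn ℂ h Ω ∧ BijOn h Ω (annulus R)) ∧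
    m = 1 / (2 * Real.pi) * Real.log R

/-- The module of a doubly connected domain (the number `m` with `HasModule Ω m`). -/
def ringModule (Ω : Set ℂ) : ℝ := Classical.epsilon (HasModule Ω)

/-- The Grötzsch domain: the complement of the closed unit disc and of the ray `[r, ∞)`. -/
def grotzschDomain (r : ℝ) : Set ℂ := (closedUnitDisc ∪ {z | r ≤ z.re ∧ z.im = 0})ᶜ

/-- The Grötzsch module function `Φ`: the module of the Grötzsch domain is `log Φ(r) / (2π)`. -/
def grotzschPhi (r : ℝ) : ℝ := Real.exp (2 * Real.pi * ringModule (grotzschDomain r))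

/-! ### The two branched coverings of the disc by ellipses -/

/-- The unit disc with the segment `i [-√x, √x]` removed. -/
def slitDisc (x : ℝ) : Set ℂ := unitDisc \ {z | z.re = 0 ∧ |z.im| ≤ √x}

/-- The open first quadrant. -/
def firstQuadrant : Set ℂ := {z | 0 < z.re ∧ 0 < z.im}

/-- The normalized conformal map of the slit disc onto the annulus `1 < |w| < R`: it maps the first
quadrant of the disc onto the first quadrant of the annulus, with the four vertices
`0, 1, i, i√x` going to `1, R, iR, i` respectively, and it commutes with the reflections in the two
coordinate axes. -/
structure IsSlitDiscMap (x R : ℝ) (φ : ℂ → ℂ) : Prop where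
  holo : DifferentiableOn ℂ φ (slitDisc x)
  bij : BijOn φ (slitDisc x) (annulus R)
  quadrant : φ '' (unitDisc ∩ firstQuadrant) = annulus R ∩ firstQuadrant
  vertex_zero : Tendsto φ (𝓝[unitDisc ∩ firstQuadrant] 0) (𝓝 1)
  vertex_one : Tendsto φ (𝓝[unitDisc ∩ firstQuadrant] 1) (𝓝 (R : ℂ))
  vertex_I : Tendsto φ (𝓝[unitDisc ∩ firstQuadrant] Complex.I) (𝓝 ((R : ℂ) * Complex.I))
  vertex_tip : Tendsto φ (𝓝[unitDisc ∩ firstQuadrant] (((√x : ℝ) : ℂ) * Complex.I))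
    (𝓝 Complex.I)
  reflect_horizontal : ∀ z ∈ slitDisc x, φ (star z) = star (φ z)
  reflect_vertical : ∀ z ∈ slitDisc x, φ (-star z) = -star (φ z)

/-- The open ellipse centred at `0` with semi-axes `a` (horizontal) and `b` (vertical). -/
def ellipse (a b : ℝ) : Set ℂ := {z | (z.re / a) ^ 2 + (z.im / b) ^ 2 < 1}

/-- The closed ellipse centred at `0` with semi-axes `a` (horizontal) and `b` (vertical). -/
def closedEllipse (a b : ℝ) : Set ℂ := {z | (z.re / a) ^ 2 + (z.im / b) ^ 2 ≤ 1}

/-- `p` is a holomorphic two-sheeted covering of the unit disc by the ellipse with semi-axes `a, b`,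
with sheet exchange `z ↦ -z`, branched only at `0`, over the value `v`, and extending continuously
to the closed ellipse, with the same sheet exchange. -/
structure IsEllipseCover (a b : ℝ) (v : ℂ) (p : ℂ → ℂ) : Prop where
  holo : DifferentiableOn ℂ p (ellipse a b)
  cont : ContinuousOn p (closedEllipse a b)
  image : p '' ellipse a b = unitDisc
  image_closed : p '' closedEllipse a b = closedUnitDisc
  fiber : ∀ z ∈ closedEllipse a b, ∀ w ∈ closedEllipse a b, p z = p w ↔ w = z ∨ w = -z
  branch : p 0 = v

/-- The affine map `u + iv ↦ ((R + 1/R) / (R - 1/R)) u + i ((R - 1/R) / (R + 1/R)) v`. -/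
def ellipseAffine (R : ℝ) (z : ℂ) : ℂ :=
  ⟨(R + 1 / R) / (R - 1 / R) * z.re, (R - 1 / R) / (R + 1 / R) * z.im⟩

end

/-!
# Teichmüller's shift problem for the disc

All holomorphic maps come from one explicit formula. For `ρ > 1` the Joukowski map `w + 1 / w`
takes the circle `‖w‖ = ρ` to an ellipse with foci `±2`, and a quotient of theta products in
`s = w + 1 / w`, squared and multiplied by `s - 2`, gives a function `ellipseToDisc ρ` which has modulus
`1` on this ellipse, by the conjugation symmetry of the products, and a single simple zero inside,
at the focus `2`. Being proper of degree one, it is a conformal map onto the disc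
(`bijOn_ball_of_unique_simple_zero`). It is real on the major axis and takes the segment between
the foci to `[-x, 0]`, where `x = focalValue ρ`; every `x` in `(0, 1)` arises, by continuity
(`exists_focalValue_eq`). Hence the annulus `1 < ‖w‖ < ρ` is conformally equivalent to the disc
without `[-x, 0]`, which `z ↦ -1 / z` takes to the Grötzsch domain of `1 / x`. Since conformally
equivalent annuli have the same module (`le_of_bijOn_annulus`), `Φ(1 / x) = ρ`
(`grotzschPhi_inv_focalValue`).

With `R ^ 2 = ρ`, the two coverings are `ellipseToDisc ρ` composed with `ζ ↦ ζ ^ 2 ± 2`, each of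
which is the quotient by `±1` of an ellipse with foci `±2i`, respectively `±2`, onto the focal
ellipse. `coverOne` is the square of an odd holomorphic function, and this square root, composed
with `w ↦ w - 1 / w`, is the inverse of the conformal map of the slit disc. The affine map `A`
commutes with `±1`, so it descends to a map `affineShift` of the disc, of constant dilatation
`axisRatio R ^ 2`.

For a competitor `f`, the function `h` on the first ellipse which is `ω ^ 2` for any point `ω` over
`f (p₁ ζ)` is even and vanishes only at `0`. In polar coordinates it has a continuous logarithm,
whose increment along half a turn is read off from the boundary values; halving it gives the odd
lift `F` (`exists_odd_sqrt`, `IsDiscShift.exists_lift`).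

The lower bound is a length and area argument for `F`. Absolute continuity on lines passes through
the coverings, which are locally conformal off the centre, and makes the pointwise horizontal
derivative `F_u` a weak derivative; since `F - A` vanishes at the centre and on the boundary, test
functions need not vanish there (`integral_weak_extend`), and in particular the mean of `F_u` over
the ellipse is `axisRatio R`. Almost everywhere `‖F_u‖ ^ 2 ≤ K * J`, with `J` the Jacobian of `F`
and `K` the dilatation of `f`. The integral of `J` is at most the area of the second ellipse,
because `F` is injective and, by Egorov's theorem applied to the difference quotients,
differentiable on sets which exhaust the ellipse up to a null set (`lintegral_abs_det_le_of_seq`).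
The two ellipses have the same area, so the mean of `‖F_u - axisRatio R‖ ^ 2` is at most
`K - axisRatio R ^ 2` (`IsEllipseLift.integral_sq_norm_sub_le`), which is therefore nonnegative. In case
of equality `F_u` is constant, `F - A` has horizontal weak derivative zero and zero boundary
values, and hence `F = A` (`eqOn_zero_of_integral_mul_fderiv`).
-/


/-! ### Holomorphic maps: critical points, inverses, and proper maps of degree one -/

/-- Near a critical point a nonconstant holomorphic function takes every nearby value at least
twice. -/
lemma AnalyticAt.eventually_two_preimages {f : ℂ → ℂ} {z₀ : ℂ} (hf : AnalyticAt ℂ f z₀)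
    (hd : deriv f z₀ = 0) (hc : ¬ ∀ᶠ z in 𝓝 z₀, f z = f z₀) {U : Set ℂ} (hU : U ∈ 𝓝 z₀) :
    ∀ᶠ b in 𝓝[≠] (f z₀), ∃ z₁ ∈ U, ∃ z₂ ∈ U, z₁ ≠ z₂ ∧ f z₁ = b ∧ f z₂ = b := by
  have hF : AnalyticAt ℂ (fun z => f z - f z₀) z₀ := hf.sub analyticAt_const
  -- write `f z - f z₀ = (z - z₀) ^ m g z` with `g z₀ ≠ 0`; the order `m` is at least two
  have hord : analyticOrderAt (fun z => f z - f z₀) z₀ ≠ ⊤ := by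
    intro h
    rw [analyticOrderAt_eq_top] at h
    exact hc (h.mono fun z hz => sub_eq_zero.1 hz)
  obtain ⟨g, hg, hg0, hfg⟩ := hF.analyticOrderAt_ne_top.1 hord
  set m := analyticOrderNatAt (fun z => f z - f z₀) z₀ with hm
  have hm0 : m ≠ 0 := by
    intro h0
    have := hfg.self_of_nhds
    simp [h0] at this
    exact hg0 this.symm
  have hm1 : m ≠ 1 := by
    intro h1
    have h2 : HasDerivAt (fun z => (z - z₀) ^ m • g z) (g z₀) z₀ := by
      have h3 := ((hasDerivAt_id z₀).sub_const z₀).mul hg.differentiableAt.hasDerivAt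
      have h4 : ((fun z => (z - z₀) ^ m • g z)) = (fun z => (id z - z₀) * g z) := by
        funext z; simp [h1]
      rw [h4]
      convert! h3 using 1
      simp
    have h5 : HasDerivAt (fun z => f z - f z₀) (g z₀) z₀ := h2.congr_of_eventuallyEq hfg
    have h6 := (hf.differentiableAt.hasDerivAt.sub_const (f z₀)).unique h5
    exact hg0 (by rw [← h6, hd])
  have hmC : (m : ℂ) ≠ 0 := by exact_mod_cast hm0
  -- a holomorphic `m`-th root of `g` near `z₀`
  obtain ⟨c, hcm⟩ : ∃ c : ℂ, c ^ m = g z₀ := ⟨_, Complex.cpow_nat_inv_pow (g z₀) hm0⟩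
  have hc0 : c ≠ 0 := by
    rintro rfl
    exact hg0 (by rw [← hcm, zero_pow hm0])
  set h : ℂ → ℂ := fun z => c * Complex.exp (Complex.log (g z / g z₀) / m) with hh
  have hh0 : h z₀ = c := by simp [hh, div_self hg0]
  have hslit : g z₀ / g z₀ ∈ Complex.slitPlane := by rw [div_self hg0]; simp
  have hhan : AnalyticAt ℂ h z₀ := by
    refine analyticAt_const.mul (((AnalyticAt.clog ?_ ?_).div_const).cexp)
    · exact hg.div_const
    · exact hslit
  have hgne : ∀ᶠ z in 𝓝 z₀, g z ≠ 0 := hg.continuousAt.eventually_ne hg0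
  have hhm : ∀ᶠ z in 𝓝 z₀, h z ^ m = g z := by
    filter_upwards [hgne] with z hz
    simp only [hh]
    rw [mul_pow, hcm, ← Complex.exp_nat_mul, mul_div_cancel₀ _ hmC,
      Complex.exp_log (div_ne_zero hz hg0)]
    field_simp
  set Ψ : ℂ → ℂ := fun z => (z - z₀) * h z with hΨ
  -- `f = f z₀ + Ψ ^ m` near `z₀` with a local biholomorphic map `Ψ`; two preimages of a nearby
  -- value come from two different `m`-th roots `d` and `ω d`
  have hΨan : AnalyticAt ℂ Ψ z₀ := (analyticAt_id.sub analyticAt_const).mul hhan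
  have hΨd : HasStrictDerivAt Ψ c z₀ := by
    have h1 := hΨan.hasStrictDerivAt
    have h2 : deriv Ψ z₀ = c := by
      have h3 := ((hasDerivAt_id z₀).sub_const z₀).mul hhan.differentiableAt.hasDerivAt
      have h4 := h3.deriv
      simp only [id, sub_self, zero_mul, add_zero, one_mul, hh0] at h4
      exact h4
    rwa [h2] at h1
  have hmap := hΨd.map_nhds_eq hc0
  have hfΨ : ∀ᶠ z in 𝓝 z₀, f z = f z₀ + Ψ z ^ m := by
    filter_upwards [hfg, hhm] with z h1 h2
    simp only [hΨ, mul_pow, h2]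
    rw [smul_eq_mul] at h1
    rw [← h1]; ring
  have hΨ0 : Ψ z₀ = 0 := by simp [hΨ]
  rw [hΨ0] at hmap
  have himg : Ψ '' (U ∩ {z | f z = f z₀ + Ψ z ^ m}) ∈ 𝓝 (0 : ℂ) := by
    rw [← hmap]
    exact image_mem_map (inter_mem hU hfΨ)
  obtain ⟨δ, hδ, hball⟩ := Metric.mem_nhds_iff.1 himg
  have hnear : ∀ᶠ b in 𝓝 (f z₀), ‖b - f z₀‖ < δ ^ m := by
    have : ContinuousAt (fun b : ℂ => ‖b - f z₀‖) (f z₀) := by fun_prop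
    exact this.eventually_lt continuousAt_const (by simp; positivity)
  filter_upwards [nhdsWithin_le_nhds hnear, self_mem_nhdsWithin] with b hb hbne
  obtain ⟨d, hdm⟩ : ∃ d : ℂ, d ^ m = b - f z₀ := ⟨_, Complex.cpow_nat_inv_pow (b - f z₀) hm0⟩
  have hd0 : d ≠ 0 := by
    rintro rfl
    rw [zero_pow hm0] at hdm
    exact hbne (sub_eq_zero.1 hdm.symm)
  have hprim := Complex.isPrimitiveRoot_exp m hm0
  set ω := Complex.exp (2 * Real.pi * Complex.I / m) with hω
  have hω1 : ω ≠ 1 := hprim.ne_one (by omega)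
  have hdn : ‖d‖ < δ := by
    refine lt_of_pow_lt_pow_left₀ m hδ.le ?_
    rw [← norm_pow, hdm]; exact hb
  have hωn : ‖ω‖ = 1 := hprim.norm'_eq_one hm0
  obtain ⟨z₁, ⟨hz₁, hfz₁⟩, e₁⟩ := hball (show d ∈ Metric.ball 0 δ by simpa using hdn)
  obtain ⟨z₂, ⟨hz₂, hfz₂⟩, e₂⟩ := hball (show ω * d ∈ Metric.ball 0 δ by simpa [hωn] using hdn)
  refine ⟨z₁, hz₁, z₂, hz₂, ?_, ?_, ?_⟩
  · rintro rfl
    rw [e₁] at e₂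
    exact hω1 (mul_right_cancel₀ hd0 (by rw [one_mul]; exact e₂.symm))
  · rw [hfz₁, e₁, hdm]; ring
  · rw [hfz₂, e₂, mul_pow, hprim.pow_eq_one, one_mul, hdm]; ring

lemma not_eventually_const_of_injOn {f : ℂ → ℂ} {U : Set ℂ} (hU : IsOpen U) (hi : InjOn f U)
    {z : ℂ} (hz : z ∈ U) : ¬ ∀ᶠ w in 𝓝 z, f w = f z := by
  intro h
  have h1 : ∀ᶠ w in 𝓝[≠] z, w = z := by
    filter_upwards [nhdsWithin_le_nhds h, nhdsWithin_le_nhds (hU.mem_nhds hz)] with w h1 h2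
    exact hi h2 hz h1
  have h2 : ∀ᶠ w in 𝓝[≠] z, False := by
    filter_upwards [h1, self_mem_nhdsWithin] with w h3 h4
    exact h4 h3
  exact (NormedField.nhdsNE_neBot z).ne (by simpa using h2)

/-- An injective holomorphic function has no critical points. -/
lemma DifferentiableOn.deriv_ne_zero_of_injOn {f : ℂ → ℂ} {U : Set ℂ} (hU : IsOpen U)
    (hf : DifferentiableOn ℂ f U) (hi : InjOn f U) {z : ℂ} (hz : z ∈ U) : _root_.deriv f z ≠ 0 := by
  intro hd
  have h := (hf.analyticAt (hU.mem_nhds hz)).eventually_two_preimages hd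
    (not_eventually_const_of_injOn hU hi hz) (hU.mem_nhds hz)
  obtain ⟨b, z₁, h₁, z₂, h₂, hne, e₁, e₂⟩ := h.exists
  exact hne (hi h₁ h₂ (e₁.trans e₂.symm))

lemma DifferentiableOn.image_mem_nhds_of_injOn {f : ℂ → ℂ} {U : Set ℂ} (hU : IsOpen U)
    (hf : DifferentiableOn ℂ f U) (hi : InjOn f U) {z : ℂ} (hz : z ∈ U) {V : Set ℂ}
    (hV : V ∈ 𝓝 z) : f '' V ∈ 𝓝 (f z) :=
  (((hf.analyticAt (hU.mem_nhds hz)).eventually_constant_or_nhds_le_map_nhds).resolve_left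
    (not_eventually_const_of_injOn hU hi hz)) (image_mem_map hV)

lemma DifferentiableOn.isOpen_image_of_injOn {f : ℂ → ℂ} {U : Set ℂ} (hU : IsOpen U)
    (hf : DifferentiableOn ℂ f U) (hi : InjOn f U) : IsOpen (f '' U) := by
  rw [isOpen_iff_mem_nhds]
  rintro _ ⟨z, hz, rfl⟩
  exact hf.image_mem_nhds_of_injOn hU hi hz (hU.mem_nhds hz)

/-- A left inverse of an injective holomorphic function is holomorphic on the image. -/
lemma DifferentiableOn.hasDerivAt_of_leftInvOn {f g : ℂ → ℂ} {U : Set ℂ} (hU : IsOpen U)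
    (hf : DifferentiableOn ℂ f U) (hg : LeftInvOn g f U) {z : ℂ} (hz : z ∈ U) :
    HasDerivAt g (_root_.deriv f z)⁻¹ (f z) := by
  have hi : InjOn f U := hg.injOn
  have hgz : g (f z) = z := hg hz
  have hcont : ContinuousAt g (f z) := by
    intro V hV
    rw [hgz] at hV
    have h1 := hf.image_mem_nhds_of_injOn hU hi hz (inter_mem hV (hU.mem_nhds hz))
    refine mem_map.2 (mem_of_superset h1 ?_)
    rintro _ ⟨w, ⟨hw1, hw2⟩, rfl⟩
    simpa [hg hw2] using hw1
  refine HasDerivAt.of_local_left_inverse (f := f) hcont ?_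
    (hf.deriv_ne_zero_of_injOn hU hi hz) ?_
  · rw [hgz]
    exact (hf.differentiableAt (hU.mem_nhds hz)).hasDerivAt
  · filter_upwards [(hf.isOpen_image_of_injOn hU hi).mem_nhds (mem_image_of_mem f hz)]
    rintro _ ⟨w, hw, rfl⟩
    rw [hg hw]

lemma DifferentiableOn.differentiableOn_of_leftInvOn {f g : ℂ → ℂ} {U : Set ℂ} (hU : IsOpen U)
    (hf : DifferentiableOn ℂ f U) (hg : LeftInvOn g f U) : DifferentiableOn ℂ g (f '' U) := by
  rintro _ ⟨z, hz, rfl⟩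
  exact (hf.hasDerivAt_of_leftInvOn hU hg hz).differentiableAt.differentiableWithinAt

/-- A proper holomorphic map onto the disc which takes the value `0` exactly once, without
multiplicity, is bijective: the set of values which are taken exactly once, without multiplicity, is
open and closed in the disc. -/
lemma bijOn_ball_of_unique_simple_zero {P : ℂ → ℂ} {Ω K : Set ℂ} (hΩ : IsOpen Ω)
    (hc : IsPreconnected Ω) (hK : IsCompact K) (hΩK : Ω ⊆ K) (hPc : ContinuousOn P K)
    (hPd : DifferentiableOn ℂ P Ω) (hb : ∀ z ∈ K \ Ω, ‖P z‖ = 1) (hin : ∀ z ∈ Ω, ‖P z‖ < 1)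
    {z₀ : ℂ} (hz₀ : z₀ ∈ Ω) (h0 : ∀ z ∈ Ω, P z = 0 ↔ z = z₀) (hd : deriv P z₀ ≠ 0) :
    BijOn P Ω (Metric.ball 0 1) := by
  have hnc : ∀ z ∈ Ω, ¬ ∀ᶠ w in 𝓝 z, P w = P z := by
    intro z hz h
    have han : AnalyticOnNhd ℂ P Ω := hPd.analyticOnNhd hΩ
    have := han.eqOn_of_preconnected_of_eventuallyEq
      (g := fun _ => P z) analyticOnNhd_const hc hz h
    apply hd
    have h2 : P =ᶠ[𝓝 z₀] fun _ => P z := by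
      filter_upwards [hΩ.mem_nhds hz₀] with w hw using this hw
    rw [h2.deriv_eq]; simp
  have hopen : ∀ z ∈ Ω, ∀ V ∈ 𝓝 z, P '' V ∈ 𝓝 (P z) := fun z hz V hV =>
    (((hPd.analyticAt (hΩ.mem_nhds hz)).eventually_constant_or_nhds_le_map_nhds).resolve_left
      (hnc z hz)) (image_mem_map hV)
  -- the values which are taken exactly once, without multiplicity
  set T : Set ℂ := {a | ‖a‖ < 1 ∧ ∃ ζ ∈ Ω, P ζ = a ∧ deriv P ζ ≠ 0 ∧ ∀ ζ' ∈ Ω, P ζ' = a → ζ' = ζ}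
    with hT
  have hTopen : IsOpen T := by
    rw [isOpen_iff_mem_nhds]
    rintro a ⟨ha, ζ, hζ, rfl, hdζ, huniq⟩
    have han := hPd.analyticAt (hΩ.mem_nhds hζ)
    -- a neighbourhood of `ζ` on which `P` is injective without critical points
    have hstrict : HasStrictDerivAt P (deriv P ζ) ζ := han.hasStrictDerivAt
    have hinj : ∃ N ∈ 𝓝 ζ, InjOn P N := by
      have h1 := (hstrict.hasStrictFDerivAt_equiv hdζ)
      refine ⟨h1.toOpenPartialHomeomorph.source, ?_, h1.toOpenPartialHomeomorph.injOn⟩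
      exact h1.toOpenPartialHomeomorph.open_source.mem_nhds h1.mem_toOpenPartialHomeomorph_source
    obtain ⟨N, hN, hNi⟩ := hinj
    have hdN : ∀ᶠ w in 𝓝 ζ, deriv P w ≠ 0 :=
      han.deriv.continuousAt.eventually_ne hdζ
    obtain ⟨N', hN'sub, hN'o, hζN'⟩ := mem_nhds_iff.1 (inter_mem (inter_mem hN hdN) (hΩ.mem_nhds hζ))
    have hcl : IsClosed (P '' (K \ N')) := by
      refine ((hK.diff hN'o).image_of_continuousOn (hPc.mono sdiff_subset)).isClosed
    have hnot : P ζ ∉ P '' (K \ N') := by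
      rintro ⟨w, ⟨hwK, hwN⟩, hw⟩
      by_cases hwΩ : w ∈ Ω
      · exact hwN (huniq w hwΩ hw ▸ hζN')
      · have := hb w ⟨hwK, hwΩ⟩
        rw [hw] at this
        exact absurd this ha.ne
    filter_upwards [hcl.isOpen_compl.mem_nhds hnot, hopen ζ hζ N' (hN'o.mem_nhds hζN')]
    rintro b hb1 ⟨w, hw, rfl⟩
    refine ⟨hin w (hN'sub hw).2, w, (hN'sub hw).2, rfl, (hN'sub hw).1.2, ?_⟩
    intro w' hw' e
    have : w' ∈ N' := by
      by_contra hcon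
      exact hb1 ⟨w', ⟨hΩK hw', hcon⟩, e⟩
    exact hNi (hN'sub this).1.1 (hN'sub hw).1.1 e
  have h0T : (0 : ℂ) ∈ T :=
    ⟨by simp, z₀, hz₀, (h0 z₀ hz₀).2 rfl, hd, fun ζ' h1 h2 => (h0 ζ' h1).1 h2⟩
  have hTcl : closure T ∩ Metric.ball 0 1 ⊆ T := by
    rintro a ⟨hacl, haball⟩
    have ha1 : ‖a‖ < 1 := by simpa using haball
    have hTK : T ⊆ P '' K := by
      rintro b ⟨-, ζ, hζ, rfl, -⟩
      exact mem_image_of_mem P (hΩK hζ)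
    have hPK : IsClosed (P '' K) := (hK.image_of_continuousOn hPc).isClosed
    obtain ⟨ζ, hζK, hζ⟩ := closure_minimal hTK hPK hacl
    have hζΩ : ζ ∈ Ω := by
      by_contra hcon
      have := hb ζ ⟨hζK, hcon⟩
      rw [hζ] at this
      exact absurd this ha1.ne
    -- a limit value `a` of values in `T` has a preimage; a critical point there, or a second
    -- preimage, would produce two preimages of the values in `T` close to `a`
    by_contra haT
    have hfreq : ∃ᶠ b in 𝓝 a, b ∈ T := mem_closure_iff_frequently.1 hacl
    by_cases hdζ : deriv P ζ = 0
    · have h2 := (hPd.analyticAt (hΩ.mem_nhds hζΩ)).eventually_two_preimages hdζ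
        (hnc ζ hζΩ) (hΩ.mem_nhds hζΩ)
      rw [hζ, eventually_nhdsWithin_iff] at h2
      obtain ⟨b, ⟨-, ζ₁, _, _, _, hu⟩, hb2⟩ := (hfreq.and_eventually h2).exists
      have hba : b ≠ a := by
        rintro rfl
        exact haT ⟨ha1, ζ₁, ‹_›, ‹_›, ‹_›, hu⟩
      obtain ⟨z₁, h₁, z₂, h₂, hne, e₁, e₂⟩ := hb2 hba
      exact hne ((hu z₁ h₁ e₁).trans (hu z₂ h₂ e₂).symm)
    · apply haT
      refine ⟨ha1, ζ, hζΩ, hζ, hdζ, ?_⟩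
      intro ζ' hζ' e
      by_contra hne
      obtain ⟨V, V', hV, hV', hVV'⟩ := t2_separation_nhds hne
      have i1 := hopen ζ' hζ' (V ∩ Ω) (inter_mem hV (hΩ.mem_nhds hζ'))
      have i2 := hopen ζ hζΩ (V' ∩ Ω) (inter_mem hV' (hΩ.mem_nhds hζΩ))
      rw [e] at i1
      rw [hζ] at i2
      obtain ⟨b, ⟨-, ζ₁, _, _, _, hu⟩, ⟨w₁, hw₁, e₁⟩, ⟨w₂, hw₂, e₂⟩⟩ :=
        (hfreq.and_eventually (inter_mem i1 i2)).exists
      have := (hu w₁ hw₁.2 e₁).trans (hu w₂ hw₂.2 e₂).symm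
      exact hVV'.le_bot ⟨hw₁.1, this ▸ hw₂.1⟩
  have hball : Metric.ball (0 : ℂ) 1 ⊆ T :=
    (convex_ball (0 : ℂ) 1).isPreconnected.subset_of_closure_inter_subset hTopen
      ⟨0, by simp, h0T⟩ hTcl
  refine ⟨fun z hz => by simpa using hin z hz, ?_, ?_⟩
  · intro z hz w hw e
    obtain ⟨-, ζ, _, _, _, hu⟩ := hball (show P z ∈ Metric.ball 0 1 by simpa using hin z hz)
    exact (hu z hz rfl).trans (hu w hw e.symm).symm
  · intro a ha
    obtain ⟨-, ζ, hζ, e, _⟩ := hball ha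
    exact ⟨ζ, hζ, e⟩


/-! ### Uniqueness of the module of an annulus -/

lemma Complex.exp_eq_exp_iff_sub {a b : ℂ} :
    Complex.exp a = Complex.exp b ↔ ∃ n : ℤ, a - b = n * (2 * Real.pi * Complex.I) := by
  rw [Complex.exp_eq_exp_iff_exists_int]
  exact exists_congr fun n => by rw [sub_eq_iff_eq_add, add_comm]

lemma Convex.isSimplyConnected_of_nonempty {E : Type*} [AddCommGroup E] [Module ℝ E]
    [TopologicalSpace E] [ContinuousAdd E] [ContinuousSMul ℝ E] {S : Set E} (hS : Convex ℝ S)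
    (hne : S.Nonempty) : IsSimplyConnected S := by
  have := hS.contractibleSpace hne
  exact (inferInstance : SimplyConnectedSpace S)

/-- Two continuous logarithms of the same function on a preconnected set differ by a constant. -/
lemma exists_int_sub_eq_of_exp_eq {X : Type*} [TopologicalSpace X] {S : Set X}
    (hS : IsPreconnected S) {L M : X → ℂ} (hL : ContinuousOn L S) (hM : ContinuousOn M S)
    (h : ∀ s ∈ S, Complex.exp (L s) = Complex.exp (M s)) :
    ∃ n : ℤ, ∀ s ∈ S, L s - M s = n * (2 * Real.pi * Complex.I) := by
  have hpi : (2 * Real.pi * Complex.I : ℂ) ≠ 0 := Complex.two_pi_I_ne_zero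
  rcases S.eq_empty_or_nonempty with rfl | ⟨s₀, hs₀⟩
  · exact ⟨0, by simp⟩
  choose! k hk using fun s hs => Complex.exp_eq_exp_iff_sub.1 (h s hs)
  refine ⟨k s₀, fun s hs => ?_⟩
  -- the continuous function `(L - M) / (2πi)` is integer valued
  have hcont : ContinuousOn (fun s => ((L s - M s) / (2 * Real.pi * Complex.I)).re) S :=
    Complex.continuous_re.comp_continuousOn ((hL.sub hM).div_const _)
  have hval : ∀ s ∈ S, ((L s - M s) / (2 * Real.pi * Complex.I)).re = k s := by
    intro s hs
    rw [hk s hs, mul_div_cancel_right₀ _ hpi]; simp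
  have hord := (hS.image _ hcont).ordConnected
  have hkk : k s = k s₀ := by
    by_contra hne
    wlog hlt : k s < k s₀ generalizing s s₀ with H
    · exact H s hs s₀ hs₀ (Ne.symm hne) (lt_of_le_of_ne (not_lt.1 hlt) (Ne.symm hne))
    have hmem : ((k s : ℝ) + 1 / 2) ∈
        (fun s => ((L s - M s) / (2 * Real.pi * Complex.I)).re) '' S := by
      refine hord.out ⟨s, hs, hval s hs⟩ ⟨s₀, hs₀, hval s₀ hs₀⟩ ⟨by linarith, ?_⟩
      have : (k s : ℝ) + 1 ≤ k s₀ := by exact_mod_cast hlt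
      linarith
    obtain ⟨t, ht, e⟩ := hmem
    have e' := (hval t ht).symm.trans e
    have e2 : (2 * k t : ℝ) = 2 * k s + 1 := by linarith
    have e3 : 2 * k t = 2 * k s + 1 := by exact_mod_cast e2
    omega
  rw [hk s hs, hkk]

/-- A continuous logarithm of a holomorphic function is holomorphic. -/
lemma hasDerivAt_of_exp_eventuallyEq {L g : ℂ → ℂ} {z g' : ℂ} (hL : ContinuousAt L z)
    (hg : HasDerivAt g g' z) (h : ∀ᶠ w in 𝓝 z, Complex.exp (L w) = g w) :
    HasDerivAt L (g' / g z) z := by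
  have hz : Complex.exp (L z) = g z := h.self_of_nhds
  have hg0 : g z ≠ 0 := hz ▸ Complex.exp_ne_zero _
  have h1 : HasDerivAt (fun w => Complex.log (g w / g z) + L z) (g' / g z) z := by
    have h2 : HasDerivAt (fun w => g w / g z) (g' / g z) z := hg.div_const _
    have h3 := (h2.clog (by rw [div_self hg0]; simp)).add_const (L z)
    simpa [div_self hg0] using h3
  refine h1.congr_of_eventuallyEq ?_
  have h4 : ∀ᶠ w in 𝓝 z, ‖L w - L z‖ < Real.pi := by
    have : ContinuousAt (fun w => ‖L w - L z‖) z := (hL.sub continuousAt_const).norm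
    exact this.eventually_lt continuousAt_const (by simpa using Real.pi_pos)
  filter_upwards [h, h4] with w h5 h6
  have h7 := (Complex.abs_im_le_norm (L w - L z)).trans_lt h6
  rw [abs_lt] at h7
  rw [← h5, ← hz, ← Complex.exp_sub, Complex.log_exp h7.1 h7.2.le]
  ring

lemma isOpen_annulus (R : ℝ) : IsOpen (annulus R) :=
  (isOpen_lt continuous_const continuous_norm).inter (isOpen_lt continuous_norm continuous_const)

/-- The strip of logarithms of the points of `annulus R`. -/
def logStrip (R : ℝ) : Set ℂ := {ζ | 0 < ζ.re ∧ ζ.re < Real.log R}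

lemma isOpen_logStrip (R : ℝ) : IsOpen (logStrip R) :=
  (isOpen_lt continuous_const Complex.continuous_re).inter
    (isOpen_lt Complex.continuous_re continuous_const)

lemma convex_logStrip (R : ℝ) : Convex ℝ (logStrip R) :=
  (convex_halfSpace_re_gt 0).inter (convex_halfSpace_re_lt _)

lemma exp_mem_annulus {R : ℝ} (hR : 1 < R) {ζ : ℂ} :
    Complex.exp ζ ∈ annulus R ↔ ζ ∈ logStrip R := by
  have : 0 < R := by linarith
  simp only [annulus, logStrip, mem_ofPred_eq, Complex.norm_exp, Real.one_lt_exp_iff]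
  rw [Real.lt_log_iff_exp_lt this]

lemma log_mem_logStrip {R : ℝ} (hR : 1 < R) {w : ℂ} (hw : w ∈ annulus R) :
    Complex.log w ∈ logStrip R := by
  rw [← exp_mem_annulus hR, Complex.exp_log]
  · exact hw
  · rintro rfl
    have := hw.1
    simp at this
    linarith

/-- A holomorphic function on the strip of logarithms with period `2πi` descends to the annulus. -/
lemma exists_descent_of_periodic {R : ℝ} (hR : 1 < R) {M : ℂ → ℂ}
    (hM : DifferentiableOn ℂ M (logStrip R))
    (hper : ∀ ζ ∈ logStrip R, M (ζ + 2 * Real.pi * Complex.I) = M ζ) :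
    ∃ m : ℂ → ℂ, DifferentiableOn ℂ m (annulus R) ∧
      ∀ ζ ∈ logStrip R, m (Complex.exp ζ) = M ζ := by
  have hstrip : ∀ ζ ∈ logStrip R, ∀ n : ℤ,
      ζ + n * (2 * Real.pi * Complex.I) ∈ logStrip R := by
    intro ζ hζ n
    have h : (ζ + n * (2 * Real.pi * Complex.I)).re = ζ.re := by simp
    simpa only [logStrip, mem_ofPred_eq, h] using hζ
  have hperZ : ∀ n : ℤ, ∀ ζ ∈ logStrip R, M (ζ + n * (2 * Real.pi * Complex.I)) = M ζ := by
    intro n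
    induction n using Int.induction_on with
    | zero => simp
    | succ k ih =>
      intro ζ hζ
      rw [← ih ζ hζ, ← hper _ (hstrip ζ hζ k)]
      congr 1; push_cast; ring
    | pred k ih =>
      intro ζ hζ
      rw [← ih ζ hζ, ← hper _ (hstrip ζ hζ _)]
      congr 1; push_cast; ring
  have hval : ∀ ζ ∈ logStrip R, M (Complex.log (Complex.exp ζ)) = M ζ := by
    intro ζ hζ
    obtain ⟨n, hn⟩ := Complex.exp_eq_exp_iff_sub.1
      (Complex.exp_log (Complex.exp_ne_zero ζ))
    rw [← hperZ n ζ hζ, ← hn]; congr 1; ring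
  refine ⟨fun w => M (Complex.log w), ?_, hval⟩
  intro w hw
  have hw0 : w ≠ 0 := by
    rintro rfl
    have := hw.1
    simp at this
    linarith
  set ζ₀ := Complex.log w with hζ₀
  have hζ : ζ₀ ∈ logStrip R := log_mem_logStrip hR hw
  set lam : ℂ → ℂ := fun v => Complex.log (v / w) + ζ₀ with hlam
  have hlamw : lam w = ζ₀ := by simp [hlam, div_self hw0]
  have hlamd : DifferentiableAt ℂ lam w := by
    refine DifferentiableAt.add_const _ (DifferentiableAt.clog (by fun_prop) ?_)
    rw [div_self hw0]; simp
  have hcomp : DifferentiableAt ℂ (fun v => M (lam v)) w := by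
    refine DifferentiableAt.comp w ?_ hlamd
    rw [hlamw]
    exact hM.differentiableAt ((isOpen_logStrip R).mem_nhds hζ)
  refine (hcomp.congr_of_eventuallyEq ?_).differentiableWithinAt
  filter_upwards [(isOpen_annulus R).mem_nhds hw] with v hv
  have hv0 : v ≠ 0 := by
    rintro rfl
    have := hv.1
    simp at this
    linarith
  have hexp : Complex.exp (lam v) = v := by
    simp only [hlam]
    rw [Complex.exp_add, Complex.exp_log (div_ne_zero hv0 hw0), hζ₀, Complex.exp_log hw0]
    field_simp
  have hmem : lam v ∈ logStrip R := by
    rw [← exp_mem_annulus hR, hexp]; exact hv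
  have := hval _ hmem
  rw [hexp] at this
  exact this

/-- There is no holomorphic logarithm on an annulus, as it would be a primitive of `1/w`. -/
lemma not_exists_log_annulus {R : ℝ} (hR : 1 < R) {l : ℂ → ℂ}
    (hl : DifferentiableOn ℂ l (annulus R)) (he : ∀ w ∈ annulus R, Complex.exp (l w) = w) :
    False := by
  obtain ⟨r, hr1, hrR⟩ := exists_between hR
  have hr0 : 0 < r := by linarith
  have hsub : ∀ w ∈ Metric.sphere (0 : ℂ) r, w ∈ annulus R := by
    intro w hw
    have : ‖w‖ = r := by simpa using hw
    exact ⟨by rw [this]; exact hr1, by rw [this]; exact hrR⟩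
  have hder : ∀ w ∈ Metric.sphere (0 : ℂ) r, HasDerivWithinAt l (w - 0)⁻¹ (Metric.sphere 0 r) w := by
    intro w hw
    have hw' := hsub w hw
    have h1 := hasDerivAt_of_exp_eventuallyEq
      (hl.differentiableAt ((isOpen_annulus R).mem_nhds hw')).continuousAt (hasDerivAt_id w)
      (by filter_upwards [(isOpen_annulus R).mem_nhds hw'] with v hv using he v hv)
    simpa using h1.hasDerivWithinAt
  have h0 := circleIntegral.integral_eq_zero_of_hasDerivWithinAt hr0.le hder
  rw [circleIntegral.integral_sub_center_inv _ hr0.ne'] at h0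
  exact Complex.two_pi_I_ne_zero h0

lemma circleIntegral_inv_mul_eq (m : ℂ → ℂ) {r : ℝ} (hr : r ≠ 0) :
    (∮ z in C(0, r), (z - 0)⁻¹ • m z)
      = Complex.I * ∫ θ in (0)..(2 * Real.pi), m (r * Complex.exp (θ * Complex.I)) := by
  rw [circleIntegral, ← intervalIntegral.integral_const_mul]
  refine intervalIntegral.integral_congr fun θ _ => ?_
  have : circleMap 0 r θ ≠ 0 := by
    simp [circleMap, hr]
  simp only [deriv_circleMap, sub_zero, smul_eq_mul]
  rw [show (r : ℂ) * Complex.exp (θ * Complex.I) = circleMap 0 r θ by simp [circleMap]]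
  field_simp

/-- If an annulus is mapped bijectively and holomorphically onto another one, then its module is not
larger: the mean of `log ‖h‖` over the circle of radius `r` is an affine function of `log r` with a
nonzero integer as its slope, and its values lie in `[0, log R']`. -/
lemma le_of_bijOn_annulus {R R' : ℝ} (hR : 1 < R) (hR' : 1 < R') {h : ℂ → ℂ}
    (hd : DifferentiableOn ℂ h (annulus R)) (hb : BijOn h (annulus R) (annulus R')) :
    R ≤ R' := by
  have hS := isOpen_logStrip R
  have hSne : (logStrip R).Nonempty := by
    obtain ⟨t, h1, h2⟩ := exists_between (Real.log_pos hR)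
    exact ⟨t, by simpa using h1, by simpa using h2⟩
  have hmaps : ∀ ζ ∈ logStrip R, Complex.exp ζ ∈ annulus R := fun ζ hζ =>
    (exp_mem_annulus hR).2 hζ
  have hne : ∀ ζ ∈ logStrip R, h (Complex.exp ζ) ≠ 0 := by
    intro ζ hζ h0
    have := (hb.mapsTo (hmaps ζ hζ)).1
    rw [h0] at this
    simp at this
    linarith
  -- a logarithm of `h ∘ exp` on the strip
  obtain ⟨L, hLc, hL⟩ := Complex.exists_continuousOn_eqOn_exp_comp (U := logStrip R)
    ((convex_logStrip R).isSimplyConnected_of_nonempty hSne) hS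
    (g := fun ζ => h (Complex.exp ζ))
    (hd.continuousOn.comp Complex.continuous_exp.continuousOn hmaps)
    (by rintro ⟨ζ, hζ, e⟩; exact hne ζ hζ e)
  have hL' : ∀ ζ ∈ logStrip R, Complex.exp (L ζ) = h (Complex.exp ζ) := fun ζ hζ => hL hζ
  have hLd : DifferentiableOn ℂ L (logStrip R) := by
    intro ζ hζ
    have h1 : HasDerivAt (fun ζ => h (Complex.exp ζ)) _ ζ :=
      ((hd.differentiableAt ((isOpen_annulus R).mem_nhds (hmaps ζ hζ))).hasDerivAt).comp ζ
        (Complex.hasDerivAt_exp ζ)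
    exact (hasDerivAt_of_exp_eventuallyEq (hLc.continuousAt (hS.mem_nhds hζ)) h1
      (by filter_upwards [hS.mem_nhds hζ] with v hv using hL' v hv)).differentiableAt
        |>.differentiableWithinAt
  have hshift : ∀ ζ ∈ logStrip R, ζ + 2 * Real.pi * Complex.I ∈ logStrip R := by
    intro ζ hζ
    have h : (ζ + 2 * Real.pi * Complex.I).re = ζ.re := by simp
    simpa only [logStrip, mem_ofPred_eq, h] using hζ
  -- `n` is the winding number of the image of a circle; `L ζ - n ζ` is periodic and descends to a
  -- holomorphic function `m` with `log ‖h w‖ = Re (m w) + n log ‖w‖`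
  obtain ⟨n, hn⟩ := exists_int_sub_eq_of_exp_eq (convex_logStrip R).isPreconnected
    (L := fun ζ => L (ζ + 2 * Real.pi * Complex.I)) (M := L)
    (hLc.comp (by fun_prop) hshift) hLc (by
      intro ζ hζ
      rw [hL' _ (hshift ζ hζ), hL' ζ hζ, Complex.exp_add, Complex.exp_two_pi_mul_I, mul_one])
  obtain ⟨m, hmd, hm⟩ := exists_descent_of_periodic hR (M := fun ζ => L ζ - n * ζ)
    (hLd.sub (by fun_prop)) (by
      intro ζ hζ
      have := hn ζ hζ
      have h2 : L (ζ + 2 * Real.pi * Complex.I) = L ζ + n * (2 * Real.pi * Complex.I) := by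
        rw [← this]; ring
      rw [h2]; ring)
  -- for `n = 0` the function `m` is a logarithm of `h`, and `m ∘ h⁻¹` a logarithm on `annulus R'`
  have hn0 : n ≠ 0 := by
    rintro rfl
    set k := Function.invFunOn h (annulus R) with hk
    have hleft : LeftInvOn k h (annulus R) := hb.injOn.leftInvOn_invFunOn
    have hkd : DifferentiableOn ℂ k (annulus R') := by
      have := hd.differentiableOn_of_leftInvOn (isOpen_annulus R) hleft
      rwa [hb.image_eq] at this
    have hkm : MapsTo k (annulus R') (annulus R) := by
      intro w hw
      obtain ⟨v, hv, rfl⟩ := hb.surjOn hw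
      rw [hleft hv]; exact hv
    refine not_exists_log_annulus hR' (l := fun w => m (k w)) (hmd.comp hkd hkm) ?_
    intro w hw
    obtain ⟨v, hv, rfl⟩ := hb.surjOn hw
    rw [hleft hv]
    have hv0 : v ≠ 0 := by
      rintro rfl
      have := hv.1
      simp at this
      linarith
    have hlog := log_mem_logStrip hR hv
    have h3 := hm _ hlog
    rw [Complex.exp_log hv0] at h3
    rw [h3]
    have := hL' _ hlog
    rw [Complex.exp_log hv0] at this
    simpa using this
  -- the mean over a circle
  have key : ∀ r₁ r₂ : ℝ, 1 < r₁ → r₁ < r₂ → r₂ < R →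
      |(n : ℝ)| * (Real.log r₂ - Real.log r₁) ≤ Real.log R' := by
    intro r₁ r₂ h1 h12 h2
    have hr₁ : 0 < r₁ := by linarith
    have hr₂ : 0 < r₂ := by linarith
    -- the mean of `m` does not depend on the radius
    have hcirc : (∮ z in C(0, r₂), (z - 0)⁻¹ • m z) = ∮ z in C(0, r₁), (z - 0)⁻¹ • m z := by
      refine Complex.circleIntegral_sub_center_inv_smul_eq_of_differentiable_on_annulus_off_countable
        hr₁ h12.le countable_empty ?_ ?_
      · refine hmd.continuousOn.mono ?_
        rintro z ⟨hz1, hz2⟩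
        simp at hz1 hz2
        exact ⟨by linarith, by linarith⟩
      · rintro z ⟨⟨hz1, hz2⟩, -⟩
        simp at hz1 hz2
        exact hmd.differentiableAt ((isOpen_annulus R).mem_nhds ⟨by linarith, by linarith⟩)
    rw [circleIntegral_inv_mul_eq m hr₁.ne', circleIntegral_inv_mul_eq m hr₂.ne'] at hcirc
    have hint := mul_left_cancel₀ Complex.I_ne_zero hcirc
    have hstr : ∀ r : ℝ, 1 < r → r < R → ∀ θ : ℝ,
        (Real.log r : ℂ) + θ * Complex.I ∈ logStrip R := by
      intro r h3 h4 θ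
      refine ⟨by simpa using Real.log_pos h3, ?_⟩
      simpa using Real.log_lt_log (by linarith) h4
    have hmval : ∀ r : ℝ, 1 < r → r < R → ∀ θ : ℝ, m (r * Complex.exp (θ * Complex.I)) =
        L (Real.log r + θ * Complex.I) - n * (Real.log r + θ * Complex.I) := by
      intro r h3 h4 θ
      rw [← hm _ (hstr r h3 h4 θ), Complex.exp_add, ← Complex.ofReal_exp,
        Real.exp_log (by linarith)]
    have hcont : ∀ r : ℝ, 1 < r → r < R →
        Continuous (fun θ : ℝ => m (r * Complex.exp (θ * Complex.I))) := by
      intro r h3 h4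
      refine hmd.continuousOn.comp_continuous (by fun_prop) fun θ => ?_
      refine ⟨?_, ?_⟩ <;> simp [Complex.norm_exp_ofReal_mul_I, abs_of_pos (show 0 < r by linarith)] <;>
        linarith
    have hre : ∀ r : ℝ, 1 < r → r < R → ∃ c : ℝ, 0 ≤ c ∧ c ≤ 2 * Real.pi * Real.log R' ∧
        (∫ θ in (0)..(2 * Real.pi), m (r * Complex.exp (θ * Complex.I))).re
          = c - 2 * Real.pi * (n * Real.log r) := by
      intro r h3 h4
      refine ⟨∫ θ in (0)..(2 * Real.pi), ((m (r * Complex.exp (θ * Complex.I))).re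
        + n * Real.log r), ?_, ?_, ?_⟩
      · refine intervalIntegral.integral_nonneg (by positivity) fun θ _ => ?_
        have h5 := (hb.mapsTo (hmaps _ (hstr r h3 h4 θ))).1
        rw [← hL' _ (hstr r h3 h4 θ), Complex.norm_exp, Real.one_lt_exp_iff] at h5
        rw [hmval r h3 h4 θ]
        simpa using h5.le
      · have : ∫ θ in (0)..(2 * Real.pi), ((m (r * Complex.exp (θ * Complex.I))).re
            + n * Real.log r) ≤ ∫ θ in (0)..(2 * Real.pi), Real.log R' := by
          refine intervalIntegral.integral_mono_on (by positivity) ?_ (by simp) fun θ _ => ?_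
          · exact ((Complex.continuous_re.comp (hcont r h3 h4)).add
              continuous_const).intervalIntegrable _ _
          have h5 := (hb.mapsTo (hmaps _ (hstr r h3 h4 θ))).2
          rw [← hL' _ (hstr r h3 h4 θ), Complex.norm_exp,
            ← Real.lt_log_iff_exp_lt (by linarith)] at h5
          rw [hmval r h3 h4 θ]
          simpa using h5.le
        simpa using this
      · rw [intervalIntegral.integral_add]
        · have h6 : (∫ θ in (0)..(2 * Real.pi), m (r * Complex.exp (θ * Complex.I))).re =
              ∫ θ in (0)..(2 * Real.pi), (m (r * Complex.exp (θ * Complex.I))).re := by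
            have := Complex.reCLM.intervalIntegral_comp_comm
              ((hcont r h3 h4).intervalIntegrable (μ := volume) 0 (2 * Real.pi))
            simpa using this.symm
          rw [h6, intervalIntegral.integral_const, smul_eq_mul]
          linarith
        · exact (Complex.continuous_re.comp (hcont r h3 h4)).intervalIntegrable _ _
        · exact (continuous_const).intervalIntegrable _ _
    obtain ⟨c₁, p1, p2, p3⟩ := hre r₁ h1 (by linarith)
    obtain ⟨c₂, q1, q2, q3⟩ := hre r₂ (by linarith) h2
    have hdiff : c₂ - c₁ = 2 * Real.pi * (n * (Real.log r₂ - Real.log r₁)) := by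
      rw [hint, p3] at q3; linarith
    have hpos : 0 < Real.log r₂ - Real.log r₁ := by
      have := Real.log_lt_log hr₁ h12; linarith
    have habs : |c₂ - c₁| ≤ 2 * Real.pi * Real.log R' := by
      rw [abs_le]; constructor <;> linarith
    rw [hdiff, abs_mul, abs_mul (n : ℝ), abs_of_pos hpos,
      abs_of_pos (by positivity : 0 < 2 * Real.pi)] at habs
    exact le_of_mul_le_mul_left habs (by positivity)
  have hn1 : (1 : ℝ) ≤ |(n : ℝ)| := by exact_mod_cast Int.one_le_abs hn0
  by_contra hlt
  rw [not_le] at hlt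
  have hlog : Real.log R' < Real.log R := Real.log_lt_log (by linarith) hlt
  -- radii close to `1` and to `R`
  set ε := (Real.log R - Real.log R') / 3 with hε
  have hR'0 := Real.log_pos hR'
  have := key (Real.exp ε) (Real.exp (Real.log R - ε)) (by
    rw [Real.one_lt_exp_iff]; linarith) (by
    rw [Real.exp_lt_exp]; linarith) (by
    rw [← Real.lt_log_iff_exp_lt (by linarith)]; linarith)
  rw [Real.log_exp, Real.log_exp] at this
  have h9 : Real.log R - ε - ε ≤ |(n : ℝ)| * (Real.log R - ε - ε) :=
    le_mul_of_one_le_left (by linarith) hn1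
  linarith

/-- An open set has at most one module, so that `ringModule` is determined by any conformal map onto
an annulus. -/
lemma HasModule.unique {Ω : Set ℂ} (hΩ : IsOpen Ω) {m m' : ℝ} (h : HasModule Ω m)
    (h' : HasModule Ω m') : m = m' := by
  have key : ∀ {R R' : ℝ} {f g : ℂ → ℂ}, 1 < R → 1 < R' → DifferentiableOn ℂ f Ω →
      BijOn f Ω (annulus R) → DifferentiableOn ℂ g Ω → BijOn g Ω (annulus R') → R ≤ R' := by
    intro R R' f g hR hR' hf hfb hg hgb
    have hleft : LeftInvOn (Function.invFunOn f Ω) f Ω := hfb.injOn.leftInvOn_invFunOn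
    have hkd := hf.differentiableOn_of_leftInvOn hΩ hleft
    rw [hfb.image_eq] at hkd
    have hkb : BijOn (Function.invFunOn f Ω) (annulus R) Ω := hfb.invOn_invFunOn.symm.bijOn
      (by intro w hw; obtain ⟨v, hv, rfl⟩ := hfb.surjOn hw; rw [hleft hv]; exact hv) hfb.mapsTo
    exact le_of_bijOn_annulus hR hR' (h := g ∘ Function.invFunOn f Ω)
      (hg.comp hkd hkb.mapsTo) (hgb.comp hkb)
  obtain ⟨R, hR, ⟨f, hf, hfb⟩, rfl⟩ := h
  obtain ⟨R', hR', ⟨g, hg, hgb⟩, rfl⟩ := h'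
  rw [le_antisymm (key hR hR' hf hfb hg hgb) (key hR' hR hg hgb hf hfb)]


/-! ### Ellipses and the Joukowski map -/

/-- The gauge whose sublevel sets are the ellipses with semi-axes `a`, `b`. -/
noncomputable def ellipseGauge (a b : ℝ) (z : ℂ) : ℝ := (z.re / a) ^ 2 + (z.im / b) ^ 2

lemma mem_ellipse {a b : ℝ} {z : ℂ} : z ∈ ellipse a b ↔ ellipseGauge a b z < 1 := Iff.rfl

lemma mem_closedEllipse {a b : ℝ} {z : ℂ} : z ∈ closedEllipse a b ↔ ellipseGauge a b z ≤ 1 := Iff.rfl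

lemma ellipse_subset_closedEllipse (a b : ℝ) : ellipse a b ⊆ closedEllipse a b :=
  fun _ hz => le_of_lt (mem_ellipse.1 hz)

lemma contDiff_ellipseGauge (a b : ℝ) {n : WithTop ℕ∞} : ContDiff ℝ n (ellipseGauge a b) := by
  unfold ellipseGauge
  exact ((Complex.reCLM.contDiff.div_const a).pow 2).add ((Complex.imCLM.contDiff.div_const b).pow 2)

lemma continuous_ellipseGauge (a b : ℝ) : Continuous (ellipseGauge a b) :=
  (contDiff_ellipseGauge a b (n := 0)).continuous

lemma isOpen_ellipse (a b : ℝ) : IsOpen (ellipse a b) :=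
  isOpen_lt (continuous_ellipseGauge a b) continuous_const

lemma isClosed_closedEllipse (a b : ℝ) : IsClosed (closedEllipse a b) :=
  isClosed_le (continuous_ellipseGauge a b) continuous_const

lemma ellipseGauge_neg (a b : ℝ) (z : ℂ) : ellipseGauge a b (-z) = ellipseGauge a b z := by
  simp only [ellipseGauge, Complex.neg_re, Complex.neg_im]; ring

lemma ellipseGauge_conj (a b : ℝ) (z : ℂ) : ellipseGauge a b (star z) = ellipseGauge a b z := by
  simp [ellipseGauge, neg_div]

lemma ellipseGauge_smul (a b t : ℝ) (z : ℂ) :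
    ellipseGauge a b (t • z) = t ^ 2 * ellipseGauge a b z := by
  simp only [ellipseGauge, Complex.smul_re, Complex.smul_im, smul_eq_mul]; ring

lemma ellipseGauge_nonneg (a b : ℝ) (z : ℂ) : 0 ≤ ellipseGauge a b z := by
  unfold ellipseGauge; positivity

lemma ellipseGauge_eq_zero {a b : ℝ} (ha : a ≠ 0) (hb : b ≠ 0) {z : ℂ} :
    ellipseGauge a b z = 0 ↔ z = 0 := by
  unfold ellipseGauge
  rw [add_eq_zero_iff_of_nonneg (by positivity) (by positivity)]
  simp [ha, hb, Complex.ext_iff]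

lemma zero_mem_ellipse (a b : ℝ) : (0 : ℂ) ∈ ellipse a b := by simp [mem_ellipse, ellipseGauge]

lemma isCompact_closedEllipse {a b : ℝ} (ha : 0 < a) (hb : 0 < b) :
    IsCompact (closedEllipse a b) := by
  refine Metric.isCompact_of_isClosed_isBounded (isClosed_closedEllipse a b) ?_
  refine (Metric.isBounded_closedBall (x := (0 : ℂ)) (r := a + b)).subset ?_
  intro z hz
  have hz' : (z.re / a) ^ 2 + (z.im / b) ^ 2 ≤ 1 := hz
  have h1 : |z.re / a| ≤ 1 := by
    rw [← sq_le_one_iff_abs_le_one]; nlinarith [sq_nonneg (z.im / b)]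
  have h2 : |z.im / b| ≤ 1 := by
    rw [← sq_le_one_iff_abs_le_one]; nlinarith [sq_nonneg (z.re / a)]
  rw [abs_div, abs_of_pos ha, div_le_one ha] at h1
  rw [abs_div, abs_of_pos hb, div_le_one hb] at h2
  rw [mem_closedBall_zero_iff]
  exact (Complex.norm_le_abs_re_add_abs_im z).trans (add_le_add h1 h2)

lemma starConvex_ellipse (a b : ℝ) : StarConvex ℝ 0 (ellipse a b) := by
  rw [starConvex_zero_iff]
  intro z hz t ht0 ht1
  rw [mem_ellipse] at hz ⊢
  rw [ellipseGauge_smul]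
  have := ellipseGauge_nonneg a b z
  nlinarith [mul_le_mul ht1 ht1 ht0 zero_le_one]

lemma isPreconnected_ellipse (a b : ℝ) : IsPreconnected (ellipse a b) :=
  ((starConvex_ellipse a b).isPathConnected (zero_mem_ellipse a b)).isConnected.isPreconnected

/-- The Joukowski map. -/
noncomputable def joukowski (w : ℂ) : ℂ := w + 1 / w

lemma joukowski_eq_iff {w v : ℂ} (hw : w ≠ 0) (hv : v ≠ 0) :
    joukowski w = joukowski v ↔ v = w ∨ v = 1 / w := by
  unfold joukowski
  constructor
  · intro h
    have h1 : (w - v) * (w * v - 1) = 0 := by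
      field_simp at h
      linear_combination h
    rcases mul_eq_zero.1 h1 with h2 | h2
    · exact Or.inl (sub_eq_zero.1 h2).symm
    · right; rw [eq_div_iff hw]; linear_combination h2
  · rintro (rfl | rfl)
    · rfl
    · field_simp; ring

/-- The Joukowski map of the exterior of the open unit disc onto the plane is surjective: one of the
two roots of `w² - s w + 1` has modulus at least `1`. -/
lemma exists_joukowski_eq (s : ℂ) : ∃ w : ℂ, 1 ≤ ‖w‖ ∧ joukowski w = s := by
  obtain ⟨d, hd⟩ : ∃ d : ℂ, d ^ 2 = s ^ 2 / 4 - 1 := ⟨_, Complex.cpow_nat_inv_pow _ two_ne_zero⟩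
  have hprod : (s / 2 + d) * (s / 2 - d) = 1 := by linear_combination -hd
  have h1 : s / 2 + d ≠ 0 := left_ne_zero_of_mul_eq_one hprod
  have h2 : s / 2 - d ≠ 0 := right_ne_zero_of_mul_eq_one hprod
  by_cases h : 1 ≤ ‖s / 2 + d‖
  · refine ⟨s / 2 + d, h, ?_⟩
    rw [joukowski, ← hprod, mul_div_cancel_left₀ _ h1]; ring
  · refine ⟨s / 2 - d, ?_, ?_⟩
    · have hn : ‖s / 2 + d‖ * ‖s / 2 - d‖ = 1 := by rw [← norm_mul, hprod, norm_one]
      rw [not_le] at h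
      by_contra hlt
      rw [not_le] at hlt
      have := mul_lt_one_of_nonneg_of_lt_one_left (norm_nonneg _) h hlt.le
      linarith
    · rw [joukowski, ← hprod, mul_div_cancel_right₀ _ h2]; ring

lemma ellipseGauge_joukowski {ρ : ℝ} {w : ℂ} (hw : w ≠ 0) :
    ellipseGauge (ρ + 1 / ρ) (ρ - 1 / ρ) (joukowski w) =
      (w.re / ‖w‖) ^ 2 * ((‖w‖ + 1 / ‖w‖) / (ρ + 1 / ρ)) ^ 2 +
      (w.im / ‖w‖) ^ 2 * ((‖w‖ - 1 / ‖w‖) / (ρ - 1 / ρ)) ^ 2 := by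
  have hn : ‖w‖ ≠ 0 := norm_ne_zero_iff.2 hw
  have h1 : (joukowski w).re = w.re / ‖w‖ * (‖w‖ + 1 / ‖w‖) := by
    simp only [joukowski, Complex.add_re, one_div, Complex.inv_re, Complex.normSq_eq_norm_sq]
    field_simp
  have h2 : (joukowski w).im = w.im / ‖w‖ * (‖w‖ - 1 / ‖w‖) := by
    simp only [joukowski, Complex.add_im, one_div, Complex.inv_im, Complex.normSq_eq_norm_sq]
    field_simp
    ring
  rw [ellipseGauge, h1, h2]; ring

lemma sq_re_add_sq_im_div_norm {w : ℂ} (hw : w ≠ 0) :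
    (w.re / ‖w‖) ^ 2 + (w.im / ‖w‖) ^ 2 = 1 := by
  have hn : ‖w‖ ≠ 0 := norm_ne_zero_iff.2 hw
  have := Complex.sq_norm w
  rw [Complex.normSq_apply] at this
  field_simp
  linarith

lemma add_inv_lt_add_inv {s t : ℝ} (hs : 1 ≤ s) (hst : s < t) : s + 1 / s < t + 1 / t := by
  have hs0 : 0 < s := by linarith
  have ht0 : 0 < t := by linarith
  have : t + 1 / t - (s + 1 / s) = (t - s) * (s * t - 1) / (s * t) := by field_simp; ring
  have h2 : 0 < (t - s) * (s * t - 1) / (s * t) := by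
    apply div_pos _ (by positivity)
    apply mul_pos (by linarith)
    nlinarith
  linarith

lemma sub_inv_lt_sub_inv {s t : ℝ} (hs : 0 < s) (hst : s < t) : s - 1 / s < t - 1 / t := by
  have := one_div_lt_one_div_of_lt hs hst
  linarith

lemma sub_inv_pos {R : ℝ} (hR : 1 < R) : 0 < R - 1 / R := by
  have := sub_inv_lt_sub_inv one_pos hR
  simpa using this

lemma add_inv_pos {R : ℝ} (hR : 1 < R) : 0 < R + 1 / R := by positivity

lemma ellipseGauge_joukowski_lt {ρ : ℝ} (hρ : 1 < ρ) {w : ℂ} (hw : 1 ≤ ‖w‖) (h : ‖w‖ < ρ) :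
    ellipseGauge (ρ + 1 / ρ) (ρ - 1 / ρ) (joukowski w) < 1 := by
  have hw0 : w ≠ 0 := norm_pos_iff.1 (by linarith)
  rw [ellipseGauge_joukowski hw0]
  have hs := sq_re_add_sq_im_div_norm hw0
  have hα : ((‖w‖ + 1 / ‖w‖) / (ρ + 1 / ρ)) ^ 2 < 1 := by
    have h1 := add_inv_lt_add_inv hw h
    have h0 : 0 ≤ ‖w‖ + 1 / ‖w‖ := by positivity
    rw [sq_lt_one_iff₀ (div_nonneg h0 (add_inv_pos hρ).le), div_lt_one (add_inv_pos hρ)]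
    exact h1
  have hβ : ((‖w‖ - 1 / ‖w‖) / (ρ - 1 / ρ)) ^ 2 < 1 := by
    have h1 := sub_inv_lt_sub_inv (by linarith : 0 < ‖w‖) h
    have h0 : 0 ≤ ‖w‖ - 1 / ‖w‖ := by
      have : 1 / ‖w‖ ≤ 1 := (div_le_one (by linarith)).2 hw
      linarith
    rw [sq_lt_one_iff₀ (div_nonneg h0 (sub_inv_pos hρ).le), div_lt_one (sub_inv_pos hρ)]
    exact h1
  set A := (w.re / ‖w‖) ^ 2
  set B := (w.im / ‖w‖) ^ 2
  have hA : 0 ≤ A := sq_nonneg _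
  have hB : 0 ≤ B := sq_nonneg _
  rcases hA.eq_or_lt with h0 | h0
  · have hB1 : B = 1 := by linarith
    rw [← h0, hB1]; linarith
  · nlinarith [mul_lt_mul_of_pos_left hα h0, mul_le_mul_of_nonneg_left hβ.le hB]

lemma ellipseGauge_joukowski_eq {ρ : ℝ} (hρ : 1 < ρ) {w : ℂ} (h : ‖w‖ = ρ) :
    ellipseGauge (ρ + 1 / ρ) (ρ - 1 / ρ) (joukowski w) = 1 := by
  have hw0 : w ≠ 0 := norm_pos_iff.1 (by linarith)
  rw [ellipseGauge_joukowski hw0, h, div_self (add_inv_pos hρ).ne', div_self (sub_inv_pos hρ).ne']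
  have := sq_re_add_sq_im_div_norm hw0
  rw [h] at this
  linarith

lemma ellipseGauge_joukowski_gt {ρ : ℝ} (hρ : 1 < ρ) {w : ℂ} (h : ρ < ‖w‖) :
    1 < ellipseGauge (ρ + 1 / ρ) (ρ - 1 / ρ) (joukowski w) := by
  have hw0 : w ≠ 0 := norm_pos_iff.1 (by linarith)
  rw [ellipseGauge_joukowski hw0]
  have hs := sq_re_add_sq_im_div_norm hw0
  have hα : 1 < ((‖w‖ + 1 / ‖w‖) / (ρ + 1 / ρ)) ^ 2 := by
    have h1 := add_inv_lt_add_inv hρ.le h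
    rw [one_lt_sq_iff₀ (div_nonneg (by positivity) (add_inv_pos hρ).le), one_lt_div (add_inv_pos hρ)]
    exact h1
  have hβ : 1 < ((‖w‖ - 1 / ‖w‖) / (ρ - 1 / ρ)) ^ 2 := by
    have h1 := sub_inv_lt_sub_inv (by linarith : 0 < ρ) h
    have h0 := sub_inv_pos hρ
    rw [one_lt_sq_iff₀ (div_nonneg (by linarith) h0.le), one_lt_div h0]
    exact h1
  set A := (w.re / ‖w‖) ^ 2
  set B := (w.im / ‖w‖) ^ 2
  have hA : 0 ≤ A := sq_nonneg _
  have hB : 0 ≤ B := sq_nonneg _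
  rcases hA.eq_or_lt with h0 | h0
  · have hB1 : B = 1 := by linarith
    rw [← h0, hB1]; linarith
  · nlinarith [mul_lt_mul_of_pos_left hα h0, mul_le_mul_of_nonneg_left hβ.le hB]

/-- Outside the open unit disc the Joukowski preimage of the focal ellipse is the disc of radius
`ρ`. -/
lemma joukowski_mem_ellipse {ρ : ℝ} (hρ : 1 < ρ) {w : ℂ} (hw : 1 ≤ ‖w‖) :
    joukowski w ∈ ellipse (ρ + 1 / ρ) (ρ - 1 / ρ) ↔ ‖w‖ < ρ := by
  rw [mem_ellipse]
  refine ⟨fun h => ?_, fun h => ellipseGauge_joukowski_lt hρ hw h⟩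
  by_contra hlt
  rcases (not_lt.1 hlt).eq_or_lt with h1 | h1
  · linarith [ellipseGauge_joukowski_eq hρ h1.symm]
  · linarith [ellipseGauge_joukowski_gt hρ h1]

lemma joukowski_mem_closedEllipse {ρ : ℝ} (hρ : 1 < ρ) {w : ℂ} (hw : 1 ≤ ‖w‖) :
    joukowski w ∈ closedEllipse (ρ + 1 / ρ) (ρ - 1 / ρ) ↔ ‖w‖ ≤ ρ := by
  rw [mem_closedEllipse]
  constructor
  · intro h
    by_contra hlt
    linarith [ellipseGauge_joukowski_gt hρ (not_le.1 hlt)]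
  · intro h
    rcases h.eq_or_lt with h1 | h1
    · exact (ellipseGauge_joukowski_eq hρ h1).le
    · exact (ellipseGauge_joukowski_lt hρ hw h1).le

lemma joukowski_sq {w : ℂ} (hw : w ≠ 0) : joukowski (w ^ 2) = joukowski w ^ 2 - 2 := by
  unfold joukowski; field_simp; ring

/-- The map `ω ↦ ω² - 2` is the quotient by `±1` of the second ellipse onto the focal ellipse: it is
conjugate to `w ↦ w²` under the Joukowski map. -/
lemma sq_sub_two_mem_ellipse {R : ℝ} (hR : 1 < R) {ω : ℂ} :
    ω ^ 2 - 2 ∈ ellipse (R ^ 2 + 1 / R ^ 2) (R ^ 2 - 1 / R ^ 2) ↔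
      ω ∈ ellipse (R + 1 / R) (R - 1 / R) := by
  obtain ⟨w, hw, rfl⟩ := exists_joukowski_eq ω
  have hw0 : w ≠ 0 := norm_pos_iff.1 (by linarith)
  rw [← joukowski_sq hw0, joukowski_mem_ellipse (one_lt_pow₀ hR two_ne_zero)
    (by rw [norm_pow]; exact one_le_pow₀ hw), joukowski_mem_ellipse hR hw, norm_pow]
  exact pow_lt_pow_iff_left₀ (norm_nonneg _) (by linarith) two_ne_zero

lemma sq_sub_two_mem_closedEllipse {R : ℝ} (hR : 1 < R) {ω : ℂ} :
    ω ^ 2 - 2 ∈ closedEllipse (R ^ 2 + 1 / R ^ 2) (R ^ 2 - 1 / R ^ 2) ↔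
      ω ∈ closedEllipse (R + 1 / R) (R - 1 / R) := by
  obtain ⟨w, hw, rfl⟩ := exists_joukowski_eq ω
  have hw0 : w ≠ 0 := norm_pos_iff.1 (by linarith)
  rw [← joukowski_sq hw0, joukowski_mem_closedEllipse (one_lt_pow₀ hR two_ne_zero)
    (by rw [norm_pow]; exact one_le_pow₀ hw), joukowski_mem_closedEllipse hR hw, norm_pow]
  exact pow_le_pow_iff_left₀ (norm_nonneg _) (by linarith) two_ne_zero

lemma ellipseGauge_I_mul (a b : ℝ) (z : ℂ) :
    ellipseGauge a b (Complex.I * z) = ellipseGauge b a z := by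
  simp only [ellipseGauge, Complex.mul_re, Complex.mul_im, Complex.I_re, Complex.I_im]
  ring

/-- The map `ζ ↦ ζ² + 2` is the quotient by `±1` of the first ellipse onto the same focal ellipse,
since `(iζ)² - 2 = -(ζ² + 2)`. -/
lemma sq_add_two_mem_ellipse {R : ℝ} (hR : 1 < R) {ζ : ℂ} :
    ζ ^ 2 + 2 ∈ ellipse (R ^ 2 + 1 / R ^ 2) (R ^ 2 - 1 / R ^ 2) ↔
      ζ ∈ ellipse (R - 1 / R) (R + 1 / R) := by
  have h := sq_sub_two_mem_ellipse hR (ω := Complex.I * ζ)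
  rw [mem_ellipse, mem_ellipse, ellipseGauge_I_mul, mul_pow, Complex.I_sq,
    show (-1 : ℂ) * ζ ^ 2 - 2 = -(ζ ^ 2 + 2) by ring, ellipseGauge_neg] at h
  exact h

lemma sq_add_two_mem_closedEllipse {R : ℝ} (hR : 1 < R) {ζ : ℂ} :
    ζ ^ 2 + 2 ∈ closedEllipse (R ^ 2 + 1 / R ^ 2) (R ^ 2 - 1 / R ^ 2) ↔
      ζ ∈ closedEllipse (R - 1 / R) (R + 1 / R) := by
  have h := sq_sub_two_mem_closedEllipse hR (ω := Complex.I * ζ)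
  rw [mem_closedEllipse, mem_closedEllipse, ellipseGauge_I_mul, mul_pow, Complex.I_sq,
    show (-1 : ℂ) * ζ ^ 2 - 2 = -(ζ ^ 2 + 2) by ring, ellipseGauge_neg] at h
  exact h

/-! ### Theta products -/

/-- The infinite `q`-Pochhammer symbol `(a; p)_∞ = ∏ (1 - a pⁿ)`. -/
noncomputable def pochInf (p : ℝ) (a : ℂ) : ℂ := ∏' n : ℕ, (1 + -(a * (p : ℂ) ^ n))

/-- The product `∏ (1 - a pⁿ s + a² p²ⁿ)`, which is `(aW; p)_∞ (a/W; p)_∞` for `s = W + 1/W`. -/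
noncomputable def thetaProd (a p : ℝ) (s : ℂ) : ℂ :=
  ∏' n : ℕ, (1 + (-(a * (p : ℂ) ^ n * s) + (a * (p : ℂ) ^ n) ^ 2))

section products
variable {p : ℝ}

lemma summable_pochInf (h0 : 0 ≤ p) (h1 : p < 1) (a : ℂ) :
    Summable fun n : ℕ => ‖-(a * (p : ℂ) ^ n)‖ := by
  have : (fun n : ℕ => ‖-(a * (p : ℂ) ^ n)‖) = fun n : ℕ => ‖a‖ * p ^ n := by
    funext n; simp [abs_of_nonneg h0]
  rw [this]
  exact (summable_geometric_of_lt_one h0 h1).mul_left _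

lemma multipliable_pochInf (h0 : 0 ≤ p) (h1 : p < 1) (a : ℂ) :
    Multipliable fun n : ℕ => (1 + -(a * (p : ℂ) ^ n)) :=
  multipliable_one_add_of_summable (summable_pochInf h0 h1 a)

lemma pochInf_ne_zero (h0 : 0 ≤ p) (h1 : p < 1) {a : ℂ} (ha : ‖a‖ < 1) : pochInf p a ≠ 0 := by
  refine tprod_one_add_ne_zero_of_summable (fun n h => ?_) (summable_pochInf h0 h1 a)
  have h2 : a * (p : ℂ) ^ n = 1 := by linear_combination -h
  have h3 : ‖a * (p : ℂ) ^ n‖ < 1 := by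
    rw [norm_mul, norm_pow, Complex.norm_real, Real.norm_of_nonneg h0]
    exact (mul_le_of_le_one_right (norm_nonneg _) (pow_le_one₀ h0 h1.le)).trans_lt ha
  rw [h2] at h3
  simp at h3

/-- The functional equation of the `q`-Pochhammer symbol. -/
lemma pochInf_eq_mul (h0 : 0 ≤ p) (h1 : p < 1) (a : ℂ) :
    pochInf p a = (1 - a) * pochInf p (a * p) := by
  unfold pochInf
  rw [tprod_eq_zero_mul']
  · congr 1
    · simp [sub_eq_add_neg]
    · refine tprod_congr fun n => ?_
      rw [pow_succ]; ring
  · refine (multipliable_pochInf h0 h1 (a * p)).congr fun n => ?_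
    rw [pow_succ]; ring

lemma pochInf_conj (h0 : 0 ≤ p) (h1 : p < 1) (a : ℂ) :
    pochInf p (star a) = star (pochInf p a) := by
  unfold pochInf
  have h := ((multipliable_pochInf h0 h1 a).hasProd.map (starRingEnd ℂ) Complex.continuous_conj)
  refine Eq.trans (tprod_congr fun n => ?_) h.tprod_eq
  simp

/-- Under the Joukowski map the theta product factors into two `q`-Pochhammer symbols, which are
exchanged by `W ↦ 1/W`. -/
lemma thetaProd_joukowski (h0 : 0 ≤ p) (h1 : p < 1) (a : ℝ) {W : ℂ} (hW : W ≠ 0) :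
    thetaProd a p (joukowski W) = pochInf p (a * W) * pochInf p (a / W) := by
  unfold thetaProd pochInf
  rw [← (multipliable_pochInf h0 h1 (a * W)).tprod_mul (multipliable_pochInf h0 h1 (a / W))]
  refine tprod_congr fun n => ?_
  unfold joukowski
  field_simp
  ring

lemma norm_thetaTerm_le (h0 : 0 ≤ p) (h1 : p < 1) (a : ℝ) (s : ℂ) (n : ℕ) :
    ‖-(a * (p : ℂ) ^ n * s) + (a * (p : ℂ) ^ n) ^ 2‖ ≤ (|a| * ‖s‖ + a ^ 2) * p ^ n := by
  have hp : p ^ n ≤ 1 := pow_le_one₀ h0 h1.le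
  have hp0 : 0 ≤ p ^ n := pow_nonneg h0 n
  refine (norm_add_le _ _).trans ?_
  simp only [norm_neg, norm_mul, norm_pow, Complex.norm_real, Real.norm_eq_abs, abs_of_nonneg h0]
  rw [mul_pow, sq_abs, add_mul]
  refine add_le_add (le_of_eq (by ring)) ?_
  refine mul_le_mul_of_nonneg_left ?_ (sq_nonneg a)
  nlinarith

lemma summable_thetaProd (h0 : 0 ≤ p) (h1 : p < 1) (a : ℝ) (s : ℂ) :
    Summable fun n : ℕ => ‖-(a * (p : ℂ) ^ n * s) + (a * (p : ℂ) ^ n) ^ 2‖ :=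
  Summable.of_nonneg_of_le (fun _ => norm_nonneg _) (norm_thetaTerm_le h0 h1 a s)
    ((summable_geometric_of_lt_one h0 h1).mul_left _)

lemma differentiable_thetaProd (h0 : 0 ≤ p) (h1 : p < 1) (a : ℝ) :
    Differentiable ℂ (thetaProd a p) := by
  intro s
  have hball : DifferentiableOn ℂ (thetaProd a p) (Metric.ball 0 (‖s‖ + 1)) := by
    have h := Summable.hasProdLocallyUniformlyOn_nat_one_add
      (f := fun (n : ℕ) (s : ℂ) => -(a * (p : ℂ) ^ n * s) + (a * (p : ℂ) ^ n) ^ 2)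
      (K := Metric.ball (0 : ℂ) (‖s‖ + 1)) Metric.isOpen_ball
      (u := fun n => (|a| * (‖s‖ + 1) + a ^ 2) * p ^ n)
      ((summable_geometric_of_lt_one h0 h1).mul_left _)
      (.of_forall fun n x hx => (norm_thetaTerm_le h0 h1 a x n).trans (by
        have : ‖x‖ ≤ ‖s‖ + 1 := (mem_ball_zero_iff.1 hx).le
        gcongr)) (fun n => by fun_prop)
    refine h.differentiableOn (.of_forall fun S => ?_) Metric.isOpen_ball
    simpa [Finset.prod_fn] using
      DifferentiableOn.finsetProd (fun _ _ => by fun_prop)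
  exact hball.differentiableAt (Metric.isOpen_ball.mem_nhds (by simp))

lemma thetaProd_conj (h0 : 0 ≤ p) (h1 : p < 1) (a : ℝ) (s : ℂ) :
    thetaProd a p (star s) = star (thetaProd a p s) := by
  obtain ⟨W, hW, rfl⟩ := exists_joukowski_eq s
  have hW0 : W ≠ 0 := norm_pos_iff.1 (by linarith)
  have hW1 : star W ≠ 0 := star_ne_zero.2 hW0
  have : star (joukowski W) = joukowski (star W) := by simp [joukowski]
  rw [this, thetaProd_joukowski h0 h1 a hW0, thetaProd_joukowski h0 h1 a hW1, star_mul',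
    ← pochInf_conj h0 h1, ← pochInf_conj h0 h1]
  congr 2 <;> simp

/-- A theta product with positive real factors is a positive real number. -/
lemma thetaProd_ofReal_pos (h0 : 0 ≤ p) (h1 : p < 1) (a s : ℝ)
    (hpos : ∀ n : ℕ, 0 < 1 + (-(a * p ^ n * s) + (a * p ^ n) ^ 2)) :
    ∃ t : ℝ, 0 < t ∧ thetaProd a p s = t := by
  have hs : Summable fun n : ℕ => (-(a * p ^ n * s) + (a * p ^ n) ^ 2) := by
    refine Summable.of_norm ((summable_thetaProd h0 h1 a s).congr fun n => ?_)
    rw [← Complex.norm_real]; push_cast; rfl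
  have hm : Multipliable fun n : ℕ => (1 + (-(a * p ^ n * s) + (a * p ^ n) ^ 2)) :=
    multipliable_one_add_of_summable hs.norm
  refine ⟨∏' n : ℕ, (1 + (-(a * p ^ n * s) + (a * p ^ n) ^ 2)), ?_, ?_⟩
  · rw [← Real.rexp_tsum_eq_tprod hpos (by
      exact Real.summable_log_one_add_of_summable hs)]
    exact Real.exp_pos _
  · have h := hm.hasProd.map Complex.ofRealHom Complex.continuous_ofReal
    unfold thetaProd
    refine Eq.trans (tprod_congr fun n => ?_) h.tprod_eq
    simp

end products


/-! ### The conformal map of an ellipse onto the disc -/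

/-- For `ρ > 1`, the conformal map onto the unit disc of the ellipse with foci `±2` bounded by the
Joukowski image of the circle of radius `ρ`. It vanishes at the focus `2`. -/
noncomputable def ellipseToDisc (ρ : ℝ) (s : ℂ) : ℂ :=
  (ρ⁻¹ : ℝ) * (s - 2) * (thetaProd (ρ⁻¹ ^ 4) (ρ⁻¹ ^ 4) s / thetaProd (ρ⁻¹ ^ 2) (ρ⁻¹ ^ 4) s) ^ 2

section ellipseToDisc
variable {ρ : ℝ}

lemma inv_pow_four_mem (hρ : 1 < ρ) : 0 ≤ ρ⁻¹ ^ 4 ∧ ρ⁻¹ ^ 4 < 1 :=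
  ⟨by positivity, pow_lt_one₀ (by positivity) (inv_lt_one_of_one_lt₀ hρ) (by norm_num)⟩

/-- The conformal map in the coordinate `W`. The factor `s - 2 = W (1 - 1/W)²` turns
`(ρ⁻⁴/W; ρ⁻⁴)_∞` into `(1/W; ρ⁻⁴)_∞`. -/
lemma ellipseToDisc_joukowski (hρ : 1 < ρ) {W : ℂ} (hW : W ≠ 0) :
    ellipseToDisc ρ (joukowski W) = W * (ρ⁻¹ : ℝ) *
      (pochInf (ρ⁻¹ ^ 4) ((ρ⁻¹ ^ 4 : ℝ) * W) * pochInf (ρ⁻¹ ^ 4) (1 / W) /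
        (pochInf (ρ⁻¹ ^ 4) ((ρ⁻¹ ^ 2 : ℝ) * W) * pochInf (ρ⁻¹ ^ 4) ((ρ⁻¹ ^ 2 : ℝ) / W))) ^ 2 := by
  obtain ⟨h0, h1⟩ := inv_pow_four_mem hρ
  unfold ellipseToDisc
  rw [thetaProd_joukowski h0 h1 _ hW, thetaProd_joukowski h0 h1 _ hW,
    pochInf_eq_mul h0 h1 (1 / W)]
  have e1 : 1 / W * ((ρ⁻¹ ^ 4 : ℝ) : ℂ) = ((ρ⁻¹ ^ 4 : ℝ) : ℂ) / W := by ring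
  have e2 : joukowski W - 2 = W * (1 - 1 / W) ^ 2 := by
    unfold joukowski; field_simp; ring
  rw [e1, e2]
  simp only [div_pow, mul_pow]
  ring

lemma norm_ofReal_mul_lt_one {c t : ℝ} (hc : 0 < c) {W : ℂ} (hW : ‖W‖ < t) (h : c * t ≤ 1) :
    ‖(c : ℂ) * W‖ < 1 := by
  rw [norm_mul, Complex.norm_real, Real.norm_of_nonneg hc.le]
  exact (mul_lt_mul_of_pos_left hW hc).trans_le h

lemma norm_ofReal_div_lt_one {c : ℝ} (hc : 0 < c) (h1 : c < 1) {W : ℂ} (hW : 1 ≤ ‖W‖) :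
    ‖(c : ℂ) / W‖ < 1 := by
  rw [norm_div, Complex.norm_real, Real.norm_of_nonneg hc.le, div_lt_one (by linarith)]
  linarith

/-- On the circle `|W| = ρ` one has `1/W = ρ⁻² W̄`, so that the four `q`-Pochhammer symbols in the
formula for the conformal map are conjugate in pairs and their moduli cancel. -/
lemma norm_ellipseToDisc_joukowski_eq_one (hρ : 1 < ρ) {W : ℂ} (hW : ‖W‖ = ρ) :
    ‖ellipseToDisc ρ (joukowski W)‖ = 1 := by
  obtain ⟨h0, h1⟩ := inv_pow_four_mem hρ
  have hρ0 : 0 < ρ := by linarith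
  have hW0 : W ≠ 0 := norm_pos_iff.1 (by linarith)
  have hr := inv_lt_one_of_one_lt₀ hρ
  have hr0 : 0 < ρ⁻¹ := by positivity
  have hρC : (ρ : ℂ) ≠ 0 := by exact_mod_cast hρ0.ne'
  have hWW : W * star W = (ρ : ℂ) ^ 2 := by
    have := Complex.mul_conj' W
    rw [hW] at this
    simpa using this
  have e1 : 1 / W = star (((ρ⁻¹ ^ 2 : ℝ) : ℂ) * W) := by
    rw [star_mul', div_eq_iff hW0]
    have : star (((ρ⁻¹ ^ 2 : ℝ) : ℂ)) = ((ρ : ℂ) ^ 2)⁻¹ := by simp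
    rw [this, mul_assoc, mul_comm (star W), hWW]; field_simp
  have e2 : ((ρ⁻¹ ^ 2 : ℝ) : ℂ) / W = star (((ρ⁻¹ ^ 4 : ℝ) : ℂ) * W) := by
    rw [div_eq_mul_one_div, e1, star_mul', star_mul', ← mul_assoc]
    congr 1
    simp; ring
  have n1 : ‖((ρ⁻¹ ^ 2 : ℝ) : ℂ) * W‖ < 1 := by
    rw [norm_mul, Complex.norm_real, Real.norm_of_nonneg (by positivity), hW, pow_two, mul_assoc,
      inv_mul_cancel₀ hρ0.ne', mul_one]
    exact hr
  have n2 : ‖((ρ⁻¹ ^ 4 : ℝ) : ℂ) * W‖ < 1 := by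
    rw [norm_mul, Complex.norm_real, Real.norm_of_nonneg (by positivity), hW, pow_succ, mul_assoc,
      inv_mul_cancel₀ hρ0.ne', mul_one]
    exact pow_lt_one₀ hr0.le hr (by norm_num)
  have a1 := pochInf_ne_zero h0 h1 n1
  have a2 := pochInf_ne_zero h0 h1 n2
  rw [ellipseToDisc_joukowski hρ hW0, e1, e2, pochInf_conj h0 h1, pochInf_conj h0 h1]
  simp only [norm_mul, norm_pow, norm_div, norm_star, hW, Complex.norm_real,
    Real.norm_of_nonneg hr0.le]
  rw [mul_inv_cancel₀ hρ0.ne', one_mul, mul_comm ‖pochInf (ρ⁻¹ ^ 4) (((ρ⁻¹ ^ 2 : ℝ) : ℂ) * W)‖,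
    div_self, one_pow]
  exact mul_ne_zero (norm_ne_zero_iff.2 a2) (norm_ne_zero_iff.2 a1)

/-- The reflection in the circle of radius `ρ` corresponds to the reflection in the unit circle. -/
lemma ellipseToDisc_joukowski_reflect (hρ : 1 < ρ) {W : ℂ} (hW1 : 1 < ‖W‖) (hW : ‖W‖ < ρ) :
    ellipseToDisc ρ (joukowski (ρ ^ 2 / star W)) * star (ellipseToDisc ρ (joukowski W)) = 1 := by
  obtain ⟨h0, h1⟩ := inv_pow_four_mem hρ
  have hρ0 : 0 < ρ := by linarith
  have hW0 : W ≠ 0 := norm_pos_iff.1 (by linarith)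
  have hsW0 : star W ≠ 0 := star_ne_zero.2 hW0
  have hr := inv_lt_one_of_one_lt₀ hρ
  have hr0 : 0 < ρ⁻¹ := by positivity
  have hρC : (ρ : ℂ) ≠ 0 := by exact_mod_cast hρ0.ne'
  have hW'0 : (ρ : ℂ) ^ 2 / star W ≠ 0 := div_ne_zero (pow_ne_zero 2 hρC) hsW0
  have c2 : ρ⁻¹ ^ 2 * ρ ≤ 1 := by
    rw [pow_two, mul_assoc, inv_mul_cancel₀ hρ0.ne', mul_one]; exact hr.le
  have c4 : ρ⁻¹ ^ 4 * ρ ≤ 1 := by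
    rw [pow_succ, mul_assoc, inv_mul_cancel₀ hρ0.ne', mul_one]; exact pow_le_one₀ hr0.le hr.le
  have e1 : ((ρ⁻¹ ^ 4 : ℝ) : ℂ) * ((ρ : ℂ) ^ 2 / star W) = star (((ρ⁻¹ ^ 2 : ℝ) : ℂ) / W) := by
    rw [star_div₀]; simp; field_simp
  have e2 : 1 / ((ρ : ℂ) ^ 2 / star W) = star (((ρ⁻¹ ^ 2 : ℝ) : ℂ) * W) := by
    rw [star_mul']; simp; field_simp
  have e3 : ((ρ⁻¹ ^ 2 : ℝ) : ℂ) * ((ρ : ℂ) ^ 2 / star W) = star (1 / W) := by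
    rw [star_div₀]; simp; field_simp
  have e4 : ((ρ⁻¹ ^ 2 : ℝ) : ℂ) / ((ρ : ℂ) ^ 2 / star W) = star (((ρ⁻¹ ^ 4 : ℝ) : ℂ) * W) := by
    rw [star_mul']; simp; field_simp
  have a1 := pochInf_ne_zero h0 h1 (norm_ofReal_mul_lt_one (by positivity : 0 < ρ⁻¹ ^ 2) hW c2)
  have a2 := pochInf_ne_zero h0 h1 (norm_ofReal_mul_lt_one (by positivity : 0 < ρ⁻¹ ^ 4) hW c4)
  have a3 := pochInf_ne_zero h0 h1 (norm_ofReal_div_lt_one (by positivity : 0 < ρ⁻¹ ^ 2)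
    (pow_lt_one₀ hr0.le hr two_ne_zero) hW1.le)
  have a4 : pochInf (ρ⁻¹ ^ 4) (1 / W) ≠ 0 := pochInf_ne_zero h0 h1 (by
    rw [norm_div, norm_one, div_lt_one (by linarith)]; exact hW1)
  rw [ellipseToDisc_joukowski hρ hW0, ellipseToDisc_joukowski hρ hW'0, e1, e2, e3, e4,
    pochInf_conj h0 h1, pochInf_conj h0 h1, pochInf_conj h0 h1, pochInf_conj h0 h1]
  simp only [star_mul', star_div₀, star_pow]
  have b1 := star_ne_zero.2 a1
  have b2 := star_ne_zero.2 a2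
  have b3 := star_ne_zero.2 a3
  have b4 := star_ne_zero.2 a4
  have hs : star ((ρ⁻¹ : ℝ) : ℂ) = (ρ : ℂ)⁻¹ := by simp
  rw [hs]
  generalize star (pochInf (ρ⁻¹ ^ 4) (((ρ⁻¹ ^ 2 : ℝ) : ℂ) * W)) = u₁ at *
  generalize star (pochInf (ρ⁻¹ ^ 4) (((ρ⁻¹ ^ 4 : ℝ) : ℂ) * W)) = u₂ at *
  generalize star (pochInf (ρ⁻¹ ^ 4) (((ρ⁻¹ ^ 2 : ℝ) : ℂ) / W)) = u₃ at *
  generalize star (pochInf (ρ⁻¹ ^ 4) (1 / W)) = u₄ at *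
  push_cast
  field_simp

/-- The open ellipse with foci `±2` bounded by the Joukowski image of the circle of radius `ρ`. -/
noncomputable abbrev focalEllipse (ρ : ℝ) : Set ℂ := ellipse (ρ + 1 / ρ) (ρ - 1 / ρ)

/-- The closure of `focalEllipse ρ`. -/
noncomputable abbrev closedFocalEllipse (ρ : ℝ) : Set ℂ := closedEllipse (ρ + 1 / ρ) (ρ - 1 / ρ)

lemma one_lt_sq_of_one_lt (hρ : 1 < ρ) : 1 < ρ ^ 2 := one_lt_pow₀ hρ two_ne_zero

lemma lt_sq_of_one_lt (hρ : 1 < ρ) : ρ < ρ ^ 2 := by nlinarith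

lemma closedFocalEllipse_subset (hρ : 1 < ρ) : closedFocalEllipse ρ ⊆ focalEllipse (ρ ^ 2) := by
  intro s hs
  obtain ⟨w, hw, rfl⟩ := exists_joukowski_eq s
  rw [joukowski_mem_closedEllipse hρ hw] at hs
  rw [joukowski_mem_ellipse (one_lt_sq_of_one_lt hρ) hw]
  exact hs.trans_lt (lt_sq_of_one_lt hρ)

/-- The theta products in the definition of `ellipseToDisc` have no zeros in the ellipse of
parameter `ρ²`, which contains the closed ellipse of parameter `ρ`. -/
lemma thetaProd_ne_zero (hρ : 1 < ρ) {s : ℂ} (hs : s ∈ focalEllipse (ρ ^ 2)) :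
    thetaProd (ρ⁻¹ ^ 4) (ρ⁻¹ ^ 4) s ≠ 0 ∧ thetaProd (ρ⁻¹ ^ 2) (ρ⁻¹ ^ 4) s ≠ 0 := by
  obtain ⟨h0, h1⟩ := inv_pow_four_mem hρ
  have hρ0 : 0 < ρ := by linarith
  obtain ⟨W, hW1, rfl⟩ := exists_joukowski_eq s
  have hW0 : W ≠ 0 := norm_pos_iff.1 (by linarith)
  rw [joukowski_mem_ellipse (one_lt_sq_of_one_lt hρ) hW1] at hs
  have hr := inv_lt_one_of_one_lt₀ hρ
  have hr0 : 0 < ρ⁻¹ := by positivity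
  have c2 : ρ⁻¹ ^ 2 * ρ ^ 2 ≤ 1 := by
    rw [← mul_pow, inv_mul_cancel₀ hρ0.ne', one_pow]
  have c4 : ρ⁻¹ ^ 4 * ρ ^ 2 ≤ 1 := by
    have : ρ⁻¹ ^ 4 * ρ ^ 2 = ρ⁻¹ ^ 2 := by field_simp
    rw [this]; exact pow_le_one₀ hr0.le hr.le
  rw [thetaProd_joukowski h0 h1 _ hW0, thetaProd_joukowski h0 h1 _ hW0]
  exact ⟨mul_ne_zero
    (pochInf_ne_zero h0 h1 (norm_ofReal_mul_lt_one (by positivity) hs c4))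
    (pochInf_ne_zero h0 h1 (norm_ofReal_div_lt_one (by positivity) h1 hW1)),
    mul_ne_zero
    (pochInf_ne_zero h0 h1 (norm_ofReal_mul_lt_one (by positivity) hs c2))
    (pochInf_ne_zero h0 h1 (norm_ofReal_div_lt_one (by positivity)
      (pow_lt_one₀ hr0.le hr two_ne_zero) hW1))⟩

lemma differentiableOn_thetaQuot (hρ : 1 < ρ) :
    DifferentiableOn ℂ (fun s => thetaProd (ρ⁻¹ ^ 4) (ρ⁻¹ ^ 4) s / thetaProd (ρ⁻¹ ^ 2) (ρ⁻¹ ^ 4) s)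
      (focalEllipse (ρ ^ 2)) := by
  obtain ⟨h0, h1⟩ := inv_pow_four_mem hρ
  exact (differentiable_thetaProd h0 h1 _).differentiableOn.div
    (differentiable_thetaProd h0 h1 _).differentiableOn fun s hs => (thetaProd_ne_zero hρ hs).2

lemma differentiableOn_ellipseToDisc (hρ : 1 < ρ) :
    DifferentiableOn ℂ (ellipseToDisc ρ) (focalEllipse (ρ ^ 2)) := by
  unfold ellipseToDisc
  exact ((differentiableOn_const _).mul (differentiableOn_id.sub (differentiableOn_const _))).mul
    ((differentiableOn_thetaQuot hρ).pow 2)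

lemma ellipseToDisc_eq_zero_iff (hρ : 1 < ρ) {s : ℂ} (hs : s ∈ focalEllipse (ρ ^ 2)) :
    ellipseToDisc ρ s = 0 ↔ s = 2 := by
  have h := thetaProd_ne_zero hρ hs
  have hρ0 : ρ ≠ 0 := by linarith
  simp [ellipseToDisc, h.1, h.2, hρ0, sub_eq_zero, -inv_pow]

lemma ellipseToDisc_two : ellipseToDisc ρ 2 = 0 := by simp [ellipseToDisc]

lemma ellipseToDisc_conj (hρ : 1 < ρ) (s : ℂ) :
    ellipseToDisc ρ (star s) = star (ellipseToDisc ρ s) := by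
  obtain ⟨h0, h1⟩ := inv_pow_four_mem hρ
  unfold ellipseToDisc
  rw [thetaProd_conj h0 h1, thetaProd_conj h0 h1]
  simp [star_div₀]

lemma two_eq_joukowski : (2 : ℂ) = joukowski 1 := by unfold joukowski; norm_num

lemma neg_two_eq_joukowski : (-2 : ℂ) = joukowski (-1) := by unfold joukowski; norm_num

lemma two_mem_focalEllipse (hρ : 1 < ρ) : (2 : ℂ) ∈ focalEllipse ρ := by
  rw [two_eq_joukowski, joukowski_mem_ellipse hρ (by simp)]; simpa using hρ

lemma neg_two_mem_focalEllipse (hρ : 1 < ρ) : (-2 : ℂ) ∈ focalEllipse ρ := by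
  rw [neg_two_eq_joukowski, joukowski_mem_ellipse hρ (by simp)]; simpa using hρ

lemma deriv_ellipseToDisc_two_ne_zero (hρ : 1 < ρ) : deriv (ellipseToDisc ρ) 2 ≠ 0 := by
  have h2 := closedFocalEllipse_subset hρ (ellipse_subset_closedEllipse _ _ (two_mem_focalEllipse hρ))
  have hq := ((differentiableOn_thetaQuot hρ).differentiableAt
    ((isOpen_ellipse _ _).mem_nhds h2)).hasDerivAt.pow 2
  have hl : HasDerivAt (fun s : ℂ => ((ρ⁻¹ : ℝ) : ℂ) * (s - 2)) ((ρ⁻¹ : ℝ) : ℂ) 2 := by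
    simpa using ((hasDerivAt_id (2 : ℂ)).sub_const 2).const_mul ((ρ⁻¹ : ℝ) : ℂ)
  have h := (hl.mul hq).deriv
  have e : deriv (ellipseToDisc ρ) 2 = _ := h
  rw [e]
  have hn := thetaProd_ne_zero hρ h2
  have hρ0 : ρ ≠ 0 := by linarith
  simp [hn.1, hn.2, hρ0, -inv_pow]

lemma closure_focalEllipse_subset : closure (focalEllipse ρ) ⊆ closedFocalEllipse ρ :=
  closure_minimal (ellipse_subset_closedEllipse _ _) (isClosed_closedEllipse _ _)

lemma isCompact_closedFocalEllipse (hρ : 1 < ρ) : IsCompact (closedFocalEllipse ρ) :=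
  isCompact_closedEllipse (add_inv_pos hρ) (sub_inv_pos hρ)

lemma frontier_focalEllipse_subset :
    frontier (focalEllipse ρ) ⊆ closedFocalEllipse ρ \ focalEllipse ρ := by
  rw [(isOpen_ellipse _ _).frontier_eq]
  exact fun s hs => ⟨closure_focalEllipse_subset hs.1, hs.2⟩

lemma norm_ellipseToDisc_of_boundary (hρ : 1 < ρ) {s : ℂ}
    (hs : s ∈ closedFocalEllipse ρ \ focalEllipse ρ) : ‖ellipseToDisc ρ s‖ = 1 := by
  obtain ⟨W, hW1, rfl⟩ := exists_joukowski_eq s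
  obtain ⟨h1, h2⟩ := hs
  rw [joukowski_mem_closedEllipse hρ hW1] at h1
  rw [joukowski_mem_ellipse hρ hW1, not_lt] at h2
  exact norm_ellipseToDisc_joukowski_eq_one hρ (le_antisymm h1 h2)

lemma diffContOnCl_of_focalEllipse {g : ℂ → ℂ}
    (hg : DifferentiableOn ℂ g (closedFocalEllipse ρ)) : DiffContOnCl ℂ g (focalEllipse ρ) :=
  ⟨hg.mono (ellipse_subset_closedEllipse _ _), hg.continuousOn.mono closure_focalEllipse_subset⟩

lemma norm_ellipseToDisc_lt_one (hρ : 1 < ρ) {s : ℂ} (hs : s ∈ focalEllipse ρ) :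
    ‖ellipseToDisc ρ s‖ < 1 := by
  have hdc : DiffContOnCl ℂ (ellipseToDisc ρ) (focalEllipse ρ) :=
    diffContOnCl_of_focalEllipse ((differentiableOn_ellipseToDisc hρ).mono
      (closedFocalEllipse_subset hρ))
  have hbd : Bornology.IsBounded (focalEllipse ρ) :=
    (isCompact_closedFocalEllipse hρ).isBounded.subset (ellipse_subset_closedEllipse _ _)
  have hle : ∀ z ∈ focalEllipse ρ, ‖ellipseToDisc ρ z‖ ≤ 1 := fun z hz =>
    Complex.norm_le_of_forall_mem_frontier_norm_le hbd hdc
      (fun w hw => (norm_ellipseToDisc_of_boundary hρ (frontier_focalEllipse_subset hw)).le)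
      (subset_closure hz)
  refine lt_of_le_of_ne (hle s hs) fun h1 => ?_
  have := Complex.eqOn_of_isPreconnected_of_isMaxOn_norm (isPreconnected_ellipse _ _)
    (isOpen_ellipse _ _) hdc.1 hs (f := ellipseToDisc ρ) (by
      intro z hz
      simp only [Function.comp, mem_ofPred_eq]
      rw [h1]; exact hle z hz)
  have h2 := this (two_mem_focalEllipse hρ)
  rw [ellipseToDisc_two] at h2
  simp only [Function.const_apply] at h2
  rw [← h2] at h1
  simp at h1

/-- A point outside the ellipse is the reflection of a point inside it, and is therefore mapped
outside the unit disc. -/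
lemma mem_focalEllipse_of_norm_lt_one (hρ : 1 < ρ) {s : ℂ} (hs : s ∈ focalEllipse (ρ ^ 2))
    (h : ‖ellipseToDisc ρ s‖ < 1) : s ∈ focalEllipse ρ := by
  obtain ⟨W, hW1, rfl⟩ := exists_joukowski_eq s
  rw [joukowski_mem_ellipse (one_lt_sq_of_one_lt hρ) hW1] at hs
  rw [joukowski_mem_ellipse hρ hW1]
  have hρ0 : 0 < ρ := by linarith
  by_contra hcon
  rw [not_lt] at hcon
  rcases hcon.eq_or_lt with h1 | h1
  · rw [norm_ellipseToDisc_joukowski_eq_one hρ h1.symm] at h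
    exact lt_irrefl _ h
  · set V : ℂ := (ρ : ℂ) ^ 2 / star W with hV
    have hW0 : W ≠ 0 := norm_pos_iff.1 (by linarith)
    have hVn : ‖V‖ = ρ ^ 2 / ‖W‖ := by simp [hV]
    have hV1 : 1 < ‖V‖ := by rw [hVn, one_lt_div (by linarith)]; exact hs
    have hVρ : ‖V‖ < ρ := by
      rw [hVn, div_lt_iff₀ (by linarith), pow_two]
      exact mul_lt_mul_of_pos_left h1 hρ0
    have hrefl := ellipseToDisc_joukowski_reflect hρ hV1 hVρ
    have hVV : (ρ : ℂ) ^ 2 / star V = W := by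
      have : (ρ : ℂ) ≠ 0 := by exact_mod_cast hρ0.ne'
      rw [hV, star_div₀]; simp; field_simp
    rw [hVV] at hrefl
    have h3 := norm_ellipseToDisc_lt_one hρ ((joukowski_mem_ellipse hρ hV1.le).2 hVρ)
    have h4 := congrArg norm hrefl
    rw [norm_mul, norm_star, norm_one] at h4
    have := mul_lt_one_of_nonneg_of_lt_one_left (norm_nonneg _) h h3.le
    linarith

lemma ellipseToDisc_image_mem_nhds (hρ : 1 < ρ) {s : ℂ} (hs : s ∈ focalEllipse (ρ ^ 2)) {V : Set ℂ}
    (hV : V ∈ 𝓝 s) : ellipseToDisc ρ '' V ∈ 𝓝 (ellipseToDisc ρ s) := by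
  have han : AnalyticOnNhd ℂ (ellipseToDisc ρ) (focalEllipse (ρ ^ 2)) :=
    (differentiableOn_ellipseToDisc hρ).analyticOnNhd (isOpen_ellipse _ _)
  refine ((han s hs).eventually_constant_or_nhds_le_map_nhds.resolve_left fun hc => ?_)
    (image_mem_map hV)
  have heq := han.eqOn_of_preconnected_of_eventuallyEq (g := fun _ => ellipseToDisc ρ s)
    analyticOnNhd_const (isPreconnected_ellipse _ _) hs hc
  have hρ2 := one_lt_sq_of_one_lt hρ
  have e1 := heq (two_mem_focalEllipse hρ2)
  have e2 := heq (neg_two_mem_focalEllipse hρ2)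
  have e3 := (ellipseToDisc_eq_zero_iff hρ (neg_two_mem_focalEllipse hρ2)).1
    (e2.trans (e1.symm.trans ellipseToDisc_two))
  norm_num at e3

/-- The map is conformal because its only zero is the simple zero at the focus `2`. -/
lemma bijOn_ellipseToDisc (hρ : 1 < ρ) :
    BijOn (ellipseToDisc ρ) (focalEllipse ρ) unitDisc := by
  have hsub := (ellipse_subset_closedEllipse _ _).trans (closedFocalEllipse_subset hρ)
  exact bijOn_ball_of_unique_simple_zero (isOpen_ellipse _ _) (isPreconnected_ellipse _ _)
    (isCompact_closedFocalEllipse hρ) (ellipse_subset_closedEllipse _ _)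
    ((differentiableOn_ellipseToDisc hρ).continuousOn.mono (closedFocalEllipse_subset hρ))
    ((differentiableOn_ellipseToDisc hρ).mono hsub)
    (fun z hz => norm_ellipseToDisc_of_boundary hρ hz) (fun z hz => norm_ellipseToDisc_lt_one hρ hz)
    (two_mem_focalEllipse hρ) (fun z hz => ellipseToDisc_eq_zero_iff hρ (hsub hz))
    (deriv_ellipseToDisc_two_ne_zero hρ)

lemma continuousOn_ellipseToDisc (hρ : 1 < ρ) :
    ContinuousOn (ellipseToDisc ρ) (closedFocalEllipse ρ) :=
  (differentiableOn_ellipseToDisc hρ).continuousOn.mono (closedFocalEllipse_subset hρ)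

lemma norm_ellipseToDisc_le_one (hρ : 1 < ρ) {s : ℂ} (hs : s ∈ closedFocalEllipse ρ) :
    ‖ellipseToDisc ρ s‖ ≤ 1 := by
  by_cases h : s ∈ focalEllipse ρ
  · exact (norm_ellipseToDisc_lt_one hρ h).le
  · exact (norm_ellipseToDisc_of_boundary hρ ⟨hs, h⟩).le

/-- The conformal map of the ellipse extends to a bijection of the closures. Injectivity on the
boundary follows from the open mapping theorem, as the map is holomorphic across the boundary and
maps no exterior point near it into the disc. -/
lemma bijOn_closed_ellipseToDisc (hρ : 1 < ρ) :
    BijOn (ellipseToDisc ρ) (closedFocalEllipse ρ) closedUnitDisc := by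
  refine ⟨fun s hs => by simpa [closedUnitDisc] using norm_ellipseToDisc_le_one hρ hs, ?_, ?_⟩
  · intro s₁ hs₁ s₂ hs₂ e
    by_contra hne
    obtain ⟨V₁, V₂, hV₁, hV₂, hdisj⟩ := t2_separation_nhds hne
    have hU := isOpen_ellipse (ρ ^ 2 + 1 / ρ ^ 2) (ρ ^ 2 - 1 / ρ ^ 2)
    have m₁ := closedFocalEllipse_subset hρ hs₁
    have m₂ := closedFocalEllipse_subset hρ hs₂
    have i₁ := ellipseToDisc_image_mem_nhds hρ m₁ (inter_mem hV₁ (hU.mem_nhds m₁))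
    have i₂ := ellipseToDisc_image_mem_nhds hρ m₂ (inter_mem hV₂ (hU.mem_nhds m₂))
    rw [← e] at i₂
    -- points of the disc close to the common value would have preimages near `s₁` and near `s₂`
    have hcl : ellipseToDisc ρ s₁ ∈ closure (Metric.ball (0 : ℂ) 1) := by
      rw [closure_ball _ one_ne_zero]
      simpa using norm_ellipseToDisc_le_one hρ hs₁
    obtain ⟨b, ⟨⟨v₁, hv₁, e₁⟩, ⟨v₂, hv₂, e₂⟩⟩, hb⟩ := mem_closure_iff_nhds.1 hcl _ (inter_mem i₁ i₂)
    have hb' : ‖b‖ < 1 := by simpa using hb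
    have k₁ := mem_focalEllipse_of_norm_lt_one hρ hv₁.2 (by rw [e₁]; exact hb')
    have k₂ := mem_focalEllipse_of_norm_lt_one hρ hv₂.2 (by rw [e₂]; exact hb')
    have := (bijOn_ellipseToDisc hρ).injOn k₁ k₂ (e₁.trans e₂.symm)
    exact hdisj.le_bot ⟨hv₁.1, this ▸ hv₂.1⟩
  · have hc : IsClosed (ellipseToDisc ρ '' closedFocalEllipse ρ) :=
      ((isCompact_closedFocalEllipse hρ).image_of_continuousOn (continuousOn_ellipseToDisc hρ)).isClosed
    have hsub : Metric.ball (0 : ℂ) 1 ⊆ ellipseToDisc ρ '' closedFocalEllipse ρ :=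
      (bijOn_ellipseToDisc hρ).surjOn.trans (image_mono (ellipse_subset_closedEllipse _ _))
    have := closure_minimal hsub hc
    rwa [closure_ball _ one_ne_zero] at this

/-! ### The value at the second focus -/

/-- The point `-focalValue ρ` is the image of the focus `-2`. -/
noncomputable def focalValue (ρ : ℝ) : ℝ := ‖ellipseToDisc ρ (-2)‖

/-- The focus `-2` is mapped to the negative real axis, as the theta products are positive there. -/
lemma ellipseToDisc_neg_two (hρ : 1 < ρ) : ellipseToDisc ρ (-2) = -(focalValue ρ : ℂ) := by
  obtain ⟨h0, h1⟩ := inv_pow_four_mem hρ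
  have hr0 : 0 < ρ⁻¹ := by have : 0 < ρ := by linarith
                           positivity
  have hpos : ∀ a : ℝ, 0 < a → ∀ n : ℕ,
      0 < 1 + (-(a * (ρ⁻¹ ^ 4) ^ n * (-2)) + (a * (ρ⁻¹ ^ 4) ^ n) ^ 2) := by
    intro a ha n
    have : 0 < a * (ρ⁻¹ ^ 4) ^ n := by positivity
    nlinarith
  obtain ⟨t₁, ht₁, e₁⟩ := thetaProd_ofReal_pos h0 h1 (ρ⁻¹ ^ 4) (-2) (hpos _ (by positivity))
  obtain ⟨t₂, ht₂, e₂⟩ := thetaProd_ofReal_pos h0 h1 (ρ⁻¹ ^ 2) (-2) (hpos _ (by positivity))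
  have e : ellipseToDisc ρ (-2) = ((ρ⁻¹ * (-4) * (t₁ / t₂) ^ 2 : ℝ) : ℂ) := by
    unfold ellipseToDisc
    push_cast at e₁ e₂ ⊢
    rw [e₁, e₂]; ring
  rw [focalValue, e, Complex.norm_real, Real.norm_eq_abs, abs_of_neg (by
    have : 0 < ρ⁻¹ * (t₁ / t₂) ^ 2 := by positivity
    nlinarith)]
  push_cast; ring

/-- The comparison of the conformal map of the ellipse onto the disc with the one of the half plane
`Im s < ρ - 1/ρ`, which contains the ellipse. -/
lemma le_focalValue (hρ : 1 < ρ) :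
    4 / √(16 + 4 * (ρ - 1 / ρ) ^ 2) ≤ focalValue ρ := by
  set δ := ρ - 1 / ρ with hδ
  have hδ0 : 0 < δ := sub_inv_pos hρ
  set k : ℂ → ℂ := fun s => ((ρ⁻¹ : ℝ) : ℂ) * (thetaProd (ρ⁻¹ ^ 4) (ρ⁻¹ ^ 4) s /
    thetaProd (ρ⁻¹ ^ 2) (ρ⁻¹ ^ 4) s) ^ 2 with hk
  have hQk : ∀ s, ellipseToDisc ρ s = (s - 2) * k s := by
    intro s; simp only [ellipseToDisc, hk]; ring
  have hρ0 : ρ ≠ 0 := by linarith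
  have hkne : ∀ s ∈ focalEllipse (ρ ^ 2), k s ≠ 0 := by
    intro s hs
    have h := thetaProd_ne_zero hρ hs
    simp [hk, h.1, h.2, hρ0, -inv_pow]
  have him : ∀ s ∈ closedFocalEllipse ρ, s.im ≤ δ := by
    intro s hs
    have h1 : (s.re / (ρ + 1 / ρ)) ^ 2 + (s.im / δ) ^ 2 ≤ 1 := hs
    have h2 : |s.im / δ| ≤ 1 := by
      rw [← sq_le_one_iff_abs_le_one]; nlinarith [sq_nonneg (s.re / (ρ + 1 / ρ))]
    have h3 := (abs_le.1 h2).2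
    rwa [div_le_one hδ0] at h3
  have hden : ∀ s ∈ closedFocalEllipse ρ, s - 2 - 2 * δ * Complex.I ≠ 0 := by
    intro s hs h
    have h2 := him s hs
    have h3 := congrArg Complex.im h
    simp at h3
    linarith
  -- the quotient of the map of the half plane by the map of the ellipse, in which the zeros at `2`
  -- cancel; its modulus on the boundary is at most `1`
  set B : ℂ → ℂ := fun s => 1 / ((s - 2 - 2 * δ * Complex.I) * k s) with hB
  have hBd : DifferentiableOn ℂ B (closedFocalEllipse ρ) := by
    refine (differentiableOn_const _).div (DifferentiableOn.mul (by fun_prop) ?_) ?_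
    · exact (differentiableOn_const _).mul (((differentiableOn_thetaQuot hρ).mono
        (closedFocalEllipse_subset hρ)).pow 2)
    · exact fun s hs => mul_ne_zero (hden s hs) (hkne s (closedFocalEllipse_subset hρ hs))
  have hbd : Bornology.IsBounded (focalEllipse ρ) :=
    (isCompact_closedFocalEllipse hρ).isBounded.subset (ellipse_subset_closedEllipse _ _)
  have hle : ‖B (-2)‖ ≤ 1 := by
    refine Complex.norm_le_of_forall_mem_frontier_norm_le hbd (diffContOnCl_of_focalEllipse hBd)
      (fun s hs => ?_) (subset_closure (neg_two_mem_focalEllipse hρ))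
    have hs' := frontier_focalEllipse_subset hs
    have h1 := norm_ellipseToDisc_of_boundary hρ hs'
    rw [hQk, norm_mul] at h1
    have h2 : ‖s - 2‖ ≤ ‖s - 2 - 2 * δ * Complex.I‖ := by
      rw [← sq_le_sq₀ (norm_nonneg _) (norm_nonneg _), Complex.sq_norm, Complex.sq_norm,
        Complex.normSq_apply, Complex.normSq_apply]
      have := him s hs'.1
      simp
      nlinarith
    simp only [hB, norm_div, norm_one, norm_mul]
    have h3 : 1 ≤ ‖s - 2 - 2 * δ * Complex.I‖ * ‖k s‖ := by
      rw [← h1]; gcongr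
    rw [div_le_one (by linarith)]
    exact h3
  have hn : ‖(-2 : ℂ) - 2 - 2 * δ * Complex.I‖ = √(16 + 4 * δ ^ 2) := by
    rw [Complex.norm_def, Complex.normSq_apply]
    congr 1; simp; ring
  have hkpos : 0 < ‖k (-2)‖ := norm_pos_iff.2 (hkne _ (neg_two_mem_focalEllipse
    (one_lt_sq_of_one_lt hρ)))
  have hspos : 0 < √(16 + 4 * δ ^ 2) := by positivity
  simp only [hB, norm_div, norm_one, norm_mul, hn] at hle
  rw [div_le_one (by positivity)] at hle
  rw [focalValue, hQk, norm_mul, div_le_iff₀ hspos]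
  have : ‖(-2 : ℂ) - 2‖ = 4 := by norm_num
  rw [this]
  nlinarith

/-- Continuity of the theta products in the parameter `r = ρ⁻¹`, including the degenerate value
`r = 0`. -/
lemma continuousOn_thetaProd_param (k : ℕ) (s : ℂ) {c : ℝ} (hc0 : 0 < c) (hc : c < 1) :
    ContinuousOn (fun r : ℝ => thetaProd (r ^ k) (r ^ 4) s) (Metric.ball 0 c) := by
  have hc4 : c ^ 4 < 1 := pow_lt_one₀ hc0.le hc (by norm_num)
  have h := Summable.hasProdLocallyUniformlyOn_nat_one_add
    (f := fun (n : ℕ) (r : ℝ) => -(((r ^ k : ℝ) : ℂ) * ((r ^ 4 : ℝ) : ℂ) ^ n * s) +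
      (((r ^ k : ℝ) : ℂ) * ((r ^ 4 : ℝ) : ℂ) ^ n) ^ 2)
    (K := Metric.ball (0 : ℝ) c) Metric.isOpen_ball
    (u := fun n => (‖s‖ + 1) * (c ^ 4) ^ n)
    ((summable_geometric_of_lt_one (by positivity) hc4).mul_left _)
    (.of_forall fun n r hr => by
      have hr' : |r| < c := by simpa using hr
      have h4 : r ^ 4 ≤ c ^ 4 := by
        rw [← Even.pow_abs (by decide)]
        exact pow_le_pow_left₀ (abs_nonneg r) hr'.le 4
      have hk1 : |r ^ k| ≤ 1 := by
        rw [abs_pow]; exact pow_le_one₀ (abs_nonneg r) (by linarith)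
      refine (norm_thetaTerm_le (by positivity) (h4.trans_lt hc4) (r ^ k) s n).trans ?_
      have hsq : (r ^ k) ^ 2 ≤ 1 := by rw [← sq_abs]; exact pow_le_one₀ (abs_nonneg _) hk1
      have hss : |r ^ k| * ‖s‖ ≤ ‖s‖ := mul_le_of_le_one_left (norm_nonneg s) hk1
      have : |r ^ k| * ‖s‖ + (r ^ k) ^ 2 ≤ ‖s‖ + 1 := by linarith
      gcongr) (fun n => by fun_prop)
  exact h.continuousOn (.of_forall fun S => by
    simpa [Finset.prod_fn] using continuousOn_finsetProd _ fun _ _ => by fun_prop)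

/-- By the intermediate value theorem every number in `(0, 1)` is the modulus of the image of the
focus `-2`: the modulus tends to `0` as `ρ⁻¹` tends to `0`, and to `1` as `ρ⁻¹` tends to `1`. -/
lemma exists_focalValue_eq {x : ℝ} (hx0 : 0 < x) (hx1 : x < 1) : ∃ ρ, 1 < ρ ∧ focalValue ρ = x := by
  set g : ℝ → ℝ := fun r => ‖(r : ℂ) * (-4) *
    (thetaProd (r ^ 4) (r ^ 4) (-2) / thetaProd (r ^ 2) (r ^ 4) (-2)) ^ 2‖ with hg
  have hgval : ∀ r : ℝ, focalValue r⁻¹ = g r := by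
    intro r
    simp only [focalValue, ellipseToDisc, hg, inv_inv]
    congr 3; ring
  -- a parameter close to `1` with a large value
  obtain ⟨r₁, hr₁, hr₁0, hr₁1⟩ : ∃ r : ℝ, x < g r ∧ 0 < r ∧ r < 1 := by
    have hcont : ContinuousAt (fun r : ℝ => 4 / √(16 + 4 * (r⁻¹ - 1 / r⁻¹) ^ 2)) 1 := by
      refine continuousAt_const.div ?_ (by norm_num)
      refine ContinuousAt.sqrt ?_
      have : ContinuousAt (fun r : ℝ => r⁻¹) 1 := continuousAt_inv₀ one_ne_zero
      exact continuousAt_const.add (continuousAt_const.mul ((this.sub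
        (continuousAt_const.div this (by norm_num))).pow 2))
    have hlim : ∀ᶠ r : ℝ in 𝓝[<] 1, x < 4 / √(16 + 4 * (r⁻¹ - 1 / r⁻¹) ^ 2) := by
      refine nhdsWithin_le_nhds (continuousAt_const.eventually_lt hcont ?_)
      have : √(16 : ℝ) = 4 := by rw [show (16 : ℝ) = 4 ^ 2 by norm_num]; simp
      simpa [this] using hx1
    obtain ⟨r, h1, h2, h3⟩ := (hlim.and (Ioo_mem_nhdsLT (zero_lt_one' ℝ))).exists
    exact ⟨r, h1.trans_le ((le_focalValue ((one_lt_inv₀ h2).2 h3)).trans_eq (hgval r)), h2, h3⟩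
  obtain ⟨c, hc1, hc2⟩ := exists_between hr₁1
  have hc0 : 0 < c := hr₁0.trans hc1
  have hgc : ContinuousOn g (Icc 0 r₁) := by
    have hsub : Icc 0 r₁ ⊆ Metric.ball (0 : ℝ) c := by
      intro r hr
      rw [mem_ball_zero_iff, Real.norm_of_nonneg hr.1]
      exact hr.2.trans_lt hc1
    have h1 := (continuousOn_thetaProd_param 4 (-2) hc0 hc2).mono hsub
    have h2 := (continuousOn_thetaProd_param 2 (-2) hc0 hc2).mono hsub
    refine ContinuousOn.norm (ContinuousOn.mul (by fun_prop) ((h1.div h2 ?_).pow 2))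
    intro r hr
    rcases hr.1.eq_or_lt with h0 | h0
    · rw [← h0]; simp [thetaProd]
    · have hρ : 1 < r⁻¹ := (one_lt_inv₀ h0).2 (hr.2.trans_lt hr₁1)
      have := (thetaProd_ne_zero hρ (neg_two_mem_focalEllipse (one_lt_sq_of_one_lt hρ))).2
      simpa using this
  obtain ⟨r, hr, hgr⟩ := intermediate_value_Icc hr₁0.le hgc
    (show x ∈ Icc (g 0) (g r₁) from ⟨by simp [hg, hx0.le], hr₁.le⟩)
  have hr0 : 0 < r := by
    refine lt_of_le_of_ne hr.1 ?_
    rintro rfl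
    simp [hg] at hgr
    exact hx0.ne hgr
  exact ⟨r⁻¹, (one_lt_inv₀ hr0).2 (hr.2.trans_lt hr₁1), (hgval r).trans hgr⟩

end ellipseToDisc


/-! ### The Grötzsch module -/

section grotzsch
variable {ρ : ℝ}

lemma focalValue_pos (hρ : 1 < ρ) : 0 < focalValue ρ := by
  rw [focalValue, norm_pos_iff, Ne, ellipseToDisc_eq_zero_iff hρ
    (neg_two_mem_focalEllipse (one_lt_sq_of_one_lt hρ))]
  norm_num

lemma ofReal_mem_closedFocalEllipse (hρ : 1 < ρ) {t : ℝ} :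
    (t : ℂ) ∈ closedFocalEllipse ρ ↔ |t| ≤ ρ + 1 / ρ := by
  have h := add_inv_pos hρ
  simp only [mem_closedEllipse, ellipseGauge, Complex.ofReal_re, Complex.ofReal_im]
  rw [zero_div, zero_pow two_ne_zero, add_zero, sq_le_one_iff_abs_le_one, abs_div, abs_of_pos h,
    div_le_one h]

lemma ellipseToDisc_im_eq_zero_iff (hρ : 1 < ρ) {s : ℂ} (hs : s ∈ closedFocalEllipse ρ) :
    (ellipseToDisc ρ s).im = 0 ↔ s.im = 0 := by
  rw [← Complex.conj_eq_iff_im, ← Complex.conj_eq_iff_im]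
  constructor
  · intro h
    refine (bijOn_closed_ellipseToDisc hρ).injOn ?_ hs ?_
    · rw [mem_closedEllipse]
      exact (ellipseGauge_conj _ _ s).trans_le hs
    · exact (ellipseToDisc_conj hρ s).trans h
  · intro h
    exact (ellipseToDisc_conj hρ s).symm.trans (congrArg _ h)

lemma ofReal_re_ellipseToDisc (hρ : 1 < ρ) {t : ℝ} (ht : |t| ≤ ρ + 1 / ρ) :
    (((ellipseToDisc ρ t).re : ℝ) : ℂ) = ellipseToDisc ρ t :=
  Complex.ext (by simp) (by
    simp [(ellipseToDisc_im_eq_zero_iff hρ ((ofReal_mem_closedFocalEllipse hρ).2 ht)).2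
      (Complex.ofReal_im t)])

lemma two_lt_add_inv (hρ : 1 < ρ) : 2 < ρ + 1 / ρ := by
  have := add_inv_lt_add_inv le_rfl hρ
  linarith

/-- On the major axis the conformal map is real, continuous and injective, hence monotone; it
increases because `-2` and `2` are mapped to `-focalValue ρ` and `0`. -/
lemma strictMonoOn_re_ellipseToDisc (hρ : 1 < ρ) :
    StrictMonoOn (fun t : ℝ => (ellipseToDisc ρ t).re) (Icc (-(ρ + 1 / ρ)) (ρ + 1 / ρ)) := by
  have h2 := two_lt_add_inv hρ
  have hmaps : MapsTo (fun t : ℝ => (t : ℂ)) (Icc (-(ρ + 1 / ρ)) (ρ + 1 / ρ))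
      (closedFocalEllipse ρ) := fun t ht => (ofReal_mem_closedFocalEllipse hρ).2 (abs_le.2 ht)
  have hc : ContinuousOn (fun t : ℝ => (ellipseToDisc ρ t).re)
      (Icc (-(ρ + 1 / ρ)) (ρ + 1 / ρ)) :=
    Complex.continuous_re.comp_continuousOn
      ((continuousOn_ellipseToDisc hρ).comp Complex.continuous_ofReal.continuousOn hmaps)
  have hi : InjOn (fun t : ℝ => (ellipseToDisc ρ t).re) (Icc (-(ρ + 1 / ρ)) (ρ + 1 / ρ)) := by
    intro s hs t ht h
    have h' := congrArg (fun r : ℝ => (r : ℂ)) h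
    simp only [ofReal_re_ellipseToDisc hρ (abs_le.2 hs),
      ofReal_re_ellipseToDisc hρ (abs_le.2 ht)] at h'
    exact Complex.ofReal_injective
      ((bijOn_closed_ellipseToDisc hρ).injOn (hmaps hs) (hmaps ht) h')
  rcases hc.strictMonoOn_of_injOn_Icc' (by linarith) hi with h | h
  · exact h
  -- a decreasing function would take a larger value at `-2` than at `2`
  · exfalso
    have := h (show (-2 : ℝ) ∈ _ from ⟨by linarith, by linarith⟩)
      (show (2 : ℝ) ∈ _ from ⟨by linarith, by linarith⟩) (by norm_num)
    have e := ellipseToDisc_two (ρ := ρ)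
    have e' := ellipseToDisc_neg_two hρ
    simp only [Complex.ofReal_neg, Complex.ofReal_ofNat, e, e', Complex.neg_re, Complex.ofReal_re,
      Complex.zero_re] at this
    linarith [focalValue_pos hρ]

/-- The segment between the foci corresponds to the segment between the images of the foci. -/
lemma ellipseToDisc_mem_segment_iff (hρ : 1 < ρ) {s : ℂ} (hs : s ∈ closedFocalEllipse ρ) :
    ((ellipseToDisc ρ s).im = 0 ∧ -focalValue ρ ≤ (ellipseToDisc ρ s).re ∧
      (ellipseToDisc ρ s).re ≤ 0) ↔ s.im = 0 ∧ -2 ≤ s.re ∧ s.re ≤ 2 := by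
  rw [ellipseToDisc_im_eq_zero_iff hρ hs]
  refine and_congr_right fun him => ?_
  have h2 := two_lt_add_inv hρ
  obtain ⟨t, rfl⟩ : ∃ t : ℝ, s = t := ⟨s.re, Complex.ext (by simp) (by simp [him])⟩
  rw [ofReal_mem_closedFocalEllipse hρ] at hs
  have hm := strictMonoOn_re_ellipseToDisc hρ
  have h1 := hm.le_iff_le (show (-2 : ℝ) ∈ _ from ⟨by linarith, by linarith⟩) (abs_le.1 hs)
  have h3 := hm.le_iff_le (abs_le.1 hs) (show (2 : ℝ) ∈ _ from ⟨by linarith, by linarith⟩)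
  simp only [Complex.ofReal_neg, Complex.ofReal_ofNat, ellipseToDisc_two, ellipseToDisc_neg_two hρ,
    Complex.neg_re, Complex.ofReal_re, Complex.zero_re] at h1 h3
  rw [Complex.ofReal_re, h1, h3]

/-- Outside the open unit disc the Joukowski preimage of the segment between the foci is the unit
circle. -/
lemma joukowski_mem_segment_iff {W : ℂ} (hW : 1 ≤ ‖W‖) :
    ((joukowski W).im = 0 ∧ -2 ≤ (joukowski W).re ∧ (joukowski W).re ≤ 2) ↔ ‖W‖ = 1 := by
  have hW0 : W ≠ 0 := norm_pos_iff.1 (by linarith)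
  constructor
  · rintro ⟨h1, h2, h3⟩
    set t := (joukowski W).re / 2 with ht
    set V : ℂ := ⟨t, √(1 - t ^ 2)⟩ with hV
    have ht1 : 0 ≤ 1 - t ^ 2 := by nlinarith
    have hn : ‖V‖ = 1 := by
      rw [← sq_eq_sq₀ (norm_nonneg _) zero_le_one, Complex.sq_norm, Complex.normSq_apply]
      simp only [hV]
      rw [Real.mul_self_sqrt ht1]; ring
    have hV0 : V ≠ 0 := norm_pos_iff.1 (by linarith)
    have hinv : 1 / V = star V := by
      rw [one_div, Complex.inv_def, Complex.normSq_eq_norm_sq, hn]; simp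
    have hj : joukowski W = joukowski V := by
      rw [joukowski, joukowski, hinv]
      apply Complex.ext
      · simp only [hV, Complex.add_re, Complex.star_def, Complex.conj_re, ht, joukowski]; ring
      · change (joukowski W).im = _
        rw [h1]; simp [hV]
    rcases (joukowski_eq_iff hW0 hV0).1 hj with h | h
    · rw [← h, hn]
    · have := congrArg norm h
      rw [hn, norm_div, norm_one, eq_div_iff (by linarith), one_mul] at this
      exact this
  · intro hn
    have hinv : 1 / W = star W := by
      rw [one_div, Complex.inv_def, Complex.normSq_eq_norm_sq, hn]; simp
    have h1 := Complex.abs_re_le_norm W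
    rw [hn, abs_le] at h1
    refine ⟨by simp [joukowski, hinv], ?_, ?_⟩ <;>
    · simp only [joukowski, hinv, Complex.add_re, Complex.star_def, Complex.conj_re]
      linarith

lemma injOn_joukowski : InjOn joukowski {w | 1 < ‖w‖} := by
  intro w hw v hv h
  have hw' : 1 < ‖w‖ := hw
  have hv' : 1 < ‖v‖ := hv
  have hw0 : w ≠ 0 := norm_pos_iff.1 (by linarith)
  have hv0 : v ≠ 0 := norm_pos_iff.1 (by linarith)
  rcases (joukowski_eq_iff hw0 hv0).1 h with h | h
  · exact h.symm
  · have := congrArg norm h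
    rw [norm_div, norm_one, eq_div_iff (by linarith)] at this
    nlinarith

lemma differentiableOn_joukowski : DifferentiableOn ℂ joukowski {w | w ≠ 0} := by
  intro w hw
  have hw0 : w ≠ 0 := hw
  have h : DifferentiableAt ℂ (fun w : ℂ => w + 1 / w) w := by fun_prop (disch := exact hw0)
  exact h.differentiableWithinAt

lemma mem_grotzschDomain {r : ℝ} {g : ℂ} :
    g ∈ grotzschDomain r ↔ 1 < ‖g‖ ∧ ¬ (r ≤ g.re ∧ g.im = 0) := by
  simp [grotzschDomain, closedUnitDisc]

lemma isOpen_grotzschDomain (r : ℝ) : IsOpen (grotzschDomain r) := by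
  rw [grotzschDomain, isOpen_compl_iff]
  refine Metric.isClosed_closedBall.union ?_
  exact (isClosed_le continuous_const Complex.continuous_re).inter
    (isClosed_eq Complex.continuous_im continuous_const)

/-- The annulus is mapped onto the ellipse without the segment between its foci by the Joukowski
map, then onto the disc without a segment `[-x, 0]`, and the Grötzsch domain is the image of the
latter under `z ↦ -1/z`. -/
lemma bijOn_annulus_grotzschDomain (hρ : 1 < ρ) :
    BijOn (fun W => -1 / ellipseToDisc ρ (joukowski W)) (annulus ρ)
      (grotzschDomain (1 / focalValue ρ)) := by
  have hx := focalValue_pos hρ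
  have hbij := bijOn_ellipseToDisc hρ
  have hcl := ellipse_subset_closedEllipse (ρ + 1 / ρ) (ρ - 1 / ρ)
  refine ⟨fun W hW => ?_, fun W hW V hV h => ?_, fun g hg => ?_⟩
  · have hs := (joukowski_mem_ellipse hρ hW.1.le).2 hW.2
    have hseg := (ellipseToDisc_mem_segment_iff hρ (hcl hs)).not.2
      ((joukowski_mem_segment_iff hW.1.le).not.2 hW.1.ne')
    have h1 := norm_ellipseToDisc_lt_one hρ hs
    set q := ellipseToDisc ρ (joukowski W)
    have hq0 : q ≠ 0 := by
      rintro h0; rw [h0] at hseg; simp [hx.le] at hseg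
    change -1 / q ∈ grotzschDomain _
    rw [mem_grotzschDomain]
    refine ⟨?_, fun ⟨h2, h3⟩ => hseg ?_⟩
    · rw [norm_div, norm_neg, norm_one, one_lt_div (norm_pos_iff.2 hq0)]; exact h1
    · obtain ⟨t, ht⟩ : ∃ t : ℝ, -1 / q = t := ⟨(-1 / q).re, Complex.ext (by simp) (by simp [h3])⟩
      have ht0 : 0 < t := by
        have : 0 < 1 / focalValue ρ := by positivity
        rw [ht, Complex.ofReal_re] at h2
        linarith
      rw [ht, Complex.ofReal_re] at h2
      have hq : q = ((-1 / t : ℝ) : ℂ) := by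
        have : (t : ℂ) ≠ 0 := by exact_mod_cast ht0.ne'
        push_cast
        rw [← ht]; field_simp
      rw [hq]
      simp only [Complex.ofReal_im, Complex.ofReal_re, true_and]
      rw [div_le_iff₀ hx] at h2
      constructor
      · rw [le_div_iff₀ ht0]; nlinarith
      · exact div_nonpos_of_nonpos_of_nonneg (by norm_num) ht0.le
  · have hs := (joukowski_mem_ellipse hρ hW.1.le).2 hW.2
    have hs' := (joukowski_mem_ellipse hρ hV.1.le).2 hV.2
    refine injOn_joukowski hW.1 hV.1 (hbij.injOn hs hs' ?_)
    simpa [neg_div] using h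
  · rw [mem_grotzschDomain] at hg
    have hg0 : g ≠ 0 := norm_pos_iff.1 (by linarith)
    obtain ⟨s, hs, e⟩ := hbij.surjOn (show -1 / g ∈ unitDisc by
      simp only [unitDisc, mem_ball_zero_iff, norm_div, norm_neg, norm_one]
      exact (div_lt_one (by linarith)).2 hg.1)
    obtain ⟨W, hW1, rfl⟩ := exists_joukowski_eq s
    have hWρ := (joukowski_mem_ellipse hρ hW1).1 hs
    refine ⟨W, ⟨lt_of_le_of_ne hW1 fun h1 => hg.2 ?_, hWρ⟩, ?_⟩
    · obtain ⟨h2, h3, h4⟩ := (ellipseToDisc_mem_segment_iff hρ (hcl hs)).2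
        ((joukowski_mem_segment_iff hW1).2 h1.symm)
      rw [e] at h2 h3 h4
      obtain ⟨t, ht⟩ : ∃ t : ℝ, -1 / g = t := ⟨(-1 / g).re, Complex.ext (by simp) (by simp [h2])⟩
      rw [ht, Complex.ofReal_re] at h3 h4
      have ht0 : t ≠ 0 := by
        rintro rfl
        simp [div_eq_zero_iff, hg0] at ht
      have ht' : 0 < -t := by
        have := lt_of_le_of_ne h4 ht0
        linarith
      have hq : g = ((1 / (-t) : ℝ) : ℂ) := by
        have : (t : ℂ) ≠ 0 := by exact_mod_cast ht0
        push_cast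
        rw [← ht]; field_simp
      rw [hq]
      simp only [Complex.ofReal_im, Complex.ofReal_re, and_true]
      exact one_div_le_one_div_of_le ht' (by linarith)
    · simp only [e]; field_simp

/-- The Grötzsch function in terms of the conformal map of the ellipse onto the disc. -/
theorem grotzschPhi_inv_focalValue (hρ : 1 < ρ) : grotzschPhi (1 / focalValue ρ) = ρ := by
  set G : ℂ → ℂ := fun W => -1 / ellipseToDisc ρ (joukowski W) with hG
  have hbij : BijOn G _ _ := bijOn_annulus_grotzschDomain hρ
  have hopen := isOpen_annulus ρ
  have hdiff : DifferentiableOn ℂ G (annulus ρ) := by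
    have hd : DifferentiableOn ℂ (fun W => ellipseToDisc ρ (joukowski W)) (annulus ρ) :=
      (differentiableOn_ellipseToDisc hρ).comp
        (differentiableOn_joukowski.mono fun w hw h0 => by
          have := hw.1
          rw [h0, norm_zero] at this
          linarith)
        (fun w hw => closedFocalEllipse_subset hρ (ellipse_subset_closedEllipse _ _
          ((joukowski_mem_ellipse hρ hw.1.le).2 hw.2)))
    refine (differentiableOn_const _).div hd fun W hW h0 => ?_
    have := (mem_grotzschDomain.1 (hbij.mapsTo hW)).1
    simp only [hG, h0] at this
    simp at this
    linarith
  have hinv := hbij.invOn_invFunOn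
  have hmod : HasModule (grotzschDomain (1 / focalValue ρ)) (1 / (2 * Real.pi) * Real.log ρ) := by
    refine ⟨ρ, hρ, ⟨Function.invFunOn G (annulus ρ), ?_, ?_⟩, rfl⟩
    · have := hdiff.differentiableOn_of_leftInvOn hopen hinv.1
      rwa [hbij.image_eq] at this
    · exact hinv.symm.bijOn hbij.surjOn.mapsTo_invFunOn hbij.mapsTo
  have huniq : ringModule (grotzschDomain (1 / focalValue ρ)) = 1 / (2 * Real.pi) * Real.log ρ :=
    HasModule.unique (isOpen_grotzschDomain _) (Classical.epsilon_spec ⟨_, hmod⟩) hmod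
  rw [grotzschPhi, huniq]
  have : 2 * Real.pi * (1 / (2 * Real.pi) * Real.log ρ) = Real.log ρ := by
    field_simp
  rw [this, Real.exp_log (by linarith)]

end grotzsch

/-! ### The two coverings and the map of the slit disc -/

section covers
variable {R : ℝ}

/-- The covering of the disc by the ellipse with semi-axes `R - 1/R`, `R + 1/R`. -/
noncomputable def coverOne (R : ℝ) (ζ : ℂ) : ℂ := ellipseToDisc (R ^ 2) (ζ ^ 2 + 2)

/-- The covering of the disc by the ellipse with semi-axes `R + 1/R`, `R - 1/R`. -/
noncomputable def coverTwo (R : ℝ) (ω : ℂ) : ℂ := ellipseToDisc (R ^ 2) (ω ^ 2 + -2)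

/-- If `ζ ↦ ζ² + c` is the quotient by `±1` of one ellipse by a focal ellipse, its composition with
the conformal map of the focal ellipse is a two-sheeted covering. -/
lemma isEllipseCover_comp_sq {ρ a b : ℝ} (hρ : 1 < ρ) (c : ℂ)
    (ho : ∀ ζ, ζ ^ 2 + c ∈ focalEllipse ρ ↔ ζ ∈ ellipse a b)
    (hc : ∀ ζ, ζ ^ 2 + c ∈ closedFocalEllipse ρ ↔ ζ ∈ closedEllipse a b) :
    IsEllipseCover a b (ellipseToDisc ρ c) (fun ζ => ellipseToDisc ρ (ζ ^ 2 + c)) := by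
  have key : ∀ {S T U : Set ℂ}, BijOn (ellipseToDisc ρ) S T → (∀ ζ, ζ ^ 2 + c ∈ S ↔ ζ ∈ U) →
      (fun ζ => ellipseToDisc ρ (ζ ^ 2 + c)) '' U = T := by
    intro S T U hb h
    refine subset_antisymm ?_ fun z hz => ?_
    · rintro _ ⟨ζ, hζ, rfl⟩
      exact hb.mapsTo ((h ζ).2 hζ)
    · obtain ⟨s, hs, rfl⟩ := hb.surjOn hz
      obtain ⟨d, hd⟩ : ∃ d : ℂ, d ^ 2 = s - c := ⟨_, Complex.cpow_nat_inv_pow _ two_ne_zero⟩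
      have e : d ^ 2 + c = s := by rw [hd]; ring
      exact ⟨d, (h d).1 (e ▸ hs), by simp only [e]⟩
  refine ⟨?_, ?_, key (bijOn_ellipseToDisc hρ) ho, key (bijOn_closed_ellipseToDisc hρ) hc, ?_, ?_⟩
  · exact (differentiableOn_ellipseToDisc hρ).comp (by fun_prop) fun ζ hζ =>
      closedFocalEllipse_subset hρ (ellipse_subset_closedEllipse _ _ ((ho ζ).2 hζ))
  · exact (continuousOn_ellipseToDisc hρ).comp (by fun_prop) fun ζ hζ => (hc ζ).2 hζ
  · intro z hz w hw
    rw [(bijOn_closed_ellipseToDisc hρ).injOn.eq_iff ((hc z).2 hz) ((hc w).2 hw), add_left_inj,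
      eq_comm, sq_eq_sq_iff_eq_or_eq_neg]
  · simp

lemma isEllipseCover_coverOne (hR : 1 < R) :
    IsEllipseCover (R - 1 / R) (R + 1 / R) 0 (coverOne R) := by
  have := isEllipseCover_comp_sq (one_lt_sq_of_one_lt hR) 2 (fun ζ => sq_add_two_mem_ellipse hR)
    (fun ζ => sq_add_two_mem_closedEllipse hR)
  rwa [ellipseToDisc_two] at this

lemma isEllipseCover_coverTwo (hR : 1 < R) :
    IsEllipseCover (R + 1 / R) (R - 1 / R) (-(focalValue (R ^ 2) : ℂ)) (coverTwo R) := by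
  have := isEllipseCover_comp_sq (one_lt_sq_of_one_lt hR) (-2) (fun ζ => sq_sub_two_mem_ellipse hR)
    (fun ζ => sq_sub_two_mem_closedEllipse hR)
  rwa [ellipseToDisc_neg_two (one_lt_sq_of_one_lt hR)] at this

/-- The two coverings agree under the correspondence `w - 1/w ↔ w + 1/w`, as `(w + 1/w)² - 2` and
`(w - 1/w)² + 2` coincide. -/
lemma coverTwo_joukowski {w : ℂ} (hw : w ≠ 0) :
    coverTwo R (w + 1 / w) = coverOne R (w - 1 / w) := by
  unfold coverOne coverTwo
  congr 1
  field_simp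
  ring

/-- The odd holomorphic square root of `coverOne R`. -/
noncomputable def rootCover (R : ℝ) (ζ : ℂ) : ℂ :=
  ((R⁻¹ : ℝ) : ℂ) * ζ * (thetaProd ((R ^ 2)⁻¹ ^ 4) ((R ^ 2)⁻¹ ^ 4) (ζ ^ 2 + 2) /
    thetaProd ((R ^ 2)⁻¹ ^ 2) ((R ^ 2)⁻¹ ^ 4) (ζ ^ 2 + 2))

lemma rootCover_sq (ζ : ℂ) : rootCover R ζ ^ 2 = coverOne R ζ := by
  unfold rootCover coverOne ellipseToDisc
  push_cast
  ring

lemma rootCover_neg (ζ : ℂ) : rootCover R (-ζ) = -rootCover R ζ := by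
  unfold rootCover
  rw [neg_sq]; ring

lemma rootCover_conj (hR : 1 < R) (ζ : ℂ) : rootCover R (star ζ) = star (rootCover R ζ) := by
  obtain ⟨h0, h1⟩ := inv_pow_four_mem (one_lt_sq_of_one_lt hR)
  unfold rootCover
  have : star ζ ^ 2 + 2 = star (ζ ^ 2 + 2) := by simp
  rw [this, thetaProd_conj h0 h1, thetaProd_conj h0 h1]
  simp [star_div₀]

lemma differentiableOn_rootCover (hR : 1 < R) :
    DifferentiableOn ℂ (rootCover R) {ζ | ζ ^ 2 + 2 ∈ focalEllipse ((R ^ 2) ^ 2)} := by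
  unfold rootCover
  exact (by fun_prop : DifferentiableOn ℂ (fun ζ : ℂ => ((R⁻¹ : ℝ) : ℂ) * ζ) _).mul
    ((differentiableOn_thetaQuot (one_lt_sq_of_one_lt hR)).comp
      (by fun_prop : DifferentiableOn ℂ (fun ζ : ℂ => ζ ^ 2 + 2) _) fun ζ hζ => hζ)

lemma injOn_rootCover (hR : 1 < R) :
    InjOn (rootCover R) (closedEllipse (R - 1 / R) (R + 1 / R)) := by
  intro z hz w hw h
  have hc := isEllipseCover_coverOne hR
  have h1 : coverOne R z = coverOne R w := by rw [← rootCover_sq, h, rootCover_sq]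
  rcases (hc.fiber z hz w hw).1 h1 with h2 | h2
  · exact h2.symm
  · rw [h2, rootCover_neg] at h
    have h0 : rootCover R z = 0 := self_eq_neg.1 h
    have h3 : coverOne R z = coverOne R 0 := by
      rw [hc.branch, ← rootCover_sq, h0]; simp
    have h4 : (0 : ℂ) = z ∨ (0 : ℂ) = -z := (hc.fiber z hz 0
      (ellipse_subset_closedEllipse _ _ (zero_mem_ellipse _ _))).1 h3
    have h5 : z = 0 := by
      rcases h4 with h4 | h4
      · exact h4.symm
      · exact neg_eq_zero.1 h4.symm
    rw [h2, h5, neg_zero]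

/-- The square root of the covering is injective, hence maps the first ellipse conformally onto the
disc. -/
lemma bijOn_rootCover (hR : 1 < R) :
    BijOn (rootCover R) (ellipse (R - 1 / R) (R + 1 / R)) unitDisc := by
  have hc := isEllipseCover_coverOne hR
  refine ⟨fun ζ hζ => ?_, (injOn_rootCover hR).mono (ellipse_subset_closedEllipse _ _),
    fun z hz => ?_⟩
  · have h1 : coverOne R ζ ∈ unitDisc := hc.image ▸ mem_image_of_mem _ hζ
    simp only [unitDisc, mem_ball_zero_iff] at h1 ⊢
    rw [← rootCover_sq, norm_pow] at h1
    exact (sq_lt_one_iff₀ (norm_nonneg _)).1 h1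
  · have hz2 : z ^ 2 ∈ coverOne R '' ellipse (R - 1 / R) (R + 1 / R) := by
      rw [hc.image]
      simp only [unitDisc, mem_ball_zero_iff] at hz ⊢
      rw [norm_pow]
      exact (sq_lt_one_iff₀ (norm_nonneg _)).2 hz
    obtain ⟨ζ, hζ, e⟩ := hz2
    rw [← rootCover_sq] at e
    rcases sq_eq_sq_iff_eq_or_eq_neg.1 e with h | h
    · exact ⟨ζ, hζ, h⟩
    · refine ⟨-ζ, ?_, ?_⟩
      · rw [mem_ellipse, ellipseGauge_neg]; exact hζ
      · rw [rootCover_neg, h, neg_neg]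

lemma thetaQuot_ofReal_pos {ρ : ℝ} (hρ : 1 < ρ) {s : ℝ} (hs : |s| ≤ ρ + 1 / ρ) :
    ∃ t : ℝ, 0 < t ∧ thetaProd (ρ⁻¹ ^ 4) (ρ⁻¹ ^ 4) s / thetaProd (ρ⁻¹ ^ 2) (ρ⁻¹ ^ 4) s = t := by
  obtain ⟨h0, h1⟩ := inv_pow_four_mem hρ
  have hρ0 : 0 < ρ := by linarith
  have hr := inv_lt_one_of_one_lt₀ hρ
  have hr0 : 0 < ρ⁻¹ := by positivity
  -- `1 - c s + c² ≥ (1 - c ρ) (1 - c / ρ)`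
  have hfac : ∀ c : ℝ, 0 < c → c ≤ ρ⁻¹ ^ 2 → 0 < 1 + (-(c * s) + c ^ 2) := by
    intro c hc hc2
    have e1 : c * ρ < 1 := by
      have h2 : ρ⁻¹ ^ 2 * ρ = ρ⁻¹ := by field_simp
      nlinarith
    have e2 : c * (1 / ρ) < 1 := by
      rw [one_div]; nlinarith
    have e3 := mul_pos (sub_pos.2 e1) (sub_pos.2 e2)
    have e4 : (1 - c * ρ) * (1 - c * (1 / ρ)) = 1 - c * (ρ + 1 / ρ) + c ^ 2 := by
      field_simp; ring
    have e5 : c * s ≤ c * (ρ + 1 / ρ) :=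
      mul_le_mul_of_nonneg_left ((le_abs_self s).trans hs) hc.le
    linarith
  have hpos : ∀ a : ℝ, 0 < a → a ≤ ρ⁻¹ ^ 2 → ∀ n : ℕ,
      0 < 1 + (-(a * (ρ⁻¹ ^ 4) ^ n * s) + (a * (ρ⁻¹ ^ 4) ^ n) ^ 2) := fun a ha ha' n =>
    hfac _ (by positivity) ((mul_le_of_le_one_right ha.le (pow_le_one₀ h0 h1.le)).trans ha')
  obtain ⟨t₁, ht₁, e₁⟩ := thetaProd_ofReal_pos h0 h1 (ρ⁻¹ ^ 4) s (hpos _ (by positivity)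
    (pow_le_pow_of_le_one hr0.le hr.le (by norm_num)))
  obtain ⟨t₂, ht₂, e₂⟩ := thetaProd_ofReal_pos h0 h1 (ρ⁻¹ ^ 2) s (hpos _ (by positivity) le_rfl)
  exact ⟨t₁ / t₂, by positivity, by rw [e₁, e₂]; push_cast; rfl⟩

/-- On the two axes of the ellipse the square root of the covering differs from the identity by a
positive factor. -/
lemma rootCover_eq_mul_pos (hR : 1 < R) {ζ : ℂ} (hζ : ζ ∈ closedEllipse (R - 1 / R) (R + 1 / R))
    (hre : (ζ ^ 2).im = 0) : ∃ t : ℝ, 0 < t ∧ rootCover R ζ = ζ * t := by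
  have hR2 := one_lt_sq_of_one_lt hR
  have hs := (sq_add_two_mem_closedEllipse hR).2 hζ
  obtain ⟨s, e⟩ : ∃ s : ℝ, ζ ^ 2 + 2 = s :=
    ⟨(ζ ^ 2 + 2).re, Complex.ext (by simp) (by simp [hre])⟩
  rw [e] at hs
  obtain ⟨t, ht, e'⟩ := thetaQuot_ofReal_pos hR2 ((ofReal_mem_closedFocalEllipse hR2).1 hs)
  refine ⟨R⁻¹ * t, by have : 0 < R := by linarith
                      positivity, ?_⟩
  rw [rootCover, e, e']; push_cast; ring

end covers


/-! ### The conformal map of the slit disc -/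

section slit
variable {R : ℝ}

/-- The conformal map of the annulus onto the slit disc. -/
noncomputable def annulusToSlit (R : ℝ) (w : ℂ) : ℂ := rootCover R (w - 1 / w)

lemma neg_I_mul_sub_inv {w : ℂ} (hw : w ≠ 0) :
    w - 1 / w = Complex.I * joukowski (-Complex.I * w) := by
  unfold joukowski
  field_simp
  linear_combination (w ^ 2) * Complex.I_sq

lemma sub_inv_mem_ellipse (hR : 1 < R) {w : ℂ} (hw : 1 ≤ ‖w‖) :
    w - 1 / w ∈ ellipse (R - 1 / R) (R + 1 / R) ↔ ‖w‖ < R := by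
  have hw0 : w ≠ 0 := norm_pos_iff.1 (by linarith)
  have hn : ‖-Complex.I * w‖ = ‖w‖ := by simp
  rw [neg_I_mul_sub_inv hw0, mem_ellipse, ellipseGauge_I_mul, ← mem_ellipse,
    joukowski_mem_ellipse hR (by rwa [hn]), hn]

lemma sub_inv_mem_closedEllipse (hR : 1 < R) {w : ℂ} (hw : 1 ≤ ‖w‖) :
    w - 1 / w ∈ closedEllipse (R - 1 / R) (R + 1 / R) ↔ ‖w‖ ≤ R := by
  have hw0 : w ≠ 0 := norm_pos_iff.1 (by linarith)
  have hn : ‖-Complex.I * w‖ = ‖w‖ := by simp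
  rw [neg_I_mul_sub_inv hw0, mem_closedEllipse, ellipseGauge_I_mul, ← mem_closedEllipse,
    joukowski_mem_closedEllipse hR (by rwa [hn]), hn]

lemma exists_sub_inv_eq (ζ : ℂ) : ∃ w : ℂ, 1 ≤ ‖w‖ ∧ w - 1 / w = ζ := by
  obtain ⟨v, hv, e⟩ := exists_joukowski_eq (-Complex.I * ζ)
  have hv0 : v ≠ 0 := norm_pos_iff.1 (by linarith)
  refine ⟨Complex.I * v, by simpa using hv, ?_⟩
  rw [neg_I_mul_sub_inv (mul_ne_zero Complex.I_ne_zero hv0), ← mul_assoc, neg_mul, Complex.I_mul_I,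
    neg_neg, one_mul, e, ← mul_assoc, mul_neg, Complex.I_mul_I, neg_neg, one_mul]

lemma sub_inv_eq_iff {w v : ℂ} (hw : w ≠ 0) (hv : v ≠ 0) :
    w - 1 / w = v - 1 / v ↔ v = w ∨ v = -(1 / w) := by
  rw [neg_I_mul_sub_inv hw, neg_I_mul_sub_inv hv, mul_right_inj' Complex.I_ne_zero,
    joukowski_eq_iff (by simp [hw]) (by simp [hv])]
  refine or_congr (by simp) ?_
  constructor
  · intro h
    have h1 : v = Complex.I * (-Complex.I * v) := by
      rw [← mul_assoc, mul_neg, Complex.I_mul_I, neg_neg, one_mul]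
    rw [h1, h]
    field_simp
  · rintro rfl
    field_simp
    linear_combination Complex.I_sq

lemma mem_slit_iff {x : ℝ} (hx : 0 ≤ x) {z : ℂ} :
    (z.re = 0 ∧ |z.im| ≤ √x) ↔ ((z ^ 2).im = 0 ∧ -x ≤ (z ^ 2).re ∧ (z ^ 2).re ≤ 0) := by
  have h1 : (z ^ 2).re = z.re ^ 2 - z.im ^ 2 := by simp [pow_two]
  have h2 : (z ^ 2).im = 2 * z.re * z.im := by simp [pow_two]; ring
  rw [h1, h2, Real.le_sqrt (abs_nonneg _) hx, sq_abs]
  constructor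
  · rintro ⟨h3, h4⟩
    rw [h3]
    exact ⟨by ring, by linarith, by nlinarith [sq_nonneg z.im]⟩
  · rintro ⟨h3, h4, h5⟩
    have h6 : z.re = 0 := by
      rcases mul_eq_zero.1 h3 with h | h
      · linarith
      · rw [h] at h5
        nlinarith
    refine ⟨h6, ?_⟩
    rw [h6] at h4; linarith

lemma ne_zero_of_one_lt_norm {w : ℂ} (h : 1 < ‖w‖) : w ≠ 0 := norm_pos_iff.1 (by linarith)

/-- The map `w ↦ w - 1/w` takes the annulus onto the ellipse without the segment `[-2i, 2i]`, which
is mapped by `rootCover R` onto the slit. -/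
lemma bijOn_annulusToSlit (hR : 1 < R) :
    BijOn (annulusToSlit R) (annulus R) (slitDisc (focalValue (R ^ 2))) := by
  have hR2 := one_lt_sq_of_one_lt hR
  have hx := focalValue_pos hR2
  have hP := bijOn_rootCover hR
  -- the unit circle corresponds to the slit, via the squares `z²` and `w²`
  have hslit : ∀ w : ℂ, 1 ≤ ‖w‖ → ‖w‖ < R → (((annulusToSlit R w).re = 0 ∧
      |(annulusToSlit R w).im| ≤ √(focalValue (R ^ 2))) ↔ ‖w‖ = 1) := by
    intro w hw hwR
    have hw0 : w ≠ 0 := norm_pos_iff.1 (by linarith)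
    have hw2 : 1 ≤ ‖w ^ 2‖ := by rw [norm_pow]; exact one_le_pow₀ hw
    have e : (w - 1 / w) ^ 2 + 2 = joukowski (w ^ 2) := by
      rw [joukowski_sq hw0, joukowski]; field_simp; ring
    have hs := (sq_add_two_mem_closedEllipse hR).2
      (ellipse_subset_closedEllipse _ _ ((sub_inv_mem_ellipse hR hw).2 hwR))
    rw [mem_slit_iff hx.le, annulusToSlit, rootCover_sq, coverOne,
      ellipseToDisc_mem_segment_iff hR2 hs, e, joukowski_mem_segment_iff hw2, norm_pow,
      pow_eq_one_iff_of_nonneg (norm_nonneg _) two_ne_zero]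
  refine ⟨fun w hw => ⟨hP.mapsTo ((sub_inv_mem_ellipse hR hw.1.le).2 hw.2), fun h => ?_⟩,
    fun w hw v hv h => ?_, fun z hz => ?_⟩
  · exact hw.1.ne' ((hslit w hw.1.le hw.2).1 h)
  · have h1 := hP.injOn ((sub_inv_mem_ellipse hR hw.1.le).2 hw.2)
      ((sub_inv_mem_ellipse hR hv.1.le).2 hv.2) h
    rcases (sub_inv_eq_iff (ne_zero_of_one_lt_norm hw.1) (ne_zero_of_one_lt_norm hv.1)).1 h1 with
      h2 | h2
    · exact h2.symm
    · have h3 := congrArg norm h2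
      have h4 := hw.1
      rw [norm_neg, norm_div, norm_one, eq_div_iff (by linarith)] at h3
      nlinarith [hv.1]
  · obtain ⟨ζ, hζ, e⟩ := hP.surjOn hz.1
    obtain ⟨w, hw, rfl⟩ := exists_sub_inv_eq ζ
    have hwR := (sub_inv_mem_ellipse hR hw).1 hζ
    refine ⟨w, ⟨lt_of_le_of_ne hw fun h => hz.2 ?_, hwR⟩, e⟩
    have := (hslit w hw hwR).2 h.symm
    rwa [annulusToSlit, e] at this

lemma differentiableAt_annulusToSlit (hR : 1 < R) {w : ℂ} (hw : 1 ≤ ‖w‖) (hwR : ‖w‖ ≤ R) :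
    DifferentiableAt ℂ (annulusToSlit R) w := by
  have hw0 : w ≠ 0 := norm_pos_iff.1 (by linarith)
  have h1 : DifferentiableAt ℂ (fun w : ℂ => w - 1 / w) w := by fun_prop (disch := exact hw0)
  have hopen : IsOpen {ζ : ℂ | ζ ^ 2 + 2 ∈ focalEllipse ((R ^ 2) ^ 2)} :=
    (isOpen_ellipse _ _).preimage (by fun_prop)
  have h2 : DifferentiableAt ℂ (rootCover R) (w - 1 / w) :=
    (differentiableOn_rootCover hR).differentiableAt (hopen.mem_nhds
      (closedFocalEllipse_subset (one_lt_sq_of_one_lt hR) ((sq_add_two_mem_closedEllipse hR).2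
        ((sub_inv_mem_closedEllipse hR hw).2 hwR))))
  exact h2.comp w h1

lemma annulusToSlit_conj (hR : 1 < R) (w : ℂ) :
    annulusToSlit R (star w) = star (annulusToSlit R w) := by
  rw [annulusToSlit, annulusToSlit, ← rootCover_conj hR]
  congr 1
  simp

lemma annulusToSlit_neg (w : ℂ) : annulusToSlit R (-w) = -annulusToSlit R w := by
  rw [annulusToSlit, annulusToSlit, ← rootCover_neg]
  congr 1
  rw [div_neg]; ring

/-- The closed quarter of the closed annulus. -/
def closedQuarter (R : ℝ) : Set ℂ := {w | (1 ≤ ‖w‖ ∧ ‖w‖ ≤ R) ∧ 0 ≤ w.re ∧ 0 ≤ w.im}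

lemma isCompact_closedQuarter (R : ℝ) : IsCompact (closedQuarter R) := by
  refine (isCompact_closedBall (0 : ℂ) R).of_isClosed_subset ?_ fun w hw => by
    simpa using hw.1.2
  exact ((isClosed_le continuous_const continuous_norm).inter
    (isClosed_le continuous_norm continuous_const)).inter
    ((isClosed_le continuous_const Complex.continuous_re).inter
      (isClosed_le continuous_const Complex.continuous_im))

/-- On a closed quarter of the annulus the map `w ↦ w - 1/w` is injective up to the boundary; on the
whole closed annulus it identifies `w` and `-w̄` on the unit circle. -/
lemma injOn_annulusToSlit_closedQuarter (hR : 1 < R) :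
    InjOn (annulusToSlit R) (closedQuarter R) := by
  intro w hw v hv h
  have hw0 : w ≠ 0 := norm_pos_iff.1 (by linarith [hw.1.1])
  have hv0 : v ≠ 0 := norm_pos_iff.1 (by linarith [hv.1.1])
  have h1 := injOn_rootCover hR ((sub_inv_mem_closedEllipse hR hw.1.1).2 hw.1.2)
      ((sub_inv_mem_closedEllipse hR hv.1.1).2 hv.1.2) h
  rcases (sub_inv_eq_iff hw0 hv0).1 h1 with h2 | h2
  · exact h2.symm
  · have h3 := congrArg norm h2
    have h4 := hw.1.1
    have h5 := hv.1.1
    rw [norm_neg, norm_div, norm_one, eq_div_iff (by linarith)] at h3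
    have hwn : ‖w‖ = 1 := by nlinarith
    have hinv : 1 / w = star w := by
      rw [one_div, Complex.inv_def, Complex.normSq_eq_norm_sq, hwn]; simp
    rw [hinv] at h2
    have h6 : w.re = 0 := by
      have := congrArg Complex.re h2
      simp at this
      linarith [hw.2.1, hv.2.1]
    rw [h2]
    exact Complex.ext (by simp [h6]) (by simp)

/-- Boundary values of inverse branches, by compactness of the closed quarter of the annulus. -/
lemma tendsto_of_annulusToSlit {α : Type*} {l : Filter α} {φ : α → ℂ} (hR : 1 < R) {w₀ : ℂ}
    (hw₀ : w₀ ∈ closedQuarter R) (hφ : ∀ᶠ a in l, φ a ∈ closedQuarter R)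
    (h : Tendsto (fun a => annulusToSlit R (φ a)) l (𝓝 (annulusToSlit R w₀))) :
    Tendsto φ l (𝓝 w₀) := by
  refine (isCompact_closedQuarter R).tendsto_nhds_of_unique_mapClusterPt hφ fun w hw hc => ?_
  refine injOn_annulusToSlit_closedQuarter hR hw hw₀ ?_
  have hcont := (differentiableAt_annulusToSlit hR hw.1.1 hw.1.2).continuousAt
  have h1 : MapClusterPt (annulusToSlit R w) l (annulusToSlit R ∘ φ) :=
    hc.continuousAt_comp hcont
  have h2 : ClusterPt (annulusToSlit R w) (𝓝 (annulusToSlit R w₀)) := ClusterPt.mono h1 h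
  exact eq_of_nhds_neBot h2

lemma mem_closure_quadrant {z : ℂ} (hz : ‖z‖ < 1) (hre : 0 ≤ z.re) (him : 0 ≤ z.im) :
    z ∈ closure (unitDisc ∩ firstQuadrant) := by
  have ht : Tendsto (fun ε : ℝ => z + ε * (1 + Complex.I)) (𝓝[>] 0) (𝓝 z) := by
    have : Continuous fun ε : ℝ => z + ε * (1 + Complex.I) := by fun_prop
    have := this.tendsto 0
    simp only [Complex.ofReal_zero, zero_mul, add_zero] at this
    exact this.mono_left nhdsWithin_le_nhds
  refine mem_closure_of_tendsto ht ?_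
  have h1 : ∀ᶠ ε : ℝ in 𝓝[>] 0, z + ε * (1 + Complex.I) ∈ unitDisc :=
    ht.eventually (Metric.isOpen_ball.mem_nhds (by simpa using hz))
  filter_upwards [h1, self_mem_nhdsWithin] with ε h2 h3
  refine ⟨h2, ?_, ?_⟩ <;> simp <;> linarith [mem_Ioi.1 h3]

lemma isPreconnected_quadrant : IsPreconnected (unitDisc ∩ firstQuadrant) := by
  refine Convex.isPreconnected ((convex_ball _ _).inter ?_)
  exact (convex_halfSpace_re_gt 0).inter (convex_halfSpace_im_gt 0)

/-- A continuous real function without zeros on a quarter of the disc, and positive at a point of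
its closure, is positive. -/
lemma pos_of_quadrant {u : ℂ → ℝ} {z₀ : ℂ} (hz₀ : z₀ ∈ closure (unitDisc ∩ firstQuadrant))
    (hu : ContinuousOn u (insert z₀ (unitDisc ∩ firstQuadrant)))
    (h0 : ∀ z ∈ unitDisc ∩ firstQuadrant, u z ≠ 0) (hpos : 0 < u z₀) :
    ∀ z ∈ unitDisc ∩ firstQuadrant, 0 < u z := by
  intro z hz
  have hp : IsPreconnected (insert z₀ (unitDisc ∩ firstQuadrant)) :=
    isPreconnected_quadrant.subset_closure (subset_insert _ _)
      (insert_subset hz₀ subset_closure)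
  by_contra hn
  obtain ⟨y, hy, hy0⟩ := hp.intermediate_value (mem_insert_of_mem _ hz) (mem_insert _ _) hu
    (show (0 : ℝ) ∈ Icc (u z) (u z₀) from ⟨not_lt.1 hn, hpos.le⟩)
  rcases hy with rfl | hy
  · exact hpos.ne' hy0
  · exact h0 y hy hy0

/-- The inverse of `annulusToSlit R`, as a map defined on the slit disc. -/
noncomputable def slitToAnnulus (R : ℝ) : ℂ → ℂ :=
  Function.invFunOn (annulusToSlit R) (annulus R)

lemma annulusToSlit_slitToAnnulus (hR : 1 < R) {z : ℂ} (hz : z ∈ slitDisc (focalValue (R ^ 2))) :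
    slitToAnnulus R z ∈ annulus R ∧ annulusToSlit R (slitToAnnulus R z) = z :=
  ⟨(bijOn_annulusToSlit hR).surjOn.mapsTo_invFunOn hz,
    (bijOn_annulusToSlit hR).surjOn.rightInvOn_invFunOn hz⟩

lemma slitToAnnulus_eq (hR : 1 < R) {w : ℂ} (hw : w ∈ annulus R) :
    slitToAnnulus R (annulusToSlit R w) = w :=
  (bijOn_annulusToSlit hR).invOn_invFunOn.1 hw

lemma slitToAnnulus_eq_of_eq (hR : 1 < R) {w z : ℂ} (hw : w ∈ annulus R)
    (h : annulusToSlit R w = z) : slitToAnnulus R z = w := by rw [← h, slitToAnnulus_eq hR hw]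

lemma star_mem_annulus {w : ℂ} (hw : w ∈ annulus R) : star w ∈ annulus R := by
  simpa [annulus] using hw

lemma neg_mem_annulus {w : ℂ} (hw : w ∈ annulus R) : -w ∈ annulus R := by
  simpa [annulus] using hw

lemma slitToAnnulus_conj (hR : 1 < R) {z : ℂ} (hz : z ∈ slitDisc (focalValue (R ^ 2))) :
    slitToAnnulus R (star z) = star (slitToAnnulus R z) := by
  obtain ⟨h1, h2⟩ := annulusToSlit_slitToAnnulus hR hz
  exact slitToAnnulus_eq_of_eq hR (star_mem_annulus h1) (by rw [annulusToSlit_conj hR, h2])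

lemma slitToAnnulus_neg (hR : 1 < R) {z : ℂ} (hz : z ∈ slitDisc (focalValue (R ^ 2))) :
    slitToAnnulus R (-z) = -slitToAnnulus R z := by
  obtain ⟨h1, h2⟩ := annulusToSlit_slitToAnnulus hR hz
  exact slitToAnnulus_eq_of_eq hR (neg_mem_annulus h1) (by rw [annulusToSlit_neg, h2])

lemma differentiableOn_slitToAnnulus (hR : 1 < R) :
    DifferentiableOn ℂ (slitToAnnulus R) (slitDisc (focalValue (R ^ 2))) := by
  have h : DifferentiableOn ℂ (annulusToSlit R) (annulus R) := fun w hw =>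
    (differentiableAt_annulusToSlit hR hw.1.le hw.2.le).differentiableWithinAt
  have := h.differentiableOn_of_leftInvOn (isOpen_annulus R)
    (bijOn_annulusToSlit hR).invOn_invFunOn.1
  rwa [(bijOn_annulusToSlit hR).image_eq] at this

lemma quadrant_subset_slitDisc (x : ℝ) : unitDisc ∩ firstQuadrant ⊆ slitDisc x :=
  fun _ hz => ⟨hz.1, fun h => hz.2.1.ne' h.1⟩

lemma star_mem_slitDisc {x : ℝ} {z : ℂ} (hz : z ∈ slitDisc x) : star z ∈ slitDisc x := by
  simpa [slitDisc, unitDisc] using hz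

lemma neg_mem_slitDisc {x : ℝ} {z : ℂ} (hz : z ∈ slitDisc x) : -z ∈ slitDisc x := by
  simpa [slitDisc, unitDisc] using hz

/-- On the real and imaginary axes the conformal map of the annulus is multiplication by positive
numbers, up to `w ↦ w - 1/w`. -/
lemma annulusToSlit_ofReal (hR : 1 < R) {t : ℝ} (ht : 1 ≤ t) (htR : t ≤ R) :
    ∃ r : ℝ, 0 < r ∧ annulusToSlit R t = ((t - 1 / t) * r : ℝ) := by
  have hn : ‖(t : ℂ)‖ = t := by simp [abs_of_nonneg (by linarith : (0 : ℝ) ≤ t)]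
  obtain ⟨r, hr, e⟩ := rootCover_eq_mul_pos hR ((sub_inv_mem_closedEllipse hR
    (by rwa [hn])).2 (by rwa [hn])) (by
      have : ((t : ℂ) - 1 / t) ^ 2 = (((t - 1 / t) ^ 2 : ℝ) : ℂ) := by push_cast; ring
      rw [this, Complex.ofReal_im])
  exact ⟨r, hr, by rw [annulusToSlit, e]; push_cast; ring⟩

lemma annulusToSlit_ofReal_mul_I (hR : 1 < R) {t : ℝ} (ht : 1 ≤ t) (htR : t ≤ R) :
    ∃ r : ℝ, 0 < r ∧ annulusToSlit R (t * Complex.I) = ((t + 1 / t) * r : ℝ) * Complex.I := by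
  have hn : ‖(t : ℂ) * Complex.I‖ = t := by simp [abs_of_nonneg (by linarith : (0 : ℝ) ≤ t)]
  have ht0 : (t : ℂ) ≠ 0 := by
    have : t ≠ 0 := by linarith
    exact_mod_cast this
  have e0 : (t : ℂ) * Complex.I - 1 / (t * Complex.I) = ((t + 1 / t : ℝ) : ℂ) * Complex.I := by
    push_cast
    field_simp
    linear_combination (-1 : ℂ) * Complex.I_sq
  obtain ⟨r, hr, e⟩ := rootCover_eq_mul_pos hR ((sub_inv_mem_closedEllipse hR
    (by rwa [hn])).2 (by rwa [hn])) (by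
      rw [e0, mul_pow, Complex.I_sq]
      have : ((t + 1 / t : ℝ) : ℂ) ^ 2 * -1 = ((-(t + 1 / t) ^ 2 : ℝ) : ℂ) := by push_cast; ring
      rw [this, Complex.ofReal_im])
  exact ⟨r, hr, by rw [annulusToSlit, e, e0]; push_cast; ring⟩

/-- The inverse map commutes with the reflection in the imaginary axis, hence takes points of this
axis to points of this axis. -/
lemma slitToAnnulus_re_ne_zero (hR : 1 < R) {z : ℂ} (hz : z ∈ slitDisc (focalValue (R ^ 2)))
    (h : z.re ≠ 0) : (slitToAnnulus R z).re ≠ 0 := by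
  intro h0
  obtain ⟨h1, h2⟩ := annulusToSlit_slitToAnnulus hR hz
  have e : -star (slitToAnnulus R z) = slitToAnnulus R z :=
    Complex.ext (by simp [h0]) (by simp)
  have e2 := congrArg (annulusToSlit R) e
  rw [annulusToSlit_neg, annulusToSlit_conj hR, h2] at e2
  have := congrArg Complex.re e2
  simp at this
  exact h (by linarith)

lemma slitToAnnulus_im_ne_zero (hR : 1 < R) {z : ℂ} (hz : z ∈ slitDisc (focalValue (R ^ 2)))
    (h : z.im ≠ 0) : (slitToAnnulus R z).im ≠ 0 := by
  intro h0
  obtain ⟨h1, h2⟩ := annulusToSlit_slitToAnnulus hR hz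
  have e : star (slitToAnnulus R z) = slitToAnnulus R z :=
    Complex.ext (by simp) (by simp [h0])
  have e2 := congrArg (annulusToSlit R) e
  rw [annulusToSlit_conj hR, h2] at e2
  have := congrArg Complex.im e2
  simp at this
  exact h (by linarith)

/-- The real and the imaginary part of the conformal map have no zeros in the quadrant, and are
positive at a point of the real, respectively imaginary, axis. -/
lemma slitToAnnulus_mem_firstQuadrant (hR : 1 < R) {z : ℂ} (hz : z ∈ unitDisc ∩ firstQuadrant) :
    slitToAnnulus R z ∈ firstQuadrant := by
  obtain ⟨t, ht1, ht2⟩ := exists_between hR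
  have hc := (differentiableOn_slitToAnnulus hR).continuousOn
  have hsub := quadrant_subset_slitDisc (focalValue (R ^ 2))
  have ht0 : 0 < t := by linarith
  constructor
  · obtain ⟨r, hr, e⟩ := annulusToSlit_ofReal hR ht1.le ht2.le
    have hta : (t : ℂ) ∈ annulus R := by simp [annulus, abs_of_pos ht0, ht1, ht2]
    have hm := (bijOn_annulusToSlit hR).mapsTo hta
    refine pos_of_quadrant (u := fun z => (slitToAnnulus R z).re) (z₀ := annulusToSlit R t) ?_ ?_ ?_ ?_ z hz
    · refine mem_closure_quadrant (by simpa [unitDisc] using hm.1) ?_ (by simp [e])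
      rw [e, Complex.ofReal_re]
      exact (mul_pos (sub_inv_pos ht1) hr).le
    · exact Complex.continuous_re.comp_continuousOn (hc.mono (insert_subset hm hsub))
    · exact fun z hz => slitToAnnulus_re_ne_zero hR (hsub hz) hz.2.1.ne'
    · simp [slitToAnnulus_eq hR hta, ht0]
  · obtain ⟨r, hr, e⟩ := annulusToSlit_ofReal_mul_I hR ht1.le ht2.le
    have hta : (t : ℂ) * Complex.I ∈ annulus R := by simp [annulus, abs_of_pos ht0, ht1, ht2]
    have hm := (bijOn_annulusToSlit hR).mapsTo hta
    refine pos_of_quadrant (u := fun z => (slitToAnnulus R z).im)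
      (z₀ := annulusToSlit R (t * Complex.I)) ?_ ?_ ?_ ?_ z hz
    · refine mem_closure_quadrant (by simpa [unitDisc] using hm.1) (by simp [e]) ?_
      rw [e, Complex.im_ofReal_mul, Complex.I_im, mul_one]
      positivity
    · exact Complex.continuous_im.comp_continuousOn (hc.mono (insert_subset hm hsub))
    · exact fun z hz => slitToAnnulus_im_ne_zero hR (hsub hz) hz.2.2.ne'
    · simp [slitToAnnulus_eq hR hta, ht0]

lemma image_quadrant_slitToAnnulus (hR : 1 < R) :
    slitToAnnulus R '' (unitDisc ∩ firstQuadrant) = annulus R ∩ firstQuadrant := by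
  refine subset_antisymm ?_ fun w hw => ?_
  · rintro _ ⟨z, hz, rfl⟩
    exact ⟨(annulusToSlit_slitToAnnulus hR (quadrant_subset_slitDisc _ hz)).1,
      slitToAnnulus_mem_firstQuadrant hR hz⟩
  · set z := annulusToSlit R w with hz
    have hzs : z ∈ slitDisc (focalValue (R ^ 2)) := (bijOn_annulusToSlit hR).mapsTo hw.1
    have e : slitToAnnulus R z = w := slitToAnnulus_eq hR hw.1
    have hzre : z.re ≠ 0 := by
      intro h
      have e1 : -star z = z := Complex.ext (by simp [h]) (by simp)
      have e2 := slitToAnnulus_neg hR (star_mem_slitDisc hzs)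
      rw [e1, slitToAnnulus_conj hR hzs, e] at e2
      have := congrArg Complex.re e2
      simp at this
      linarith [hw.2.1]
    have hzim : z.im ≠ 0 := by
      intro h
      have e1 : star z = z := Complex.ext (by simp) (by simp [h])
      have e2 := slitToAnnulus_conj hR hzs
      rw [e1, e] at e2
      have := congrArg Complex.im e2
      simp at this
      linarith [hw.2.2]
    refine ⟨z, ⟨hzs.1, ?_⟩, e⟩
    have hball : ∀ v ∈ slitDisc (focalValue (R ^ 2)), 0 < v.re → 0 < v.im →
        slitToAnnulus R v ∈ firstQuadrant := fun v hv h1 h2 =>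
      slitToAnnulus_mem_firstQuadrant hR ⟨hv.1, h1, h2⟩
    -- otherwise a reflection of `z` lies in the quadrant, and its image does not
    rcases hzre.lt_or_gt with h1 | h1 <;> rcases hzim.lt_or_gt with h2 | h2
    · have h3 := (hball (-z) (neg_mem_slitDisc hzs) (by simpa using h1) (by simpa using h2)).1
      rw [slitToAnnulus_neg hR hzs, e] at h3
      simp at h3
      linarith [hw.2.1]
    · have h3 := (hball (-star z) (neg_mem_slitDisc (star_mem_slitDisc hzs)) (by simpa using h1)
        (by simpa using h2)).1
      rw [slitToAnnulus_neg hR (star_mem_slitDisc hzs), slitToAnnulus_conj hR hzs, e] at h3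
      simp at h3
      linarith [hw.2.1]
    · have h3 := (hball (star z) (star_mem_slitDisc hzs) (by simpa using h1)
        (by simpa using h2)).2
      rw [slitToAnnulus_conj hR hzs, e] at h3
      simp at h3
      linarith [hw.2.2]
    · exact ⟨h1, h2⟩

lemma tendsto_slitToAnnulus (hR : 1 < R) {w₀ : ℂ} (hw₀ : w₀ ∈ closedQuarter R) :
    Tendsto (slitToAnnulus R) (𝓝[unitDisc ∩ firstQuadrant] (annulusToSlit R w₀)) (𝓝 w₀) := by
  have hmem : ∀ z ∈ unitDisc ∩ firstQuadrant, slitToAnnulus R z ∈ closedQuarter R ∧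
      annulusToSlit R (slitToAnnulus R z) = z := by
    intro z hz
    obtain ⟨h1, h2⟩ := annulusToSlit_slitToAnnulus hR (quadrant_subset_slitDisc _ hz)
    have h3 := slitToAnnulus_mem_firstQuadrant hR hz
    exact ⟨⟨⟨h1.1.le, h1.2.le⟩, h3.1.le, h3.2.le⟩, h2⟩
  refine tendsto_of_annulusToSlit hR hw₀ ?_ ?_
  · filter_upwards [self_mem_nhdsWithin] with z hz using (hmem z hz).1
  · refine (tendsto_id.mono_left nhdsWithin_le_nhds).congr' ?_
    filter_upwards [self_mem_nhdsWithin] with z hz using (hmem z hz).2.symm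

lemma norm_annulusToSlit_eq_one (hR : 1 < R) {w : ℂ} (hw : ‖w‖ = R) : ‖annulusToSlit R w‖ = 1 := by
  have h1 : 1 ≤ ‖w‖ := by linarith
  have h2 := (sub_inv_mem_closedEllipse hR h1).2 hw.le
  have h3 := (sub_inv_mem_ellipse hR h1).not.2 hw.not_lt
  have h4 := norm_ellipseToDisc_of_boundary (one_lt_sq_of_one_lt hR)
    ⟨(sq_add_two_mem_closedEllipse hR).2 h2, (sq_add_two_mem_ellipse hR).not.2 h3⟩
  rw [← coverOne, ← rootCover_sq, norm_pow] at h4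
  exact (pow_eq_one_iff_of_nonneg (norm_nonneg _) two_ne_zero).1 h4

theorem isSlitDiscMap_slitToAnnulus (hR : 1 < R) :
    IsSlitDiscMap (focalValue (R ^ 2)) R (slitToAnnulus R) := by
  have hR2 := one_lt_sq_of_one_lt hR
  have hR0 : 0 < R := by linarith
  refine ⟨differentiableOn_slitToAnnulus hR, ?_, image_quadrant_slitToAnnulus hR, ?_, ?_, ?_, ?_,
    fun z hz => slitToAnnulus_conj hR hz, fun z hz => ?_⟩
  · exact (bijOn_annulusToSlit hR).invOn_invFunOn.symm.bijOn
      (bijOn_annulusToSlit hR).surjOn.mapsTo_invFunOn (bijOn_annulusToSlit hR).mapsTo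
  · have := tendsto_slitToAnnulus hR (w₀ := 1) ⟨⟨by simp, by simpa using hR.le⟩, by simp, by simp⟩
    have e : annulusToSlit R 1 = 0 := by simp [annulusToSlit, rootCover]
    rwa [e] at this
  · have := tendsto_slitToAnnulus hR (w₀ := R) ⟨by simp [abs_of_pos hR0, hR.le], by simp [hR0.le],
      by simp⟩
    have e : annulusToSlit R R = 1 := by
      obtain ⟨r, hr, e⟩ := annulusToSlit_ofReal hR hR.le le_rfl
      have hn := norm_annulusToSlit_eq_one hR (w := R) (by simp [abs_of_pos hR0])
      rw [e, Complex.norm_real, Real.norm_of_nonneg (mul_pos (sub_inv_pos hR) hr).le] at hn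
      rw [e, hn, Complex.ofReal_one]
    rwa [e] at this
  · have := tendsto_slitToAnnulus hR (w₀ := R * Complex.I)
      ⟨by simp [abs_of_pos hR0, hR.le], by simp, by simp [hR0.le]⟩
    have e : annulusToSlit R (R * Complex.I) = Complex.I := by
      obtain ⟨r, hr, e⟩ := annulusToSlit_ofReal_mul_I hR hR.le le_rfl
      have hn := norm_annulusToSlit_eq_one hR (w := R * Complex.I) (by simp [abs_of_pos hR0])
      rw [e, norm_mul, Complex.norm_I, mul_one, Complex.norm_real,
        Real.norm_of_nonneg (mul_pos (add_inv_pos hR) hr).le] at hn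
      rw [e, hn, Complex.ofReal_one, one_mul]
    rwa [e] at this
  · have := tendsto_slitToAnnulus hR (w₀ := Complex.I)
      ⟨⟨by simp, by simpa using hR.le⟩, by simp, by simp⟩
    have e : annulusToSlit R Complex.I = ((√(focalValue (R ^ 2)) : ℝ) : ℂ) * Complex.I := by
      obtain ⟨r, hr, e⟩ := annulusToSlit_ofReal_mul_I hR le_rfl hR.le
      rw [Complex.ofReal_one, one_mul] at e
      have h2 : annulusToSlit R Complex.I ^ 2 = -(focalValue (R ^ 2) : ℂ) := by
        have h3 : (Complex.I - 1 / Complex.I) ^ 2 + 2 = -2 := by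
          rw [one_div, Complex.inv_I, sub_neg_eq_add, ← two_mul, mul_pow, Complex.I_sq]; norm_num
        rw [annulusToSlit, rootCover_sq, coverOne, h3, ellipseToDisc_neg_two hR2]
      rw [e, mul_pow, Complex.I_sq, mul_neg, mul_one, neg_inj] at h2
      have h4 : ((1 + 1 / 1) * r) ^ 2 = focalValue (R ^ 2) := by exact_mod_cast h2
      rw [e, ← h4, Real.sqrt_sq (by positivity)]
    rwa [e] at this
  · rw [slitToAnnulus_neg hR (star_mem_slitDisc hz), slitToAnnulus_conj hR hz]

lemma coverOne_slitToAnnulus (hR : 1 < R) {z : ℂ} (hz : z ∈ slitDisc (focalValue (R ^ 2))) :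
    coverOne R (slitToAnnulus R z - 1 / slitToAnnulus R z) = z ^ 2 := by
  rw [← rootCover_sq]
  exact congrArg (· ^ 2) (annulusToSlit_slitToAnnulus hR hz).2

lemma coverTwo_slitToAnnulus (hR : 1 < R) {z : ℂ} (hz : z ∈ slitDisc (focalValue (R ^ 2))) :
    coverTwo R (slitToAnnulus R z + 1 / slitToAnnulus R z) = z ^ 2 := by
  rw [coverTwo_joukowski (ne_zero_of_one_lt_norm (annulusToSlit_slitToAnnulus hR hz).1.1),
    coverOne_slitToAnnulus hR hz]

end slit


/-! ### Two-sheeted coverings by ellipses -/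

/-- Continuity descends along a continuous surjection from a compact set. -/
lemma IsCompact.continuousOn_of_comp {X Y Z : Type*} [TopologicalSpace X] [TopologicalSpace Y]
    [T2Space Y] [TopologicalSpace Z] {K : Set X} {p : X → Y} {f : Y → Z} (hK : IsCompact K)
    (hp : ContinuousOn p K) (hf : ContinuousOn (f ∘ p) K) : ContinuousOn f (p '' K) := by
  rw [continuousOn_iff_isClosed]
  intro t ht
  obtain ⟨u, hu, e⟩ := continuousOn_iff_isClosed.1 hf t ht
  refine ⟨p '' (u ∩ K), ((hK.inter_left hu).image_of_continuousOn
    (hp.mono inter_subset_right)).isClosed, ?_⟩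
  rw [← e]
  ext z
  constructor
  · rintro ⟨h1, w, hw, rfl⟩
    exact ⟨⟨w, ⟨h1, hw⟩, rfl⟩, w, hw, rfl⟩
  · rintro ⟨⟨w, ⟨h1, hw⟩, rfl⟩, h2⟩
    exact ⟨h1, h2⟩

namespace IsEllipseCover

variable {a b : ℝ} {v : ℂ} {p : ℂ → ℂ}

lemma mem_unitDisc_iff (h : IsEllipseCover a b v p) {w : ℂ} (hw : w ∈ closedEllipse a b) :
    p w ∈ unitDisc ↔ w ∈ ellipse a b := by
  constructor
  · intro hd
    rw [← h.image] at hd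
    obtain ⟨w', hw', e⟩ := hd
    rcases (h.fiber w' (ellipse_subset_closedEllipse _ _ hw') w hw).1 e with rfl | rfl
    · exact hw'
    · rw [mem_ellipse, ellipseGauge_neg]; exact hw'
  · exact fun hw => h.image ▸ mem_image_of_mem _ hw

lemma map_neg (h : IsEllipseCover a b v p) {w : ℂ} (hw : w ∈ closedEllipse a b) :
    p (-w) = p w :=
  ((h.fiber w hw (-w) (by rw [mem_closedEllipse, ellipseGauge_neg]; exact hw)).2
    (Or.inr rfl)).symm

lemma eq_branch_iff (h : IsEllipseCover a b v p) {w : ℂ} (hw : w ∈ closedEllipse a b) :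
    p w = v ↔ w = 0 := by
  rw [← h.branch, h.fiber w hw 0 (ellipse_subset_closedEllipse _ _ (zero_mem_ellipse _ _))]
  constructor
  · rintro (h1 | h1)
    · exact h1.symm
    · exact neg_eq_zero.1 h1.symm
  · rintro rfl; simp

/-- Away from the centre the covering is locally a biholomorphic map. -/
lemma exists_injOn_nhds (h : IsEllipseCover a b v p) {w : ℂ} (hw : w ∈ ellipse a b) (hw0 : w ≠ 0) :
    ∃ U : Set ℂ, IsOpen U ∧ w ∈ U ∧ U ⊆ ellipse a b ∧ (0 : ℂ) ∉ U ∧ InjOn p U := by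
  refine ⟨ellipse a b ∩ Metric.ball w ‖w‖, (isOpen_ellipse _ _).inter Metric.isOpen_ball,
    ⟨hw, Metric.mem_ball_self (norm_pos_iff.2 hw0)⟩, inter_subset_left, fun h0 => ?_, ?_⟩
  · have := h0.2
    simp at this
  · intro z hz y hy e
    have hz' := ellipse_subset_closedEllipse _ _ hz.1
    have hy' := ellipse_subset_closedEllipse _ _ hy.1
    rcases (h.fiber z hz' y hy').1 e with h1 | h1
    · exact h1.symm
    · exfalso
      have h2 := hz.2
      have h3 := hy.2
      rw [Metric.mem_ball, dist_eq_norm] at h2 h3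
      have h4 : ‖(z - w) + (y - w)‖ < ‖w‖ + ‖w‖ := (norm_add_le _ _).trans_lt (add_lt_add h2 h3)
      rw [h1, show z - w + (-z - w) = -(w + w) by ring, norm_neg, ← two_mul, norm_mul] at h4
      simp at h4
      linarith

lemma deriv_ne_zero (h : IsEllipseCover a b v p) {w : ℂ} (hw : w ∈ ellipse a b) (hw0 : w ≠ 0) :
    deriv p w ≠ 0 := by
  obtain ⟨U, hU, hwU, hUE, h0, hi⟩ := h.exists_injOn_nhds hw hw0
  exact (h.holo.mono hUE).deriv_ne_zero_of_injOn hU hi hwU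

lemma differentiableAt (h : IsEllipseCover a b v p) {w : ℂ} (hw : w ∈ ellipse a b) :
    DifferentiableAt ℂ p w := h.holo.differentiableAt ((isOpen_ellipse _ _).mem_nhds hw)

lemma analyticAt (h : IsEllipseCover a b v p) {w : ℂ} (hw : w ∈ ellipse a b) : AnalyticAt ℂ p w :=
  h.holo.analyticAt ((isOpen_ellipse _ _).mem_nhds hw)

lemma exists_preimage (h : IsEllipseCover a b v p) {z : ℂ} (hz : z ∈ unitDisc) :
    ∃ w ∈ ellipse a b, p w = z := by
  rw [← h.image] at hz; exact hz

lemma exists_preimage_closed (h : IsEllipseCover a b v p) {z : ℂ} (hz : z ∈ closedUnitDisc) :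
    ∃ w ∈ closedEllipse a b, p w = z := by
  rw [← h.image_closed] at hz; exact hz

end IsEllipseCover

/-! ### The affine map and the extremal map -/

section affine
variable {R : ℝ}

/-- The ratio of the semi-axes of the two ellipses. -/
noncomputable def axisRatio (R : ℝ) : ℝ := (R + 1 / R) / (R - 1 / R)

lemma one_lt_axisRatio (hR : 1 < R) : 1 < axisRatio R := by
  rw [axisRatio, one_lt_div (sub_inv_pos hR)]
  have : 0 < 1 / R := by positivity
  linarith

lemma axisRatio_eq (hR : 1 < R) : axisRatio R = (R ^ 2 + 1) / (R ^ 2 - 1) := by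
  have h0 : R ≠ 0 := by linarith
  have h1 : R ^ 2 - 1 ≠ 0 := by nlinarith
  rw [axisRatio]
  field_simp

lemma ellipseAffine_re (z : ℂ) : (ellipseAffine R z).re = axisRatio R * z.re := rfl

lemma ellipseAffine_im (z : ℂ) : (ellipseAffine R z).im = (axisRatio R)⁻¹ * z.im := by
  rw [axisRatio, inv_div]; rfl

lemma ellipseAffine_eq (z : ℂ) : ellipseAffine R z =
    (((axisRatio R + (axisRatio R)⁻¹) / 2 : ℝ) : ℂ) * z +
      (((axisRatio R - (axisRatio R)⁻¹) / 2 : ℝ) : ℂ) * star z := by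
  apply Complex.ext
  · rw [ellipseAffine_re]; simp only [Complex.add_re, Complex.re_ofReal_mul, Complex.star_def,
      Complex.conj_re]; ring
  · rw [ellipseAffine_im]; simp only [Complex.add_im, Complex.im_ofReal_mul, Complex.star_def,
      Complex.conj_im]; ring

lemma ellipseAffine_neg (z : ℂ) : ellipseAffine R (-z) = -ellipseAffine R z := by
  rw [ellipseAffine_eq, ellipseAffine_eq, star_neg]; ring

lemma ellipseAffine_zero : ellipseAffine R 0 = 0 := by simp [ellipseAffine_eq]

lemma contDiff_ellipseAffine {n : WithTop ℕ∞} : ContDiff ℝ n (ellipseAffine R) := by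
  have : ellipseAffine R = fun z => (((axisRatio R + (axisRatio R)⁻¹) / 2 : ℝ) : ℂ) * z +
      (((axisRatio R - (axisRatio R)⁻¹) / 2 : ℝ) : ℂ) * Complex.conjCLE z :=
    funext fun z => ellipseAffine_eq z
  rw [this]
  exact (contDiff_const.mul contDiff_id).add
    (contDiff_const.mul Complex.conjCLE.contDiff)

lemma injective_ellipseAffine (hR : 1 < R) : Function.Injective (ellipseAffine R) := by
  have h := one_lt_axisRatio hR
  intro z w e
  have h1 := congrArg Complex.re e
  have h2 := congrArg Complex.im e
  rw [ellipseAffine_re, ellipseAffine_re] at h1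
  rw [ellipseAffine_im, ellipseAffine_im] at h2
  exact Complex.ext (mul_left_cancel₀ (by linarith) h1)
    (mul_left_cancel₀ (inv_ne_zero (by linarith)) h2)

lemma ellipseGauge_ellipseAffine (hR : 1 < R) (z : ℂ) :
    ellipseGauge (R + 1 / R) (R - 1 / R) (ellipseAffine R z) =
      ellipseGauge (R - 1 / R) (R + 1 / R) z := by
  have h1 := (sub_inv_pos hR).ne'
  have h2 := (add_inv_pos hR).ne'
  rw [ellipseGauge, ellipseGauge, ellipseAffine_re, ellipseAffine_im, axisRatio, inv_div]
  have e1 : (R + 1 / R) / (R - 1 / R) * z.re / (R + 1 / R) = z.re / (R - 1 / R) := by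
    rw [div_mul_eq_mul_div, div_right_comm, mul_div_cancel_left₀ _ h2]
  have e2 : (R - 1 / R) / (R + 1 / R) * z.im / (R - 1 / R) = z.im / (R + 1 / R) := by
    rw [div_mul_eq_mul_div, div_right_comm, mul_div_cancel_left₀ _ h1]
  rw [e1, e2]

lemma surjective_ellipseAffine (hR : 1 < R) : Function.Surjective (ellipseAffine R) := by
  have h := one_lt_axisRatio hR
  have h0 : axisRatio R ≠ 0 := by linarith
  intro w
  refine ⟨⟨(axisRatio R)⁻¹ * w.re, axisRatio R * w.im⟩, Complex.ext ?_ ?_⟩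
  · rw [ellipseAffine_re, mul_inv_cancel_left₀ h0]
  · rw [ellipseAffine_im, inv_mul_cancel_left₀ h0]

lemma ellipseAffine_mem_ellipse (hR : 1 < R) {z : ℂ} :
    ellipseAffine R z ∈ ellipse (R + 1 / R) (R - 1 / R) ↔ z ∈ ellipse (R - 1 / R) (R + 1 / R) := by
  rw [mem_ellipse, mem_ellipse, ellipseGauge_ellipseAffine hR]

lemma ellipseAffine_mem_closedEllipse (hR : 1 < R) {z : ℂ} :
    ellipseAffine R z ∈ closedEllipse (R + 1 / R) (R - 1 / R) ↔
      z ∈ closedEllipse (R - 1 / R) (R + 1 / R) := by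
  rw [mem_closedEllipse, mem_closedEllipse, ellipseGauge_ellipseAffine hR]

/-- On the circle `|w| = R` the affine map takes `w - 1/w` to `w + 1/w`. -/
lemma ellipseAffine_sub_inv (hR : 1 < R) {w : ℂ} (hw : ‖w‖ = R) :
    ellipseAffine R (w - 1 / w) = w + 1 / w := by
  have hR0 : R ≠ 0 := by linarith
  have hinv : 1 / w = ((1 / R ^ 2 : ℝ) : ℂ) * star w := by
    rw [one_div, Complex.inv_def, Complex.normSq_eq_norm_sq, hw, mul_comm]; simp
  have h1 : R ^ 2 - 1 ≠ 0 := by nlinarith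
  have h2 : R ^ 2 + 1 ≠ 0 := by positivity
  rw [hinv]
  apply Complex.ext
  · rw [ellipseAffine_re, axisRatio_eq hR]
    simp only [Complex.sub_re, Complex.add_re, Complex.re_ofReal_mul, Complex.star_def,
      Complex.conj_re]
    field_simp
  · rw [ellipseAffine_im, axisRatio_eq hR]
    simp only [Complex.sub_im, Complex.add_im, Complex.im_ofReal_mul, Complex.star_def,
      Complex.conj_im]
    field_simp
    ring

lemma exists_boundary_param (hR : 1 < R) {ζ : ℂ}
    (hζ : ζ ∈ closedEllipse (R - 1 / R) (R + 1 / R) \ ellipse (R - 1 / R) (R + 1 / R)) :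
    ∃ w : ℂ, ‖w‖ = R ∧ w - 1 / w = ζ := by
  obtain ⟨w, hw, rfl⟩ := exists_sub_inv_eq ζ
  refine ⟨w, le_antisymm ((sub_inv_mem_closedEllipse hR hw).1 hζ.1) ?_, rfl⟩
  exact not_lt.1 ((sub_inv_mem_ellipse hR hw).not.1 hζ.2)

/-- On the boundary the affine map intertwines the two coverings. -/
lemma coverTwo_ellipseAffine_of_boundary (hR : 1 < R) {ζ : ℂ}
    (hζ : ζ ∈ closedEllipse (R - 1 / R) (R + 1 / R) \ ellipse (R - 1 / R) (R + 1 / R)) :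
    coverTwo R (ellipseAffine R ζ) = coverOne R ζ := by
  obtain ⟨w, hw, rfl⟩ := exists_boundary_param hR hζ
  rw [ellipseAffine_sub_inv hR hw, coverTwo_joukowski (ne_zero_of_one_lt_norm (by rwa [hw]))]

/-- The map of the disc covered by the affine map of the ellipses. -/
noncomputable def affineShift (R : ℝ) (z : ℂ) : ℂ :=
  coverTwo R (ellipseAffine R
    (Function.invFunOn (coverOne R) (closedEllipse (R - 1 / R) (R + 1 / R)) z))

lemma affineShift_coverOne (hR : 1 < R) {w : ℂ} (hw : w ∈ closedEllipse (R - 1 / R) (R + 1 / R)) :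
    affineShift R (coverOne R w) = coverTwo R (ellipseAffine R w) := by
  have hc := isEllipseCover_coverOne hR
  have hex : ∃ w' ∈ closedEllipse (R - 1 / R) (R + 1 / R), coverOne R w' = coverOne R w :=
    ⟨w, hw, rfl⟩
  have h1 := Function.invFunOn_mem hex
  have h2 := Function.invFunOn_eq hex
  rw [affineShift]
  rcases (hc.fiber w hw _ h1).1 h2.symm with h3 | h3
  · rw [h3]
  · rw [h3, ellipseAffine_neg, (isEllipseCover_coverTwo hR).map_neg
      ((ellipseAffine_mem_closedEllipse hR).2 hw)]

lemma continuousOn_affineShift (hR : 1 < R) : ContinuousOn (affineShift R) closedUnitDisc := by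
  have hc := isEllipseCover_coverOne hR
  rw [← hc.image_closed]
  refine (isCompact_closedEllipse (sub_inv_pos hR) (add_inv_pos hR)).continuousOn_of_comp hc.cont ?_
  have h : ContinuousOn (fun w => coverTwo R (ellipseAffine R w))
      (closedEllipse (R - 1 / R) (R + 1 / R)) :=
    (isEllipseCover_coverTwo hR).cont.comp (contDiff_ellipseAffine (n := 0)).continuous.continuousOn
      fun w hw => (ellipseAffine_mem_closedEllipse hR).2 hw
  exact h.congr fun w hw => affineShift_coverOne hR hw

lemma bijOn_affineShift (hR : 1 < R) : BijOn (affineShift R) unitDisc unitDisc := by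
  have hc := isEllipseCover_coverOne hR
  have hc2 := isEllipseCover_coverTwo hR
  have hsub := ellipse_subset_closedEllipse (R - 1 / R) (R + 1 / R)
  refine ⟨fun z hz => ?_, fun z hz z' hz' e => ?_, fun z hz => ?_⟩
  · obtain ⟨w, hw, rfl⟩ := hc.exists_preimage hz
    rw [affineShift_coverOne hR (hsub hw)]
    exact hc2.image ▸ mem_image_of_mem _ ((ellipseAffine_mem_ellipse hR).2 hw)
  · obtain ⟨w, hw, rfl⟩ := hc.exists_preimage hz
    obtain ⟨w', hw', rfl⟩ := hc.exists_preimage hz'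
    rw [affineShift_coverOne hR (hsub hw), affineShift_coverOne hR (hsub hw')] at e
    rw [hc.fiber w (hsub hw) w' (hsub hw')]
    rcases (hc2.fiber _ ((ellipseAffine_mem_closedEllipse hR).2 (hsub hw)) _
      ((ellipseAffine_mem_closedEllipse hR).2 (hsub hw'))).1 e with h | h
    · exact Or.inl (injective_ellipseAffine hR h)
    · rw [← ellipseAffine_neg] at h
      exact Or.inr (injective_ellipseAffine hR h)
  · obtain ⟨ω, hω, rfl⟩ := hc2.exists_preimage hz
    obtain ⟨w, rfl⟩ := surjective_ellipseAffine hR ω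
    have hw := (ellipseAffine_mem_ellipse hR).1 hω
    exact ⟨coverOne R w, hc.image ▸ mem_image_of_mem _ hw, affineShift_coverOne hR (hsub hw)⟩

lemma affineShift_of_norm_eq_one (hR : 1 < R) {z : ℂ} (hz : ‖z‖ = 1) : affineShift R z = z := by
  have hc := isEllipseCover_coverOne hR
  obtain ⟨w, hw, rfl⟩ := hc.exists_preimage_closed (show z ∈ closedUnitDisc by
    simp [closedUnitDisc, hz])
  rw [affineShift_coverOne hR hw]
  refine coverTwo_ellipseAffine_of_boundary hR ⟨hw, fun h => ?_⟩
  have := (hc.mem_unitDisc_iff hw).2 h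
  simp [unitDisc, hz] at this

lemma affineShift_zero (hR : 1 < R) : affineShift R 0 = -(focalValue (R ^ 2) : ℂ) := by
  have hc := isEllipseCover_coverOne hR
  have h := affineShift_coverOne hR (ellipse_subset_closedEllipse _ _ (zero_mem_ellipse _ _))
  rw [hc.branch, ellipseAffine_zero, (isEllipseCover_coverTwo hR).branch] at h
  exact h

/-- A continuous injective map of the closed disc is an embedding of the disc. -/
lemma isEmbedding_of_injOn_closedUnitDisc {f : ℂ → ℂ} (hf : ContinuousOn f closedUnitDisc)
    (hi : InjOn f closedUnitDisc) : IsEmbedding (fun z : unitDisc => f z) := by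
  have : CompactSpace closedUnitDisc := isCompact_iff_compactSpace.1 (isCompact_closedBall _ _)
  have h1 : IsEmbedding (closedUnitDisc.domRestrict f) :=
    ((continuousOn_iff_continuous_domRestrict.1 hf).isClosedEmbedding
      (injOn_iff_injective.1 hi)).isEmbedding
  have hsub : unitDisc ⊆ closedUnitDisc := Metric.ball_subset_closedBall
  exact h1.comp (IsEmbedding.inclusion hsub)

/-- Off the origin, the extremal map is the composition of a holomorphic branch of the inverse of
the first covering, of the affine map, and of the second covering. -/
lemma affineShift_eventuallyEq (hR : 1 < R) {z : ℂ} (hz : z ∈ unitDisc) (hz0 : z ≠ 0) :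
    ∃ w ∈ ellipse (R - 1 / R) (R + 1 / R), ∃ q : ℂ → ℂ, w ≠ 0 ∧ coverOne R w = z ∧ q z = w ∧
      AnalyticAt ℂ q z ∧ deriv q z ≠ 0 ∧
      affineShift R =ᶠ[𝓝 z] fun y => coverTwo R (ellipseAffine R (q y)) := by
  have hc := isEllipseCover_coverOne hR
  obtain ⟨w, hw, rfl⟩ := hc.exists_preimage hz
  have hw0 : w ≠ 0 := by
    rintro rfl
    exact hz0 hc.branch
  obtain ⟨U, hU, hwU, hUE, h0, hi⟩ := hc.exists_injOn_nhds hw hw0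
  set q := Function.invFunOn (coverOne R) U
  have hq : LeftInvOn q (coverOne R) U := hi.leftInvOn_invFunOn
  have hh := hc.holo.mono hUE
  have hopen := hh.isOpen_image_of_injOn hU hi
  have hmem := hopen.mem_nhds (mem_image_of_mem (coverOne R) hwU)
  refine ⟨w, hw, q, hw0, rfl, hq hwU,
    (hh.differentiableOn_of_leftInvOn hU hq).analyticAt hmem, ?_, ?_⟩
  · rw [(hh.hasDerivAt_of_leftInvOn hU hq hwU).deriv]
    exact inv_ne_zero (hc.deriv_ne_zero hw hw0)
  · filter_upwards [hmem]
    rintro _ ⟨y, hy, rfl⟩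
    rw [hq hy, affineShift_coverOne hR (ellipse_subset_closedEllipse _ _ (hUE hy))]

lemma contDiffAt_affineShift (hR : 1 < R) {z : ℂ} (hz : z ∈ unitDisc) (hz0 : z ≠ 0) :
    ContDiffAt ℝ 1 (affineShift R) z := by
  obtain ⟨w, hw, q, hw0, rfl, hq, hqa, -, he⟩ := affineShift_eventuallyEq hR hz hz0
  refine ContDiffAt.congr_of_eventuallyEq ?_ he
  have h1 : ContDiffAt ℝ 1 q (coverOne R w) := hqa.contDiffAt.restrict_scalars ℝ
  have h2 : ContDiffAt ℝ 1 (ellipseAffine R) (q (coverOne R w)) :=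
    contDiff_ellipseAffine.contDiffAt
  have h3 : ContDiffAt ℝ 1 (coverTwo R) (ellipseAffine R (q (coverOne R w))) := by
    rw [hq]
    exact ((isEllipseCover_coverTwo hR).analyticAt
      ((ellipseAffine_mem_ellipse hR).2 hw)).contDiffAt.restrict_scalars ℝ
  exact ContDiffAt.comp (g := coverTwo R) _ h3 (ContDiffAt.comp _ h2 h1)

/-- A map which is continuously differentiable off the origin is absolutely continuous on lines:
only the coordinate axes may meet the exceptional point. -/
lemma isACL_of_contDiffAt {f : ℂ → ℂ} {Ω : Set ℂ}
    (hf : ∀ z ∈ Ω, z ≠ 0 → ContDiffAt ℝ 1 f z) : IsACL f Ω := by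
  have h0 : ∀ᵐ y : ℝ, y ≠ 0 := by simp [ae_iff]
  intro a b c d hab hcd hsub
  constructor
  · filter_upwards [h0] with y hy hyI
    refine ContDiffOn.absolutelyContinuousOnInterval fun t ht => ?_
    rw [uIcc_of_le hab.le] at ht
    have h1 : ContDiffAt ℝ 1 f ⟨t, y⟩ := hf _ (hsub ⟨ht, hyI⟩) (fun h => hy (congrArg Complex.im h))
    have h2 : ContDiffAt ℝ 1 (fun t : ℝ => (⟨t, y⟩ : ℂ)) t := by
      have : (fun t : ℝ => (⟨t, y⟩ : ℂ)) = fun t : ℝ => (t : ℂ) + y * Complex.I :=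
        funext fun t => Complex.mk_eq_add_mul_I t y
      rw [this]
      exact (Complex.ofRealCLM.contDiff.add contDiff_const).contDiffAt
    exact (ContDiffAt.comp t h1 h2).contDiffWithinAt
  · filter_upwards [h0] with y hy hyI
    refine ContDiffOn.absolutelyContinuousOnInterval fun t ht => ?_
    rw [uIcc_of_le hcd.le] at ht
    have h1 : ContDiffAt ℝ 1 f ⟨y, t⟩ := hf _ (hsub ⟨hyI, ht⟩) (fun h => hy (congrArg Complex.re h))
    have h2 : ContDiffAt ℝ 1 (fun t : ℝ => (⟨y, t⟩ : ℂ)) t := by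
      have : (fun t : ℝ => (⟨y, t⟩ : ℂ)) = fun t : ℝ => (y : ℂ) + t * Complex.I :=
        funext fun t => Complex.mk_eq_add_mul_I y t
      rw [this]
      exact (contDiff_const.add (Complex.ofRealCLM.contDiff.mul contDiff_const)).contDiffAt
    exact (ContDiffAt.comp t h1 h2).contDiffWithinAt

/-- Composition with holomorphic maps multiplies both Wirtinger derivatives by factors of equal
modulus, so that the extremal map has the constant dilatation of the affine map. -/
lemma norm_wirtinger_affineShift (hR : 1 < R) {z : ℂ} (hz : z ∈ unitDisc) (hz0 : z ≠ 0) :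
    ∃ c : ℝ, 0 < c ∧ ‖wirtingerZ (affineShift R) z‖ = c * ((axisRatio R + (axisRatio R)⁻¹) / 2) ∧
      ‖wirtingerZbar (affineShift R) z‖ = c * ((axisRatio R - (axisRatio R)⁻¹) / 2) := by
  obtain ⟨w, hw, q, hw0, rfl, hq, hqa, hqd, he⟩ := affineShift_eventuallyEq hR hz hz0
  set z := coverOne R w
  set α := (axisRatio R + (axisRatio R)⁻¹) / 2 with hα
  set β := (axisRatio R - (axisRatio R)⁻¹) / 2 with hβ
  have ha := one_lt_axisRatio hR
  have hai : (axisRatio R)⁻¹ < 1 := inv_lt_one_of_one_lt₀ ha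
  have hai0 : 0 < (axisRatio R)⁻¹ := by positivity
  have hα0 : 0 < α := by rw [hα]; linarith
  have hβ0 : 0 < β := by rw [hβ]; linarith
  have hω := (ellipseAffine_mem_ellipse hR).2 hw
  have hc2 := isEllipseCover_coverTwo hR
  have hω0 : ellipseAffine R w ≠ 0 := fun h =>
    hw0 (injective_ellipseAffine hR (h.trans ellipseAffine_zero.symm))
  set P := deriv (coverTwo R) (ellipseAffine R w)
  set Q := deriv q z
  have hP0 : P ≠ 0 := hc2.deriv_ne_zero hω hω0
  -- the derivative along a curve with velocity `ξ`
  have hcurve : ∀ (γ : ℝ → ℂ) (ξ : ℂ), γ 0 = z → HasDerivAt γ ξ 0 →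
      HasDerivAt (fun t => affineShift R (γ t)) (P * (α * (Q * ξ) + β * star (Q * ξ))) 0 := by
    intro γ ξ hγ0 hγ
    have h1 : HasDerivAt (fun t => q (γ t)) (Q * ξ) 0 := by
      have : HasDerivAt q Q (γ 0) := by rw [hγ0]; exact hqa.differentiableAt.hasDerivAt
      exact this.comp (0 : ℝ) hγ
    have h2 : HasDerivAt (fun t => star (q (γ t))) (star (Q * ξ)) 0 := h1.star
    have h3 : HasDerivAt (fun t => ellipseAffine R (q (γ t))) (α * (Q * ξ) + β * star (Q * ξ)) 0 :=
      ((h1.const_mul (α : ℂ)).add (h2.const_mul (β : ℂ))).congr_of_eventuallyEq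
        (.of_forall fun t => ellipseAffine_eq _)
    have h4 : HasDerivAt (coverTwo R) P (ellipseAffine R (q (γ 0))) := by
      rw [hγ0, hq]; exact (hc2.differentiableAt hω).hasDerivAt
    refine (h4.comp (0 : ℝ) h3).congr_of_eventuallyEq ?_
    have : Tendsto γ (𝓝 0) (𝓝 z) := hγ0 ▸ hγ.continuousAt.tendsto
    exact this.eventually he
  have hX : partialX (affineShift R) z = P * (α * Q + β * star Q) := by
    have h1 : HasDerivAt (fun t : ℝ => z + (t : ℂ)) 1 0 :=
      (HasDerivAt.ofReal_comp (hasDerivAt_id (0 : ℝ))).const_add z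
    have := (hcurve _ 1 (by simp) h1).deriv
    simpa [partialX] using this
  have hY : partialY (affineShift R) z = P * (α * (Q * Complex.I) - β * (star Q * Complex.I)) := by
    have h1 : HasDerivAt (fun t : ℝ => z + (t : ℂ) * Complex.I) (1 * Complex.I) 0 :=
      ((HasDerivAt.ofReal_comp (hasDerivAt_id (0 : ℝ))).mul_const Complex.I).const_add z
    have := (hcurve _ (1 * Complex.I) (by simp) h1).deriv
    rw [partialY, this, one_mul, star_mul', Complex.star_def, Complex.conj_I]
    ring
  have hZ : wirtingerZ (affineShift R) z = P * Q * α := by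
    rw [wirtingerZ, hX, hY]
    linear_combination (-(P * (α * Q - β * star Q)) / 2) * Complex.I_sq
  have hZb : wirtingerZbar (affineShift R) z = P * star Q * β := by
    rw [wirtingerZbar, hX, hY]
    linear_combination ((P * (α * Q - β * star Q)) / 2) * Complex.I_sq
  refine ⟨‖P‖ * ‖Q‖, by positivity, ?_, ?_⟩
  · rw [hZ, norm_mul, norm_mul, Complex.norm_real, Real.norm_of_nonneg hα0.le]
  · rw [hZb, norm_mul, norm_mul, norm_star, Complex.norm_real, Real.norm_of_nonneg hβ0.le]

lemma ae_mem_unitDisc_ne_zero : ∀ᵐ z : ℂ ∂(volume.restrict unitDisc), z ∈ unitDisc ∧ z ≠ 0 := by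
  have h0 : ∀ᵐ z : ℂ ∂(volume.restrict unitDisc), z ≠ 0 :=
    ae_restrict_of_ae (by simp [ae_iff])
  filter_upwards [h0, ae_restrict_mem Metric.isOpen_ball.measurableSet] with z h1 h2
  exact ⟨h2, h1⟩

lemma volume_restrict_unitDisc_ne_zero : (volume.restrict unitDisc : Measure ℂ) ≠ 0 := by
  rw [Ne, Measure.restrict_eq_zero]
  exact (Metric.measure_ball_pos _ _ one_pos).ne'

lemma qcDilatation_affineShift (hR : 1 < R) :
    qcDilatation (affineShift R) unitDisc = axisRatio R ^ 2 := by
  have ha := one_lt_axisRatio hR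
  rw [qcDilatation, essSup_congr_ae (g := fun _ => axisRatio R ^ 2) ?_,
    essSup_const _ volume_restrict_unitDisc_ne_zero]
  filter_upwards [ae_mem_unitDisc_ne_zero] with z hz
  obtain ⟨c, hc, h1, h2⟩ := norm_wirtinger_affineShift hR hz.1 hz.2
  rw [h1, h2]
  have : axisRatio R ≠ 0 := by linarith
  field_simp
  ring_nf

/-- The extremal map is a competitor. -/
theorem isDiscShift_affineShift (hR : 1 < R) :
    IsDiscShift (focalValue (R ^ 2)) (affineShift R) := by
  have ha := one_lt_axisRatio hR
  have hb := bijOn_affineShift hR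
  have hi : InjOn (affineShift R) closedUnitDisc := by
    intro z hz y hy e
    have key : ∀ {z : ℂ}, z ∈ closedUnitDisc → z ∈ unitDisc ∨ ‖z‖ = 1 := fun {z} hz => by
      have : ‖z‖ ≤ 1 := by simpa [closedUnitDisc] using hz
      rcases this.lt_or_eq with h | h
      · left; simpa [unitDisc] using h
      · exact Or.inr h
    have key2 : ∀ {z y : ℂ}, z ∈ unitDisc → ‖y‖ = 1 → affineShift R z ≠ affineShift R y := by
      intro z y hz hy e
      have := hb.mapsTo hz
      rw [e, affineShift_of_norm_eq_one hR hy] at this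
      simp [unitDisc, hy] at this
    rcases key hz with h1 | h1 <;> rcases key hy with h2 | h2
    · exact hb.injOn h1 h2 e
    · exact absurd e (key2 h1 h2)
    · exact absurd e.symm (key2 h2 h1)
    · rwa [affineShift_of_norm_eq_one hR h1, affineShift_of_norm_eq_one hR h2] at e
  refine ⟨⟨axisRatio R ^ 2, one_le_pow₀ ha.le, Metric.isOpen_ball,
    isEmbedding_of_injOn_closedUnitDisc (continuousOn_affineShift hR) hi,
    isACL_of_contDiffAt fun z hz hz0 => contDiffAt_affineShift hR hz hz0, ?_⟩, hb.image_eq,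
    continuousOn_affineShift hR, fun z hz => affineShift_of_norm_eq_one hR hz,
    affineShift_zero hR⟩
  filter_upwards [ae_mem_unitDisc_ne_zero] with z hz
  obtain ⟨c, hc, h1, h2⟩ := norm_wirtinger_affineShift hR hz.1 hz.2
  rw [h1, h2]
  have : axisRatio R ≠ 0 := by linarith
  refine le_of_eq ?_
  field_simp

end affine


/-! ### Partial derivatives of maps that are absolutely continuous on lines -/

lemma ae_complex_of_ae_vertical {P : ℂ → Prop} (hP : MeasurableSet {z | P z})
    (h : ∀ᵐ x : ℝ, ∀ᵐ y : ℝ, P ⟨x, y⟩) : ∀ᵐ z : ℂ, P z := by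
  have e := Complex.volume_preserving_equiv_real_prod.symm
  have h1 : ∀ᵐ w : ℝ × ℝ, P (Complex.measurableEquivRealProd.symm w) :=
    (Measure.ae_prod_iff_ae_ae (hP.preimage Complex.measurableEquivRealProd.symm.measurable)).2 h
  have h2 := Complex.volume_preserving_equiv_real_prod.quasiMeasurePreserving.ae h1
  simpa using h2

lemma ae_complex_of_ae_horizontal {P : ℂ → Prop} (hP : MeasurableSet {z | P z})
    (h : ∀ᵐ y : ℝ, ∀ᵐ x : ℝ, P ⟨x, y⟩) : ∀ᵐ z : ℂ, P z := by
  have hm := hP.preimage Complex.measurableEquivRealProd.symm.measurable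
  have h1 : ∀ᵐ w : ℝ × ℝ, P (Complex.measurableEquivRealProd.symm w) :=
    (Measure.ae_prod_iff_ae_ae hm).2
      ((Measure.ae_ae_comm (p := fun x y : ℝ => P ⟨x, y⟩) hm).2 h)
  have h2 := Complex.volume_preserving_equiv_real_prod.quasiMeasurePreserving.ae h1
  simpa using h2

/-- Every point of an open set has a closed rectangle around it inside the set. -/
lemma exists_reProdIm_nhds {Ω : Set ℂ} (hΩ : IsOpen Ω) {z : ℂ} (hz : z ∈ Ω) :
    ∃ a b c d : ℝ, a < b ∧ c < d ∧ Icc a b ×ℂ Icc c d ⊆ Ω ∧ Ioo a b ×ℂ Ioo c d ∈ 𝓝 z := by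
  obtain ⟨ε, hε, hsub⟩ := Metric.isOpen_iff.1 hΩ z hz
  have hε2 : 0 < ε / 4 := by positivity
  refine ⟨z.re - ε / 4, z.re + ε / 4, z.im - ε / 4, z.im + ε / 4, by linarith, by linarith, ?_, ?_⟩
  · rintro w ⟨⟨h1, h2⟩, h3, h4⟩
    apply hsub
    rw [Metric.mem_ball, dist_eq_norm]
    refine (Complex.norm_le_abs_re_add_abs_im _).trans_lt ?_
    have h5 : |(w - z).re| ≤ ε / 4 := abs_le.2 ⟨by simp; linarith, by simp; linarith⟩
    have h6 : |(w - z).im| ≤ ε / 4 := abs_le.2 ⟨by simp; linarith, by simp; linarith⟩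
    linarith
  · refine (IsOpen.reProdIm isOpen_Ioo isOpen_Ioo).mem_nhds ⟨⟨?_, ?_⟩, ?_, ?_⟩ <;> linarith

/-- The points at which the horizontal partial derivative exists. -/
def diffX (f : ℂ → ℂ) : Set ℂ := {z | DifferentiableAt ℝ (fun t : ℝ => f (z + t)) 0}

/-- The points at which the vertical partial derivative exists. -/
def diffY (f : ℂ → ℂ) : Set ℂ := {z | DifferentiableAt ℝ (fun t : ℝ => f (z + t * Complex.I)) 0}

section measurability
variable {f : ℂ → ℂ}

lemma measurableSet_diffX (hf : Continuous f) : MeasurableSet (diffX f) := by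
  have h := measurableSet_of_differentiableAt_with_param ℝ (f := fun (z : ℂ) (t : ℝ) => f (z + t))
    (by simp only [Function.uncurry_def]; fun_prop)
  exact h.preimage (measurable_id.prodMk (measurable_const (a := (0 : ℝ))))

lemma measurableSet_diffY (hf : Continuous f) : MeasurableSet (diffY f) := by
  have h := measurableSet_of_differentiableAt_with_param ℝ
    (f := fun (z : ℂ) (t : ℝ) => f (z + t * Complex.I))
    (by simp only [Function.uncurry_def]; fun_prop)
  exact h.preimage (measurable_id.prodMk (measurable_const (a := (0 : ℝ))))

lemma measurable_partialX (hf : Continuous f) : Measurable (partialX f) := by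
  have h := measurable_deriv_with_param (f := fun (z : ℂ) (t : ℝ) => f (z + t))
    (by simp only [Function.uncurry_def]; fun_prop)
  exact h.comp (measurable_id.prodMk (measurable_const (a := (0 : ℝ))))

lemma measurable_partialY (hf : Continuous f) : Measurable (partialY f) := by
  have h := measurable_deriv_with_param (f := fun (z : ℂ) (t : ℝ) => f (z + t * Complex.I))
    (by simp only [Function.uncurry_def]; fun_prop)
  exact h.comp (measurable_id.prodMk (measurable_const (a := (0 : ℝ))))

end measurability

lemma differentiableAt_horizontal_iff {f : ℂ → ℂ} {x y : ℝ} :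
    DifferentiableAt ℝ (fun t : ℝ => f ⟨t, y⟩) x ↔ (⟨x, y⟩ : ℂ) ∈ diffX f := by
  have e : (fun t : ℝ => f ((⟨x, y⟩ : ℂ) + t)) = (fun t : ℝ => f ⟨t, y⟩) ∘ (fun t => x + t) := by
    funext t
    simp only [Function.comp]
    congr 1
    apply Complex.ext <;> simp
  rw [diffX, mem_ofPred_eq, e]
  have := differentiableAt_comp_add_left (f := fun t : ℝ => f ⟨t, y⟩) (𝕜 := ℝ) (x := 0) x
  rw [add_zero] at this
  exact this.symm

lemma differentiableAt_vertical_iff {f : ℂ → ℂ} {x y : ℝ} :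
    DifferentiableAt ℝ (fun t : ℝ => f ⟨x, t⟩) y ↔ (⟨x, y⟩ : ℂ) ∈ diffY f := by
  have e : (fun t : ℝ => f ((⟨x, y⟩ : ℂ) + t * Complex.I)) =
      (fun t : ℝ => f ⟨x, t⟩) ∘ (fun t => y + t) := by
    funext t
    simp only [Function.comp]
    congr 1
    apply Complex.ext <;> simp
  rw [diffY, mem_ofPred_eq, e]
  have := differentiableAt_comp_add_left (f := fun t : ℝ => f ⟨x, t⟩) (𝕜 := ℝ) (x := 0) y
  rw [add_zero] at this
  exact this.symm

lemma deriv_horizontal (f : ℂ → ℂ) (x y : ℝ) :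
    deriv (fun t : ℝ => f ⟨t, y⟩) x = partialX f ⟨x, y⟩ := by
  have e : (fun t : ℝ => f ((⟨x, y⟩ : ℂ) + t)) = fun t => (fun t : ℝ => f ⟨t, y⟩) (x + t) := by
    funext t
    congr 1
    apply Complex.ext <;> simp
  rw [partialX, e]
  simpa using (deriv_comp_const_add (fun t : ℝ => f ⟨t, y⟩) x 0).symm

lemma deriv_vertical (f : ℂ → ℂ) (x y : ℝ) :
    deriv (fun t : ℝ => f ⟨x, t⟩) y = partialY f ⟨x, y⟩ := by
  have e : (fun t : ℝ => f ((⟨x, y⟩ : ℂ) + t * Complex.I)) =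
      fun t => (fun t : ℝ => f ⟨x, t⟩) (y + t) := by
    funext t
    congr 1
    apply Complex.ext <;> simp
  rw [partialY, e]
  simpa using (deriv_comp_const_add (fun t : ℝ => f ⟨x, t⟩) y 0).symm

lemma LipschitzOnWith.comp_absolutelyContinuousOnInterval {X Y : Type*} [PseudoMetricSpace X]
    [PseudoMetricSpace Y] {φ : X → Y} {S : Set X} {K : NNReal} (hφ : LipschitzOnWith K φ S)
    {f : ℝ → X} {a b : ℝ} (hf : AbsolutelyContinuousOnInterval f a b)
    (hm : MapsTo f (uIcc a b) S) : AbsolutelyContinuousOnInterval (fun t => φ (f t)) a b := by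
  unfold AbsolutelyContinuousOnInterval at hf ⊢
  refine squeeze_zero' (.of_forall fun E => Finset.sum_nonneg fun _ _ => dist_nonneg) ?_
    (by simpa using hf.const_mul (K : ℝ))
  filter_upwards [mem_inf_of_right (mem_principal_self _)] with E hE
  rw [Finset.mul_sum]
  refine Finset.sum_le_sum fun i hi => ?_
  exact hφ.dist_le_mul _ (hm (hE.1 i hi).1) _ (hm (hE.1 i hi).2)

lemma AbsolutelyContinuousOnInterval.re {f : ℝ → ℂ} {a b : ℝ}
    (hf : AbsolutelyContinuousOnInterval f a b) :
    AbsolutelyContinuousOnInterval (fun t => (f t).re) a b :=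
  (Complex.reCLM.lipschitz.lipschitzOnWith (s := univ)).comp_absolutelyContinuousOnInterval hf
    (mapsTo_univ _ _)

lemma AbsolutelyContinuousOnInterval.im {f : ℝ → ℂ} {a b : ℝ}
    (hf : AbsolutelyContinuousOnInterval f a b) :
    AbsolutelyContinuousOnInterval (fun t => (f t).im) a b :=
  (Complex.imCLM.lipschitz.lipschitzOnWith (s := univ)).comp_absolutelyContinuousOnInterval hf
    (mapsTo_univ _ _)

lemma differentiableAt_of_re_im {f : ℝ → ℂ} {t : ℝ}
    (h1 : DifferentiableAt ℝ (fun t => (f t).re) t)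
    (h2 : DifferentiableAt ℝ (fun t => (f t).im) t) : DifferentiableAt ℝ f t := by
  have e : f = fun t => ((f t).re : ℂ) + ((f t).im : ℂ) * Complex.I :=
    funext fun t => (Complex.re_add_im _).symm
  rw [e]
  exact (h1.hasDerivAt.ofReal_comp.add (h2.hasDerivAt.ofReal_comp.mul_const _)).differentiableAt

lemma AbsolutelyContinuousOnInterval.ae_differentiableAt_complex {f : ℝ → ℂ} {a b : ℝ}
    (hf : AbsolutelyContinuousOnInterval f a b) :
    ∀ᵐ t : ℝ, t ∈ uIcc a b → DifferentiableAt ℝ f t := by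
  filter_upwards [hf.re.ae_differentiableAt, hf.im.ae_differentiableAt] with t h1 h2 ht
  exact differentiableAt_of_re_im (h1 ht) (h2 ht)

/-- The fundamental theorem of calculus for complex-valued absolutely continuous functions. -/
lemma AbsolutelyContinuousOnInterval.integral_deriv_eq_sub_complex {f : ℝ → ℂ} {a b : ℝ}
    (hf : AbsolutelyContinuousOnInterval f a b)
    (hint : IntervalIntegrable (deriv f) volume a b) : ∫ t in a..b, deriv f t = f b - f a := by
  have hd := hf.ae_differentiableAt_complex
  apply Complex.ext
  · have h1 : (∫ t in a..b, deriv f t).re = ∫ t in a..b, (deriv f t).re :=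
      (Complex.reCLM.intervalIntegral_comp_comm hint).symm
    rw [h1, Complex.sub_re, ← hf.re.integral_deriv_eq_sub]
    refine intervalIntegral.integral_congr_ae ?_
    filter_upwards [hd] with t ht htI
    have := (ht (uIoc_subset_uIcc htI)).hasDerivAt
    exact (Complex.reCLM.hasFDerivAt.comp_hasDerivAt t this).deriv.symm
  · have h1 : (∫ t in a..b, deriv f t).im = ∫ t in a..b, (deriv f t).im :=
      (Complex.imCLM.intervalIntegral_comp_comm hint).symm
    rw [h1, Complex.sub_im, ← hf.im.integral_deriv_eq_sub]
    refine intervalIntegral.integral_congr_ae ?_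
    filter_upwards [hd] with t ht htI
    have := (ht (uIoc_subset_uIcc htI)).hasDerivAt
    exact (Complex.imCLM.hasFDerivAt.comp_hasDerivAt t this).deriv.symm

/-- A property which holds almost everywhere on every closed rectangle in an open set holds almost
everywhere in the set. -/
lemma ae_of_forall_rectangle {Ω : Set ℂ} (hΩ : IsOpen Ω) {P : ℂ → Prop}
    (h : ∀ a b c d : ℝ, a < b → c < d → Icc a b ×ℂ Icc c d ⊆ Ω →
      ∀ᵐ z : ℂ, z ∈ Icc a b ×ℂ Icc c d → P z) : ∀ᵐ z : ℂ, z ∈ Ω → P z := by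
  rw [ae_iff]
  refine measure_null_of_locally_null _ fun z hz => ?_
  have hzΩ : z ∈ Ω := by
    by_contra hc
    exact hz fun h => absurd h hc
  obtain ⟨a, b, c, d, hab, hcd, hsub, hnhds⟩ := exists_reProdIm_nhds hΩ hzΩ
  refine ⟨_, inter_mem_nhdsWithin _ hnhds, measure_mono_null ?_ (h a b c d hab hcd hsub)⟩
  rintro w ⟨h1, h2⟩ h3
  exact h1 fun _ => h3 ⟨Ioo_subset_Icc_self h2.1, Ioo_subset_Icc_self h2.2⟩

/-- A map that is absolutely continuous on lines has partial derivatives almost everywhere. -/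
lemma IsACL.ae_diff {f : ℂ → ℂ} (hf : Continuous f) {Ω : Set ℂ} (hΩ : IsOpen Ω)
    (h : IsACL f Ω) : ∀ᵐ z : ℂ, z ∈ Ω → z ∈ diffX f ∧ z ∈ diffY f := by
  refine ae_of_forall_rectangle hΩ fun a b c d hab hcd hsub => ?_
  obtain ⟨h1, h2⟩ := h a b c d hab hcd hsub
  have hm : MeasurableSet (Icc a b ×ℂ Icc c d) :=
    (isClosed_Icc.reProdIm isClosed_Icc).measurableSet
  have e1 : ∀ᵐ z : ℂ, z ∈ Icc a b ×ℂ Icc c d → z ∈ diffX f := by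
    refine ae_complex_of_ae_horizontal (hm.imp (measurableSet_diffX hf)) ?_
    filter_upwards [h1] with y hy
    by_cases hyI : y ∈ Icc c d
    · filter_upwards [(hy hyI).ae_differentiableAt_complex] with x hx hxI
      rw [uIcc_of_le hab.le] at hx
      exact differentiableAt_horizontal_iff.1 (hx hxI.1)
    · exact .of_forall fun x hx => absurd hx.2 hyI
  have e2 : ∀ᵐ z : ℂ, z ∈ Icc a b ×ℂ Icc c d → z ∈ diffY f := by
    refine ae_complex_of_ae_vertical (hm.imp (measurableSet_diffY hf)) ?_
    filter_upwards [h2] with x hx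
    by_cases hxI : x ∈ Icc a b
    · filter_upwards [(hx hxI).ae_differentiableAt_complex] with y hy hyI
      rw [uIcc_of_le hcd.le] at hy
      exact differentiableAt_vertical_iff.1 (hy hyI.2)
    · exact .of_forall fun y hy => absurd hy.1 hxI
  filter_upwards [e1, e2] with z h3 h4 hz using ⟨h3 hz, h4 hz⟩

/-! ### Differentiability on large sets -/

/-- The real linear map with the given partial derivatives. -/
noncomputable def partialDeriv (f : ℂ → ℂ) (z : ℂ) : ℂ →L[ℝ] ℂ :=
  Complex.reCLM.smulRight (partialX f z) + Complex.imCLM.smulRight (partialY f z)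

lemma partialDeriv_apply (f : ℂ → ℂ) (z h : ℂ) :
    partialDeriv f z h = h.re * partialX f z + h.im * partialY f z := by
  simp [partialDeriv]

/-- A truncated modulus of differentiability in the vertical direction, over rational increments. -/
noncomputable def verticalModulus (f : ℂ → ℂ) (n : ℕ) (z : ℂ) : ℝ :=
  ⨆ q : {q : ℚ // q ≠ 0 ∧ |(q : ℝ)| < 1 / ((n : ℝ) + 1)},
    min 1 (‖(f (z + (q.1 : ℝ) * Complex.I) - f z) - (q.1 : ℝ) * partialY f z‖ / |(q.1 : ℝ)|)

section modulus
variable {f : ℂ → ℂ}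

lemma bddAbove_verticalModulus (n : ℕ) (z : ℂ) :
    BddAbove (range fun q : {q : ℚ // q ≠ 0 ∧ |(q : ℝ)| < 1 / ((n : ℝ) + 1)} =>
      min 1 (‖(f (z + (q.1 : ℝ) * Complex.I) - f z) - (q.1 : ℝ) * partialY f z‖ / |(q.1 : ℝ)|)) :=
  ⟨1, by rintro _ ⟨q, rfl⟩; exact min_le_left _ _⟩

lemma measurable_verticalModulus (hf : Continuous f) (n : ℕ) : Measurable (verticalModulus f n) := by
  have h := measurable_partialY hf
  refine Measurable.iSup fun q => ?_
  refine measurable_const.min (Measurable.div_const (Measurable.norm ?_) _)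
  exact ((by fun_prop : Continuous fun z => f (z + (q.1 : ℝ) * Complex.I) - f z).measurable).sub
    (measurable_const.mul h)

lemma verticalModulus_nonneg (n : ℕ) (z : ℂ) : 0 ≤ verticalModulus f n z :=
  Real.iSup_nonneg fun q => le_min zero_le_one (by positivity)

/-- At every point with a vertical derivative the vertical modulus tends to zero; this pointwise
convergence is the input to Egorov's theorem. -/
lemma tendsto_verticalModulus {z : ℂ} (hz : z ∈ diffY f) :
    Tendsto (fun n => verticalModulus f n z) atTop (𝓝 0) := by
  have hd : HasDerivAt (fun t : ℝ => f (z + t * Complex.I)) (partialY f z) 0 :=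
    DifferentiableAt.hasDerivAt hz
  rw [Metric.tendsto_atTop]
  intro ε hε
  have h1 := (hasDerivAt_iff_isLittleO.1 hd).def (half_pos hε)
  obtain ⟨δ, hδ, hball⟩ := Metric.eventually_nhds_iff.1 h1
  obtain ⟨N, hN⟩ := exists_nat_one_div_lt hδ
  refine ⟨N, fun n hn => ?_⟩
  rw [Real.dist_eq, sub_zero, abs_of_nonneg (verticalModulus_nonneg n z)]
  refine lt_of_le_of_lt (Real.iSup_le (fun q => (min_le_right _ _).trans ?_) (half_pos hε).le)
    (half_lt_self hε)
  have hq0 : (q.1 : ℝ) ≠ 0 := by exact_mod_cast q.2.1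
  have hqδ : |(q.1 : ℝ)| < δ := by
    refine q.2.2.trans_le (le_trans ?_ hN.le)
    gcongr
  have h2 := hball (y := (q.1 : ℝ)) (by rwa [Real.dist_eq, sub_zero])
  rw [div_le_iff₀ (abs_pos.2 hq0)]
  simpa [-Rat.norm_cast_real] using h2

/-- A bound of the vertical modulus controls all small real increments. -/
lemma norm_sub_le_of_verticalModulus (hf : Continuous f) {n : ℕ} {z : ℂ} {ε : ℝ} (hε1 : ε < 1)
    (h : verticalModulus f n z ≤ ε) {t : ℝ} (ht : |t| < 1 / ((n : ℝ) + 1)) :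
    ‖f (z + t * Complex.I) - f z - t * partialY f z‖ ≤ ε * |t| := by
  by_cases ht0 : t = 0
  · simp [ht0]
  have hU : IsOpen {t : ℝ | t ≠ 0 ∧ |t| < 1 / ((n : ℝ) + 1)} :=
    isOpen_ne.inter (isOpen_lt continuous_abs continuous_const)
  have hcl : t ∈ closure ({t : ℝ | t ≠ 0 ∧ |t| < 1 / ((n : ℝ) + 1)} ∩ range ((↑) : ℚ → ℝ)) :=
    (Rat.denseRange_cast (𝕜 := ℝ)).open_subset_closure_inter hU ⟨ht0, ht⟩
  have hclosed : IsClosed {t : ℝ | ‖f (z + t * Complex.I) - f z - t * partialY f z‖ ≤ ε * |t|} :=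
    isClosed_le (by fun_prop) (by fun_prop)
  refine closure_minimal ?_ hclosed hcl
  rintro _ ⟨⟨h1, h2⟩, q, rfl⟩
  have hq := (le_ciSup (bddAbove_verticalModulus (f := f) n z) ⟨q, by simpa using h1, h2⟩).trans h
  rw [min_le_iff] at hq
  have h3 := hq.resolve_left (not_le.2 hε1)
  rw [div_le_iff₀ (abs_pos.2 h1)] at h3
  exact h3

/-- A continuous map with horizontal derivatives, and uniformly with vertical derivatives, is
differentiable on a set. Only horizontal increments at the base point and vertical increments ending
at the nearby points of the set enter. -/
lemma hasFDerivWithinAt_of_tendstoUniformlyOn (hf : Continuous f) {S : Set ℂ} (hS : S ⊆ diffX f)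
    (hu : TendstoUniformlyOn (verticalModulus f) 0 atTop S) {z : ℂ} (hz : z ∈ S) :
    HasFDerivWithinAt f (partialDeriv f z) S z := by
  -- vertical increments are approximated uniformly in the base point
  have hunif : ∀ ε > 0, ∃ δ > 0, ∀ w ∈ S, ∀ t : ℝ, |t| < δ →
      ‖f (w + t * Complex.I) - f w - t * partialY f w‖ ≤ ε * |t| := by
    intro ε hε
    obtain ⟨n, hn⟩ := (Metric.tendstoUniformlyOn_iff.1 hu (min ε (1 / 2))
      (lt_min hε (by norm_num))).exists
    refine ⟨1 / ((n : ℝ) + 1), by positivity, fun w hw t ht => ?_⟩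
    have h1 := hn w hw
    simp only [Pi.zero_apply, dist_zero_left, Real.norm_eq_abs,
      abs_of_nonneg (verticalModulus_nonneg n w)] at h1
    have h2 := norm_sub_le_of_verticalModulus hf
      ((min_le_right ε (1 / 2)).trans_lt (by norm_num)) h1.le ht
    exact h2.trans (mul_le_mul_of_nonneg_right (min_le_left _ _) (abs_nonneg _))
  -- hence the vertical derivative is a uniform limit of continuous functions
  have hcont : ContinuousOn (partialY f) S := by
    have h1 : TendstoUniformlyOn (fun (n : ℕ) w =>
        (f (w + ((1 / ((n : ℝ) + 1) : ℝ) : ℂ) * Complex.I) - f w) / ((1 / ((n : ℝ) + 1) : ℝ) : ℂ))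
        (partialY f) atTop S := by
      rw [Metric.tendstoUniformlyOn_iff]
      intro ε hε
      obtain ⟨δ, hδ, h⟩ := hunif (ε / 2) (half_pos hε)
      have ht := tendsto_one_div_add_atTop_nhds_zero_nat (𝕜 := ℝ)
      filter_upwards [ht.eventually (gt_mem_nhds hδ)] with n hn w hw
      have hpos : 0 < 1 / ((n : ℝ) + 1) := by positivity
      have h2 := h w hw _ (by rwa [abs_of_pos hpos])
      set t : ℝ := 1 / ((n : ℝ) + 1)
      have ht0 : (t : ℂ) ≠ 0 := by exact_mod_cast hpos.ne'
      rw [dist_comm, dist_eq_norm]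
      have e : (f (w + t * Complex.I) - f w) / t - partialY f w =
          (f (w + t * Complex.I) - f w - t * partialY f w) / t := by field_simp
      rw [e, norm_div, Complex.norm_real, Real.norm_eq_abs]
      have : ‖f (w + t * Complex.I) - f w - t * partialY f w‖ / |t| ≤ ε / 2 := by
        rw [div_le_iff₀ (abs_pos.2 hpos.ne')]; exact h2
      linarith
    refine h1.continuousOn (Frequently.of_forall fun n => ?_)
    fun_prop
  rw [hasFDerivWithinAt_iff_isLittleO, Asymptotics.isLittleO_iff]
  intro ε hε
  have hε3 : 0 < ε / 3 := by positivity
  obtain ⟨δ, hδ, h1⟩ := hunif (ε / 3) hε3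
  have hx : HasDerivAt (fun t : ℝ => f (z + t)) (partialX f z) 0 :=
    DifferentiableAt.hasDerivAt (hS hz)
  obtain ⟨δ', hδ', h2⟩ := Metric.eventually_nhds_iff.1 ((hasDerivAt_iff_isLittleO.1 hx).def hε3)
  have h3 : ∀ᶠ w in 𝓝[S] z, ‖partialY f w - partialY f z‖ < ε / 3 := by
    have := (hcont z hz).eventually (Metric.ball_mem_nhds _ hε3)
    filter_upwards [this] with w hw
    rw [← dist_eq_norm]
    exact hw
  have h4 : ∀ᶠ w in 𝓝[S] z, ‖w - z‖ < min δ δ' := by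
    have : ∀ᶠ w in 𝓝 z, ‖w - z‖ < min δ δ' := by
      filter_upwards [Metric.ball_mem_nhds z (lt_min hδ hδ')] with w hw
      rwa [Metric.mem_ball, dist_eq_norm] at hw
    exact nhdsWithin_le_nhds this
  filter_upwards [h3, h4, self_mem_nhdsWithin] with w hw3 hw4 hwS
  set h := w - z with hh
  have hre : |h.re| ≤ ‖h‖ := Complex.abs_re_le_norm h
  have him : |h.im| ≤ ‖h‖ := Complex.abs_im_le_norm h
  have k1 := h1 w hwS (-h.im) (by rw [abs_neg]; exact him.trans_lt (hw4.trans_le (min_le_left _ _)))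
  have k2 := h2 (y := h.re) (by
    rw [Real.dist_eq, sub_zero]; exact hre.trans_lt (hw4.trans_le (min_le_right _ _)))
  -- go from `z` horizontally to the corner, and from there vertically to `w`, with the vertical
  -- derivative taken at the end point `w`, which lies in `S`
  have ecorner : w + ((-h.im : ℝ) : ℂ) * Complex.I = z + (h.re : ℂ) := by
    apply Complex.ext <;> simp [hh]
  rw [ecorner, abs_neg] at k1
  simp only [Complex.ofReal_zero, add_zero, sub_zero, Complex.real_smul, Real.norm_eq_abs] at k2
  have edec : f w - f z - partialDeriv f z h =
      -(f (z + (h.re : ℂ)) - f w - ((-h.im : ℝ) : ℂ) * partialY f w)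
      + (h.im : ℂ) * (partialY f w - partialY f z)
      + (f (z + (h.re : ℂ)) - f z - h.re * partialX f z) := by
    rw [partialDeriv_apply]; push_cast; ring
  rw [edec]
  have k3 : ‖(h.im : ℂ) * (partialY f w - partialY f z)‖ ≤ ε / 3 * |h.im| := by
    rw [norm_mul, Complex.norm_real, Real.norm_eq_abs, mul_comm]
    exact mul_le_mul_of_nonneg_right hw3.le (abs_nonneg _)
  refine (norm_add₃_le).trans ?_
  rw [norm_neg]
  have l1 := mul_le_mul_of_nonneg_left hre hε3.le
  have l2 := mul_le_mul_of_nonneg_left him hε3.le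
  linarith

/-- By Egorov's theorem, a continuous map with partial derivatives almost everywhere is
differentiable on each of countably many measurable sets that exhaust its domain up to a null set. -/
lemma exists_seq_hasFDerivWithinAt (hf : Continuous f) {Ω : Set ℂ} (hΩ : MeasurableSet Ω)
    (hfin : volume Ω ≠ ⊤) (hd : ∀ᵐ z : ℂ, z ∈ Ω → z ∈ diffX f ∧ z ∈ diffY f) :
    ∃ E : ℕ → Set ℂ, (∀ k, MeasurableSet (E k)) ∧ (∀ k, E k ⊆ Ω) ∧
      volume (Ω \ ⋃ k, E k) = 0 ∧
      ∀ k, ∀ z ∈ E k, HasFDerivWithinAt f (partialDeriv f z) (E k) z := by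
  have hegorov : ∀ k : ℕ, ∃ t ⊆ Ω, MeasurableSet t ∧
      volume t ≤ ENNReal.ofReal (1 / ((k : ℝ) + 1)) ∧
      TendstoUniformlyOn (verticalModulus f) 0 atTop (Ω \ t) := by
    intro k
    refine tendstoUniformlyOn_of_ae_tendsto_of_measurable_edist (fun n => ?_) hΩ hfin ?_
      (by positivity)
    · exact (measurable_verticalModulus hf n).edist measurable_const
    · filter_upwards [hd] with z hz hzΩ using tendsto_verticalModulus (hz hzΩ).2
  choose t htΩ htm htv htu using hegorov
  refine ⟨fun k => (Ω \ t k) ∩ diffX f, fun k => (hΩ.diff (htm k)).inter (measurableSet_diffX hf),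
    fun k z hz => hz.1.1, ?_, fun k z hz => ?_⟩
  · have hsub : Ω \ ⋃ k, (Ω \ t k) ∩ diffX f ⊆
        {z | ¬ (z ∈ Ω → z ∈ diffX f ∧ z ∈ diffY f)} ∪ ⋂ k, t k := by
      rintro z ⟨hzΩ, hz⟩
      by_cases h : z ∈ diffX f
      · right
        rw [mem_iInter]
        intro k
        by_contra hk
        exact hz (mem_iUnion.2 ⟨k, ⟨hzΩ, hk⟩, h⟩)
      · left
        exact fun hc => h (hc hzΩ).1
    refine measure_mono_null hsub (measure_union_null (ae_iff.1 hd) ?_)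
    have hlim := ENNReal.tendsto_ofReal (tendsto_one_div_add_atTop_nhds_zero_nat (𝕜 := ℝ))
    rw [ENNReal.ofReal_zero] at hlim
    exact le_antisymm (ge_of_tendsto' hlim fun k => (measure_mono (iInter_subset t k)).trans (htv k))
      bot_le
  · exact hasFDerivWithinAt_of_tendstoUniformlyOn hf inter_subset_right
      ((htu k).mono inter_subset_left) hz

end modulus

/-- The area inequality for an injective map that is differentiable on countably many sets
exhausting its domain up to a null set. -/
lemma lintegral_abs_det_le_of_seq {F : ℂ → ℂ} {F' : ℂ → ℂ →L[ℝ] ℂ} {Ω : Set ℂ} {S : ℕ → Set ℂ}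
    (hi : InjOn F Ω) (hSm : ∀ k, MeasurableSet (S k)) (hSΩ : ∀ k, S k ⊆ Ω)
    (hnull : volume (Ω \ ⋃ k, S k) = 0)
    (hF : ∀ k, ∀ z ∈ S k, HasFDerivWithinAt F (F' z) (S k) z) :
    ∫⁻ z in Ω, ENNReal.ofReal |(F' z).det| ≤ volume (F '' Ω) := by
  -- the pieces have to be disjoint for the areas of their images to add up
  set D := disjointed S with hD
  have hDS : ∀ k, D k ⊆ S k := disjointed_subset S
  have hDm : ∀ k, MeasurableSet (D k) := fun k => MeasurableSet.disjointed hSm k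
  have hdisj : Pairwise (Function.onFun Disjoint D) := disjoint_disjointed S
  have hd : ∀ k, ∀ z ∈ D k, HasFDerivWithinAt F (F' z) (D k) z := fun k z hz =>
    (hF k z (hDS k hz)).mono (hDS k)
  have hiD : ∀ k, InjOn F (D k) := fun k => hi.mono ((hDS k).trans (hSΩ k))
  have h1 : ∀ k, ∫⁻ z in D k, ENNReal.ofReal |(F' z).det| = volume (F '' D k) := fun k =>
    lintegral_abs_det_fderiv_eq_addHaar_image volume (hDm k) (hd k) (hiD k)
  have hUD : ⋃ k, D k = ⋃ k, S k := iUnion_disjointed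
  calc ∫⁻ z in Ω, ENNReal.ofReal |(F' z).det|
      ≤ ∫⁻ z in ((⋃ k, D k) ∪ (Ω \ ⋃ k, S k)), ENNReal.ofReal |(F' z).det| := by
        refine lintegral_mono_set fun z hz => ?_
        by_cases h : z ∈ ⋃ k, S k
        · exact Or.inl (hUD ▸ h)
        · exact Or.inr ⟨hz, h⟩
    _ ≤ (∫⁻ z in ⋃ k, D k, ENNReal.ofReal |(F' z).det|) +
          ∫⁻ z in (Ω \ ⋃ k, S k), ENNReal.ofReal |(F' z).det| := lintegral_union_le _ _ _
    _ = ∑' k, volume (F '' D k) := by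
        rw [setLIntegral_measure_zero _ _ hnull, add_zero, lintegral_iUnion hDm hdisj]
        exact tsum_congr h1
    _ = volume (⋃ k, F '' D k) := by
        refine (measure_iUnion (fun j k hjk => ?_) fun k =>
          measurable_image_of_fderivWithin (hDm k) (hd k) (hiD k)).symm
        exact (hdisj hjk).image hi ((hDS j).trans (hSΩ j)) ((hDS k).trans (hSΩ k))
    _ ≤ volume (F '' Ω) := measure_mono (iUnion_subset fun k =>
        image_mono ((hDS k).trans (hSΩ k)))


/-! ### The lift to the ellipses -/

section lift
variable {R : ℝ}

/-- The boundary of the first ellipse in the parametrization `w ↦ w - 1/w` by the circle. -/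
noncomputable def ellipseBoundary (R θ : ℝ) : ℂ :=
  R * Complex.exp (θ * Complex.I) - 1 / (R * Complex.exp (θ * Complex.I))

/-- Polar coordinates adapted to the first ellipse, with logarithmic radius. -/
noncomputable def ellipsePolar (R t θ : ℝ) : ℂ := Real.exp t * ellipseBoundary R θ

lemma norm_mul_exp_mul_I (hR : 1 < R) (θ : ℝ) : ‖(R : ℂ) * Complex.exp (θ * Complex.I)‖ = R := by
  rw [norm_mul, Complex.norm_exp_ofReal_mul_I, mul_one, Complex.norm_real,
    Real.norm_of_nonneg (by linarith)]

lemma ellipseBoundary_mem (hR : 1 < R) (θ : ℝ) : ellipseBoundary R θ ∈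
    closedEllipse (R - 1 / R) (R + 1 / R) \ ellipse (R - 1 / R) (R + 1 / R) := by
  have hn := norm_mul_exp_mul_I hR θ
  exact ⟨(sub_inv_mem_closedEllipse hR (by rw [hn]; exact hR.le)).2 hn.le,
    (sub_inv_mem_ellipse hR (by rw [hn]; exact hR.le)).not.2 hn.not_lt⟩

lemma ellipseGauge_eq_one {a b : ℝ} {ζ : ℂ} (h : ζ ∈ closedEllipse a b \ ellipse a b) :
    ellipseGauge a b ζ = 1 :=
  le_antisymm h.1 (not_lt.1 h.2)

lemma ellipseGauge_ellipsePolar (hR : 1 < R) (t θ : ℝ) :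
    ellipseGauge (R - 1 / R) (R + 1 / R) (ellipsePolar R t θ) = Real.exp (2 * t) := by
  rw [ellipsePolar, ← Complex.real_smul, ellipseGauge_smul, ellipseGauge_eq_one (ellipseBoundary_mem hR θ), mul_one,
    ← Real.exp_nat_mul]
  norm_num

lemma ellipsePolar_ne_zero (hR : 1 < R) (t θ : ℝ) : ellipsePolar R t θ ≠ 0 := by
  intro h
  have := ellipseGauge_ellipsePolar hR t θ
  rw [h] at this
  simp [ellipseGauge] at this
  exact (Real.exp_pos _).ne this

lemma ellipsePolar_mem (hR : 1 < R) {t : ℝ} (ht : t ≤ 0) (θ : ℝ) :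
    ellipsePolar R t θ ∈ closedEllipse (R - 1 / R) (R + 1 / R) := by
  rw [mem_closedEllipse, ellipseGauge_ellipsePolar hR, Real.exp_le_one_iff]
  linarith

lemma continuous_ellipsePolar (hR : 1 < R) :
    Continuous fun p : ℝ × ℝ => ellipsePolar R p.1 p.2 := by
  have h : ∀ θ : ℝ, (R : ℂ) * Complex.exp (θ * Complex.I) ≠ 0 := fun θ =>
    norm_pos_iff.1 (by rw [norm_mul_exp_mul_I hR]; linarith)
  unfold ellipsePolar ellipseBoundary
  refine Continuous.mul (by fun_prop) (Continuous.sub (by fun_prop) ?_)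
  exact continuous_const.div (by fun_prop) fun p => h p.2

lemma ellipseBoundary_add_pi (θ : ℝ) : ellipseBoundary R (θ + Real.pi) = -ellipseBoundary R θ := by
  unfold ellipseBoundary
  have : Complex.exp (((θ + Real.pi : ℝ) : ℂ) * Complex.I) = -Complex.exp (θ * Complex.I) := by
    push_cast
    rw [add_mul, Complex.exp_add, Complex.exp_pi_mul_I, mul_neg_one]
  rw [this, mul_neg, div_neg]; ring

lemma ellipsePolar_add_pi (t θ : ℝ) : ellipsePolar R t (θ + Real.pi) = -ellipsePolar R t θ := by
  rw [ellipsePolar, ellipsePolar, ellipseBoundary_add_pi, mul_neg]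

/-- Every point of the closed ellipse other than the centre has polar coordinates. -/
lemma exists_ellipsePolar_eq (hR : 1 < R) {ζ : ℂ}
    (hζ : ζ ∈ closedEllipse (R - 1 / R) (R + 1 / R)) (h0 : ζ ≠ 0) :
    ∃ t θ : ℝ, t ≤ 0 ∧ θ ∈ Icc (-Real.pi) Real.pi ∧ ellipsePolar R t θ = ζ := by
  set g := ellipseGauge (R - 1 / R) (R + 1 / R) ζ with hg
  have hg0 : 0 < g := lt_of_le_of_ne (ellipseGauge_nonneg _ _ _) fun h =>
    h0 ((ellipseGauge_eq_zero (sub_inv_pos hR).ne' (add_inv_pos hR).ne').1 h.symm)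
  have hg1 : g ≤ 1 := hζ
  have hs := Real.sqrt_pos.2 hg0
  have hsc : ((√g : ℝ) : ℂ) ≠ 0 := by exact_mod_cast hs.ne'
  have hgauge : ellipseGauge (R - 1 / R) (R + 1 / R) (((√g)⁻¹ : ℝ) * ζ) = 1 := by
    rw [← Complex.real_smul, ellipseGauge_smul, ← hg, inv_pow, Real.sq_sqrt hg0.le, inv_mul_cancel₀ hg0.ne']
  obtain ⟨w, hw, e⟩ := exists_boundary_param hR (ζ := (((√g)⁻¹ : ℝ) : ℂ) * ζ)
    ⟨hgauge.le, by rw [mem_ellipse, hgauge]; exact lt_irrefl 1⟩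
  refine ⟨Real.log (√g), w.arg, Real.log_nonpos hs.le (Real.sqrt_le_one.2 hg1),
    ⟨(Complex.neg_pi_lt_arg w).le, Complex.arg_le_pi w⟩, ?_⟩
  have hw' : (R : ℂ) * Complex.exp (w.arg * Complex.I) = w := by
    rw [← hw]; exact Complex.norm_mul_exp_arg_mul_I w
  rw [ellipsePolar, ellipseBoundary, hw', e, Real.exp_log hs]
  push_cast
  field_simp

/-- The polar coordinates are unique up to multiples of `2π` in the angle. -/
lemma ellipsePolar_eq_iff (hR : 1 < R) {t θ t' θ' : ℝ}
    (h : ellipsePolar R t θ = ellipsePolar R t' θ') :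
    t = t' ∧ ∃ n : ℤ, θ = θ' + n * (2 * Real.pi) := by
  have ht : t = t' := by
    have h1 := congrArg (ellipseGauge (R - 1 / R) (R + 1 / R)) h
    rw [ellipseGauge_ellipsePolar hR, ellipseGauge_ellipsePolar hR, Real.exp_eq_exp] at h1
    linarith
  refine ⟨ht, ?_⟩
  subst ht
  have hexp : ((Real.exp t : ℝ) : ℂ) ≠ 0 := by exact_mod_cast (Real.exp_pos t).ne'
  have h1 : ellipseBoundary R θ = ellipseBoundary R θ' := mul_left_cancel₀ hexp h
  have hn := norm_mul_exp_mul_I hR θ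
  have hn' := norm_mul_exp_mul_I hR θ'
  rcases (sub_inv_eq_iff (ne_zero_of_one_lt_norm (by rwa [hn]))
    (ne_zero_of_one_lt_norm (by rwa [hn']))).1 h1 with h2 | h2
  · have hR0 : (R : ℂ) ≠ 0 := by
      have : R ≠ 0 := by linarith
      exact_mod_cast this
    obtain ⟨n, hn⟩ := Complex.exp_eq_exp_iff_exists_int.1 (mul_left_cancel₀ hR0 h2)
    refine ⟨-n, ?_⟩
    have h3 : ((θ' : ℂ) - (θ + n * (2 * Real.pi))) * Complex.I = 0 := by linear_combination hn
    rcases mul_eq_zero.1 h3 with h4 | h4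
    · have h5 : θ' = θ + n * (2 * Real.pi) := by exact_mod_cast sub_eq_zero.1 h4
      rw [h5]; push_cast; ring
    · exact absurd h4 Complex.I_ne_zero
  · have h3 := congrArg norm h2
    rw [hn', norm_neg, norm_div, norm_one, hn, eq_div_iff (by linarith)] at h3
    nlinarith

/-- A continuous logarithm of the affine image of the boundary of the first ellipse. -/
noncomputable def boundaryLog (R θ : ℝ) : ℂ :=
  Real.log R + θ * Complex.I +
    Complex.log (1 + (((1 / R ^ 2 : ℝ) : ℂ) * Complex.exp (-(2 * θ * Complex.I))))

lemma boundaryLog_mem_slitPlane (hR : 1 < R) (θ : ℝ) :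
    1 + (((1 / R ^ 2 : ℝ) : ℂ) * Complex.exp (-(2 * θ * Complex.I))) ∈ Complex.slitPlane := by
  refine Complex.mem_slitPlane_of_norm_lt_one ?_
  have e : -(2 * θ * Complex.I) = ((-(2 * θ) : ℝ) : ℂ) * Complex.I := by push_cast; ring
  rw [norm_mul, e, Complex.norm_exp_ofReal_mul_I, mul_one, Complex.norm_real,
    Real.norm_of_nonneg (by positivity), div_lt_one (by positivity)]
  exact one_lt_pow₀ hR two_ne_zero

lemma continuous_boundaryLog (hR : 1 < R) : Continuous (boundaryLog R) := by
  unfold boundaryLog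
  refine Continuous.add (by fun_prop) (Continuous.clog (by fun_prop) (boundaryLog_mem_slitPlane hR))

lemma boundaryLog_add_pi (θ : ℝ) :
    boundaryLog R (θ + Real.pi) = boundaryLog R θ + Real.pi * Complex.I := by
  unfold boundaryLog
  have : Complex.exp (-(2 * ((θ + Real.pi : ℝ) : ℂ) * Complex.I)) =
      Complex.exp (-(2 * θ * Complex.I)) := by
    rw [Complex.exp_eq_exp_iff_exists_int]
    exact ⟨-1, by push_cast; ring⟩
  rw [this]; push_cast; ring

lemma exp_boundaryLog (hR : 1 < R) (θ : ℝ) :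
    Complex.exp (boundaryLog R θ) = ellipseAffine R (ellipseBoundary R θ) := by
  have hR0 : (R : ℂ) ≠ 0 := by
    have : R ≠ 0 := by linarith
    exact_mod_cast this
  rw [boundaryLog, ellipseBoundary, ellipseAffine_sub_inv hR (norm_mul_exp_mul_I hR θ),
    Complex.exp_add, Complex.exp_log (Complex.slitPlane_ne_zero (boundaryLog_mem_slitPlane hR θ)),
    Complex.exp_add, ← Complex.ofReal_exp, Real.exp_log (by linarith)]
  have e : Complex.exp (-(2 * θ * Complex.I)) =
      1 / (Complex.exp (θ * Complex.I) * Complex.exp (θ * Complex.I)) := by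
    rw [Complex.exp_neg, ← Complex.exp_add, one_div]; congr 2; ring
  have he := Complex.exp_ne_zero (θ * Complex.I)
  rw [e]
  push_cast
  field_simp

/-- A square root with the boundary values of the affine map exists: in polar coordinates the
function has a continuous logarithm, and the boundary values show that the logarithm increases by
`2πi` along a half turn. -/
lemma exists_odd_sqrt (hR : 1 < R) {h : ℂ → ℂ}
    (hc : ContinuousOn h (closedEllipse (R - 1 / R) (R + 1 / R)))
    (heven : ∀ ζ, h (-ζ) = h ζ)
    (hzero : ∀ ζ ∈ closedEllipse (R - 1 / R) (R + 1 / R), h ζ = 0 ↔ ζ = 0)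
    (hbd : ∀ ζ ∈ closedEllipse (R - 1 / R) (R + 1 / R) \ ellipse (R - 1 / R) (R + 1 / R),
      h ζ = ellipseAffine R ζ ^ 2) :
    ∃ F : ℂ → ℂ, ContinuousOn F (closedEllipse (R - 1 / R) (R + 1 / R)) ∧
      (∀ ζ ∈ closedEllipse (R - 1 / R) (R + 1 / R), F ζ ^ 2 = h ζ) ∧
      (∀ ζ ∈ closedEllipse (R - 1 / R) (R + 1 / R), F (-ζ) = -F ζ) ∧
      ∀ ζ ∈ closedEllipse (R - 1 / R) (R + 1 / R) \ ellipse (R - 1 / R) (R + 1 / R),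
        F ζ = ellipseAffine R ζ := by
  set K := closedEllipse (R - 1 / R) (R + 1 / R) with hK
  -- `h` in polar coordinates, extended to a half plane of logarithmic radii by its boundary values;
  -- it has no zeros, and so has a continuous logarithm `L`
  set H : ℝ × ℝ → ℂ := fun p => h (ellipsePolar R (min p.1 0) p.2) with hH
  have hHc : Continuous H := by
    rw [← continuousOn_univ]
    refine hc.comp (Continuous.continuousOn ?_) fun p _ => ellipsePolar_mem hR (min_le_right _ _) _
    exact (continuous_ellipsePolar hR).comp
      ((continuous_fst.min continuous_const).prodMk continuous_snd)
  have hH0 : ∀ p, H p ≠ 0 := fun p hp =>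
    ellipsePolar_ne_zero hR _ _ ((hzero _ (ellipsePolar_mem hR (min_le_right _ _) _)).1 hp)
  obtain ⟨L, hLc, hL⟩ := Complex.exists_continuousOn_eqOn_exp_comp
    ((convex_univ (𝕜 := ℝ) (E := ℝ × ℝ)).isSimplyConnected_of_nonempty univ_nonempty) isOpen_univ
    (g := H) hHc.continuousOn (by rintro ⟨p, -, hp⟩; exact hH0 p hp)
  rw [continuousOn_univ] at hLc
  have hL' : ∀ p, Complex.exp (L p) = H p := fun p => hL (mem_univ p)
  have hlogc := continuous_boundaryLog hR
  -- on the boundary `L` and `2 * boundaryLog` are logarithms of the same function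
  obtain ⟨m, hm⟩ := exists_int_sub_eq_of_exp_eq (isPreconnected_univ (α := ℝ))
    (L := fun θ => L (0, θ)) (M := fun θ => 2 * boundaryLog R θ)
    (Continuous.continuousOn (by fun_prop)) (Continuous.continuousOn (by fun_prop)) (by
      intro θ _
      have e : Complex.exp (2 * boundaryLog R θ) = Complex.exp (boundaryLog R θ) ^ 2 := by
        rw [← Complex.exp_nat_mul]; norm_num
      rw [hL', e, exp_boundaryLog hR, ← hbd _ (ellipseBoundary_mem hR θ)]
      simp [hH, ellipsePolar])
  -- since `h` is even, a half turn changes `L` by a constant, which is computed on the boundary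
  obtain ⟨n, hn⟩ := exists_int_sub_eq_of_exp_eq (isPreconnected_univ (α := ℝ × ℝ))
    (L := fun p => L (p.1, p.2 + Real.pi)) (M := L)
    (Continuous.continuousOn (by fun_prop)) hLc.continuousOn (by
      intro p _
      rw [hL', hL']
      simp only [hH]
      rw [ellipsePolar_add_pi, heven])
  have hn1 : ∀ t θ, L (t, θ + Real.pi) = L (t, θ) + 2 * Real.pi * Complex.I := by
    have h1 := hn (0, 0) (mem_univ _)
    have h2 := hm (0 + Real.pi) (mem_univ _)
    have h3 := hm 0 (mem_univ _)
    rw [boundaryLog_add_pi] at h2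
    have h4 : (n : ℂ) * (2 * Real.pi * Complex.I) = 2 * Real.pi * Complex.I := by
      rw [← h1]
      linear_combination h2 - h3
    intro t θ
    have h5 := hn (t, θ) (mem_univ _)
    rw [h4] at h5
    linear_combination h5
  -- half of the logarithm, normalized by the boundary values, gives the square root
  set G : ℝ → ℝ → ℂ := fun t θ =>
    Complex.exp ((L (t, θ) - m * (2 * Real.pi * Complex.I)) / 2) with hG
  have hGsq : ∀ t θ, G t θ ^ 2 = H (t, θ) := by
    intro t θ
    rw [← hL', hG, ← Complex.exp_nat_mul, Complex.exp_eq_exp_iff_exists_int]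
    exact ⟨-m, by push_cast; ring⟩
  have hGanti : ∀ t, Function.Antiperiodic (G t) Real.pi := by
    intro t θ
    simp only [hG]
    rw [hn1, show (L (t, θ) + 2 * Real.pi * Complex.I - m * (2 * Real.pi * Complex.I)) / 2 =
      (L (t, θ) - m * (2 * Real.pi * Complex.I)) / 2 + Real.pi * Complex.I by ring,
      Complex.exp_add, Complex.exp_pi_mul_I, mul_neg_one]
  have hGper : ∀ t θ (k : ℤ), G t (θ + k * (2 * Real.pi)) = G t θ := by
    intro t θ k
    exact ((hGanti t).periodic_two_mul.int_mul k) θ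
  have hGbd : ∀ θ, G 0 θ = ellipseAffine R (ellipseBoundary R θ) := by
    intro θ
    rw [← exp_boundaryLog hR]
    simp only [hG]
    congr 1
    have := hm θ (mem_univ _)
    linear_combination (1 / 2) * this
  have hGc : Continuous fun p : ℝ × ℝ => G p.1 p.2 := by
    simp only [hG]
    fun_prop
  choose! T Θ hT hΘ hpol using fun ζ (hζ : ζ ∈ K ∧ ζ ≠ 0) => exists_ellipsePolar_eq hR hζ.1 hζ.2
  set F : ℂ → ℂ := fun ζ => if ζ = 0 then 0 else G (T ζ) (Θ ζ) with hF
  have hF0 : F 0 = 0 := by simp [hF]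
  have hFpol : ∀ t θ, t ≤ 0 → F (ellipsePolar R t θ) = G t θ := by
    intro t θ ht
    have hne := ellipsePolar_ne_zero hR t θ
    have hmem : ellipsePolar R t θ ∈ K := ellipsePolar_mem hR ht θ
    obtain ⟨h1, k, hk⟩ := ellipsePolar_eq_iff hR (hpol _ ⟨hmem, hne⟩)
    simp only [hF, hne, if_false]
    rw [h1, hk, hGper]
  have hFsq : ∀ ζ ∈ K, F ζ ^ 2 = h ζ := by
    intro ζ hζ
    by_cases h0 : ζ = 0
    · rw [h0, hF0, (hzero 0 (h0 ▸ hζ)).2 rfl]; norm_num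
    · have ht := hT _ ⟨hζ, h0⟩
      rw [← hpol _ ⟨hζ, h0⟩, hFpol _ _ ht, hGsq]
      simp only [hH, min_eq_left ht]
  refine ⟨F, ?_, hFsq, ?_, ?_⟩
  · intro ζ hζ
    by_cases h0 : ζ = 0
    -- at the centre `|F|² = |h|` tends to zero
    · rw [h0, ContinuousWithinAt, hF0, tendsto_zero_iff_norm_tendsto_zero]
      have h0K : (0 : ℂ) ∈ K := h0 ▸ hζ
      have h1 : Tendsto (fun ζ => √‖h ζ‖) (𝓝[K] 0) (𝓝 0) := by
        have := ((hc 0 h0K).norm).sqrt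
        rw [ContinuousWithinAt, (hzero 0 h0K).2 rfl] at this
        simpa using this
      refine h1.congr' ?_
      filter_upwards [self_mem_nhdsWithin] with y hy
      rw [← hFsq y hy, norm_pow, Real.sqrt_sq (norm_nonneg _)]
    -- elsewhere, near `ζ`, the ellipse is the image of a compact set of polar coordinates, and
    -- continuity descends to the quotient
    · set t₀ := T ζ - 1 with ht₀
      set C := (Icc t₀ 0) ×ˢ (Icc (-Real.pi) Real.pi) with hC
      have hcont : ContinuousOn F ((fun p : ℝ × ℝ => ellipsePolar R p.1 p.2) '' C) := by
        refine (isCompact_Icc.prod isCompact_Icc).continuousOn_of_comp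
          (continuous_ellipsePolar hR).continuousOn ?_
        exact hGc.continuousOn.congr fun p hp => hFpol _ _ hp.1.2
      have hsub : K ∩ {y | Real.exp (2 * t₀) < ellipseGauge (R - 1 / R) (R + 1 / R) y} ⊆
          (fun p : ℝ × ℝ => ellipsePolar R p.1 p.2) '' C := by
        rintro y ⟨hyK, hy⟩
        have hy0 : y ≠ 0 := by
          rintro rfl
          have h1 : ellipseGauge (R - 1 / R) (R + 1 / R) 0 = 0 := by simp [ellipseGauge]
          rw [mem_ofPred_eq, h1] at hy
          exact hy.not_gt (Real.exp_pos _)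
        refine ⟨(T y, Θ y), ⟨⟨?_, hT _ ⟨hyK, hy0⟩⟩, hΘ _ ⟨hyK, hy0⟩⟩, hpol _ ⟨hyK, hy0⟩⟩
        rw [mem_ofPred_eq, ← hpol _ ⟨hyK, hy0⟩, ellipseGauge_ellipsePolar hR,
          Real.exp_lt_exp] at hy
        simp only
        linarith
      have hmem : {y | Real.exp (2 * t₀) < ellipseGauge (R - 1 / R) (R + 1 / R) y} ∈ 𝓝 ζ := by
        refine (isOpen_lt continuous_const (continuous_ellipseGauge _ _)).mem_nhds ?_
        rw [mem_ofPred_eq, ← hpol _ ⟨hζ, h0⟩, ellipseGauge_ellipsePolar hR, Real.exp_lt_exp]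
        linarith
      exact (hcont ζ (hsub ⟨hζ, mem_of_mem_nhds hmem⟩)).mono_of_mem_nhdsWithin
        (mem_of_superset (inter_mem_nhdsWithin K hmem) hsub)
  · intro ζ hζ
    by_cases h0 : ζ = 0
    · rw [h0, neg_zero, hF0, neg_zero]
    · have ht := hT _ ⟨hζ, h0⟩
      rw [← hpol _ ⟨hζ, h0⟩, ← ellipsePolar_add_pi, hFpol _ _ ht, hFpol _ _ ht]
      exact hGanti _ _
  · intro ζ hζ
    obtain ⟨w, hw, rfl⟩ := exists_boundary_param hR hζ
    have hw' : (R : ℂ) * Complex.exp (w.arg * Complex.I) = w := by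
      rw [← hw]; exact Complex.norm_mul_exp_arg_mul_I w
    have e : w - 1 / w = ellipsePolar R 0 w.arg := by
      rw [ellipsePolar, ellipseBoundary, hw']; simp
    rw [e, hFpol _ _ le_rfl, hGbd]
    simp [ellipsePolar]

/-- A competitor is injective up to the boundary, as it maps the disc into itself and fixes the unit
circle. -/
lemma IsDiscShift.injOn {x : ℝ} {f : ℂ → ℂ} (hf : IsDiscShift x f) : InjOn f closedUnitDisc := by
  obtain ⟨K, hK⟩ := hf.qc
  have key : ∀ {z : ℂ}, z ∈ closedUnitDisc → z ∈ unitDisc ∨ ‖z‖ = 1 := fun {z} hz => by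
    have : ‖z‖ ≤ 1 := by simpa [closedUnitDisc] using hz
    rcases this.lt_or_eq with h | h
    · left; simpa [unitDisc] using h
    · exact Or.inr h
  have key2 : ∀ {z y : ℂ}, z ∈ unitDisc → ‖y‖ = 1 → f z ≠ f y := by
    intro z y hz hy e
    have := hf.image ▸ mem_image_of_mem f hz
    rw [e, hf.boundary y hy] at this
    simp [unitDisc, hy] at this
  intro z hz y hy e
  rcases key hz with h1 | h1 <;> rcases key hy with h2 | h2
  · have := hK.isEmbedding.injective (a₁ := ⟨z, h1⟩) (a₂ := ⟨y, h2⟩) e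
    exact congrArg Subtype.val this
  · exact absurd e (key2 h1 h2)
  · exact absurd e.symm (key2 h2 h1)
  · rwa [hf.boundary z h1, hf.boundary y h2] at e

lemma IsDiscShift.bijOn_closed {x : ℝ} {f : ℂ → ℂ} (hf : IsDiscShift x f) :
    BijOn f closedUnitDisc closedUnitDisc := by
  have hsub : ∀ z ∈ closedUnitDisc, z ∈ unitDisc ∨ ‖z‖ = 1 := fun z hz => by
    have : ‖z‖ ≤ 1 := by simpa [closedUnitDisc] using hz
    rcases this.lt_or_eq with h | h
    · left; simpa [unitDisc] using h
    · exact Or.inr h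
  have hle : unitDisc ⊆ closedUnitDisc := Metric.ball_subset_closedBall
  refine ⟨fun z hz => ?_, hf.injOn, fun z hz => ?_⟩
  · rcases hsub z hz with h | h
    · exact hle (hf.image ▸ mem_image_of_mem f h)
    · rwa [hf.boundary z h]
  · rcases hsub z hz with h | h
    · rw [← hf.image] at h
      obtain ⟨y, hy, e⟩ := h
      exact ⟨y, hle hy, e⟩
    · exact ⟨z, hz, hf.boundary z h⟩

/-- Every competitor lifts to a map of the closed ellipses with the boundary values of the affine
map. -/
theorem IsDiscShift.exists_lift (hR : 1 < R) {f : ℂ → ℂ}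
    (hf : IsDiscShift (focalValue (R ^ 2)) f) :
    ∃ F : ℂ → ℂ, ContinuousOn F (closedEllipse (R - 1 / R) (R + 1 / R)) ∧
      BijOn F (closedEllipse (R - 1 / R) (R + 1 / R)) (closedEllipse (R + 1 / R) (R - 1 / R)) ∧
      F 0 = 0 ∧
      (∀ w ∈ closedEllipse (R - 1 / R) (R + 1 / R) \ ellipse (R - 1 / R) (R + 1 / R),
        F w = ellipseAffine R w) ∧
      ∀ w ∈ closedEllipse (R - 1 / R) (R + 1 / R), f (coverOne R w) = coverTwo R (F w) := by
  have hR2 := one_lt_sq_of_one_lt hR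
  set ρ := R ^ 2 with hρ
  set K := closedEllipse (R - 1 / R) (R + 1 / R) with hK
  have hc1 := isEllipseCover_coverOne hR
  have hc2 := isEllipseCover_coverTwo hR
  have hQ := bijOn_closed_ellipseToDisc hR2
  have hfb := hf.bijOn_closed
  set Qi := Function.invFunOn (ellipseToDisc ρ) (closedFocalEllipse ρ) with hQi
  have hQim : ∀ z ∈ closedUnitDisc, Qi z ∈ closedFocalEllipse ρ ∧ ellipseToDisc ρ (Qi z) = z :=
    fun z hz => ⟨hQ.surjOn.mapsTo_invFunOn hz, hQ.surjOn.rightInvOn_invFunOn hz⟩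
  have hQic : ContinuousOn Qi closedUnitDisc := by
    rw [← hQ.image_eq]
    refine (isCompact_closedFocalEllipse hR2).continuousOn_of_comp (continuousOn_ellipseToDisc hR2) ?_
    exact continuousOn_id.congr fun s hs => hQ.injOn.leftInvOn_invFunOn hs
  have hp1 : ∀ ζ ∈ K, coverOne R ζ ∈ closedUnitDisc := fun ζ hζ =>
    hc1.image_closed ▸ mem_image_of_mem _ hζ
  -- the lift is a square root of `h`, since `coverTwo R ω = ellipseToDisc (R ^ 2) (ω ^ 2 - 2)`
  set h : ℂ → ℂ := fun ζ => Qi (f (coverOne R ζ)) + 2 with hh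
  have hspec : ∀ ζ ∈ K, h ζ + -2 ∈ closedFocalEllipse ρ ∧
      ellipseToDisc ρ (h ζ + -2) = f (coverOne R ζ) := by
    intro ζ hζ
    have := hQim _ (hfb.mapsTo (hp1 ζ hζ))
    simpa [hh] using this
  have h0K : (0 : ℂ) ∈ K := ellipse_subset_closedEllipse _ _ (zero_mem_ellipse _ _)
  have hzero : ∀ ζ ∈ K, h ζ = 0 ↔ ζ = 0 := by
    intro ζ hζ
    rw [← hc1.eq_branch_iff hζ, ← hfb.injOn.eq_iff (hp1 ζ hζ) (by simp [closedUnitDisc]),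
      hf.map_zero, ← (hspec ζ hζ).2, ← ellipseToDisc_neg_two hR2,
      hQ.injOn.eq_iff (hspec ζ hζ).1
        (ellipse_subset_closedEllipse _ _ (neg_two_mem_focalEllipse hR2))]
    constructor
    · intro h; rw [h, zero_add]
    · intro h; linear_combination h
  obtain ⟨F, hFc, hFsq, hFodd, hFbd⟩ := exists_odd_sqrt hR (h := h)
    (by
      have h1 : ContinuousOn (fun ζ => Qi (f (coverOne R ζ))) K :=
        hQic.comp (hf.cont.comp hc1.cont fun ζ hζ => hp1 ζ hζ) fun ζ hζ => hfb.mapsTo (hp1 ζ hζ)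
      exact h1.add continuousOn_const)
    (fun ζ => by simp only [hh, coverOne, neg_sq]) hzero
    (by
      intro ζ hζ
      have h1 : ‖coverOne R ζ‖ = 1 := norm_ellipseToDisc_of_boundary hR2
        ⟨(sq_add_two_mem_closedEllipse hR).2 hζ.1, (sq_add_two_mem_ellipse hR).not.2 hζ.2⟩
      have h2 := (hspec ζ hζ.1).2
      rw [hf.boundary _ h1, ← coverTwo_ellipseAffine_of_boundary hR hζ, coverTwo] at h2
      have h3 := hQ.injOn (hspec ζ hζ.1).1 ((sq_sub_two_mem_closedEllipse hR).2
        ((ellipseAffine_mem_closedEllipse hR).2 hζ.1)) h2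
      linear_combination h3)
  have hFp : ∀ ζ ∈ K, f (coverOne R ζ) = coverTwo R (F ζ) := by
    intro ζ hζ
    rw [← (hspec ζ hζ).2, ← hFsq ζ hζ, coverTwo]
  have hFm : MapsTo F K (closedEllipse (R + 1 / R) (R - 1 / R)) := by
    intro ζ hζ
    rw [← sq_sub_two_mem_closedEllipse hR, hFsq ζ hζ]
    exact (hspec ζ hζ).1
  have hnegK : ∀ ζ ∈ K, -ζ ∈ K := fun ζ hζ => by
    rw [hK, mem_closedEllipse, ellipseGauge_neg]; exact hζ
  have hF0 : ∀ ζ ∈ K, F ζ = 0 ↔ ζ = 0 := by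
    intro ζ hζ
    rw [← hzero ζ hζ, ← hFsq ζ hζ]
    simp
  refine ⟨F, hFc, ⟨hFm, fun ζ hζ ζ' hζ' e => ?_, fun ω hω => ?_⟩, (hF0 0 h0K).2 rfl, hFbd, hFp⟩
  · have h1 : coverOne R ζ = coverOne R ζ' := hfb.injOn (hp1 ζ hζ) (hp1 ζ' hζ') (by
      rw [hFp ζ hζ, hFp ζ' hζ', e])
    rcases (hc1.fiber ζ hζ ζ' hζ').1 h1 with h2 | h2
    · exact h2.symm
    · rw [h2, hFodd ζ hζ] at e
      have h3 := (hF0 ζ hζ).1 (self_eq_neg.1 e)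
      rw [h2, h3, neg_zero]
  · obtain ⟨z, hz, e⟩ := hfb.surjOn (show coverTwo R ω ∈ closedUnitDisc from
      hc2.image_closed ▸ mem_image_of_mem _ hω)
    obtain ⟨ζ, hζ, rfl⟩ := hc1.exists_preimage_closed hz
    rw [hFp ζ hζ] at e
    rcases (hc2.fiber _ (hFm hζ) _ hω).1 e with h2 | h2
    · exact ⟨ζ, hζ, h2.symm⟩
    · exact ⟨-ζ, hnegK ζ hζ, by rw [hFodd ζ hζ, h2]⟩

end lift


/-! ### Real-linear maps of the plane and the dilatation -/

lemma det_reCLM_smulRight_add (X Y : ℂ) :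
    (Complex.reCLM.smulRight X + Complex.imCLM.smulRight Y : ℂ →L[ℝ] ℂ).det =
      X.re * Y.im - X.im * Y.re := by
  rw [ContinuousLinearMap.det, ← LinearMap.det_toMatrix Complex.basisOneI, Matrix.det_fin_two]
  simp [LinearMap.toMatrix_apply]
  ring

/-- Multiplication by a complex number, as a real-linear map. -/
noncomputable def mulRealCLM (c : ℂ) : ℂ →L[ℝ] ℂ := ContinuousLinearMap.mul ℝ ℂ c

lemma mulRealCLM_apply (c h : ℂ) : mulRealCLM c h = c * h := rfl

lemma det_mulRealCLM (c : ℂ) : (mulRealCLM c).det = ‖c‖ ^ 2 := by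
  have : mulRealCLM c = Complex.reCLM.smulRight c + Complex.imCLM.smulRight (c * Complex.I) := by
    refine ContinuousLinearMap.ext fun h => ?_
    have e : h = h.re + h.im * Complex.I := (Complex.re_add_im h).symm
    simp only [mulRealCLM_apply, add_apply,
      ContinuousLinearMap.smulRight_apply, Complex.reCLM_apply, Complex.imCLM_apply,
      Complex.real_smul]
    linear_combination c * e
  rw [this, det_reCLM_smulRight_add, Complex.sq_norm, Complex.normSq_apply]
  simp

lemma HasDerivAt.hasFDerivAt_mulRealCLM {p : ℂ → ℂ} {p' w : ℂ} (h : HasDerivAt p p' w) :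
    HasFDerivAt p (mulRealCLM p') w := by
  have e : mulRealCLM p' = (ContinuousLinearMap.toSpanSingleton ℂ p').restrictScalars ℝ :=
    ContinuousLinearMap.ext fun h => by simp [mulRealCLM_apply, mul_comm]
  rw [e]
  exact h.hasFDerivAt.restrictScalars ℝ

lemma det_comp_comp (A B C : ℂ →L[ℝ] ℂ) :
    ((A.comp B).comp C).det = A.det * B.det * C.det := by
  simp only [ContinuousLinearMap.det, ContinuousLinearMap.toLinearMap_comp, LinearMap.det_comp]

section dilatation
variable {f : ℂ → ℂ}

lemma det_partialDeriv (z : ℂ) :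
    (partialDeriv f z).det = ‖wirtingerZ f z‖ ^ 2 - ‖wirtingerZbar f z‖ ^ 2 := by
  rw [partialDeriv, det_reCLM_smulRight_add, Complex.sq_norm, Complex.sq_norm,
    Complex.normSq_apply, Complex.normSq_apply, wirtingerZ, wirtingerZbar]
  simp
  ring

lemma partialDeriv_eq_wirtinger (z h : ℂ) :
    partialDeriv f z h = wirtingerZ f z * h + wirtingerZbar f z * star h := by
  rw [partialDeriv_apply, wirtingerZ, wirtingerZbar]
  have e1 : h = h.re + h.im * Complex.I := (Complex.re_add_im h).symm
  have e2 : star h = h.re - h.im * Complex.I := by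
    apply Complex.ext <;> simp
  rw [e2]
  nth_rewrite 3 [e1]
  linear_combination (partialY f z * h.im) * Complex.I_sq

lemma norm_partialDeriv_le (z h : ℂ) :
    ‖partialDeriv f z h‖ ≤ (‖wirtingerZ f z‖ + ‖wirtingerZbar f z‖) * ‖h‖ := by
  rw [partialDeriv_eq_wirtinger, add_mul]
  refine (norm_add_le _ _).trans ?_
  rw [norm_mul, norm_mul, norm_star]

lemma partialX_eq (z : ℂ) : partialX f z = partialDeriv f z 1 := by
  simp [partialDeriv_apply]

lemma partialY_eq (z : ℂ) : partialY f z = partialDeriv f z Complex.I := by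
  simp [partialDeriv_apply]

/-- The defining inequality of the dilatation, in the form `|Df|² ≤ K_f J_f`. -/
lemma IsKQuasiconformalOn.ae_sq_le {K : ℝ} {Ω : Set ℂ} (h : IsKQuasiconformalOn K f Ω) :
    ∀ᵐ z ∂(volume.restrict Ω), 0 ≤ (partialDeriv f z).det ∧ 0 ≤ qcDilatation f Ω ∧
      (‖wirtingerZ f z‖ + ‖wirtingerZbar f z‖) ^ 2 ≤
        qcDilatation f Ω * (partialDeriv f z).det := by
  have hK := h.one_le
  have hk0 : 0 ≤ (K - 1) / (K + 1) := div_nonneg (by linarith) (by linarith)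
  have hk1 : (K - 1) / (K + 1) < 1 := (div_lt_one (by linarith)).2 (by linarith)
  -- without a bound the essential supremum could be a junk value
  have hbdd : IsBoundedUnder (· ≤ ·) (ae (volume.restrict Ω))
      (fun z => (‖wirtingerZ f z‖ + ‖wirtingerZbar f z‖) /
        (‖wirtingerZ f z‖ - ‖wirtingerZbar f z‖)) := by
    refine ⟨K, ?_⟩
    rw [eventually_map]
    filter_upwards [h.dilatation] with z hz
    have h0 := norm_nonneg (wirtingerZ f z)
    rcases h0.eq_or_lt with h1 | h1
    · rw [← h1] at hz ⊢
      have : ‖wirtingerZbar f z‖ = 0 := le_antisymm (by simpa using hz) (norm_nonneg _)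
      rw [this]; simp; linarith
    · have h2 : ‖wirtingerZbar f z‖ < ‖wirtingerZ f z‖ := hz.trans_lt (mul_lt_of_lt_one_left h1 hk1)
      rw [div_le_iff₀ (sub_pos.2 h2)]
      have h3 : ‖wirtingerZbar f z‖ * (K + 1) ≤ (K - 1) * ‖wirtingerZ f z‖ := by
        rw [div_mul_eq_mul_div, le_div_iff₀ (by linarith)] at hz
        exact hz
      linarith
  filter_upwards [h.dilatation, ae_le_essSup hbdd] with z hz hz2
  change _ ≤ qcDilatation f Ω at hz2
  rw [det_partialDeriv]
  have h0 := norm_nonneg (wirtingerZ f z)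
  have hle : ‖wirtingerZbar f z‖ ≤ ‖wirtingerZ f z‖ :=
    hz.trans (mul_le_of_le_one_left h0 hk1.le)
  refine ⟨sub_nonneg.2 (pow_le_pow_left₀ (norm_nonneg _) hle 2),
    (div_nonneg (by positivity) (sub_nonneg.2 hle)).trans hz2, ?_⟩
  rcases h0.eq_or_lt with h1 | h1
  · rw [← h1] at hz ⊢
    have : ‖wirtingerZbar f z‖ = 0 := le_antisymm (by simpa using hz) (norm_nonneg _)
    rw [this]; simp
  · have h2 : ‖wirtingerZbar f z‖ < ‖wirtingerZ f z‖ := hz.trans_lt (mul_lt_of_lt_one_left h1 hk1)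
    rw [div_le_iff₀ (sub_pos.2 h2)] at hz2
    have h3 : 0 ≤ ‖wirtingerZ f z‖ + ‖wirtingerZbar f z‖ := by positivity
    calc _ = (‖wirtingerZ f z‖ + ‖wirtingerZbar f z‖) * (‖wirtingerZ f z‖ + ‖wirtingerZbar f z‖) := by
          ring
      _ ≤ (qcDilatation f Ω * (‖wirtingerZ f z‖ - ‖wirtingerZbar f z‖)) *
          (‖wirtingerZ f z‖ + ‖wirtingerZbar f z‖) := mul_le_mul_of_nonneg_right hz2 h3
      _ = _ := by ring

end dilatation

/-! ### Integration by parts on rectangles -/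

lemma setIntegral_reProdIm_horizontal {φ : ℂ → ℂ} {s t : Set ℝ}
    (hφ : IntegrableOn φ (s ×ℂ t)) :
    ∫ z in s ×ℂ t, φ z = ∫ y in t, ∫ x in s, φ ⟨x, y⟩ := by
  have e := Complex.volume_preserving_equiv_real_prod.symm
  have hemb := Complex.measurableEquivRealProd.symm.measurableEmbedding
  have hpre : Complex.measurableEquivRealProd.symm ⁻¹' (s ×ℂ t) = s ×ˢ t := by
    ext p; simp [Complex.mem_reProdIm]
  have h1 := e.setIntegral_preimage_emb hemb φ (s ×ℂ t)
  have h2 := (e.integrableOn_comp_preimage hemb (f := φ) (s := s ×ℂ t)).2 hφ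
  rw [hpre] at h1 h2
  rw [← h1, Measure.volume_eq_prod, ← setIntegral_prod_swap, setIntegral_prod]
  · rfl
  · exact h2.swap

lemma setIntegral_reProdIm_vertical {φ : ℂ → ℂ} {s t : Set ℝ}
    (hφ : IntegrableOn φ (s ×ℂ t)) :
    ∫ z in s ×ℂ t, φ z = ∫ x in s, ∫ y in t, φ ⟨x, y⟩ := by
  have e := Complex.volume_preserving_equiv_real_prod.symm
  have hemb := Complex.measurableEquivRealProd.symm.measurableEmbedding
  have hpre : Complex.measurableEquivRealProd.symm ⁻¹' (s ×ℂ t) = s ×ˢ t := by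
    ext p; simp [Complex.mem_reProdIm]
  have h1 := e.setIntegral_preimage_emb hemb φ (s ×ℂ t)
  have h2 := (e.integrableOn_comp_preimage hemb (f := φ) (s := s ×ℂ t)).2 hφ
  rw [hpre] at h1 h2
  rw [← h1, Measure.volume_eq_prod, setIntegral_prod]
  · rfl
  · exact h2

lemma ae_ae_vertical {P : ℂ → Prop} (h : ∀ᵐ z : ℂ, P z) : ∀ᵐ x : ℝ, ∀ᵐ y : ℝ, P ⟨x, y⟩ :=
  Measure.ae_ae_of_ae_prod
    (Complex.volume_preserving_equiv_real_prod.symm.quasiMeasurePreserving.ae h)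

lemma ae_ae_horizontal {P : ℂ → Prop} (h : ∀ᵐ z : ℂ, P z) : ∀ᵐ y : ℝ, ∀ᵐ x : ℝ, P ⟨x, y⟩ :=
  Measure.ae_ae_of_ae_prod (Measure.measurePreserving_swap.quasiMeasurePreserving.ae
    (Complex.volume_preserving_equiv_real_prod.symm.quasiMeasurePreserving.ae h))

lemma integrableOn_prod_of_reProdIm {φ : ℂ → ℂ} {s t : Set ℝ} (hφ : IntegrableOn φ (s ×ℂ t)) :
    Integrable (fun p : ℝ × ℝ => φ ⟨p.1, p.2⟩)
      ((volume.restrict s).prod (volume.restrict t)) := by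
  have hemb := Complex.measurableEquivRealProd.symm.measurableEmbedding
  have hpre : Complex.measurableEquivRealProd.symm ⁻¹' (s ×ℂ t) = s ×ˢ t := by
    ext p; simp [Complex.mem_reProdIm]
  have h2 := (Complex.volume_preserving_equiv_real_prod.symm.integrableOn_comp_preimage hemb
    (f := φ) (s := s ×ℂ t)).2 hφ
  rw [hpre, IntegrableOn, Measure.volume_eq_prod, ← Measure.prod_restrict] at h2
  exact h2

/-- The integral of the derivative of an absolutely continuous function vanishing at both end points
is zero. -/
lemma AbsolutelyContinuousOnInterval.setIntegral_Ioo_eq_zero {H h : ℝ → ℂ} {a b : ℝ} (hab : a ≤ b)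
    (hH : AbsolutelyContinuousOnInterval H a b) (ha : H a = 0) (hb : H b = 0)
    (hd : ∀ᵐ t : ℝ, t ∈ Ioo a b → HasDerivAt H (h t) t) (hi : IntegrableOn h (Ioo a b)) :
    ∫ t in Ioo a b, h t = 0 := by
  have hae : h =ᵐ[volume.restrict (Ioo a b)] deriv H := by
    rw [Filter.EventuallyEq, ae_restrict_iff' measurableSet_Ioo]
    filter_upwards [hd] with t ht hm using (ht hm).deriv.symm
  rw [integral_congr_ae hae, ← integral_Ioc_eq_integral_Ioo, ← intervalIntegral.integral_of_le hab,
    hH.integral_deriv_eq_sub_complex, ha, hb, sub_zero]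
  rw [intervalIntegrable_iff_integrableOn_Ioo_of_le hab]
  exact hi.congr hae

section green
variable {a b c d : ℝ} {G g : ℂ → ℂ} {l : ℂ → ℝ}

/-- Integration by parts in the horizontal direction for a function which is absolutely continuous
on almost every horizontal line. -/
lemma integral_horizontal_by_parts (hab : a < b) (hl : ContDiff ℝ 1 l)
    (hsupp : tsupport l ⊆ Ioo a b ×ℂ Ioo c d)
    (hac : ∀ᵐ y : ℝ, y ∈ Icc c d → AbsolutelyContinuousOnInterval (fun t : ℝ => G ⟨t, y⟩) a b)
    (hd : ∀ᵐ z : ℂ, z ∈ Ioo a b ×ℂ Ioo c d → HasDerivAt (fun t : ℝ => G ⟨t, z.im⟩) (g z) z.re)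
    (hi : IntegrableOn (fun z => g z * l z + G z * (fderiv ℝ l z 1 : ℝ)) (Ioo a b ×ℂ Ioo c d)) :
    ∫ z in Ioo a b ×ℂ Ioo c d, (g z * l z + G z * (fderiv ℝ l z 1 : ℝ)) = 0 := by
  rw [setIntegral_reProdIm_horizontal hi]
  have hsec := (integrableOn_prod_of_reProdIm hi).prod_left_ae
  have hd' := ae_ae_horizontal hd
  rw [setIntegral_congr_ae (g := fun _ => (0 : ℂ)) measurableSet_Ioo, integral_zero]
  rw [ae_restrict_iff' measurableSet_Ioo] at hsec
  filter_upwards [hac, hd', hsec] with y h1 h2 h3 hy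
  have hl0 : ∀ x : ℝ, x ∉ Ioo a b → l ⟨x, y⟩ = 0 := fun x hx =>
    image_eq_zero_of_notMem_tsupport fun hc => hx (hsupp hc).1
  have hline : ∀ x : ℝ, HasDerivAt (fun t : ℝ => (⟨t, y⟩ : ℂ)) 1 x := fun x => by
    have : (fun t : ℝ => (⟨t, y⟩ : ℂ)) = fun t : ℝ => (t : ℂ) + y * Complex.I := by
      funext t; apply Complex.ext <;> simp
    rw [this]
    exact (hasDerivAt_id x).ofReal_comp.add_const _
  have hlx : ∀ x : ℝ, HasDerivAt (fun t : ℝ => l ⟨t, y⟩) (fderiv ℝ l ⟨x, y⟩ 1) x := fun x =>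
    ((hl.differentiable one_ne_zero _).hasFDerivAt).comp_hasDerivAt x (hline x)
  have hlc : AbsolutelyContinuousOnInterval (fun t : ℝ => (l ⟨t, y⟩ : ℂ)) a b := by
    refine ContDiffOn.absolutelyContinuousOnInterval (ContDiff.contDiffOn ?_)
    have hc : ContDiff ℝ 1 (fun t : ℝ => (⟨t, y⟩ : ℂ)) := by
      have : (fun t : ℝ => (⟨t, y⟩ : ℂ)) = fun t : ℝ => (t : ℂ) + y * Complex.I := by
        funext t; apply Complex.ext <;> simp
      rw [this]
      exact Complex.ofRealCLM.contDiff.add contDiff_const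
    exact Complex.ofRealCLM.contDiff.comp (hl.comp hc)
  have h5 : AbsolutelyContinuousOnInterval (fun t : ℝ => G ⟨t, y⟩ * (l ⟨t, y⟩ : ℂ)) a b :=
    (h1 ⟨hy.1.le, hy.2.le⟩).fun_smul hlc
  refine h5.setIntegral_Ioo_eq_zero hab.le ?_ ?_ ?_ (h3 hy)
  · simp [hl0 a (by simp)]
  · simp [hl0 b (by simp)]
  · filter_upwards [h2] with x hx hxm
    exact (hx ⟨hxm, hy⟩).mul (hlx x).ofReal_comp

/-- Integration by parts in the vertical direction for a function which is absolutely continuous on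
almost every vertical line. -/
lemma integral_vertical_by_parts (hcd : c < d) (hl : ContDiff ℝ 1 l)
    (hsupp : tsupport l ⊆ Ioo a b ×ℂ Ioo c d)
    (hac : ∀ᵐ x : ℝ, x ∈ Icc a b → AbsolutelyContinuousOnInterval (fun t : ℝ => G ⟨x, t⟩) c d)
    (hd : ∀ᵐ z : ℂ, z ∈ Ioo a b ×ℂ Ioo c d → HasDerivAt (fun t : ℝ => G ⟨z.re, t⟩) (g z) z.im)
    (hi : IntegrableOn (fun z => g z * l z + G z * (fderiv ℝ l z Complex.I : ℝ))
      (Ioo a b ×ℂ Ioo c d)) :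
    ∫ z in Ioo a b ×ℂ Ioo c d, (g z * l z + G z * (fderiv ℝ l z Complex.I : ℝ)) = 0 := by
  rw [setIntegral_reProdIm_vertical hi]
  have hsec := (integrableOn_prod_of_reProdIm hi).prod_right_ae
  have hd' := ae_ae_vertical hd
  rw [setIntegral_congr_ae (g := fun _ => (0 : ℂ)) measurableSet_Ioo, integral_zero]
  rw [ae_restrict_iff' measurableSet_Ioo] at hsec
  filter_upwards [hac, hd', hsec] with x h1 h2 h3 hx
  have hl0 : ∀ y : ℝ, y ∉ Ioo c d → l ⟨x, y⟩ = 0 := fun y hy =>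
    image_eq_zero_of_notMem_tsupport fun hc => hy (hsupp hc).2
  have hline : ∀ y : ℝ, HasDerivAt (fun t : ℝ => (⟨x, t⟩ : ℂ)) Complex.I y := fun y => by
    have : (fun t : ℝ => (⟨x, t⟩ : ℂ)) = fun t : ℝ => (x : ℂ) + (t : ℂ) * Complex.I := by
      funext t; apply Complex.ext <;> simp
    rw [this]
    simpa using ((hasDerivAt_id y).ofReal_comp.mul_const Complex.I).const_add (x : ℂ)
  have hly : ∀ y : ℝ, HasDerivAt (fun t : ℝ => l ⟨x, t⟩) (fderiv ℝ l ⟨x, y⟩ Complex.I) y :=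
    fun y => ((hl.differentiable one_ne_zero _).hasFDerivAt).comp_hasDerivAt y (hline y)
  have hlc : AbsolutelyContinuousOnInterval (fun t : ℝ => (l ⟨x, t⟩ : ℂ)) c d := by
    refine ContDiffOn.absolutelyContinuousOnInterval (ContDiff.contDiffOn ?_)
    have hc : ContDiff ℝ 1 (fun t : ℝ => (⟨x, t⟩ : ℂ)) := by
      have : (fun t : ℝ => (⟨x, t⟩ : ℂ)) = fun t : ℝ => (x : ℂ) + (t : ℂ) * Complex.I := by
        funext t; apply Complex.ext <;> simp
      rw [this]
      exact contDiff_const.add (Complex.ofRealCLM.contDiff.mul contDiff_const)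
    exact Complex.ofRealCLM.contDiff.comp (hl.comp hc)
  have h5 : AbsolutelyContinuousOnInterval (fun t : ℝ => G ⟨x, t⟩ * (l ⟨x, t⟩ : ℂ)) c d :=
    (h1 ⟨hx.1.le, hx.2.le⟩).fun_smul hlc
  refine h5.setIntegral_Ioo_eq_zero hcd.le ?_ ?_ ?_ (h3 hx)
  · simp [hl0 c (by simp)]
  · simp [hl0 d (by simp)]
  · filter_upwards [h2] with y hy hym
    exact (hy ⟨hx, hym⟩).mul (hly y).ofReal_comp

end green


/-! ### The weak derivative of a lift: local form -/

section pullback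
variable {q : ℂ → ℂ} {l : ℂ → ℝ} {V K : Set ℂ}

/-- The pull-back of a test function `l` under a conformal map `q` of `V`, weighted by `q'` and
extended by zero. -/
noncomputable def pullbackTest (q : ℂ → ℂ) (l : ℂ → ℝ) (V : Set ℂ) : ℂ → ℂ :=
  V.indicator fun z => (l (q z) : ℂ) * deriv q z

lemma fderiv_pullbackTest_apply (hV : IsOpen V) (hq : DifferentiableOn ℂ q V)
    (hl : ContDiff ℝ 1 l) {z : ℂ} (hz : z ∈ V) (h : ℂ) :
    fderiv ℝ (pullbackTest q l V) z h =
      (fderiv ℝ l (q z) (deriv q z * h) : ℝ) * deriv q z + l (q z) * (deriv (deriv q) z * h) := by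
  have e : pullbackTest q l V =ᶠ[𝓝 z] fun z => (l (q z) : ℂ) * deriv q z := by
    filter_upwards [hV.mem_nhds hz] with y hy using indicator_of_mem hy _
  rw [e.fderiv_eq]
  have h1 := (hq.differentiableAt (hV.mem_nhds hz)).hasDerivAt.hasFDerivAt_mulRealCLM
  have h2 := ((hq.deriv hV).differentiableAt (hV.mem_nhds hz)).hasDerivAt.hasFDerivAt_mulRealCLM
  have h3 := Complex.ofRealCLM.hasFDerivAt.comp z
    (((hl.differentiable one_ne_zero (q z)).hasFDerivAt).comp z h1)
  have h4 : fderiv ℝ (fun z => (l (q z) : ℂ) * deriv q z) z = _ := (h3.mul h2).fderiv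
  rw [h4]
  simp [mulRealCLM_apply]
  ring

lemma contDiff_pullbackTest (hV : IsOpen V) (hq : DifferentiableOn ℂ q V) (hl : ContDiff ℝ 1 l)
    (hK : IsClosed K) (hKV : K ⊆ V) (h0 : ∀ z ∈ V, z ∉ K → l (q z) = 0) :
    ContDiff ℝ 1 (pullbackTest q l V) := by
  rw [contDiff_iff_contDiffAt]
  intro z
  by_cases hz : z ∈ V
  · have e : pullbackTest q l V =ᶠ[𝓝 z] fun z => (l (q z) : ℂ) * deriv q z := by
      filter_upwards [hV.mem_nhds hz] with y hy using indicator_of_mem hy _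
    refine ContDiffAt.congr_of_eventuallyEq ?_ e
    have h1 : ContDiffAt ℝ 1 q z :=
      ((hq.contDiffOn hV (n := 1)).contDiffAt (hV.mem_nhds hz)).restrict_scalars ℝ
    have h2 : ContDiffAt ℝ 1 (deriv q) z :=
      (((hq.deriv hV).contDiffOn hV (n := 1)).contDiffAt (hV.mem_nhds hz)).restrict_scalars ℝ
    exact (Complex.ofRealCLM.contDiff.contDiffAt.comp z (hl.contDiffAt.comp z h1)).mul h2
  · have e : pullbackTest q l V =ᶠ[𝓝 z] fun _ => 0 := by
      filter_upwards [hK.isOpen_compl.mem_nhds (fun hc => hz (hKV hc))] with y hy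
      by_cases hyV : y ∈ V
      · rw [pullbackTest, indicator_of_mem hyV, h0 y hyV hy]; simp
      · exact indicator_of_notMem hyV _
    exact contDiffAt_const.congr_of_eventuallyEq e

lemma tsupport_pullbackTest_subset (hK : IsClosed K) (h0 : ∀ z ∈ V, z ∉ K → l (q z) = 0) :
    tsupport (pullbackTest q l V) ⊆ K := by
  refine closure_minimal (fun z hz => ?_) hK
  by_contra hc
  refine hz ?_
  by_cases hzV : z ∈ V
  · rw [pullbackTest, indicator_of_mem hzV, h0 z hzV hc]; simp
  · exact indicator_of_notMem hzV _

end pullback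

/-- The derivative in the direction of the real axis of a lift `F`, with `p₂ ∘ F = f ∘ p₁`, computed
by the chain rule from the partial derivatives of `f`. -/
noncomputable def liftDeriv (f p₁ p₂ F : ℂ → ℂ) (w : ℂ) : ℂ :=
  partialDeriv f (p₁ w) (deriv p₁ w) / deriv p₂ (F w)

lemma fderiv_eq_re_mul_add_im_mul (l : ℂ → ℝ) (w h : ℂ) :
    fderiv ℝ l w h = h.re * fderiv ℝ l w 1 + h.im * fderiv ℝ l w Complex.I := by
  have e : h = h.re • (1 : ℂ) + h.im • Complex.I := by
    apply Complex.ext <;> simp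
  conv_lhs => rw [e, map_add, map_smul, map_smul]
  rfl

/-- The pointwise identity behind the change of variables in the weak derivative formula. -/
lemma pullback_identity {f : ℂ → ℂ} {l : ℂ → ℝ} {z w q' q'' m G : ℂ} (hq0 : q' ≠ 0) :
    (‖q'‖ ^ 2) • (partialDeriv f z q'⁻¹ * m * l w + G * (fderiv ℝ l w 1 : ℝ)) =
      partialX f z * m * ((l w : ℂ) * q').re +
          G * (((fderiv ℝ l w (q' * 1) : ℝ) * q' + l w * (q'' * 1)).re : ℝ) -
        (partialY f z * m * ((l w : ℂ) * q').im +
          G * (((fderiv ℝ l w (q' * Complex.I) : ℝ) * q' + l w * (q'' * Complex.I)).im : ℝ)) := by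
  have hn0 : (‖q'‖ ^ 2 : ℝ) ≠ 0 := pow_ne_zero 2 (norm_ne_zero_iff.2 hq0)
  have hinv : q'⁻¹ = ((‖q'‖ ^ 2)⁻¹ : ℝ) * star q' := by
    rw [Complex.inv_def, Complex.normSq_eq_norm_sq, mul_comm]; rfl
  have e1 : (q'⁻¹.re : ℂ) = ((‖q'‖ ^ 2 : ℝ) : ℂ)⁻¹ * q'.re := by
    rw [hinv, Complex.re_ofReal_mul]; simp
  have e2 : (q'⁻¹.im : ℂ) = -(((‖q'‖ ^ 2 : ℝ) : ℂ)⁻¹ * q'.im) := by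
    rw [hinv, Complex.im_ofReal_mul]; simp
  have hN : ((‖q'‖ ^ 2 : ℝ) : ℂ) = (q'.re : ℂ) ^ 2 + (q'.im : ℂ) ^ 2 := by
    rw [Complex.sq_norm, Complex.normSq_apply]; push_cast; ring
  have hNN : ((‖q'‖ ^ 2 : ℝ) : ℂ) * ((‖q'‖ ^ 2 : ℝ) : ℂ)⁻¹ = 1 :=
    mul_inv_cancel₀ (by exact_mod_cast hn0)
  rw [fderiv_eq_re_mul_add_im_mul l w (q' * 1), fderiv_eq_re_mul_add_im_mul l w (q' * Complex.I),
    partialDeriv_apply, e1, e2, Complex.real_smul, Complex.mul_I_re, Complex.mul_I_im]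
  simp only [Complex.add_re, Complex.add_im, Complex.mul_re, Complex.mul_im, Complex.ofReal_re,
    Complex.ofReal_im, Complex.I_re, Complex.I_im, mul_one, mul_zero, zero_mul, sub_zero, add_zero,
    zero_sub, Complex.ofReal_add, Complex.ofReal_mul, Complex.ofReal_neg,
    Complex.neg_re, Complex.neg_im, neg_zero]
  generalize ((‖q'‖ ^ 2 : ℝ) : ℂ) = N at *
  linear_combination ((q'.re * partialX f z - q'.im * partialY f z) * m * (l w : ℂ)) * hNN +
    G * (fderiv ℝ l w 1 : ℝ) * hN

/-- In a product chart the lift has the weak derivative given by the chain rule: this is a change of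
variables in the integration by parts formulas for the absolutely continuous functions obtained by
restricting `q₂ ∘ f` to horizontal and vertical lines, where `q₂` is the local inverse of `p₂`. -/
lemma integral_liftDeriv_local {f p₁ p₂ F q q₂ : ℂ → ℂ} {U U₂ : Set ℂ} {a b c d : ℝ}
    (hU : IsOpen U) (h1 : DifferentiableOn ℂ p₁ U) (hq : LeftInvOn q p₁ U)
    (hU₂ : IsOpen U₂) (h2 : DifferentiableOn ℂ p₂ U₂) (hq₂ : LeftInvOn q₂ p₂ U₂)
    (hFc : ContinuousOn F U) (hFm : MapsTo F U U₂) (hcomm : ∀ w ∈ U, f (p₁ w) = p₂ (F w))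
    (hf : Continuous f) (hab : a < b) (hcd : c < d) (hrect : Icc a b ×ℂ Icc c d ⊆ p₁ '' U)
    (hac : ∀ᵐ y : ℝ, y ∈ Icc c d → AbsolutelyContinuousOnInterval (fun t : ℝ => f ⟨t, y⟩) a b)
    (hac' : ∀ᵐ x : ℝ, x ∈ Icc a b → AbsolutelyContinuousOnInterval (fun t : ℝ => f ⟨x, t⟩) c d)
    (hdiff : ∀ᵐ z : ℂ, z ∈ Icc a b ×ℂ Icc c d → z ∈ diffX f ∧ z ∈ diffY f)
    (hfx : IntegrableOn (partialX f) (Icc a b ×ℂ Icc c d))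
    (hfy : IntegrableOn (partialY f) (Icc a b ×ℂ Icc c d))
    {l : ℂ → ℝ} (hl : ContDiff ℝ 1 l) (hlc : HasCompactSupport l)
    (hls : tsupport l ⊆ U ∩ p₁ ⁻¹' (Ioo a b ×ℂ Ioo c d)) :
    ∫ w in U ∩ p₁ ⁻¹' (Ioo a b ×ℂ Ioo c d),
      (liftDeriv f p₁ p₂ F w * l w + F w * (fderiv ℝ l w 1 : ℝ)) = 0 := by
  set Q := Icc a b ×ℂ Icc c d with hQ
  set V := Ioo a b ×ℂ Ioo c d with hV
  have hQc : IsCompact Q := isCompact_Icc.reProdIm isCompact_Icc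
  have hVo : IsOpen V := isOpen_Ioo.reProdIm isOpen_Ioo
  have hVQ : V ⊆ Q := fun z hz => ⟨Ioo_subset_Icc_self hz.1, Ioo_subset_Icc_self hz.2⟩
  have hVm : MeasurableSet V := hVo.measurableSet
  have hqU : ∀ z ∈ Q, q z ∈ U ∧ p₁ (q z) = z := by
    intro z hz
    obtain ⟨w, hw, rfl⟩ := hrect hz
    rw [hq hw]; exact ⟨hw, rfl⟩
  have hqd : DifferentiableOn ℂ q V :=
    (h1.differentiableOn_of_leftInvOn hU hq).mono (hVQ.trans hrect)
  have hqc : ContinuousOn q Q :=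
    ((h1.differentiableOn_of_leftInvOn hU hq).mono hrect).continuousOn
  have hq' : ∀ z ∈ Q, HasDerivAt q (deriv p₁ (q z))⁻¹ z := fun z hz => by
    have := h1.hasDerivAt_of_leftInvOn hU hq (hqU z hz).1
    rwa [(hqU z hz).2] at this
  have hp₁' : ∀ w ∈ U, deriv p₁ w ≠ 0 := fun w hw => h1.deriv_ne_zero_of_injOn hU hq.injOn hw
  have hfz : ∀ z ∈ Q, f z = p₂ (F (q z)) := fun z hz => by
    rw [← hcomm _ (hqU z hz).1, (hqU z hz).2]
  have hGF : ∀ z ∈ Q, q₂ (f z) = F (q z) := fun z hz => by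
    rw [hfz z hz, hq₂ (hFm (hqU z hz).1)]
  -- the derivative of the local inverse of `p₂` along `f`
  set m : ℂ → ℂ := fun z => (deriv p₂ (F (q z)))⁻¹ with hm
  have hmd : ∀ z ∈ Q, HasDerivAt q₂ (m z) (f z) := fun z hz => by
    rw [hfz z hz]; exact h2.hasDerivAt_of_leftInvOn hU₂ hq₂ (hFm (hqU z hz).1)
  have hFq : ContinuousOn (fun z => F (q z)) Q := hFc.comp hqc fun z hz => (hqU z hz).1
  have hmc : ContinuousOn m Q := by
    refine ContinuousOn.inv₀ ?_ fun z hz =>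
      h2.deriv_ne_zero_of_injOn hU₂ hq₂.injOn (hFm (hqU z hz).1)
    exact (h2.deriv hU₂).continuousOn.comp hFq fun z hz => hFm (hqU z hz).1
  have hGc : ContinuousOn (fun z => q₂ (f z)) Q := hFq.congr fun z hz => hGF z hz
  -- `q₂` is Lipschitz on the compact set `f '' Q`, so that `q₂ ∘ f` is absolutely continuous on the
  -- same lines as `f`
  obtain ⟨C, hC⟩ : ∃ C, LipschitzOnWith C q₂ (f '' Q) := by
    refine LocallyLipschitzOn.exists_lipschitzOnWith_of_compact (hQc.image hf) ?_
    rintro _ ⟨z, hz, rfl⟩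
    have hmem : f z ∈ p₂ '' U₂ := ⟨F (q z), hFm (hqU z hz).1, (hfz z hz).symm⟩
    have ho := h2.isOpen_image_of_injOn hU₂ hq₂.injOn
    have hcd2 : ContDiffAt ℂ 1 q₂ (f z) :=
      ((h2.differentiableOn_of_leftInvOn hU₂ hq₂).contDiffOn ho).contDiffAt (ho.mem_nhds hmem)
    obtain ⟨C, t, ht, hCt⟩ := hcd2.exists_lipschitzOnWith
    exact ⟨C, t, nhdsWithin_le_nhds ht, hCt⟩
  have hacG : ∀ᵐ y : ℝ, y ∈ Icc c d →
      AbsolutelyContinuousOnInterval (fun t : ℝ => q₂ (f ⟨t, y⟩)) a b := by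
    filter_upwards [hac] with y hy hyI
    refine hC.comp_absolutelyContinuousOnInterval (hy hyI) fun t ht => ?_
    rw [uIcc_of_le hab.le] at ht
    exact ⟨_, ⟨ht, hyI⟩, rfl⟩
  have hacG' : ∀ᵐ x : ℝ, x ∈ Icc a b →
      AbsolutelyContinuousOnInterval (fun t : ℝ => q₂ (f ⟨x, t⟩)) c d := by
    filter_upwards [hac'] with x hx hxI
    refine hC.comp_absolutelyContinuousOnInterval (hx hxI) fun t ht => ?_
    rw [uIcc_of_le hcd.le] at ht
    exact ⟨_, ⟨hxI, ht⟩, rfl⟩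
  have hdx : ∀ᵐ z : ℂ, z ∈ V →
      HasDerivAt (fun t : ℝ => q₂ (f ⟨t, z.im⟩)) (partialX f z * m z) z.re := by
    filter_upwards [hdiff] with z hz hzV
    have h3 := (differentiableAt_horizontal_iff (x := z.re) (y := z.im)).2 (hz (hVQ hzV)).1
    have h4 := h3.hasDerivAt
    rw [deriv_horizontal] at h4
    exact (hmd z (hVQ hzV)).scomp z.re h4
  have hdy : ∀ᵐ z : ℂ, z ∈ V →
      HasDerivAt (fun t : ℝ => q₂ (f ⟨z.re, t⟩)) (partialY f z * m z) z.im := by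
    filter_upwards [hdiff] with z hz hzV
    have h3 := (differentiableAt_vertical_iff (x := z.re) (y := z.im)).2 (hz (hVQ hzV)).2
    have h4 := h3.hasDerivAt
    rw [deriv_vertical] at h4
    exact (hmd z (hVQ hzV)).scomp z.im h4
  -- the transplanted test function
  set K := p₁ '' tsupport l with hK
  have hKc : IsCompact K :=
    hlc.isCompact.image_of_continuousOn (h1.continuousOn.mono (hls.trans inter_subset_left))
  have hKV : K ⊆ V := by
    rintro _ ⟨w, hw, rfl⟩; exact (hls hw).2
  have hK0 : ∀ z ∈ V, z ∉ K → l (q z) = 0 := fun z hz hzK =>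
    image_eq_zero_of_notMem_tsupport fun hc => hzK ⟨q z, hc, (hqU z (hVQ hz)).2⟩
  set L := pullbackTest q l V with hL
  have hLc : ContDiff ℝ 1 L := contDiff_pullbackTest hVo hqd hl hKc.isClosed hKV hK0
  have hLs : tsupport L ⊆ V := (tsupport_pullbackTest_subset hKc.isClosed hK0).trans hKV
  have hre : ContDiff ℝ 1 (fun z => (L z).re) := Complex.reCLM.contDiff.comp hLc
  have him : ContDiff ℝ 1 (fun z => (L z).im) := Complex.imCLM.contDiff.comp hLc
  have hres : tsupport (fun z => (L z).re) ⊆ V := by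
    refine (closure_mono fun z hz => ?_).trans hLs
    rw [Function.mem_support] at hz ⊢
    exact fun hc => hz (by rw [hc, Complex.zero_re])
  have hims : tsupport (fun z => (L z).im) ⊆ V := by
    refine (closure_mono fun z hz => ?_).trans hLs
    rw [Function.mem_support] at hz ⊢
    exact fun hc => hz (by rw [hc, Complex.zero_im])
  have hdre : ∀ z h, fderiv ℝ (fun z => (L z).re) z h = (fderiv ℝ L z h).re := fun z h => by
    have h5 : fderiv ℝ (fun z => (L z).re) z = _ :=
      (Complex.reCLM.hasFDerivAt.comp z (hLc.differentiable one_ne_zero z).hasFDerivAt).fderiv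
    rw [h5]; rfl
  have hdim : ∀ z h, fderiv ℝ (fun z => (L z).im) z h = (fderiv ℝ L z h).im := fun z h => by
    have h5 : fderiv ℝ (fun z => (L z).im) z = _ :=
      (Complex.imCLM.hasFDerivAt.comp z (hLc.differentiable one_ne_zero z).hasFDerivAt).fderiv
    rw [h5]; rfl
  have hint : ∀ {g : ℂ → ℂ} {s : ℂ → ℝ} {h : ℂ}, IntegrableOn g Q → ContDiff ℝ 1 s →
      IntegrableOn (fun z => g z * m z * s z + q₂ (f z) * (fderiv ℝ s z h : ℝ)) V := by
    intro g s h hg hs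
    refine IntegrableOn.mono_set (Integrable.add ?_ ?_) hVQ
    · refine IntegrableOn.mul_continuousOn (hg.mul_continuousOn hmc hQc) ?_ hQc
      exact (Complex.continuous_ofReal.comp hs.continuous).continuousOn
    · refine (hGc.mul ?_).integrableOn_compact hQc
      exact (Complex.continuous_ofReal.comp
        ((hs.continuous_fderiv one_ne_zero).clm_apply continuous_const)).continuousOn
  have hAi := hint hfx hre (h := 1)
  have hBi := hint hfy him (h := Complex.I)
  have hA : ∫ z in V, (partialX f z * m z * ((L z).re : ℝ) +
      q₂ (f z) * (fderiv ℝ (fun z => (L z).re) z 1 : ℝ)) = 0 :=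
    integral_horizontal_by_parts (G := fun z => q₂ (f z)) hab hre hres hacG hdx hAi
  have hB : ∫ z in V, (partialY f z * m z * ((L z).im : ℝ) +
      q₂ (f z) * (fderiv ℝ (fun z => (L z).im) z Complex.I : ℝ)) = 0 :=
    integral_vertical_by_parts (G := fun z => q₂ (f z)) hcd him hims hacG' hdy hBi
  have hAB := integral_sub hAi hBi
  rw [hA, hB, sub_zero] at hAB
  have himage : q '' V = U ∩ p₁ ⁻¹' V := by
    ext w
    constructor
    · rintro ⟨z, hz, rfl⟩
      refine ⟨(hqU z (hVQ hz)).1, ?_⟩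
      rw [mem_preimage, (hqU z (hVQ hz)).2]; exact hz
    · rintro ⟨hw, hwV⟩
      exact ⟨p₁ w, hwV, hq hw⟩
  have hqi : InjOn q V := fun z hz z' hz' e => by
    rw [← (hqU z (hVQ hz)).2, ← (hqU z' (hVQ hz')).2, e]
  -- the substitution `w = q z` turns the integral into the difference of the two formulas
  rw [← himage, integral_image_eq_integral_abs_det_fderiv_smul volume hVm
    (f' := fun z => mulRealCLM (deriv q z)) (fun z hz =>
      ((hqd.differentiableAt (hVo.mem_nhds hz)).hasDerivAt.hasFDerivAt_mulRealCLM).hasFDerivWithinAt)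
    hqi, ← hAB]
  refine setIntegral_congr_fun hVm fun z hz => ?_
  have hw := (hqU z (hVQ hz)).1
  have hp' : deriv p₁ (q z) = (deriv q z)⁻¹ := by rw [(hq' z (hVQ hz)).deriv, inv_inv]
  have hq0 : deriv q z ≠ 0 := by
    rw [(hq' z (hVQ hz)).deriv]; exact inv_ne_zero (hp₁' _ hw)
  have hLz : L z = (l (q z) : ℂ) * deriv q z := indicator_of_mem hz _
  simp only [hdre, hdim, hGF z (hVQ hz), liftDeriv, (hqU z (hVQ hz)).2, det_mulRealCLM,
    abs_of_nonneg (sq_nonneg ‖deriv q z‖), hp', div_eq_mul_inv]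
  rw [fderiv_pullbackTest_apply hVo hqd hl hz, fderiv_pullbackTest_apply hVo hqd hl hz, hLz]
  exact pullback_identity hq0


/-! ### Competitors: partial derivatives and their integrability -/

lemma measurableSet_unitDisc : MeasurableSet unitDisc := Metric.isOpen_ball.measurableSet

lemma AbsolutelyContinuousOnInterval.congr_of_eqOn {f g : ℝ → ℂ} {a b : ℝ}
    (hf : AbsolutelyContinuousOnInterval f a b) (h : EqOn f g (uIcc a b)) :
    AbsolutelyContinuousOnInterval g a b := by
  unfold AbsolutelyContinuousOnInterval at hf ⊢
  refine hf.congr' ?_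
  filter_upwards [mem_inf_of_right (mem_principal_self _)] with E hE
  refine Finset.sum_congr rfl fun i hi => ?_
  rw [h (hE.1 i hi).1, h (hE.1 i hi).2]

lemma partialX_congr {f g : ℂ → ℂ} {z : ℂ} (h : f =ᶠ[𝓝 z] g) : partialX f z = partialX g z := by
  refine Filter.EventuallyEq.deriv_eq ?_
  have : Tendsto (fun t : ℝ => z + (t : ℂ)) (𝓝 0) (𝓝 z) := by
    have hc : Continuous fun t : ℝ => z + (t : ℂ) := by fun_prop
    simpa using hc.tendsto 0
  exact this.eventually h

lemma partialY_congr {f g : ℂ → ℂ} {z : ℂ} (h : f =ᶠ[𝓝 z] g) : partialY f z = partialY g z := by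
  refine Filter.EventuallyEq.deriv_eq ?_
  have : Tendsto (fun t : ℝ => z + (t : ℂ) * Complex.I) (𝓝 0) (𝓝 z) := by
    have hc : Continuous fun t : ℝ => z + (t : ℂ) * Complex.I := by fun_prop
    simpa using hc.tendsto 0
  exact this.eventually h

lemma wirtinger_congr {f g : ℂ → ℂ} {z : ℂ} (h : f =ᶠ[𝓝 z] g) :
    wirtingerZ f z = wirtingerZ g z ∧ wirtingerZbar f z = wirtingerZbar g z := by
  simp only [wirtingerZ, wirtingerZbar, partialX_congr h, partialY_congr h, and_self]

lemma eventuallyEq_of_eqOn_closedUnitDisc {f g : ℂ → ℂ} (h : EqOn f g closedUnitDisc) {z : ℂ}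
    (hz : z ∈ unitDisc) : f =ᶠ[𝓝 z] g := by
  filter_upwards [Metric.isOpen_ball.mem_nhds hz] with y hy
    using h (Metric.ball_subset_closedBall hy)

lemma qcDilatation_congr {f g : ℂ → ℂ} (h : EqOn f g closedUnitDisc) :
    qcDilatation f unitDisc = qcDilatation g unitDisc := by
  refine essSup_congr_ae ?_
  filter_upwards [ae_restrict_mem Metric.isOpen_ball.measurableSet] with z hz
  obtain ⟨h1, h2⟩ := wirtinger_congr (eventuallyEq_of_eqOn_closedUnitDisc h hz)
  rw [h1, h2]

namespace IsDiscShift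
variable {x : ℝ} {f g : ℂ → ℂ}

/-- Only the values on the closed disc matter. -/
lemma congr (hf : IsDiscShift x f) (h : EqOn f g closedUnitDisc) : IsDiscShift x g := by
  have hsub : unitDisc ⊆ closedUnitDisc := Metric.ball_subset_closedBall
  have hd : EqOn f g unitDisc := h.mono hsub
  obtain ⟨K, hK⟩ := hf.qc
  refine ⟨⟨K, hK.one_le, hK.isOpen, ?_, ?_, ?_⟩, hd.image_eq.symm.trans hf.image,
    hf.cont.congr h.symm, fun z hz => ?_, ?_⟩
  · have : (fun z : unitDisc => g z) = fun z : unitDisc => f z := funext fun z => (hd z.2).symm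
    rw [this]; exact hK.isEmbedding
  · intro a b c d hab hcd hQ
    obtain ⟨h1, h2⟩ := hK.acl a b c d hab hcd hQ
    constructor
    · filter_upwards [h1] with y hy hyI
      refine (hy hyI).congr_of_eqOn fun t ht => hd (hQ ⟨?_, hyI⟩)
      rwa [uIcc_of_le hab.le] at ht
    · filter_upwards [h2] with y hy hyI
      refine (hy hyI).congr_of_eqOn fun t ht => hd (hQ ⟨hyI, ?_⟩)
      rwa [uIcc_of_le hcd.le] at ht
  · filter_upwards [hK.dilatation, ae_restrict_mem Metric.isOpen_ball.measurableSet] with z hz hzD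
    obtain ⟨h1, h2⟩ := wirtinger_congr (eventuallyEq_of_eqOn_closedUnitDisc h hzD)
    rwa [h1, h2] at hz
  · rw [← h (show z ∈ closedUnitDisc by simp [closedUnitDisc, hz])]; exact hf.boundary z hz
  · rw [← h (show (0 : ℂ) ∈ closedUnitDisc by simp [closedUnitDisc])]; exact hf.map_zero

/-- A competitor may be modified outside the closed disc so as to be continuous in the plane. -/
lemma exists_continuous_eqOn (hf : IsDiscShift x f) :
    ∃ g : ℂ → ℂ, Continuous g ∧ EqOn f g closedUnitDisc := by
  -- composition with the radial retraction onto the closed disc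
  refine ⟨fun z => f (z / (max 1 ‖z‖ : ℝ)), ?_, fun z hz => ?_⟩
  · refine hf.cont.comp_continuous ?_ fun z => ?_
    · refine continuous_id.div (Complex.continuous_ofReal.comp (by fun_prop)) fun z => ?_
      have : (0 : ℝ) < max 1 ‖z‖ := lt_max_of_lt_left one_pos
      exact_mod_cast this.ne'
    · have : (0 : ℝ) < max 1 ‖z‖ := lt_max_of_lt_left one_pos
      rw [closedUnitDisc, mem_closedBall_zero_iff, norm_div, Complex.norm_real,
        Real.norm_of_nonneg this.le, div_le_one this]
      exact le_max_right _ _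
  · have : ‖z‖ ≤ 1 := by simpa [closedUnitDisc] using hz
    simp [max_eq_left this]

lemma ae_diff (hf : IsDiscShift x f) (hc : Continuous f) :
    ∀ᵐ z : ℂ, z ∈ unitDisc → z ∈ diffX f ∧ z ∈ diffY f := by
  obtain ⟨K, hK⟩ := hf.qc
  exact hK.acl.ae_diff hc Metric.isOpen_ball

/-- A competitor is differentiable on each of countably many sets which exhaust the disc up to a
null set. -/
lemma exists_seq (hf : IsDiscShift x f) (hc : Continuous f) :
    ∃ E : ℕ → Set ℂ, (∀ k, MeasurableSet (E k)) ∧ (∀ k, E k ⊆ unitDisc) ∧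
      volume (unitDisc \ ⋃ k, E k) = 0 ∧
      ∀ k, ∀ z ∈ E k, HasFDerivWithinAt f (partialDeriv f z) (E k) z :=
  exists_seq_hasFDerivWithinAt hc Metric.isOpen_ball.measurableSet
    measure_ball_lt_top.ne (hf.ae_diff hc)

end IsDiscShift

lemma measurable_det_partialDeriv {f : ℂ → ℂ} (hc : Continuous f) :
    Measurable fun z => (partialDeriv f z).det := by
  have h1 := measurable_partialX hc
  have h2 := measurable_partialY hc
  simp only [partialDeriv, det_reCLM_smulRight_add]
  exact ((Complex.measurable_re.comp h1).mul (Complex.measurable_im.comp h2)).sub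
    ((Complex.measurable_im.comp h1).mul (Complex.measurable_re.comp h2))

lemma norm_le_one_add_sq {E : Type*} [SeminormedAddGroup E] (v : E) : ‖v‖ ≤ 1 + ‖v‖ ^ 2 := by
  nlinarith [sq_nonneg (‖v‖ - 1), norm_nonneg v]

/-- A function whose square is dominated by an integrable function is integrable on a set of finite
measure. -/
lemma IntegrableOn.of_sq_le {φ : ℂ → ℂ} {g : ℂ → ℝ} {s : Set ℂ} (hs : volume s ≠ ⊤)
    (hφ : AEStronglyMeasurable φ (volume.restrict s)) (hg : IntegrableOn g s)
    (h : ∀ᵐ z ∂(volume.restrict s), ‖φ z‖ ^ 2 ≤ g z) : IntegrableOn φ s := by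
  have h1 : IntegrableOn (fun z => 1 + g z) s := (integrableOn_const hs).add hg
  refine Integrable.mono' h1 hφ ?_
  filter_upwards [h] with z hz
  linarith [norm_le_one_add_sq (φ z)]

namespace IsDiscShift
variable {x : ℝ} {f : ℂ → ℂ}

/-- The Jacobian of a competitor is integrable, by the area inequality. -/
lemma integrableOn_det (hf : IsDiscShift x f) (hc : Continuous f) :
    IntegrableOn (fun z => (partialDeriv f z).det) unitDisc := by
  obtain ⟨E, hE, hED, hnull, hd⟩ := hf.exists_seq hc
  have hi : InjOn f unitDisc := hf.injOn.mono Metric.ball_subset_closedBall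
  have h1 := lintegral_abs_det_le_of_seq hi hE hED hnull hd
  rw [hf.image] at h1
  refine ⟨(measurable_det_partialDeriv hc).aestronglyMeasurable, ?_⟩
  rw [hasFiniteIntegral_iff_norm]
  exact h1.trans_lt measure_ball_lt_top

/-- The partial derivatives of a competitor are square integrable, hence integrable: their squares
are at most `K` times the Jacobian. -/
lemma integrableOn_partial (hf : IsDiscShift x f) (hc : Continuous f) :
    IntegrableOn (partialX f) unitDisc ∧ IntegrableOn (partialY f) unitDisc := by
  obtain ⟨K, hK⟩ := hf.qc
  have hdet := (hf.integrableOn_det hc).const_mul (qcDilatation f unitDisc)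
  have key : ∀ h : ℂ, ‖h‖ = 1 → ∀ᵐ z ∂(volume.restrict unitDisc),
      ‖partialDeriv f z h‖ ^ 2 ≤ qcDilatation f unitDisc * (partialDeriv f z).det := by
    intro h hh
    filter_upwards [hK.ae_sq_le] with z hz
    have := norm_partialDeriv_le (f := f) z h
    rw [hh, mul_one] at this
    exact (pow_le_pow_left₀ (norm_nonneg _) this 2).trans hz.2.2
  constructor
  · refine IntegrableOn.of_sq_le measure_ball_lt_top.ne
      (measurable_partialX hc).aestronglyMeasurable hdet ?_
    simpa only [partialX_eq] using key 1 (by simp)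
  · refine IntegrableOn.of_sq_le measure_ball_lt_top.ne
      (measurable_partialY hc).aestronglyMeasurable hdet ?_
    simpa only [partialY_eq] using key Complex.I (by simp)

end IsDiscShift

/-! ### The Jacobian of a lift -/

/-- `F` is a lift of `f` to a map of the closed ellipses which cover the disc. -/
structure IsEllipseLift (a b a' b' : ℝ) (p₁ p₂ f F : ℂ → ℂ) : Prop where
  cover₁ : IsEllipseCover a b (p₁ 0) p₁
  cover₂ : IsEllipseCover a' b' (p₂ 0) p₂
  cont : ContinuousOn F (closedEllipse a b)
  bij : BijOn F (closedEllipse a b) (closedEllipse a' b')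
  map_zero : F 0 = 0
  comm : ∀ w ∈ closedEllipse a b, f (p₁ w) = p₂ (F w)

/-- The derivative of a lift, computed by the chain rule. -/
noncomputable def liftFDeriv (f p₁ p₂ F : ℂ → ℂ) (w : ℂ) : ℂ →L[ℝ] ℂ :=
  ((mulRealCLM (deriv p₂ (F w))⁻¹).comp (partialDeriv f (p₁ w))).comp (mulRealCLM (deriv p₁ w))

/-- The preimage of a null set under a locally injective holomorphic map is a null set. -/
lemma volume_inter_preimage_eq_zero {p : ℂ → ℂ} {Ω N : Set ℂ} (hp : DifferentiableOn ℂ p Ω)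
    (hi : ∀ w ∈ Ω, ∃ U : Set ℂ, IsOpen U ∧ w ∈ U ∧ U ⊆ Ω ∧ InjOn p U) (hN : volume N = 0) :
    volume (Ω ∩ p ⁻¹' N) = 0 := by
  refine measure_null_of_locally_null _ fun w hw => ?_
  obtain ⟨U, hU, hwU, hUΩ, hUi⟩ := hi w hw.1
  refine ⟨U ∩ (Ω ∩ p ⁻¹' N), inter_mem (mem_nhdsWithin_of_mem_nhds (hU.mem_nhds hwU))
    self_mem_nhdsWithin, ?_⟩
  have hq := hUi.leftInvOn_invFunOn
  set q := Function.invFunOn p U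
  have hqd := (hp.mono hUΩ).differentiableOn_of_leftInvOn hU hq
  have h1 : U ∩ (Ω ∩ p ⁻¹' N) ⊆ q '' (p '' U ∩ N) := fun y hy =>
    ⟨p y, ⟨⟨y, hy.1, rfl⟩, hy.2.2⟩, hq hy.1⟩
  refine measure_mono_null h1 (addHaar_image_eq_zero_of_differentiableOn_of_addHaar_eq_zero
    volume ?_ (measure_mono_null inter_subset_right hN))
  intro z hz
  exact (((hqd.mono inter_subset_left) z hz).restrictScalars ℝ)

namespace IsEllipseLift
variable {a b a' b' x : ℝ} {p₁ p₂ f F : ℂ → ℂ}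

lemma map_mem_ellipse (h : IsEllipseLift a b a' b' p₁ p₂ f F) (hf : IsDiscShift x f) {w : ℂ}
    (hw : w ∈ ellipse a b) : F w ∈ ellipse a' b' := by
  have hwc := ellipse_subset_closedEllipse _ _ hw
  rw [← h.cover₂.mem_unitDisc_iff (h.bij.mapsTo hwc), ← h.comm w hwc, ← hf.image]
  exact ⟨_, (h.cover₁.mem_unitDisc_iff hwc).2 hw, rfl⟩

lemma ne_zero (h : IsEllipseLift a b a' b' p₁ p₂ f F) {w : ℂ} (hw : w ∈ ellipse a b)
    (h0 : w ≠ 0) : F w ≠ 0 := fun hF =>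
  h0 (h.bij.injOn (ellipse_subset_closedEllipse _ _ hw)
    (ellipse_subset_closedEllipse _ _ (zero_mem_ellipse _ _)) (by rw [hF, h.map_zero]))

/-- Away from the origin both coverings have compatible local inverses. -/
lemma exists_local (h : IsEllipseLift a b a' b' p₁ p₂ f F) (hf : IsDiscShift x f) {w : ℂ}
    (hw : w ∈ ellipse a b) (h0 : w ≠ 0) :
    ∃ (U U₂ : Set ℂ) (q q₂ : ℂ → ℂ), IsOpen U ∧ w ∈ U ∧ U ⊆ ellipse a b ∧ (0 : ℂ) ∉ U ∧
      LeftInvOn q p₁ U ∧ IsOpen U₂ ∧ U₂ ⊆ ellipse a' b' ∧ LeftInvOn q₂ p₂ U₂ ∧ MapsTo F U U₂ := by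
  obtain ⟨U₁, hU₁, hwU, hUE, h0U, hi⟩ := h.cover₁.exists_injOn_nhds hw h0
  obtain ⟨U₂, hU₂, hwU₂, hUE₂, -, hi₂⟩ :=
    h.cover₂.exists_injOn_nhds (h.map_mem_ellipse hf hw) (h.ne_zero hw h0)
  have hFc : ContinuousOn F U₁ := h.cont.mono (hUE.trans (ellipse_subset_closedEllipse _ _))
  exact ⟨U₁ ∩ F ⁻¹' U₂, U₂, Function.invFunOn p₁ U₁, Function.invFunOn p₂ U₂,
    hFc.isOpen_inter_preimage hU₁ hU₂, ⟨hwU, hwU₂⟩, inter_subset_left.trans hUE,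
    fun hc => h0U hc.1, hi.leftInvOn_invFunOn.mono inter_subset_left, hU₂, hUE₂,
    hi₂.leftInvOn_invFunOn, fun y hy => hy.2⟩

/-- Off the centre the lift is locally the composition of the first covering, of `f`, and of a
holomorphic branch of the inverse of the second covering. -/
lemma hasFDerivWithinAt (h : IsEllipseLift a b a' b' p₁ p₂ f F) (hf : IsDiscShift x f) {E : Set ℂ}
    {w : ℂ} (hw : w ∈ ellipse a b) (h0 : w ≠ 0)
    (hE : HasFDerivWithinAt f (partialDeriv f (p₁ w)) E (p₁ w)) :
    HasFDerivWithinAt F (liftFDeriv f p₁ p₂ F w) (p₁ ⁻¹' E) w := by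
  obtain ⟨U, U₂, q, q₂, hU, hwU, hUE, -, hq, hU₂, hUE₂, hq₂, hm⟩ := h.exists_local hf hw h0
  have h1 := (h.cover₁.differentiableAt hw).hasDerivAt.hasFDerivAt_mulRealCLM
  have hcw := h.comm w (ellipse_subset_closedEllipse _ _ hw)
  have h2 := ((h.cover₂.holo.mono hUE₂).hasDerivAt_of_leftInvOn hU₂ hq₂
    (hm hwU)).hasFDerivAt_mulRealCLM
  rw [← hcw] at h2
  have h3 := (h2.comp_hasFDerivWithinAt (p₁ w) hE).comp w h1.hasFDerivWithinAt
    (mapsTo_preimage p₁ E)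
  have hev : ∀ y ∈ U, F y = q₂ (f (p₁ y)) := fun y hy => by
    rw [h.comm y (ellipse_subset_closedEllipse _ _ (hUE hy)), hq₂ (hm hy)]
  refine h3.congr_of_eventuallyEq ?_ (hev w hwU)
  filter_upwards [mem_nhdsWithin_of_mem_nhds (hU.mem_nhds hwU)] with y hy using hev y hy

lemma locally_injOn (h : IsEllipseLift a b a' b' p₁ p₂ f F) :
    ∀ w ∈ ellipse a b \ {0}, ∃ U : Set ℂ, IsOpen U ∧ w ∈ U ∧ U ⊆ ellipse a b \ {0} ∧
      InjOn p₁ U := by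
  intro w hw
  obtain ⟨U, hU, hwU, hUE, h0U, hi⟩ := h.cover₁.exists_injOn_nhds hw.1 hw.2
  exact ⟨U, hU, hwU, fun y hy => ⟨hUE hy, fun hc => h0U (hc ▸ hy)⟩, hi⟩

/-- A property which holds almost everywhere in the disc holds almost everywhere in the ellipse,
after composition with the covering. -/
lemma ae_comp (h : IsEllipseLift a b a' b' p₁ p₂ f F) {P : ℂ → Prop}
    (hP : ∀ᵐ z ∂(volume.restrict unitDisc), P z) :
    ∀ᵐ w ∂(volume.restrict (ellipse a b)), w ≠ 0 ∧ P (p₁ w) := by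
  rw [ae_restrict_iff' measurableSet_unitDisc] at hP
  rw [ae_restrict_iff' (isOpen_ellipse _ _).measurableSet]
  have h1 := volume_inter_preimage_eq_zero (h.cover₁.holo.mono sdiff_subset) h.locally_injOn hP
  have h2 : ∀ᵐ w : ℂ, w ∉ (ellipse a b \ {0}) ∩ p₁ ⁻¹' {z | z ∈ unitDisc → P z}ᶜ :=
    measure_eq_zero_iff_ae_notMem.1 h1
  have h3 : ∀ᵐ w : ℂ, w ≠ 0 := by simp [ae_iff]
  filter_upwards [h2, h3] with w hw hw0 hwE
  refine ⟨hw0, ?_⟩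
  by_contra hc
  refine hw ⟨⟨hwE, hw0⟩, fun hz => hc (hz ?_)⟩
  exact (h.cover₁.mem_unitDisc_iff (ellipse_subset_closedEllipse _ _ hwE)).2 hwE

/-- The area inequality for a lift. -/
lemma lintegral_abs_det_le (h : IsEllipseLift a b a' b' p₁ p₂ f F) (hf : IsDiscShift x f)
    (hc : Continuous f) :
    ∫⁻ w in ellipse a b, ENNReal.ofReal |(liftFDeriv f p₁ p₂ F w).det| ≤
      volume (ellipse a' b') := by
  obtain ⟨E, hE, hED, hnull, hd⟩ := hf.exists_seq hc
  have hEo := isOpen_ellipse a b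
  have hpm : ContinuousOn p₁ (ellipse a b) := h.cover₁.holo.continuousOn
  set S : ℕ → Set ℂ := fun k => (ellipse a b ∩ p₁ ⁻¹' E k) \ {0} with hS
  have hSm : ∀ k, MeasurableSet (S k) := by
    intro k
    refine MeasurableSet.diff ?_ (measurableSet_singleton 0)
    have h1 := (continuousOn_iff_continuous_domRestrict.1 hpm).measurable (hE k)
    have h2 := hEo.measurableSet.subtype_image h1
    convert h2 using 1
    ext w
    simp [Set.domRestrict, and_comm]
  have hnull' : volume (ellipse a b \ ⋃ k, S k) = 0 := by
    have h1 : ∀ᵐ z ∂(volume.restrict unitDisc), z ∈ ⋃ k, E k := by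
      rw [ae_restrict_iff' measurableSet_unitDisc]
      filter_upwards [measure_eq_zero_iff_ae_notMem.1 hnull] with z hz hzD
      by_contra hcc
      exact hz ⟨hzD, hcc⟩
    have h2 := h.ae_comp h1
    rw [ae_restrict_iff' hEo.measurableSet] at h2
    rw [measure_eq_zero_iff_ae_notMem]
    filter_upwards [h2] with w hw hwS
    obtain ⟨h3, h4⟩ := hw hwS.1
    obtain ⟨k, hk⟩ := mem_iUnion.1 h4
    exact hwS.2 (mem_iUnion.2 ⟨k, ⟨hwS.1, hk⟩, h3⟩)
  refine (lintegral_abs_det_le_of_seq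
    (h.bij.injOn.mono (ellipse_subset_closedEllipse _ _)) hSm (fun k w hw => hw.1.1) hnull'
    fun k w hw => ((h.hasFDerivWithinAt hf hw.1.1 hw.2 (hd k _ hw.1.2)).mono ?_)).trans
    (measure_mono ?_)
  · exact fun y hy => hy.1.2
  · rintro _ ⟨w, hw, rfl⟩; exact h.map_mem_ellipse hf hw

end IsEllipseLift


lemma volume_ellipse_lt_top {a b : ℝ} (ha : 0 < a) (hb : 0 < b) : volume (ellipse a b) < ⊤ :=
  (measure_mono (ellipse_subset_closedEllipse _ _)).trans_lt
    (isCompact_closedEllipse ha hb).measure_lt_top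

lemma integrableOn_mul_add_mul_fderiv {a b : ℝ} {T H : ℂ → ℂ} (hT : IntegrableOn T (ellipse a b))
    (hH : ContinuousOn H (closedEllipse a b)) (ha : 0 < a) (hb : 0 < b) {l : ℂ → ℝ}
    (hl : ContDiff ℝ 1 l) :
    IntegrableOn (fun w => T w * l w + H w * (fderiv ℝ l w 1 : ℝ)) (ellipse a b) := by
  have hK := isCompact_closedEllipse ha hb
  refine Integrable.add ?_ ?_
  · exact hT.mul_continuousOn_of_subset
      (Complex.continuous_ofReal.comp hl.continuous).continuousOn
      (isOpen_ellipse _ _).measurableSet hK (ellipse_subset_closedEllipse _ _)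
  · refine IntegrableOn.mono_set ?_ (ellipse_subset_closedEllipse _ _)
    refine (hH.mul ?_).integrableOn_compact hK
    exact (Complex.continuous_ofReal.comp
      ((hl.continuous_fderiv one_ne_zero).clm_apply continuous_const)).continuousOn

namespace IsEllipseLift
variable {a b a' b' x : ℝ} {p₁ p₂ f F : ℂ → ℂ}

lemma aemeasurable (h : IsEllipseLift a b a' b' p₁ p₂ f F) (hf : IsDiscShift x f) :
    AEMeasurable p₁ (volume.restrict (ellipse a b)) ∧
      AEMeasurable (deriv p₁) (volume.restrict (ellipse a b)) ∧
      AEMeasurable (fun w => deriv p₂ (F w)) (volume.restrict (ellipse a b)) := by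
  have hm := (isOpen_ellipse a b).measurableSet
  refine ⟨h.cover₁.holo.continuousOn.aemeasurable hm,
    (h.cover₁.holo.deriv (isOpen_ellipse _ _)).continuousOn.aemeasurable hm, ?_⟩
  refine ContinuousOn.aemeasurable ?_ hm
  exact (h.cover₂.holo.deriv (isOpen_ellipse _ _)).continuousOn.comp
    (h.cont.mono (ellipse_subset_closedEllipse _ _)) fun _ hw => h.map_mem_ellipse hf hw

lemma det_liftFDeriv (w : ℂ) : (liftFDeriv f p₁ p₂ F w).det =
    ‖(deriv p₂ (F w))⁻¹‖ ^ 2 * (partialDeriv f (p₁ w)).det * ‖deriv p₁ w‖ ^ 2 := by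
  rw [liftFDeriv, det_comp_comp, det_mulRealCLM, det_mulRealCLM]

/-- Composition with the coverings preserves the inequality `|Df|² ≤ K_f J_f`, since they multiply
both sides by the same factor. -/
lemma ae_sq_le (h : IsEllipseLift a b a' b' p₁ p₂ f F) (hf : IsDiscShift x f) :
    ∀ᵐ w ∂(volume.restrict (ellipse a b)), 0 ≤ (liftFDeriv f p₁ p₂ F w).det ∧
      ‖liftDeriv f p₁ p₂ F w‖ ^ 2 ≤
        qcDilatation f unitDisc * (liftFDeriv f p₁ p₂ F w).det := by
  obtain ⟨K, hK⟩ := hf.qc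
  filter_upwards [h.ae_comp hK.ae_sq_le] with w hw
  obtain ⟨-, h1, h2, h3⟩ := hw
  rw [det_liftFDeriv]
  refine ⟨by positivity, ?_⟩
  have h4 := norm_partialDeriv_le (f := f) (p₁ w) (deriv p₁ w)
  rw [liftDeriv, div_eq_mul_inv, norm_mul, mul_pow]
  calc _ ≤ ((‖wirtingerZ f (p₁ w)‖ + ‖wirtingerZbar f (p₁ w)‖) * ‖deriv p₁ w‖) ^ 2 *
        ‖(deriv p₂ (F w))⁻¹‖ ^ 2 :=
        mul_le_mul_of_nonneg_right (pow_le_pow_left₀ (norm_nonneg _) h4 2) (sq_nonneg _)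
    _ = (‖wirtingerZ f (p₁ w)‖ + ‖wirtingerZbar f (p₁ w)‖) ^ 2 * (‖deriv p₁ w‖ ^ 2 *
        ‖(deriv p₂ (F w))⁻¹‖ ^ 2) := by ring
    _ ≤ (qcDilatation f unitDisc * (partialDeriv f (p₁ w)).det) * (‖deriv p₁ w‖ ^ 2 *
        ‖(deriv p₂ (F w))⁻¹‖ ^ 2) := mul_le_mul_of_nonneg_right h3 (by positivity)
    _ = _ := by ring

lemma integrableOn_det (h : IsEllipseLift a b a' b' p₁ p₂ f F) (hf : IsDiscShift x f)
    (hc : Continuous f) (ha : 0 < a') (hb : 0 < b') :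
    IntegrableOn (fun w => (liftFDeriv f p₁ p₂ F w).det) (ellipse a b) := by
  obtain ⟨h1, h2, h3⟩ := h.aemeasurable hf
  constructor
  · simp only [det_liftFDeriv]
    exact (((h3.inv.norm.pow_const 2).mul ((measurable_det_partialDeriv hc).comp_aemeasurable
      h1)).mul (h2.norm.pow_const 2)).aestronglyMeasurable
  · rw [hasFiniteIntegral_iff_norm]
    exact (h.lintegral_abs_det_le hf hc).trans_lt (volume_ellipse_lt_top ha hb)

/-- The area of the image bounds the integral of the Jacobian of a lift. -/
lemma integral_det_le (h : IsEllipseLift a b a' b' p₁ p₂ f F) (hf : IsDiscShift x f)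
    (hc : Continuous f) (ha : 0 < a') (hb : 0 < b') :
    ∫ w in ellipse a b, (liftFDeriv f p₁ p₂ F w).det ≤ volume.real (ellipse a' b') := by
  have h0 : ∀ᵐ w ∂(volume.restrict (ellipse a b)), 0 ≤ (liftFDeriv f p₁ p₂ F w).det :=
    (h.ae_sq_le hf).mono fun _ hw => hw.1
  rw [integral_eq_lintegral_of_nonneg_ae h0 (h.integrableOn_det hf hc ha hb).1]
  refine ENNReal.toReal_mono (volume_ellipse_lt_top ha hb).ne ?_
  refine (lintegral_mono_ae ?_).trans (h.lintegral_abs_det_le hf hc)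
  filter_upwards with _ using ENNReal.ofReal_le_ofReal (le_abs_self _)

lemma aestronglyMeasurable_liftDeriv (h : IsEllipseLift a b a' b' p₁ p₂ f F)
    (hf : IsDiscShift x f) (hc : Continuous f) :
    AEStronglyMeasurable (liftDeriv f p₁ p₂ F) (volume.restrict (ellipse a b)) := by
  obtain ⟨h1, h2, h3⟩ := h.aemeasurable hf
  have h4 := (measurable_partialX hc).comp_aemeasurable h1
  have h5 := (measurable_partialY hc).comp_aemeasurable h1
  have e : liftDeriv f p₁ p₂ F = fun w => ((deriv p₁ w).re * partialX f (p₁ w) +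
      (deriv p₁ w).im * partialY f (p₁ w)) / deriv p₂ (F w) :=
    funext fun w => by rw [liftDeriv, partialDeriv_apply]
  rw [e]
  refine (AEMeasurable.div (AEMeasurable.add (AEMeasurable.mul ?_ h4)
    (AEMeasurable.mul ?_ h5)) h3).aestronglyMeasurable
  · exact (Complex.measurable_ofReal.comp Complex.measurable_re).comp_aemeasurable h2
  · exact (Complex.measurable_ofReal.comp Complex.measurable_im).comp_aemeasurable h2

lemma integrableOn_liftDeriv (h : IsEllipseLift a b a' b' p₁ p₂ f F) (hf : IsDiscShift x f)
    (hc : Continuous f) (ha : 0 < a) (hb : 0 < b) (ha' : 0 < a') (hb' : 0 < b') :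
    IntegrableOn (liftDeriv f p₁ p₂ F) (ellipse a b) :=
  IntegrableOn.of_sq_le (volume_ellipse_lt_top ha hb).ne (h.aestronglyMeasurable_liftDeriv hf hc)
    ((h.integrableOn_det hf hc ha' hb').const_mul (qcDilatation f unitDisc))
    ((h.ae_sq_le hf).mono fun _ hw => hw.2)

/-! ### The weak derivative of a lift: global form -/

/-- Every point other than the centre has a neighbourhood in which the derivative given by the chain
rule is the weak derivative of the lift. -/
lemma exists_nhds_integral_eq_zero (h : IsEllipseLift a b a' b' p₁ p₂ f F) (hf : IsDiscShift x f)
    (hc : Continuous f) {w : ℂ} (hw : w ∈ ellipse a b) (h0 : w ≠ 0) :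
    ∃ W : Set ℂ, IsOpen W ∧ w ∈ W ∧ ∀ l : ℂ → ℝ, ContDiff ℝ 1 l → HasCompactSupport l →
      tsupport l ⊆ W →
      ∫ w in ellipse a b, (liftDeriv f p₁ p₂ F w * l w + F w * (fderiv ℝ l w 1 : ℝ)) = 0 := by
  obtain ⟨U, U₂, q, q₂, hU, hwU, hUE, -, hq, hU₂, hUE₂, hq₂, hm⟩ := h.exists_local hf hw h0
  have hp := h.cover₁.holo.mono hUE
  have hUc := hUE.trans (ellipse_subset_closedEllipse _ _)
  have hV := hp.isOpen_image_of_injOn hU hq.injOn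
  obtain ⟨α, β, γ, δ, hαβ, hγδ, hQ, hn⟩ := exists_reProdIm_nhds hV ⟨w, hwU, rfl⟩
  have hQD : Icc α β ×ℂ Icc γ δ ⊆ unitDisc := by
    intro z hz
    obtain ⟨y, hy, rfl⟩ := hQ hz
    exact (h.cover₁.mem_unitDisc_iff (hUc hy)).2 (hUE hy)
  obtain ⟨K, hK⟩ := hf.qc
  obtain ⟨hac, hac'⟩ := hK.acl α β γ δ hαβ hγδ hQD
  obtain ⟨hfx, hfy⟩ := hf.integrableOn_partial hc
  have hdiff : ∀ᵐ z : ℂ, z ∈ Icc α β ×ℂ Icc γ δ → z ∈ diffX f ∧ z ∈ diffY f :=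
    (hf.ae_diff hc).mono fun z hz hzQ => hz (hQD hzQ)
  have hWo : IsOpen (U ∩ p₁ ⁻¹' (Ioo α β ×ℂ Ioo γ δ)) :=
    hp.continuousOn.isOpen_inter_preimage hU (isOpen_Ioo.reProdIm isOpen_Ioo)
  refine ⟨_, hWo, ⟨hwU, (mem_of_mem_nhds hn : p₁ w ∈ _)⟩, fun l hl hlc hls => ?_⟩
  rw [setIntegral_eq_of_subset_of_forall_sdiff_eq_zero (isOpen_ellipse _ _).measurableSet
    (inter_subset_left.trans hUE : U ∩ p₁ ⁻¹' (Ioo α β ×ℂ Ioo γ δ) ⊆ ellipse a b)]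
  · exact integral_liftDeriv_local hU hp hq hU₂ (h.cover₂.holo.mono hUE₂) hq₂
      (h.cont.mono hUc) hm (fun y hy => h.comm y (hUc hy)) hc hαβ hγδ hQ hac hac' hdiff
      (hfx.mono_set hQD) (hfy.mono_set hQD) hl hlc hls
  · intro y hy
    have hyl : y ∉ tsupport l := fun hcc => hy.2 (hls hcc)
    have h1 : fderiv ℝ l y = 0 :=
      image_eq_zero_of_notMem_tsupport fun hcc => hyl (tsupport_fderiv_subset ℝ hcc)
    simp [image_eq_zero_of_notMem_tsupport hyl, h1]

open scoped Manifold in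
/-- Integration by parts for a lift, against test functions supported off the centre. -/
lemma integral_liftDeriv_add_eq_zero (h : IsEllipseLift a b a' b' p₁ p₂ f F)
    (hf : IsDiscShift x f) (hc : Continuous f) (ha : 0 < a) (hb : 0 < b) (ha' : 0 < a')
    (hb' : 0 < b') {l : ℂ → ℝ} (hl : ContDiff ℝ 1 l) (hlc : HasCompactSupport l)
    (hls : tsupport l ⊆ ellipse a b \ {0}) :
    ∫ w in ellipse a b, (liftDeriv f p₁ p₂ F w * l w + F w * (fderiv ℝ l w 1 : ℝ)) = 0 := by
  choose W hWo hwW hW using fun i : (ellipse a b \ {0} : Set ℂ) =>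
    h.exists_nhds_integral_eq_zero hf hc i.2.1 i.2.2
  obtain ⟨ρ, hρ⟩ := SmoothPartitionOfUnity.exists_isSubordinate 𝓘(ℝ, ℂ) (isClosed_tsupport l) W hWo
    fun w hw => mem_iUnion.2 ⟨⟨w, hls hw⟩, hwW ⟨w, hls hw⟩⟩
  have hfin := ρ.locallyFinite.finite_nonempty_inter_compact hlc.isCompact
  -- a finite sum of test functions, each supported in one of the neighbourhoods
  set I := hfin.toFinset with hI
  have hsum : ∀ w, l w = ∑ i ∈ I, ρ i w * l w := by
    intro w
    by_cases hw : l w = 0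
    · simp [hw]
    · have hwl : w ∈ tsupport l := subset_tsupport _ hw
      have h1 := ρ.sum_eq_one hwl
      rw [finsum_eq_sum_of_support_subset (s := I)] at h1
      · rw [← Finset.sum_mul, h1, one_mul]
      · intro i hi
        rw [hI, Finite.coe_toFinset]
        exact ⟨w, hi, hwl⟩
  have hli : ∀ i, ContDiff ℝ 1 (fun w => ρ i w * l w) := fun i =>
    ((ρ i).contMDiff.contDiff.of_le (by norm_cast)).mul hl
  have hder : ∀ w, fderiv ℝ l w 1 = ∑ i ∈ I, fderiv ℝ (fun w => ρ i w * l w) w 1 := by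
    intro w
    have e : l = fun w => ∑ i ∈ I, ρ i w * l w := funext hsum
    conv_lhs => rw [e]
    rw [fderiv_fun_sum fun i _ => (hli i).differentiable one_ne_zero w]
    simp
  have hT := h.integrableOn_liftDeriv hf hc ha hb ha' hb'
  have hpt : ∀ w, liftDeriv f p₁ p₂ F w * l w + F w * (fderiv ℝ l w 1 : ℝ) =
      ∑ i ∈ I, (liftDeriv f p₁ p₂ F w * (ρ i w * l w : ℝ) +
        F w * (fderiv ℝ (fun w => ρ i w * l w) w 1 : ℝ)) := by
    intro w
    rw [Finset.sum_add_distrib, ← Finset.mul_sum, ← Finset.mul_sum, hder w, ← Complex.ofReal_sum,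
      ← Complex.ofReal_sum, ← hsum w]
  simp_rw [hpt]
  rw [integral_finsetSum I fun i _ => integrableOn_mul_add_mul_fderiv hT h.cont ha hb (hli i)]
  refine Finset.sum_eq_zero fun i _ => hW i _ (hli i) hlc.mul_left ?_
  exact (tsupport_mul_subset_left).trans (hρ i)

end IsEllipseLift


/-! ### Cutting off near the boundary and the centre -/

lemma exists_bound_deriv_smoothTransition :
    ∃ C : ℝ, 0 ≤ C ∧ (∀ t, |deriv Real.smoothTransition t| ≤ C) ∧
      ∀ t, 1 < t → deriv Real.smoothTransition t = 0 := by
  have hc : Continuous (deriv Real.smoothTransition) :=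
    (Real.smoothTransition.contDiff (n := 1)).continuous_deriv le_rfl
  obtain ⟨C, hC⟩ := isCompact_Icc.exists_bound_of_continuousOn (s := Icc (0 : ℝ) 1) hc.continuousOn
  have h1 : ∀ t : ℝ, 1 < t → deriv Real.smoothTransition t = 0 := fun t ht => by
    have e : Real.smoothTransition =ᶠ[𝓝 t] fun _ => 1 := by
      filter_upwards [Ioi_mem_nhds ht] with s hs using Real.smoothTransition.one_of_one_le hs.le
    rw [e.deriv_eq, deriv_const]
  have h0 : ∀ t : ℝ, t < 0 → deriv Real.smoothTransition t = 0 := fun t ht => by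
    have e : Real.smoothTransition =ᶠ[𝓝 t] fun _ => 0 := by
      filter_upwards [Iio_mem_nhds ht] with s hs using Real.smoothTransition.zero_of_nonpos hs.le
    rw [e.deriv_eq, deriv_const]
  have hC0 : 0 ≤ C := (norm_nonneg _).trans (hC 0 (by simp))
  refine ⟨C, hC0, fun t => ?_, h1⟩
  by_cases ht : t ∈ Icc (0 : ℝ) 1
  · exact hC t ht
  · rw [mem_Icc, not_and_or, not_le, not_le] at ht
    rcases ht with ht | ht
    · rw [h0 t ht]; simpa using hC0
    · rw [h1 t ht]; simpa using hC0

section cutoff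
variable {a b : ℝ}

/-- A function vanishing precisely at the centre and on the boundary of the ellipse, and positive
elsewhere in the ellipse. -/
noncomputable def ellipseDefect (a b : ℝ) (w : ℂ) : ℝ := ellipseGauge a b w * (1 - ellipseGauge a b w)

/-- A cut-off function which vanishes near the centre of the ellipse and near its boundary, and
equals `1` on larger and larger subsets as `n` increases. -/
noncomputable def ellipseCutoff (a b : ℝ) (n : ℕ) (w : ℂ) : ℝ :=
  Real.smoothTransition (n * ellipseDefect a b w - 1)

lemma contDiff_ellipseDefect : ContDiff ℝ 1 (ellipseDefect a b) :=
  (contDiff_ellipseGauge a b).mul (contDiff_const.sub (contDiff_ellipseGauge a b))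

lemma contDiff_ellipseCutoff (n : ℕ) : ContDiff ℝ 1 (ellipseCutoff a b n) :=
  Real.smoothTransition.contDiff.comp
    ((contDiff_const.mul contDiff_ellipseDefect).sub contDiff_const)

lemma ellipseDefect_pos_iff (ha : 0 < a) (hb : 0 < b) {w : ℂ} :
    0 < ellipseDefect a b w ↔ w ∈ ellipse a b \ {0} := by
  have h0 := ellipseGauge_nonneg a b w
  have h1 := ellipseGauge_eq_zero ha.ne' hb.ne' (z := w)
  rw [ellipseDefect, Set.mem_sdiff, mem_ellipse, mem_singleton_iff]
  constructor
  · intro h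
    have h2 : ellipseGauge a b w ≠ 0 := fun hc => by rw [hc] at h; simp at h
    refine ⟨?_, fun hc => h2 (h1.2 hc)⟩
    have := pos_of_mul_pos_right h h0
    linarith
  · rintro ⟨h2, h3⟩
    have h4 : 0 < ellipseGauge a b w := lt_of_le_of_ne h0 fun hc => h3 (h1.1 hc.symm)
    exact mul_pos h4 (by linarith)

lemma ellipseCutoff_eq_zero {n : ℕ} {w : ℂ} (h : n * ellipseDefect a b w ≤ 1) :
    ellipseCutoff a b n w = 0 := Real.smoothTransition.zero_of_nonpos (by linarith)

lemma ellipseCutoff_eq_one {n : ℕ} {w : ℂ} (h : 2 ≤ n * ellipseDefect a b w) :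
    ellipseCutoff a b n w = 1 := Real.smoothTransition.one_of_one_le (by linarith)

lemma fderiv_ellipseCutoff (n : ℕ) (w : ℂ) : fderiv ℝ (ellipseCutoff a b n) w 1 =
    deriv Real.smoothTransition (n * ellipseDefect a b w - 1) *
      (n * fderiv ℝ (ellipseDefect a b) w 1) := by
  have h1 : HasFDerivAt (fun w => n * ellipseDefect a b w - 1)
      ((n : ℝ) • fderiv ℝ (ellipseDefect a b) w) w :=
    ((contDiff_ellipseDefect.differentiable one_ne_zero w).hasFDerivAt.const_mul (n : ℝ)).sub_const 1
  have h2 : HasDerivAt Real.smoothTransition _ (n * ellipseDefect a b w - 1) :=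
    ((Real.smoothTransition.contDiff (n := 1)).differentiable one_ne_zero _).hasDerivAt
  have h3 : HasFDerivAt (ellipseCutoff a b n) _ w := h2.comp_hasFDerivAt w h1
  rw [h3.fderiv]
  simp

lemma tsupport_ellipseCutoff_mul_subset (n : ℕ) (l : ℂ → ℝ) :
    tsupport (fun w => ellipseCutoff a b n w * l w) ⊆ {w | 1 ≤ n * ellipseDefect a b w} := by
  refine closure_minimal (fun w hw => ?_) (isClosed_le continuous_const
    (continuous_const.mul contDiff_ellipseDefect.continuous))
  by_contra hc
  refine hw ?_
  simp only
  rw [ellipseCutoff_eq_zero (not_le.1 hc).le, zero_mul]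

open scoped Pointwise in
lemma volume_real_gauge_lt (a b : ℝ) {s : ℝ} (hs : 0 < s) :
    volume.real {w : ℂ | ellipseGauge a b w < s} = s * volume.real (ellipse a b) := by
  have e : {w : ℂ | ellipseGauge a b w < s} = (√s) • ellipse a b := by
    ext w
    rw [mem_smul_set_iff_inv_smul_mem₀ (Real.sqrt_pos.2 hs).ne', mem_ellipse, ellipseGauge_smul,
      inv_pow, Real.sq_sqrt hs.le, inv_mul_lt_iff₀ hs, mul_one]
    rfl
  rw [e, measureReal_def, Measure.addHaar_smul, Complex.finrank_real_complex, ENNReal.toReal_mul,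
    Real.sq_sqrt hs.le, ENNReal.toReal_ofReal (abs_nonneg _), abs_of_pos hs, measureReal_def]

/-- The area of the set where the cut-off function is not constant. -/
lemma volume_real_ellipseDefect_le (ha : 0 < a) (hb : 0 < b) {n : ℕ} (hn : 4 < n) :
    volume.real (ellipse a b ∩ {w | ellipseDefect a b w ≤ 2 / n}) ≤
      12 / n * volume.real (ellipse a b) := by
  have hn0 : (4 : ℝ) < n := by exact_mod_cast hn
  have hnp : (0 : ℝ) < n := by linarith
  have hfin := (volume_ellipse_lt_top ha hb).ne
  have h4 : 4 / (n : ℝ) < 1 := (div_lt_one hnp).2 hn0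
  have hlt : ∀ s : ℝ, MeasurableSet {w : ℂ | ellipseGauge a b w < s} := fun s =>
    (isOpen_lt (continuous_ellipseGauge a b) continuous_const).measurableSet
  have hsub : {w : ℂ | ellipseGauge a b w < 1 - 4 / n} ⊆ ellipse a b := fun w hw => by
    have : ellipseGauge a b w < 1 - 4 / n := hw
    have h5 : 0 < 4 / (n : ℝ) := by positivity
    rw [mem_ellipse]; linarith
  have hcov : ellipse a b ∩ {w | ellipseDefect a b w ≤ 2 / n} ⊆
      {w : ℂ | ellipseGauge a b w < 8 / n} ∪
        (ellipse a b \ {w : ℂ | ellipseGauge a b w < 1 - 4 / n}) := by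
    rintro w ⟨hw, hd⟩
    have hd' : ellipseGauge a b w * (1 - ellipseGauge a b w) ≤ 2 / n := hd
    have hg := ellipseGauge_nonneg a b w
    have hw' : ellipseGauge a b w < 1 := hw
    have e8 : 8 / (n : ℝ) = 4 * (2 / n) := by ring
    have e4 : 4 / (n : ℝ) = 2 * (2 / n) := by ring
    have hp : 0 < 2 / (n : ℝ) := by positivity
    -- a gauge `g` with `g (1 - g) ≤ 2/n` is at most `4/n` or at least `1 - 4/n`
    by_cases h : ellipseGauge a b w ≤ 1 / 2
    · left
      change ellipseGauge a b w < 8 / n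
      nlinarith
    · right
      refine ⟨hw, fun hc => ?_⟩
      have hc' : ellipseGauge a b w < 1 - 4 / n := hc
      nlinarith
  have hf8 : volume {w : ℂ | ellipseGauge a b w < 8 / n} ≠ ⊤ := by
    intro hc
    have h1 := volume_real_gauge_lt a b (s := 8 / n) (by positivity)
    have hpos : 0 < volume.real (ellipse a b) := ENNReal.toReal_pos
      ((isOpen_ellipse a b).measure_pos volume ⟨0, zero_mem_ellipse a b⟩).ne' hfin
    rw [measureReal_def, hc, ENNReal.toReal_top] at h1
    have : 0 < 8 / (n : ℝ) * volume.real (ellipse a b) := by positivity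
    linarith
  calc volume.real (ellipse a b ∩ {w | ellipseDefect a b w ≤ 2 / n})
      ≤ volume.real ({w : ℂ | ellipseGauge a b w < 8 / n} ∪
        (ellipse a b \ {w : ℂ | ellipseGauge a b w < 1 - 4 / n})) :=
        measureReal_mono hcov (measure_union_lt_top hf8.lt_top
          ((measure_mono sdiff_subset).trans_lt hfin.lt_top)).ne
    _ ≤ volume.real {w : ℂ | ellipseGauge a b w < 8 / n} +
        volume.real (ellipse a b \ {w : ℂ | ellipseGauge a b w < 1 - 4 / n}) :=
        measureReal_union_le _ _
    _ = 12 / n * volume.real (ellipse a b) := by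
        rw [measureReal_sdiff hsub (hlt _), volume_real_gauge_lt a b (by positivity),
          volume_real_gauge_lt a b (by linarith)]
        ring

/-- A function continuous on the closed ellipse and vanishing at the centre and on the boundary is
uniformly small where the defect is small. -/
lemma exists_norm_lt_of_ellipseDefect_lt (ha : 0 < a) (hb : 0 < b) {H : ℂ → ℂ}
    (hH : ContinuousOn H (closedEllipse a b)) (h0 : H 0 = 0)
    (hbd : ∀ w ∈ closedEllipse a b \ ellipse a b, H w = 0) {ε : ℝ} (hε : 0 < ε) :
    ∃ δ > 0, ∀ w ∈ ellipse a b, ellipseDefect a b w < δ → ‖H w‖ < ε := by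
  have hK := isCompact_closedEllipse ha hb
  have hK' : IsCompact (closedEllipse a b ∩ (fun w => ‖H w‖) ⁻¹' Ici ε) :=
    hK.of_isClosed_subset (hH.norm.preimage_isClosed_of_isClosed hK.isClosed isClosed_Ici)
      inter_subset_left
  rcases (closedEllipse a b ∩ (fun w => ‖H w‖) ⁻¹' Ici ε).eq_empty_or_nonempty with he | hne
  · refine ⟨1, one_pos, fun w hw _ => ?_⟩
    by_contra hc
    have : w ∈ closedEllipse a b ∩ (fun w => ‖H w‖) ⁻¹' Ici ε :=
      ⟨ellipse_subset_closedEllipse _ _ hw, not_lt.1 hc⟩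
    rw [he] at this
    exact this
  · obtain ⟨w₀, hw₀, hmin⟩ := hK'.exists_isMinOn hne
      (contDiff_ellipseDefect (a := a) (b := b)).continuous.continuousOn
    have hn0 : H w₀ ≠ 0 := fun hc => by
      have : ε ≤ ‖H w₀‖ := hw₀.2
      rw [hc, norm_zero] at this; linarith
    refine ⟨ellipseDefect a b w₀, (ellipseDefect_pos_iff ha hb).2 ⟨?_, ?_⟩, fun w hw hd => ?_⟩
    · by_contra hc; exact hn0 (hbd _ ⟨hw₀.1, hc⟩)
    · rintro rfl; exact hn0 h0
    · by_contra hc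
      have := hmin (a := w) ⟨ellipse_subset_closedEllipse _ _ hw, not_lt.1 hc⟩
      exact absurd hd (not_lt.2 this)

/-- The derivative of the cut-off function is of order `n`, on a set whose area is of order `1/n`
and on which `H` is uniformly small. -/
lemma tendsto_integral_mul_fderiv_ellipseCutoff (ha : 0 < a) (hb : 0 < b) {H : ℂ → ℂ}
    (hH : ContinuousOn H (closedEllipse a b)) (h0 : H 0 = 0)
    (hbd : ∀ w ∈ closedEllipse a b \ ellipse a b, H w = 0) {l : ℂ → ℝ} (hl : Continuous l) :
    Tendsto (fun n : ℕ => ∫ w in ellipse a b,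
      H w * (fderiv ℝ (ellipseCutoff a b n) w 1 * l w : ℝ)) atTop (𝓝 0) := by
  have hK := isCompact_closedEllipse ha hb
  obtain ⟨C, hC0, hC, hC1⟩ := exists_bound_deriv_smoothTransition
  obtain ⟨D, hD⟩ := hK.exists_bound_of_continuousOn
    (((contDiff_ellipseDefect (a := a) (b := b)).continuous_fderiv one_ne_zero).clm_apply
      (continuous_const (y := (1 : ℂ)))).continuousOn
  obtain ⟨B, hB⟩ := hK.exists_bound_of_continuousOn hl.continuousOn
  have hz : (0 : ℂ) ∈ closedEllipse a b := ellipse_subset_closedEllipse _ _ (zero_mem_ellipse _ _)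
  have hD0 : 0 ≤ D := (norm_nonneg _).trans (hD 0 hz)
  have hB0 : 0 ≤ B := (norm_nonneg _).trans (hB 0 hz)
  set m := volume.real (ellipse a b) with hm
  have hm0 : 0 ≤ m := measureReal_nonneg
  rw [Metric.tendsto_atTop]
  intro ε hε
  set M := C * D * B * 12 * m + 1 with hM
  have hM0 : 0 < M := by positivity
  obtain ⟨δ, hδ, hsmall⟩ := exists_norm_lt_of_ellipseDefect_lt ha hb hH h0 hbd
    (div_pos hε hM0)
  obtain ⟨n₀, hn₀⟩ := exists_nat_gt (2 / δ)
  refine ⟨max n₀ 5, fun n hn => ?_⟩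
  have hn5 : 4 < n := by have := (le_max_right n₀ 5).trans hn; omega
  have hnp : (0 : ℝ) < n := by exact_mod_cast (by omega : 0 < n)
  have hnδ : 2 / (n : ℝ) < δ := by
    have h1 : (n₀ : ℝ) ≤ n := by exact_mod_cast (le_max_left n₀ 5).trans hn
    rw [div_lt_iff₀ hnp]
    have := (div_lt_iff₀ hδ).1 (hn₀.trans_le h1)
    linarith
  rw [dist_zero_right, setIntegral_eq_of_subset_of_forall_sdiff_eq_zero
    (isOpen_ellipse _ _).measurableSet
    (inter_subset_left : ellipse a b ∩ {w | ellipseDefect a b w ≤ 2 / n} ⊆ ellipse a b)]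
  · refine (norm_setIntegral_le_of_norm_le_const (C := ε / M * (C * (n * D) * B)) ?_ ?_).trans_lt ?_
    · exact (measure_mono inter_subset_left).trans_lt (volume_ellipse_lt_top ha hb)
    · rintro w ⟨hw, hd⟩
      have hwc := ellipse_subset_closedEllipse _ _ hw
      rw [norm_mul, Complex.norm_real, norm_mul, fderiv_ellipseCutoff, norm_mul, norm_mul,
        Real.norm_natCast]
      have h1 := (hsmall w hw (lt_of_le_of_lt hd hnδ)).le
      have h2 : ‖deriv Real.smoothTransition (n * ellipseDefect a b w - 1)‖ ≤ C := hC _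
      have h3 := hD w hwc
      have h4 := hB w hwc
      gcongr
    · calc _ ≤ ε / M * (C * (n * D) * B) * (12 / n * m) :=
            mul_le_mul_of_nonneg_left (volume_real_ellipseDefect_le ha hb hn5) (by positivity)
        _ = ε * ((C * D * B * 12 * m) / M) := by field_simp
        _ < ε * 1 := by
            refine mul_lt_mul_of_pos_left ((div_lt_one hM0).2 ?_) hε
            rw [hM]; linarith
        _ = ε := mul_one ε
  · rintro w ⟨hw, hd⟩
    have hd' : 2 / (n : ℝ) < ellipseDefect a b w := not_le.1 fun hc => hd ⟨hw, hc⟩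
    rw [fderiv_ellipseCutoff, hC1]
    · simp
    · rw [div_lt_iff₀ hnp] at hd'
      linarith

/-- A weak derivative formula, valid for test functions supported off the centre and the boundary of
the ellipse, extends to all test functions when the function vanishes at the centre and on the
boundary. -/
lemma integral_weak_extend (ha : 0 < a) (hb : 0 < b) {T H : ℂ → ℂ}
    (hT : IntegrableOn T (ellipse a b)) (hH : ContinuousOn H (closedEllipse a b)) (h0 : H 0 = 0)
    (hbd : ∀ w ∈ closedEllipse a b \ ellipse a b, H w = 0)
    (hweak : ∀ l : ℂ → ℝ, ContDiff ℝ 1 l → HasCompactSupport l → tsupport l ⊆ ellipse a b \ {0} →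
      ∫ w in ellipse a b, (T w * l w + H w * (fderiv ℝ l w 1 : ℝ)) = 0)
    {l : ℂ → ℝ} (hl : ContDiff ℝ 1 l) :
    ∫ w in ellipse a b, (T w * l w + H w * (fderiv ℝ l w 1 : ℝ)) = 0 := by
  have hE := isOpen_ellipse a b
  have hK := isCompact_closedEllipse ha hb
  have hI := integrableOn_mul_add_mul_fderiv hT hH ha hb hl
  have hcut : ∀ n, ContDiff ℝ 1 fun w => ellipseCutoff a b n w * l w := fun n =>
    (contDiff_ellipseCutoff n).mul hl
  have hsub : ∀ n : ℕ, {w | 1 ≤ n * ellipseDefect a b w} ⊆ ellipse a b \ {0} := fun n w hw => by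
    rw [← ellipseDefect_pos_iff ha hb]
    have h1 : 1 ≤ n * ellipseDefect a b w := hw
    by_contra hc
    have : (n : ℝ) * ellipseDefect a b w ≤ 0 :=
      mul_nonpos_of_nonneg_of_nonpos (Nat.cast_nonneg n) (not_lt.1 hc)
    linarith
  have hts := fun n => tsupport_ellipseCutoff_mul_subset (a := a) (b := b) n l
  have hz : ∀ n, ∫ w in ellipse a b, (T w * (ellipseCutoff a b n w * l w : ℝ) +
      H w * (fderiv ℝ (fun w => ellipseCutoff a b n w * l w) w 1 : ℝ)) = 0 := fun n => by
    refine hweak _ (hcut n) ?_ ((hts n).trans (hsub n))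
    exact hK.of_isClosed_subset (isClosed_tsupport _) (((hts n).trans (hsub n)).trans
      (sdiff_subset.trans (ellipse_subset_closedEllipse _ _)))
  have hder : ∀ n w, fderiv ℝ (fun w => ellipseCutoff a b n w * l w) w 1 =
      ellipseCutoff a b n w * fderiv ℝ l w 1 + fderiv ℝ (ellipseCutoff a b n) w 1 * l w := by
    intro n w
    rw [fderiv_fun_mul ((contDiff_ellipseCutoff n).differentiable one_ne_zero w)
      (hl.differentiable one_ne_zero w)]
    simp [mul_comm]
  have hH2 : ∀ n, IntegrableOn (fun w => H w *
      (fderiv ℝ (ellipseCutoff a b n) w 1 * l w : ℝ)) (ellipse a b) := fun n => by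
    refine IntegrableOn.mono_set ?_ (ellipse_subset_closedEllipse _ _)
    refine (hH.mul ?_).integrableOn_compact hK
    exact (Complex.continuous_ofReal.comp
      ((((contDiff_ellipseCutoff n).continuous_fderiv one_ne_zero).clm_apply
        continuous_const).mul hl.continuous)).continuousOn
  have heq : ∀ n, ∫ w in ellipse a b, (ellipseCutoff a b n w : ℂ) *
      (T w * l w + H w * (fderiv ℝ l w 1 : ℝ)) =
      -∫ w in ellipse a b, H w * (fderiv ℝ (ellipseCutoff a b n) w 1 * l w : ℝ) := by
    intro n
    have h1 := integral_sub (integrableOn_mul_add_mul_fderiv hT hH ha hb (hcut n)) (hH2 n)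
    rw [hz n, zero_sub] at h1
    rw [← h1]
    refine integral_congr_ae (.of_forall fun w => ?_)
    simp only [hder]
    push_cast
    ring
  -- the integral with the cut-off function tends to zero, and also to the integral without it
  have hlim1 : Tendsto (fun n => ∫ w in ellipse a b, (ellipseCutoff a b n w : ℂ) *
      (T w * l w + H w * (fderiv ℝ l w 1 : ℝ))) atTop (𝓝 0) := by
    simp_rw [heq]
    simpa using (tendsto_integral_mul_fderiv_ellipseCutoff ha hb hH h0 hbd hl.continuous).neg
  have hlim2 : Tendsto (fun n => ∫ w in ellipse a b, (ellipseCutoff a b n w : ℂ) *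
      (T w * l w + H w * (fderiv ℝ l w 1 : ℝ))) atTop
      (𝓝 (∫ w in ellipse a b, (T w * l w + H w * (fderiv ℝ l w 1 : ℝ)))) := by
    refine tendsto_integral_of_dominated_convergence
      (fun w => ‖T w * l w + H w * (fderiv ℝ l w 1 : ℝ)‖) (fun n => ?_) hI.norm (fun n => ?_) ?_
    · exact ((Complex.continuous_ofReal.comp
        (contDiff_ellipseCutoff n).continuous).aestronglyMeasurable).mul hI.1
    · filter_upwards with w
      rw [norm_mul, Complex.norm_real]
      refine mul_le_of_le_one_left (norm_nonneg _) ?_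
      rw [ellipseCutoff, Real.norm_of_nonneg (Real.smoothTransition.nonneg _)]
      exact Real.smoothTransition.le_one _
    · have hne : ∀ᵐ w ∂(volume.restrict (ellipse a b)), w ≠ 0 :=
        ae_restrict_of_ae (by simp [ae_iff])
      filter_upwards [hne, ae_restrict_mem hE.measurableSet] with w hw hwE
      refine tendsto_const_nhds.congr' ?_
      have hp := (ellipseDefect_pos_iff ha hb).2 ⟨hwE, hw⟩
      obtain ⟨n₀, hn₀⟩ := exists_nat_gt (2 / ellipseDefect a b w)
      filter_upwards [eventually_ge_atTop n₀] with n hn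
      rw [ellipseCutoff_eq_one, Complex.ofReal_one, one_mul]
      have h1 : (n₀ : ℝ) ≤ n := by exact_mod_cast hn
      exact ((div_lt_iff₀ hp).1 (hn₀.trans_le h1)).le
  exact tendsto_nhds_unique hlim2 hlim1

end cutoff


/-! ### The extremal property of the affine map -/

/-- A function on the ellipse which annihilates all horizontal derivatives of test functions is
zero: its integral against a test function does not change when the test function is translated. -/
lemma eqOn_zero_of_integral_mul_fderiv {a b : ℝ} (ha : 0 < a) (hb : 0 < b) {H : ℂ → ℂ}
    (hH : ContinuousOn H (closedEllipse a b))
    (h : ∀ l : ℂ → ℝ, ContDiff ℝ 1 l →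
      ∫ w in ellipse a b, H w * (fderiv ℝ l w 1 : ℝ) = 0) : EqOn H 0 (ellipse a b) := by
  have hE := isOpen_ellipse a b
  have hK := isCompact_closedEllipse ha hb
  have hHi : IntegrableOn H (ellipse a b) :=
    (hH.integrableOn_compact hK).mono_set (ellipse_subset_closedEllipse _ _)
  obtain ⟨r, hr⟩ := hK.isBounded.exists_norm_le
  have key : ∀ g : ℂ → ℝ, ContDiff ℝ 1 g → HasCompactSupport g →
      ∫ w in ellipse a b, H w * (g w : ℝ) = 0 := by
    intro g hg hgc
    obtain ⟨C, hC⟩ := (hg.continuous_fderiv one_ne_zero).bounded_above_of_compact_support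
      (hgc.fderiv ℝ)
    obtain ⟨s, hs⟩ := hgc.isCompact.isBounded.exists_norm_le
    -- the derivative with respect to the translation is the integral against a horizontal
    -- derivative
    have hd : ∀ t : ℝ, HasDerivAt (fun t : ℝ => ∫ w in ellipse a b, H w * (g (w + t) : ℝ)) 0 t := by
      intro t
      have hshift : ContDiff ℝ 1 fun w : ℂ => g (w + t) := hg.comp (contDiff_id.add contDiff_const)
      have h1 := h _ hshift
      simp_rw [fderiv_comp_add_right] at h1
      rw [← h1]
      have hgm : ∀ u : ℝ, AEStronglyMeasurable (fun w => H w * (g (w + u) : ℝ))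
          (volume.restrict (ellipse a b)) := fun u =>
        hHi.1.mul (Complex.continuous_ofReal.comp
          (hg.continuous.comp (by fun_prop))).aestronglyMeasurable
      refine (hasDerivAt_integral_of_dominated_loc_of_deriv_le (μ := volume.restrict (ellipse a b))
        (F := fun (u : ℝ) w => H w * (g (w + u) : ℝ))
        (F' := fun (u : ℝ) w => H w * (fderiv ℝ g (w + u) 1 : ℝ)) (bound := fun w => ‖H w‖ * C)
        univ_mem (.of_forall hgm) ?_ ?_ ?_ (hHi.norm.mul_const C) ?_).2
      · refine IntegrableOn.mono_set ?_ (ellipse_subset_closedEllipse _ _)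
        refine (hH.mul ?_).integrableOn_compact hK
        exact (Complex.continuous_ofReal.comp hshift.continuous).continuousOn
      · exact hHi.1.mul (Complex.continuous_ofReal.comp
          (((hg.continuous_fderiv one_ne_zero).comp (by fun_prop)).clm_apply
            continuous_const)).aestronglyMeasurable
      · filter_upwards with w u _
        rw [norm_mul, Complex.norm_real]
        refine mul_le_mul_of_nonneg_left ?_ (norm_nonneg _)
        refine ((fderiv ℝ g (w + u)).le_opNorm 1).trans ?_
        simpa using hC (w + u)
      · filter_upwards with w u _
        have h2 : HasDerivAt (fun u : ℝ => w + (u : ℂ)) 1 u :=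
          ((hasDerivAt_id u).ofReal_comp).const_add w
        have h3 := (hg.differentiable one_ne_zero (w + u)).hasFDerivAt.comp_hasDerivAt u h2
        exact h3.ofReal_comp.const_mul (H w)
    have hconst := is_const_of_deriv_eq_zero (fun t => (hd t).differentiableAt)
      (fun t => (hd t).deriv) 0 (|r| + |s| + 1)
    simp only [Complex.ofReal_zero, add_zero] at hconst
    rw [hconst]
    -- after a large translation the test function vanishes on the ellipse
    refine setIntegral_eq_zero_of_forall_eq_zero fun w hw => ?_
    have hz : g (w + ((|r| + |s| + 1 : ℝ) : ℂ)) = 0 := by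
      by_contra hc
      have h1 := hs _ (subset_tsupport _ hc)
      have h2 := hr w (ellipse_subset_closedEllipse _ _ hw)
      have h3 := norm_sub_norm_le ((|r| + |s| + 1 : ℝ) : ℂ) (-w)
      rw [sub_neg_eq_add, norm_neg, add_comm _ w, Complex.norm_real,
        Real.norm_of_nonneg (by positivity)] at h3
      linarith [le_abs_self r, le_abs_self s]
    rw [hz]; simp
  have hae : ∀ᵐ w : ℂ, (ellipse a b).indicator H w = 0 := by
    refine ae_eq_zero_of_integral_contDiff_smul_eq_zero
      ((integrable_indicator_iff hE.measurableSet).2 hHi).locallyIntegrable fun g hg hgc => ?_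
    have e : (fun w => g w • (ellipse a b).indicator H w) =
        (ellipse a b).indicator fun w => H w * (g w : ℝ) := by
      funext w
      by_cases hw : w ∈ ellipse a b <;> simp [hw, mul_comm]
    rw [e, integral_indicator hE.measurableSet]
    exact key g (hg.of_le (by norm_cast)) hgc
  refine Measure.eqOn_open_of_ae_eq (μ := volume) ?_ hE
    (hH.mono (ellipse_subset_closedEllipse _ _)) continuousOn_const
  rw [Filter.EventuallyEq, ae_restrict_iff' hE.measurableSet]
  filter_upwards [hae] with w hw hwE
  rwa [indicator_of_mem hwE] at hw

/-- The ellipses with semi-axes `a, b` and `b, a` have the same area. -/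
lemma volume_ellipse_swap (a b : ℝ) : volume (ellipse b a) = volume (ellipse a b) := by
  have h := Measure.addHaar_image_continuousLinearMap volume (mulRealCLM Complex.I) (ellipse a b)
  change _ = ENNReal.ofReal |(mulRealCLM Complex.I).det| * _ at h
  rw [det_mulRealCLM, Complex.norm_I] at h
  have e : mulRealCLM Complex.I '' ellipse a b = ellipse b a := by
    ext w
    constructor
    · rintro ⟨z, hz, rfl⟩
      have hz' : (z.re / a) ^ 2 + (z.im / b) ^ 2 < 1 := hz
      change ((mulRealCLM Complex.I z).re / b) ^ 2 + ((mulRealCLM Complex.I z).im / a) ^ 2 < 1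
      simp only [mulRealCLM_apply, Complex.I_mul_re, Complex.I_mul_im, neg_div, neg_sq]
      linarith
    · intro hw
      have hw' : (w.re / b) ^ 2 + (w.im / a) ^ 2 < 1 := hw
      refine ⟨-Complex.I * w, ?_, by rw [mulRealCLM_apply]; linear_combination -w * Complex.I_sq⟩
      change ((-Complex.I * w).re / a) ^ 2 + ((-Complex.I * w).im / b) ^ 2 < 1
      simp only [neg_mul, Complex.neg_re, Complex.neg_im, Complex.I_mul_re, Complex.I_mul_im,
        neg_neg, neg_div, neg_sq]
      linarith
  rw [← e, h]; simp

section extremal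
variable {R : ℝ}

lemma fderiv_ellipseAffine_one (w : ℂ) : fderiv ℝ (ellipseAffine R) w 1 = axisRatio R := by
  have h1 : HasDerivAt (fun t : ℝ => w + (t : ℂ) * 1) 1 0 := by
    simpa using ((hasDerivAt_id (0 : ℝ)).ofReal_comp).const_add w
  have h2 := ((contDiff_ellipseAffine (R := R) (n := 1)).differentiable one_ne_zero
    (w + ((0 : ℝ) : ℂ) * 1)).hasFDerivAt.comp_hasDerivAt (0 : ℝ) h1
  have h3 : HasDerivAt (fun t : ℝ => ellipseAffine R (w + (t : ℂ) * 1)) (axisRatio R : ℂ) 0 := by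
    have e : (fun t : ℝ => ellipseAffine R (w + (t : ℂ) * 1)) =
        fun t : ℝ => ellipseAffine R w + (t : ℂ) * axisRatio R := by
      funext t
      apply Complex.ext <;> simp [ellipseAffine_re, ellipseAffine_im]
      ring
    rw [e]
    simpa using (((hasDerivAt_id (0 : ℝ)).ofReal_comp).mul_const (axisRatio R : ℂ)).const_add
      (ellipseAffine R w)
  have := h2.unique h3
  simpa using this

/-- Integration by parts for the affine map. -/
lemma integral_ellipseAffine_weak {Ω : Set ℂ} {l : ℂ → ℝ}
    (hl : ContDiff ℝ 1 l) (hlc : HasCompactSupport l) (hls : tsupport l ⊆ Ω) :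
    ∫ w in Ω, ((axisRatio R : ℂ) * l w + ellipseAffine R w * (fderiv ℝ l w 1 : ℝ)) = 0 := by
  have hA := (contDiff_ellipseAffine (R := R) (n := 1))
  have hlC : ContDiff ℝ 1 fun w => (l w : ℂ) := Complex.ofRealCLM.contDiff.comp hl
  have hlCc : HasCompactSupport fun w => (l w : ℂ) := hlc.comp_left Complex.ofReal_zero
  have hder : ∀ w, fderiv ℝ (fun w => (l w : ℂ)) w 1 = (fderiv ℝ l w 1 : ℝ) := fun w => by
    have h5 : fderiv ℝ (fun w => (l w : ℂ)) w = _ :=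
      (Complex.ofRealCLM.hasFDerivAt.comp w (hl.differentiable one_ne_zero w).hasFDerivAt).fderiv
    rw [h5]; rfl
  have hi1 : Integrable fun w => (axisRatio R : ℂ) * l w :=
    (continuous_const.mul hlC.continuous).integrable_of_hasCompactSupport hlCc.mul_left
  have hi2 : Integrable fun w => ellipseAffine R w * (fderiv ℝ l w 1 : ℝ) := by
    simp_rw [← hder]
    refine (hA.continuous.mul ((hlC.continuous_fderiv one_ne_zero).clm_apply
      continuous_const)).integrable_of_hasCompactSupport ?_
    exact (hlCc.fderiv_apply ℝ 1).mul_left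
  have h := integral_mul_fderiv_eq_neg_fderiv_mul_of_integrable (μ := (volume : Measure ℂ))
    (f := ellipseAffine R) (g := fun w => (l w : ℂ)) (v := 1)
    (by simpa only [fderiv_ellipseAffine_one] using hi1) (by simpa only [hder] using hi2)
    ((hA.continuous.mul hlC.continuous).integrable_of_hasCompactSupport hlCc.mul_left)
    (fun w _ => hA.differentiable one_ne_zero w) (fun w _ => hlC.differentiable one_ne_zero w)
  simp only [fderiv_ellipseAffine_one, hder] at h
  rw [setIntegral_eq_integral_of_forall_compl_eq_zero, integral_add hi1 hi2, h, add_neg_cancel]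
  intro w hw
  have hyl : w ∉ tsupport l := fun hcc => hw (hls hcc)
  have h1 : fderiv ℝ l w = 0 :=
    image_eq_zero_of_notMem_tsupport fun hcc => hyl (tsupport_fderiv_subset ℝ hcc)
  simp [image_eq_zero_of_notMem_tsupport hyl, h1]

lemma sq_norm_sub_ofReal (z : ℂ) (t : ℝ) : ‖z - t‖ ^ 2 = ‖z‖ ^ 2 - 2 * t * z.re + t ^ 2 := by
  rw [Complex.sq_norm, Complex.sq_norm, Complex.normSq_apply, Complex.normSq_apply]
  simp
  ring

section
variable {x : ℝ} {p₁ p₂ f F : ℂ → ℂ}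

/-- The difference of a lift and the affine map vanishes at the centre and on the boundary, so that
its weak derivative may be tested against functions which do not vanish on the boundary. -/
lemma IsEllipseLift.integral_sub_affine_weak (hR : 1 < R)
    (h : IsEllipseLift (R - 1 / R) (R + 1 / R) (R + 1 / R) (R - 1 / R) p₁ p₂ f F)
    (hf : IsDiscShift x f) (hc : Continuous f)
    (hbd : ∀ w ∈ closedEllipse (R - 1 / R) (R + 1 / R) \ ellipse (R - 1 / R) (R + 1 / R),
      F w = ellipseAffine R w) {l : ℂ → ℝ} (hl : ContDiff ℝ 1 l) :
    ∫ w in ellipse (R - 1 / R) (R + 1 / R), ((liftDeriv f p₁ p₂ F w - axisRatio R) * l w +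
      (F w - ellipseAffine R w) * (fderiv ℝ l w 1 : ℝ)) = 0 := by
  have ha := sub_inv_pos hR
  have hb := add_inv_pos hR
  have hT := h.integrableOn_liftDeriv hf hc ha hb hb ha
  have hcA : IntegrableOn (fun _ => (axisRatio R : ℂ)) (ellipse (R - 1 / R) (R + 1 / R)) :=
    integrableOn_const (volume_ellipse_lt_top ha hb).ne
  have hAc := (contDiff_ellipseAffine (R := R) (n := 0)).continuous
  refine integral_weak_extend ha hb (T := fun w => liftDeriv f p₁ p₂ F w - axisRatio R)
    (H := fun w => F w - ellipseAffine R w) (hT.sub hcA) (h.cont.sub hAc.continuousOn) ?_ ?_ ?_ hl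
  · rw [h.map_zero, ellipseAffine_zero, sub_zero]
  · exact fun w hw => by rw [hbd w hw, sub_self]
  · intro l hl hlc hls
    have h1 := h.integral_liftDeriv_add_eq_zero hf hc ha hb hb ha hl hlc hls
    have h2 := integral_ellipseAffine_weak (R := R) hl hlc (hls.trans sdiff_subset)
    have h3 := integral_sub (integrableOn_mul_add_mul_fderiv hT h.cont ha hb hl)
      (integrableOn_mul_add_mul_fderiv hcA hAc.continuousOn ha hb hl)
    rw [h1, h2, sub_zero] at h3
    rw [← h3]
    refine integral_congr_ae (.of_forall fun w => ?_)
    simp only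
    ring

/-- The mean square deviation of the derivative of a lift from the derivative of the affine map is
controlled by the excess of the dilatation. -/
lemma IsEllipseLift.integral_sq_norm_sub_le (hR : 1 < R)
    (h : IsEllipseLift (R - 1 / R) (R + 1 / R) (R + 1 / R) (R - 1 / R) p₁ p₂ f F)
    (hf : IsDiscShift x f) (hc : Continuous f)
    (hbd : ∀ w ∈ closedEllipse (R - 1 / R) (R + 1 / R) \ ellipse (R - 1 / R) (R + 1 / R),
      F w = ellipseAffine R w) :
    IntegrableOn (fun w => ‖liftDeriv f p₁ p₂ F w - axisRatio R‖ ^ 2)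
      (ellipse (R - 1 / R) (R + 1 / R)) ∧
    ∫ w in ellipse (R - 1 / R) (R + 1 / R), ‖liftDeriv f p₁ p₂ F w - axisRatio R‖ ^ 2 ≤
      (qcDilatation f unitDisc - axisRatio R ^ 2) *
        volume.real (ellipse (R - 1 / R) (R + 1 / R)) := by
  have ha := sub_inv_pos hR
  have hb := add_inv_pos hR
  set E := ellipse (R - 1 / R) (R + 1 / R) with hE
  set m := volume.real E with hm
  set K := qcDilatation f unitDisc with hK
  have hfin := (volume_ellipse_lt_top ha hb).ne
  have hT := h.integrableOn_liftDeriv hf hc ha hb hb ha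
  have hdet := h.integrableOn_det hf hc hb ha
  have hK0 : 0 ≤ K := by
    obtain ⟨k, hk⟩ := hf.qc
    have hne : (ae (volume.restrict unitDisc)).NeBot := ae_neBot.2 volume_restrict_unitDisc_ne_zero
    obtain ⟨z, hz⟩ := hk.ae_sq_le.exists
    exact hz.2.1
  have hae := (h.ae_sq_le hf).mono fun _ hw => hw.2
  have hsq : IntegrableOn (fun w => ‖liftDeriv f p₁ p₂ F w‖ ^ 2) E := by
    refine Integrable.mono' (hdet.const_mul K) (hT.1.norm.pow 2) ?_
    filter_upwards [hae] with w hw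
    rwa [Real.norm_of_nonneg (by positivity)]
  have hre : IntegrableOn (fun w => (liftDeriv f p₁ p₂ F w).re) E := hT.re
  have hcA : IntegrableOn (fun _ => axisRatio R ^ 2) E := integrableOn_const hfin
  -- testing against the constant function `1`
  have hmean : ∫ w in E, (liftDeriv f p₁ p₂ F w).re = axisRatio R * m := by
    have h1 := h.integral_sub_affine_weak hR hf hc hbd (l := fun _ => 1) contDiff_const
    simp only [Complex.ofReal_one, mul_one, fderiv_fun_const, Pi.zero_apply,
      zero_apply, Complex.ofReal_zero, mul_zero, add_zero] at h1
    rw [integral_sub hT (integrableOn_const hfin), setIntegral_const, sub_eq_zero] at h1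
    have h2 : ∫ w in E, (liftDeriv f p₁ p₂ F w).re = (∫ w in E, liftDeriv f p₁ p₂ F w).re :=
      integral_re hT
    rw [h2, h1, Complex.smul_re, Complex.ofReal_re, smul_eq_mul, mul_comm]
  -- the dilatation inequality, the area inequality and the equality of the two areas
  have hbound : ∫ w in E, ‖liftDeriv f p₁ p₂ F w‖ ^ 2 ≤ K * m := by
    calc _ ≤ ∫ w in E, K * (liftFDeriv f p₁ p₂ F w).det :=
          integral_mono_ae hsq (hdet.const_mul K) hae
      _ = K * ∫ w in E, (liftFDeriv f p₁ p₂ F w).det := integral_const_mul _ _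
      _ ≤ K * m := by
          refine mul_le_mul_of_nonneg_left ((h.integral_det_le hf hc hb ha).trans_eq ?_) hK0
          rw [measureReal_def, volume_ellipse_swap, hm, measureReal_def]
  have hsub : IntegrableOn (fun w => ‖liftDeriv f p₁ p₂ F w‖ ^ 2 -
      2 * axisRatio R * (liftDeriv f p₁ p₂ F w).re) E := hsq.sub (hre.const_mul _)
  simp_rw [sq_norm_sub_ofReal]
  refine ⟨hsub.add hcA, ?_⟩
  rw [integral_add hsub hcA, integral_sub hsq (hre.const_mul _), integral_const_mul, hmean,
    setIntegral_const, smul_eq_mul]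
  linarith

end

/-- The affine lift is extremal, and uniquely so. -/
theorem IsDiscShift.extremal_of_continuous (hR : 1 < R) {f : ℂ → ℂ}
    (hf : IsDiscShift (focalValue (R ^ 2)) f) (hc : Continuous f) :
    axisRatio R ^ 2 ≤ qcDilatation f unitDisc ∧
      (qcDilatation f unitDisc = axisRatio R ^ 2 → EqOn f (affineShift R) closedUnitDisc) := by
  have ha := sub_inv_pos hR
  have hb := add_inv_pos hR
  have hc1 := isEllipseCover_coverOne hR
  have hc2 := isEllipseCover_coverTwo hR
  obtain ⟨F, hFc, hFb, hF0, hFbd, hcomm⟩ := hf.exists_lift hR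
  have hL : IsEllipseLift (R - 1 / R) (R + 1 / R) (R + 1 / R) (R - 1 / R) (coverOne R) (coverTwo R)
      f F := ⟨by rw [hc1.branch]; exact hc1, by rw [hc2.branch]; exact hc2, hFc, hFb, hF0, hcomm⟩
  obtain ⟨hi, hle⟩ := hL.integral_sq_norm_sub_le hR hf hc hFbd
  have hE := isOpen_ellipse (R - 1 / R) (R + 1 / R)
  have hmpos : 0 < volume.real (ellipse (R - 1 / R) (R + 1 / R)) := ENNReal.toReal_pos
    (hE.measure_pos volume ⟨0, zero_mem_ellipse _ _⟩).ne' (volume_ellipse_lt_top ha hb).ne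
  have hnn : 0 ≤ ∫ w in ellipse (R - 1 / R) (R + 1 / R),
      ‖liftDeriv f (coverOne R) (coverTwo R) F w - axisRatio R‖ ^ 2 :=
    integral_nonneg fun _ => by positivity
  refine ⟨sub_nonneg.1 (nonneg_of_mul_nonneg_left (hnn.trans hle) hmpos), fun heq => ?_⟩
  rw [heq, sub_self, zero_mul] at hle
  have hT0 := (integral_eq_zero_iff_of_nonneg (fun _ => by positivity) hi).1 (le_antisymm hle hnn)
  have hAc := (contDiff_ellipseAffine (R := R) (n := 0)).continuous
  have hFA : EqOn (fun w => F w - ellipseAffine R w) 0 (ellipse (R - 1 / R) (R + 1 / R)) := by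
    refine eqOn_zero_of_integral_mul_fderiv ha hb (hFc.sub hAc.continuousOn) fun l hl => ?_
    rw [← hL.integral_sub_affine_weak hR hf hc hFbd hl]
    refine integral_congr_ae ?_
    filter_upwards [hT0] with w hw
    have : liftDeriv f (coverOne R) (coverTwo R) F w - axisRatio R = 0 := by simpa using hw
    rw [this, zero_mul, zero_add]
  intro z hz
  obtain ⟨w, hw, rfl⟩ := hc1.exists_preimage_closed hz
  rw [hcomm w hw, affineShift_coverOne hR hw]
  by_cases hwE : w ∈ ellipse (R - 1 / R) (R + 1 / R)
  · rw [sub_eq_zero.1 (hFA hwE)]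
  · rw [hFbd w ⟨hw, hwE⟩]

/-- The extremal property for all competitors: their values outside the closed disc, where they need
not be continuous, do not matter. -/
theorem IsDiscShift.extremal (hR : 1 < R) {f : ℂ → ℂ}
    (hf : IsDiscShift (focalValue (R ^ 2)) f) :
    axisRatio R ^ 2 ≤ qcDilatation f unitDisc ∧
      (qcDilatation f unitDisc = axisRatio R ^ 2 ↔ EqOn f (affineShift R) closedUnitDisc) := by
  obtain ⟨g, hgc, hg⟩ := hf.exists_continuous_eqOn
  obtain ⟨h1, h2⟩ := (hf.congr hg).extremal_of_continuous hR hgc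
  rw [← qcDilatation_congr hg] at h1 h2
  refine ⟨h1, fun h => hg.trans (h2 h), fun h => ?_⟩
  rw [qcDilatation_congr h, qcDilatation_affineShift hR]

end extremal

theorem mainTheorem1 (x R : ℝ) (hx0 : 0 < x) (hx1 : x < 1) (hR : R = √(grotzschPhi (1 / x))) :
    ∃ φ p₁ p₂ f₀ : ℂ → ℂ,
      -- the two explicit two-sheeted branched coverings of the disc by ellipses
      IsSlitDiscMap x R φ ∧
      IsEllipseCover (R - 1 / R) (R + 1 / R) 0 p₁ ∧
      (∀ z ∈ slitDisc x, p₁ (φ z - 1 / φ z) = z ^ 2) ∧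
      IsEllipseCover (R + 1 / R) (R - 1 / R) (-(x : ℂ)) p₂ ∧
      (∀ z ∈ slitDisc x, p₂ (φ z + 1 / φ z) = z ^ 2) ∧
      -- the map `f₀` whose lift is the affine map; it is a competitor, and its dilatation
      (∀ w ∈ closedEllipse (R - 1 / R) (R + 1 / R), f₀ (p₁ w) = p₂ (ellipseAffine R w)) ∧
      IsDiscShift x f₀ ∧
      qcDilatation f₀ unitDisc
        = ((grotzschPhi (1 / x) + 1) / (grotzschPhi (1 / x) - 1)) ^ 2 ∧
      ∀ f : ℂ → ℂ, IsDiscShift x f →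
        -- `f` lifts to a map of ellipses with the boundary values of the affine map
        (∃ F : ℂ → ℂ,
          ContinuousOn F (closedEllipse (R - 1 / R) (R + 1 / R)) ∧
          BijOn F (closedEllipse (R - 1 / R) (R + 1 / R))
            (closedEllipse (R + 1 / R) (R - 1 / R)) ∧
          F 0 = 0 ∧
          (∀ w ∈ closedEllipse (R - 1 / R) (R + 1 / R) \ ellipse (R - 1 / R) (R + 1 / R),
            F w = ellipseAffine R w) ∧
          ∀ w ∈ closedEllipse (R - 1 / R) (R + 1 / R), f (p₁ w) = p₂ (F w)) ∧
        -- the lower bound and the case of equality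
        ((R ^ 2 + 1) / (R ^ 2 - 1)) ^ 2 ≤ qcDilatation f unitDisc ∧
        (qcDilatation f unitDisc = ((R ^ 2 + 1) / (R ^ 2 - 1)) ^ 2 ↔
          EqOn f f₀ closedUnitDisc) := by
  obtain ⟨ρ, hρ, rfl⟩ := exists_focalValue_eq hx0 hx1
  rw [grotzschPhi_inv_focalValue hρ] at hR ⊢
  have hR1 : 1 < R := by rw [hR]; exact Real.lt_sqrt_of_sq_lt (by simpa using hρ)
  have hρR : ρ = R ^ 2 := by rw [hR, Real.sq_sqrt (by linarith)]
  subst hρR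
  rw [← axisRatio_eq hR1]
  refine ⟨slitToAnnulus R, coverOne R, coverTwo R, affineShift R, isSlitDiscMap_slitToAnnulus hR1,
    isEllipseCover_coverOne hR1, fun z hz => coverOne_slitToAnnulus hR1 hz,
    isEllipseCover_coverTwo hR1, fun z hz => coverTwo_slitToAnnulus hR1 hz,
    fun w hw => affineShift_coverOne hR1 hw, isDiscShift_affineShift hR1,
    qcDilatation_affineShift hR1, fun f hf => ⟨hf.exists_lift hR1, hf.extremal hR1⟩⟩
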